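/- Consider equations $$f(x)u_t=(D(u)u_x)_x+K(u)u_x \qquad (*)$$ where $t,x,u$ range over nonempty open intervals, $f,D,K$ are smooth real functions, $f$ and $D$ have no zeros and $(D_u,K_u)\not\equiv(0,0)$. The maximal Lie invariance algebra $A^{\max}$ of $(*)$ is the space of smooth vector fields $Q=\xi^t\partial_t+\xi^x\partial_x+\eta\,\partial_u$ in $(t,x,u)$ whose second prolongation annihilates $fu_t-(Du_x)_x-Ku_x$ on all jets satisfying $(*)$. Call two equations equivalent if one is obtained from the other by a transformation of the group $G^{\rm equiv}$ $$\tilde t=at+b,\ \tilde x=px+q,\ \tilde u=ru+s,\ \tilde f=\tfrac{am}{p^2}f,\ \tilde D=mD,\ \tilde K=\tfrac mpK\qquad(a,p,r,m\ne0),$$ preceded, only if $f$ is constant, by a transformation $\tilde x=x-\varepsilon t$, $\tilde K=K+\varepsilon f$ (then the coefficients do not depend on $t,x$, and the new equation is considered on the same intervals). In the lists below Greek letters are real constants; $u>0$ where powers $u^\mu$, $u^\nu$ or $\ln u$ occur, except that in 3.1 and 3.2 with $\mu=0$ and $\nu$ a nonnegative integer $u$ is not restricted. Each case is followed by a list of operators.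 **Table 1** ($D$ arbitrary; $\gamma,\nu\neq0$). 1.1: $K,f$ arbitrary: $\partial_t$. 1.2a: $K$ arbitrary, $f=e^{\varepsilon x}$: $\partial_t,\ \varepsilon t\partial_t+\partial_x$. 1.2b: $K=D$, $f=e^{-2x+\gamma e^{-x}}$: $\partial_t,\ \gamma t\partial_t-e^x\partial_x$. 1.2c: $K=D$, $f=e^{-2x}|e^{-x}+\gamma|^\nu$: $\partial_t,\ (\nu+2)t\partial_t-(e^{-x}+\gamma)e^x\partial_x$. 1.2d: $K=0$, $f=|x|^\nu$: $\partial_t,\ (\nu+2)t\partial_t+x\partial_x$. 1.2e: $K=1$, $f=x^{-1}$: $\partial_t,\ e^{-t}(\partial_t-x\partial_x)$. 1.3a: $K=0$, $f=1$: $\partial_t,\ \partial_x,\ 2t\partial_t+x\partial_x$. 1.3b: $K=D$, $f=e^{-2x}$: $\partial_t,\ 2t\partial_t-\partial_x,\ e^x\partial_x$. **Table 2** ($D=e^{\mu u}$; $\mu=1$ unless $\mu$ is mentioned). 2.1: $D=e^{\mu u}$, $K=e^{\nu u}$, $f=|x|^\lambda$, $\lambda\ne0$: $\partial_t,\ (\lambda\mu-\lambda\nu+\mu-2\nu)t\partial_t+(\mu-\nu)x\partial_x+\partial_u$.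 2.2: $D=e^{\mu u}$, $K=e^u$, $f=1$: $\partial_t,\ \partial_x,\ (\mu-2)t\partial_t+(\mu-1)x\partial_x+\partial_u$. 2.3: $K=u$, $f=1$: $\partial_t,\ \partial_x,\ t\partial_t+(x-t)\partial_x+\partial_u$. 2.4: $K=\varepsilon e^u$, $f$ arbitrary: $\partial_t,\ t\partial_t-\partial_u$. 2.5a: $K=0$, $f=\exp\int\frac{-3\beta x-2\gamma_1+\alpha}{\beta x^2+\gamma_1x+\gamma_0}dx$: $\partial_t,\ t\partial_t-\partial_u,\ \alpha t\partial_t+(\beta x^2+\gamma_1x+\gamma_0)\partial_x+\beta x\partial_u$. 2.5b: $K=e^u$, $f=\exp\int\frac{\beta e^{-x}-2\gamma_0e^x-\alpha}{\beta e^{-x}+\gamma_1+\gamma_0e^x}dx$: $\partial_t,\ t\partial_t-\partial_u,\ \alpha t\partial_t-(\beta e^{-x}+\gamma_1+\gamma_0e^x)\partial_x+\beta e^{-x}\partial_u$. 2.5c: $K=1$, $f=x^{-1}$: $\partial_t,\ x\partial_x+\partial_u,\ e^{-t}(\partial_t-x\partial_x)$. 2.6a: $K=0$, $f=1$: $\partial_t,\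 t\partial_t-\partial_u,\ 2t\partial_t+x\partial_x,\ \partial_x$. 2.6b: $K=e^u$, $f=e^{-2x}$: $\partial_t,\ t\partial_t-\partial_u,\ 2t\partial_t-\partial_x,\ e^x\partial_x$. 2.6c: $K=e^u$, $f=e^{-2x}(e^{-x}+\gamma)^{-3}$: $\partial_t,\ t\partial_t-\partial_u,\ (e^{-x}+\gamma)e^x\partial_x+\partial_u,\ -(e^{-x}+\gamma)^2e^x\partial_x+(e^{-x}+\gamma)\partial_u$. 2.6d: $K=0$, $f=x^{-3}$: $\partial_t,\ t\partial_t-\partial_u,\ x\partial_x-\partial_u,\ x^2\partial_x+x\partial_u$. **Table 3** ($D=u^\mu$; $\mu\ne0$ in Cases 3.4–3.6). 3.1: $K=u^\nu$, $f=|x|^\lambda$, $\lambda\neq0$: $\partial_t,\ (\mu+\lambda\mu-2\nu-\lambda\nu)t\partial_t+(\mu-\nu)x\partial_x+u\partial_u$. 3.2: $K=u^\nu$, $f=1$: $\partial_t,\ \partial_x,\ (\mu-2\nu)t\partial_t+(\mu-\nu)x\partial_x+u\partial_u$. 3.3: $K=\ln u$, $f=1$: $\partial_t,\ \partial_x,\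 \mu t\partial_t+(\mu x-t)\partial_x+u\partial_u$. 3.4: $K=\varepsilon u^\mu$, $f$ arbitrary: $\partial_t,\ \mu t\partial_t-u\partial_u$. 3.5a: $K=0$, $f=\exp\int\frac{-(4+3\mu)\beta x-2\gamma_1+\alpha}{(1+\mu)\beta x^2+\gamma_1x+\gamma_0}dx$: $\partial_t,\ \mu t\partial_t-u\partial_u,\ \alpha t\partial_t+((1+\mu)\beta x^2+\gamma_1x+\gamma_0)\partial_x+\beta xu\partial_u$. 3.5b: $K=u^\mu$, $f=\exp\int\frac{(2+\mu)\beta e^{-x}-2\gamma_0e^x-\alpha}{(1+\mu)\beta e^{-x}+\gamma_1+\gamma_0e^x}dx$: $\partial_t,\ \mu t\partial_t-u\partial_u,\ \alpha t\partial_t-((1+\mu)\beta e^{-x}+\gamma_1+\gamma_0e^x)\partial_x+\beta e^{-x}u\partial_u$. 3.5c: $\mu\neq-\frac32$, $K=1$, $f=x^{-1}$: $\partial_t,\ e^{-t}(\partial_t-x\partial_x),\ \mu x\partial_x+u\partial_u$. 3.6a: $\mu\ne-\frac43$, $K=0$, $f=1$: $\partial_t,\ \mu t\partial_t-u\partial_u,\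 \partial_x,\ 2t\partial_t+x\partial_x$. 3.6b: $\mu\ne-\frac43$, $K=u^\mu$, $f=e^{-2x}$: $\partial_t,\ \mu t\partial_t-u\partial_u,\ 2t\partial_t-\partial_x,\ e^x\partial_x$. 3.6c: $\mu=-1$, $K=0$, $f=e^{\gamma x}$: $\partial_t,\ t\partial_t+u\partial_u,\ \partial_x-\gamma u\partial_u,\ 2t\partial_t+x\partial_x-\gamma xu\partial_u$. 3.6d: $\mu=-1$, $K=u^{-1}$, $f=e^{-2x+\gamma e^{-x}}$: $\partial_t,\ t\partial_t+u\partial_u,\ e^x\partial_x+\gamma u\partial_u,\ 2t\partial_t-\partial_x-\gamma e^{-x}u\partial_u$. 3.6e: $\mu\neq-\frac43,-1$, $K=0$, $f=|x|^{-\frac{4+3\mu}{1+\mu}}$: $\partial_t,\ \mu t\partial_t-u\partial_u,\ (2+\mu)t\partial_t-(1+\mu)x\partial_x,\ (1+\mu)x^2\partial_x+xu\partial_u$. 3.6f: $\mu\neq-\frac43,-1$, $K=u^\mu$, $f=e^{-2x}|e^{-x}+\gamma|^{-\frac{4+3\mu}{1+\mu}}$: $\partial_t,\ \mu t\partial_t-u\partial_u,\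 (2+\mu)t\partial_t+(1+\mu)(e^{-x}+\gamma)e^x\partial_x,\ -(1+\mu)(e^{-x}+\gamma)^2e^x\partial_x+(e^{-x}+\gamma)u\partial_u$. 3.6g: $\mu=-\frac32$, $K=1$, $f=x^{-1}$: $\partial_t,\ e^{-t}(\partial_t-x\partial_x),\ 3x\partial_x-2u\partial_u,\ e^t(x^2\partial_x-2xu\partial_u)$. 3.7a: $\mu=-\frac43$, $K=0$, $f=1$: $\partial_t,\ 4t\partial_t+3u\partial_u,\ \partial_x,\ 2t\partial_t+x\partial_x,\ x^2\partial_x-3xu\partial_u$. 3.7b: $\mu=-\frac43$, $K=u^{-4/3}$, $f=e^{-2x}$: $\partial_t,\ 4t\partial_t+3u\partial_u,\ 2t\partial_t-\partial_x,\ e^{-x}(\partial_x+3u\partial_u),\ e^x\partial_x$. 3.8: $\mu=0$, $K=u$, $f=1$ ($u$ unrestricted): $\partial_t,\ \partial_x,\ 2t\partial_t+x\partial_x-u\partial_u,\ t\partial_x-\partial_u,\ t^2\partial_t+tx\partial_x-(tu+x)\partial_u$. **Theorem.** (i) Every equation $(*)$ with $A^{\max}\ne\langle\partial_t\rangle$ is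 equivalent to an equation of one of the cases other than 1.1 whose listed operators form a basis of its $A^{\max}$; here one can take $\varepsilon\in\{0,1\}$ in 1.2a, 2.4, 3.4, $\gamma=\pm1$ in 1.2b, 1.2c, and $\mu=1$ or $\nu=1$ in 2.1. (ii) For every equation $(*)$ of the form of one of the cases, the listed operators are linearly independent and belong to $A^{\max}$; they form a basis of $A^{\max}$ if and only if the equation is not equivalent to an equation of a case with a larger number of listed operators. In Cases 2.1 and 3.1 this is so iff not ($\nu=0$ and $\lambda=-1$), and in Case 3.2 iff $(\mu,\nu)\notin\{(-2,-2),(0,1)\}$ and $\nu\ne0$. (iii) Two equations of different cases, for both of which the listed operators form a basis of $A^{\max}$, are not equivalent, provided $\mu\ne\nu$ in 2.1, 3.1, 3.2, $\mu\neq1$ in 2.2 and $\gamma\ne0$ in 3.6c, 3.6d. (iv) The following nondegenerate point transformations map every equation of the first case to an equation of the second one (in Table 1 with the same $D$): 1.2b $\to$ 1.2a ($K=0$, $\varepsilon=1$): $\tilde t=\gamma^2t$, $\tilde x=\gamma e^{-x}$, $\tilde u=u$; 1.2c ($\nu\ne-2$) $\to$ 1.2a ($K=-D/(\nu+2)$,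 $\varepsilon=1$): $\tilde t=(\nu+2)^2t$, $\tilde x=(\nu+2)\ln|e^{-x}+\gamma|$, $\tilde u=u$; 1.2c ($\nu=-2$) $\to$ 1.2a ($K=-D$, $\varepsilon=0$): $\tilde t=t$, $\tilde x=\ln|e^{-x}+\gamma|$, $\tilde u=u$; 1.2d ($\nu\neq-2$) $\to$ 1.2a ($K=-D/(\nu+2)$, $\varepsilon=1$): $\tilde t=(\nu+2)^2t$, $\tilde x=(\nu+2)\ln|x|$, $\tilde u=u$; 1.2d ($\nu=-2$) $\to$ 1.2a ($K=-D$, $\varepsilon=0$): $\tilde t=t$, $\tilde x=\ln|x|$, $\tilde u=u$; 1.2e $\to$ 1.2a ($K=-D$, $\varepsilon=1$): $\tilde t=e^t\,{\rm sign}\,x$, $\tilde x=\ln|x|+t$, $\tilde u=u$; 1.3b $\to$ 1.3a, 2.6b $\to$ 2.6a, 3.6b $\to$ 3.6a (same $\mu$), 3.7b $\to$ 3.7a, and 2.5b $\to$ 2.5a, 3.5b $\to$ 3.5a (same constants): $\tilde t=t$, $\tilde x=e^{-x}$, $\tilde u=u$; 2.5c $\to$ 2.5a and 3.5c $\to$ 3.5a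 (same $\mu$), both with $\alpha=\gamma_1=1$, $\beta=\gamma_0=0$: $\tilde t=e^t\,{\rm sign}\,x$, $\tilde x=e^tx$, $\tilde u=u$; 2.6c $\to$ 2.6a: $\tilde t=t\,{\rm sign}(e^{-x}+\gamma)$, $\tilde x=1/(e^{-x}+\gamma)$, $\tilde u=u-\ln|e^{-x}+\gamma|$; 2.6d $\to$ 2.6a: $\tilde t=t\,{\rm sign}\,x$, $\tilde x=1/x$, $\tilde u=u-\ln|x|$; 3.6c $\to$ 3.6a ($\mu=-1$): $\tilde t=t$, $\tilde x=x$, $\tilde u=e^{\gamma x}u$; 3.6d $\to$ 3.6a ($\mu=-1$): $\tilde t=t$, $\tilde x=e^{-x}$, $\tilde u=e^{\gamma e^{-x}}u$; 3.6e $\to$ 3.6a (same $\mu$): $\tilde t=t$, $\tilde x=-1/x$, $\tilde u=|x|^{-\frac1{1+\mu}}u$; 3.6f $\to$ 3.6a (same $\mu$): $\tilde t=t$, $\tilde x=-1/(e^{-x}+\gamma)$, $\tilde u=|e^{-x}+\gamma|^{-\frac1{1+\mu}}u$; 3.6g $\to$ 3.6a ($\mu=-\frac32$): $\tilde t=e^t\,{\rm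 sign}\,x$, $\tilde x=-e^{-t}/x$, $\tilde u=|e^tx|^{2}u$. -/

import Mathlib

open scoped ContDiff

namespace DiffConv

noncomputable section

/-! ### The class of equations `f(x) u_t = (D(u) u_x)_x + K(u) u_x` -/

/-- The data of an equation `f(x) u_t = (D(u) u_x)_x + K(u) u_x`: the domains of `t`, `x`, `u`
and the arbitrary elements (only their values on the domains matter). -/
structure Eqn where
  /-- domain of `t` -/
  T : Set ℝ
  /-- domain of `x` -/
  I : Set ℝ
  /-- domain of `u` -/
  J : Set ℝ
  f : ℝ → ℝ
  D : ℝ → ℝ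
  K : ℝ → ℝ

/-- Nonempty open interval. -/
def IsOpenInterval (S : Set ℝ) : Prop := IsOpen S ∧ S.OrdConnected ∧ S.Nonempty

/-- A nonlinear equation of the class: `t`, `x`, `u` range over nonempty open intervals, the
arbitrary elements are smooth, `f D ≠ 0`, and `D_u`, `K_u` do not both vanish identically. -/
structure Eqn.Nonlinear (E : Eqn) : Prop where
  hT : IsOpenInterval E.T
  hI : IsOpenInterval E.I
  hJ : IsOpenInterval E.J
  smooth_f : ContDiffOn ℝ ∞ E.f E.I
  smooth_D : ContDiffOn ℝ ∞ E.D E.J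
  smooth_K : ContDiffOn ℝ ∞ E.K E.J
  f_ne : ∀ x ∈ E.I, E.f x ≠ 0
  D_ne : ∀ u ∈ E.J, E.D u ≠ 0
  nonlin : ∃ u ∈ E.J, deriv E.D u ≠ 0 ∨ deriv E.K u ≠ 0

/-- The domain of the variables `(t, x, u)`. -/
def Eqn.dom (E : Eqn) : Set (ℝ × ℝ × ℝ) := E.T ×ˢ E.I ×ˢ E.J

/-- The function `u` satisfies the equation at the point `(t, x)`. -/
def Eqn.HoldsAt (E : Eqn) (u : ℝ → ℝ → ℝ) (t x : ℝ) : Prop :=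
  E.f x * deriv (fun s => u s x) t =
    deriv (fun y => E.D (u t y) * deriv (u t) y) x + E.K (u t x) * deriv (u t) x

/-! ### Lie symmetries -/

/-- A function of `(t, x, u)` with values in triples, written with curried arguments. It is used
both for vector fields `ξᵗ ∂_t + ξˣ ∂_x + η ∂_u` (as triples of coefficients) and for point
transformations. -/
def op (F : ℝ → ℝ → ℝ → ℝ × ℝ × ℝ) : ℝ × ℝ × ℝ → ℝ × ℝ × ℝ := fun p => F p.1 p.2.1 p.2.2

/-- Partial derivative with respect to `t`. -/
def pt (g : ℝ × ℝ × ℝ → ℝ) (p : ℝ × ℝ × ℝ) : ℝ := deriv (fun s => g (s, p.2.1, p.2.2)) p.1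

/-- Partial derivative with respect to `x`. -/
def px (g : ℝ × ℝ × ℝ → ℝ) (p : ℝ × ℝ × ℝ) : ℝ := deriv (fun s => g (p.1, s, p.2.2)) p.2.1

/-- Partial derivative with respect to `u`. -/
def pu (g : ℝ × ℝ × ℝ → ℝ) (p : ℝ × ℝ × ℝ) : ℝ := deriv (fun s => g (p.1, p.2.1, s)) p.2.2

/-- Total derivative `D_t g` of a function of `(t, x, u)`, as a function of the jet. -/
def totT (g : ℝ × ℝ × ℝ → ℝ) (p : ℝ × ℝ × ℝ) (ut : ℝ) : ℝ := pt g p + ut * pu g p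

/-- Total derivative `D_x g` of a function of `(t, x, u)`, as a function of the jet. -/
def totX (g : ℝ × ℝ × ℝ → ℝ) (p : ℝ × ℝ × ℝ) (ux : ℝ) : ℝ := px g p + ux * pu g p

/-- Second total derivative `D_x D_x g` of a function of `(t, x, u)`. -/
def totXX (g : ℝ × ℝ × ℝ → ℝ) (p : ℝ × ℝ × ℝ) (ux uxx : ℝ) : ℝ :=
  px (px g) p + 2 * ux * pu (px g) p + ux ^ 2 * pu (pu g) p + uxx * pu g p

/-- The infinitesimal invariance criterion: the second prolongation of
`Q = ξᵗ ∂_t + ξˣ ∂_x + η ∂_u`, applied to `L = f u_t - D u_xx - D_u u_x² - K u_x`,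
vanishes at every second-order jet with `L = 0`. Here `ηt`, `ηx`, `ηxx` are the
coefficients of the prolongation at `∂_{u_t}`, `∂_{u_x}`, `∂_{u_xx}`. -/
def Eqn.Invariant (E : Eqn) (Q : ℝ × ℝ × ℝ → ℝ × ℝ × ℝ) : Prop :=
  ∀ p ∈ E.dom, ∀ ut ux utx uxx : ℝ,
    let x := p.2.1
    let u := p.2.2
    let τ : ℝ × ℝ × ℝ → ℝ := fun q => (Q q).1
    let ξ : ℝ × ℝ × ℝ → ℝ := fun q => (Q q).2.1
    let η : ℝ × ℝ × ℝ → ℝ := fun q => (Q q).2.2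
    let ηt := totT η p ut - ut * totT τ p ut - ux * totT ξ p ut
    let ηx := totX η p ux - ut * totX τ p ux - ux * totX ξ p ux
    let ηxx := totXX η p ux uxx - ut * totXX τ p ux uxx - ux * totXX ξ p ux uxx
      - 2 * utx * totX τ p ux - 2 * uxx * totX ξ p ux
    E.f x * ut = E.D u * uxx + deriv E.D u * ux ^ 2 + E.K u * ux →
    ξ p * deriv E.f x * ut + E.f x * ηt
      - η p * (deriv E.D u * uxx + deriv (deriv E.D) u * ux ^ 2 + deriv E.K u * ux)
      - E.D u * ηxx - 2 * deriv E.D u * ux * ηx - E.K u * ηx = 0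

/-- The maximal Lie invariance algebra: all smooth vector fields on the domain that satisfy the
invariance criterion. -/
def Eqn.maxAlg (E : Eqn) : Set (E.dom → ℝ × ℝ × ℝ) :=
  {X | ∃ Q : ℝ × ℝ × ℝ → ℝ × ℝ × ℝ, ContDiffOn ℝ ∞ Q E.dom ∧ E.Invariant Q ∧
    X = E.dom.domRestrict Q}

/-- The vector field `∂_t`. -/
def dt : ℝ × ℝ × ℝ → ℝ × ℝ × ℝ := op fun _ _ _ => (1, 0, 0)

/-- The members of a list of vector fields, restricted to the domain. -/
def Eqn.fam (E : Eqn) (l : List (ℝ × ℝ × ℝ → ℝ × ℝ × ℝ)) :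
    Fin l.length → (E.dom → ℝ × ℝ × ℝ) := fun i => E.dom.domRestrict (l.get i)

/-- The list is a basis of the maximal Lie invariance algebra. -/
def Eqn.IsBasis (E : Eqn) (l : List (ℝ × ℝ × ℝ → ℝ × ℝ × ℝ)) : Prop :=
  LinearIndependent ℝ (E.fam l) ∧
    (Submodule.span ℝ (Set.range (E.fam l)) : Set (E.dom → ℝ × ℝ × ℝ)) = E.maxAlg

/-- The maximal Lie invariance algebra is larger than the kernel algebra `⟨∂_t⟩`. -/
def Eqn.HasExtension (E : Eqn) : Prop :=
  E.maxAlg ≠ (Submodule.span ℝ {E.dom.domRestrict dt} : Set (E.dom → ℝ × ℝ × ℝ))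

/-! ### Equivalence -/

/-- `E'` is the image of `E` under an element of the equivalence group:
`t' = a t + b`, `x' = p x + q`, `u' = r u + s`, `f' = a m p⁻² f`, `D' = m D`, `K' = m p⁻¹ K`. -/
def GEquiv (E E' : Eqn) : Prop :=
  ∃ a b p q r s m : ℝ, a ≠ 0 ∧ p ≠ 0 ∧ r ≠ 0 ∧ m ≠ 0 ∧
    E'.T = (fun t => a * t + b) '' E.T ∧
    E'.I = (fun x => p * x + q) '' E.I ∧
    E'.J = (fun u => r * u + s) '' E.J ∧
    (∀ x ∈ E.I, E'.f (p * x + q) = a * m / p ^ 2 * E.f x) ∧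
    (∀ u ∈ E.J, E'.D (r * u + s) = m * E.D u) ∧
    (∀ u ∈ E.J, E'.K (r * u + s) = m / p * E.K u)

/-- The equation with `K` replaced by `K + κ`. If `f = c` is constant, this is the result of
the change of variable `x' = x - (κ / c) t`; the coefficients of such an equation do not depend on
`t` and `x`, and the new equation is considered on the same intervals. -/
def Eqn.shiftK (E : Eqn) (κ : ℝ) : Eqn := { E with K := fun u => E.K u + κ }

/-- Equivalence modulo the equivalence group and, for equations with constant `f` only, the
transformations `x' = x - ε t`, `K' = K + ε f`. -/
def Equivalent (E E' : Eqn) : Prop :=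
  ∃ κ : ℝ, (κ = 0 ∨ ∃ c : ℝ, ∀ x ∈ E.I, E.f x = c) ∧ GEquiv (E.shiftK κ) E'

/-- `Φ` is a nondegenerate local transformation of `(t, x, u)` that maps the equation `E` to the
equation `E'`: whenever `Φ` carries the graph of a smooth function `u` into the graph of a smooth
function `v`, the equation `E` holds for `u` at a point iff `E'` holds for `v` at the image. -/
def Transforms (Φ : ℝ × ℝ × ℝ → ℝ × ℝ × ℝ) (E E' : Eqn) : Prop :=
  ContDiffOn ℝ ∞ Φ E.dom ∧ Set.InjOn Φ E.dom ∧ Set.MapsTo Φ E.dom E'.dom ∧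
  (∀ p ∈ E.dom, Function.Bijective (fderiv ℝ Φ p)) ∧
  ∀ (W W' : Set (ℝ × ℝ)) (u v : ℝ → ℝ → ℝ), IsOpen W → IsOpen W' →
    W ⊆ E.T ×ˢ E.I → W' ⊆ E'.T ×ˢ E'.I →
    ContDiffOn ℝ ∞ (fun z : ℝ × ℝ => u z.1 z.2) W →
    ContDiffOn ℝ ∞ (fun z : ℝ × ℝ => v z.1 z.2) W' →
    (∀ t x, (t, x) ∈ W → u t x ∈ E.J) →
    (∀ t x, (t, x) ∈ W → ((Φ (t, x, u t x)).1, (Φ (t, x, u t x)).2.1) ∈ W' ∧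
      (Φ (t, x, u t x)).2.2 = v (Φ (t, x, u t x)).1 (Φ (t, x, u t x)).2.1) →
    ∀ t x, (t, x) ∈ W →
      (E.HoldsAt u t x ↔ E'.HoldsAt v (Φ (t, x, u t x)).1 (Φ (t, x, u t x)).2.1)

/-! ### The classification list -/

/-- The cases of the three tables with their parameters. -/
inductive Case where
  | c1_1
  | c1_2a (ε : ℝ)
  | c1_2b (γ : ℝ)
  | c1_2c (γ ν : ℝ)
  | c1_2d (ν : ℝ)
  | c1_2e
  | c1_3a
  | c1_3b
  | c2_1 (μ ν l : ℝ)
  | c2_2 (μ : ℝ)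
  | c2_3
  | c2_4 (ε : ℝ)
  | c2_5a (α β γ₁ γ₀ : ℝ)
  | c2_5b (α β γ₁ γ₀ : ℝ)
  | c2_5c
  | c2_6a
  | c2_6b
  | c2_6c (γ : ℝ)
  | c2_6d
  | c3_1 (μ ν l : ℝ)
  | c3_2 (μ ν : ℝ)
  | c3_3 (μ : ℝ)
  | c3_4 (μ ε : ℝ)
  | c3_5a (μ α β γ₁ γ₀ : ℝ)
  | c3_5b (μ α β γ₁ γ₀ : ℝ)
  | c3_5c (μ : ℝ)
  | c3_6a (μ : ℝ)
  | c3_6b (μ : ℝ)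
  | c3_6c (γ : ℝ)
  | c3_6d (γ : ℝ)
  | c3_6e (μ : ℝ)
  | c3_6f (μ γ : ℝ)
  | c3_6g
  | c3_7a
  | c3_7b
  | c3_8

/-- Table, number and letter (0 if there is none) of a case. -/
def Case.label : Case → ℕ × ℕ × ℕ
  | c1_1 => (1, 1, 0)
  | c1_2a _ => (1, 2, 1)
  | c1_2b _ => (1, 2, 2)
  | c1_2c _ _ => (1, 2, 3)
  | c1_2d _ => (1, 2, 4)
  | c1_2e => (1, 2, 5)
  | c1_3a => (1, 3, 1)
  | c1_3b => (1, 3, 2)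
  | c2_1 _ _ _ => (2, 1, 0)
  | c2_2 _ => (2, 2, 0)
  | c2_3 => (2, 3, 0)
  | c2_4 _ => (2, 4, 0)
  | c2_5a _ _ _ _ => (2, 5, 1)
  | c2_5b _ _ _ _ => (2, 5, 2)
  | c2_5c => (2, 5, 3)
  | c2_6a => (2, 6, 1)
  | c2_6b => (2, 6, 2)
  | c2_6c _ => (2, 6, 3)
  | c2_6d => (2, 6, 4)
  | c3_1 _ _ _ => (3, 1, 0)
  | c3_2 _ _ => (3, 2, 0)
  | c3_3 _ => (3, 3, 0)
  | c3_4 _ _ => (3, 4, 0)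
  | c3_5a _ _ _ _ _ => (3, 5, 1)
  | c3_5b _ _ _ _ _ => (3, 5, 2)
  | c3_5c _ => (3, 5, 3)
  | c3_6a _ => (3, 6, 1)
  | c3_6b _ => (3, 6, 2)
  | c3_6c _ => (3, 6, 3)
  | c3_6d _ => (3, 6, 4)
  | c3_6e _ => (3, 6, 5)
  | c3_6f _ _ => (3, 6, 6)
  | c3_6g => (3, 6, 7)
  | c3_7a => (3, 7, 1)
  | c3_7b => (3, 7, 2)
  | c3_8 => (3, 8, 0)

/-- `D = d`, `K = k`, `f = g` on the domains. -/
def Eqn.Has (E : Eqn) (d k g : ℝ → ℝ) : Prop :=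
  Set.EqOn E.D d E.J ∧ Set.EqOn E.K k E.J ∧ Set.EqOn E.f g E.I

/-- `D = d`, `K = k` on the domain. -/
def Eqn.HasDK (E : Eqn) (d k : ℝ → ℝ) : Prop := Set.EqOn E.D d E.J ∧ Set.EqOn E.K k E.J

/-- `f = exp (∫ num / den)` with a denominator without zeros on the domain. -/
def Eqn.HasExpInt (E : Eqn) (num den : ℝ → ℝ) : Prop :=
  ∃ F : ℝ → ℝ, ∀ x ∈ E.I, den x ≠ 0 ∧ HasDerivAt F (num x / den x) x ∧
    E.f x = Real.exp (F x)

/-- The equation has the form of the case. Real powers of `u` are taken for `u > 0`; nonnegative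
integer powers, in cases where `D = 1`, are allowed for all `u`. -/
def Case.Entry : Case → Eqn → Prop
  | c1_1, _ => True
  | c1_2a ε, E => Set.EqOn E.f (fun x => Real.exp (ε * x)) E.I
  | c1_2b γ, E => γ ≠ 0 ∧ E.Has E.D E.D (fun x => Real.exp (-2 * x + γ * Real.exp (-x)))
  | c1_2c γ ν, E => γ ≠ 0 ∧ ν ≠ 0 ∧
      E.Has E.D E.D (fun x => Real.exp (-2 * x) * |Real.exp (-x) + γ| ^ ν)
  | c1_2d ν, E => ν ≠ 0 ∧ E.Has E.D (fun _ => 0) (fun x => |x| ^ ν)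
  | c1_2e, E => E.Has E.D (fun _ => 1) (fun x => x⁻¹)
  | c1_3a, E => E.Has E.D (fun _ => 0) (fun _ => 1)
  | c1_3b, E => E.Has E.D E.D (fun x => Real.exp (-2 * x))
  | c2_1 μ ν l, E => l ≠ 0 ∧
      E.Has (fun u => Real.exp (μ * u)) (fun u => Real.exp (ν * u)) (fun x => |x| ^ l)
  | c2_2 μ, E => E.Has (fun u => Real.exp (μ * u)) Real.exp (fun _ => 1)
  | c2_3, E => E.Has Real.exp (fun u => u) (fun _ => 1)
  | c2_4 ε, E => E.HasDK Real.exp (fun u => ε * Real.exp u)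
  | c2_5a α β γ₁ γ₀, E => E.HasDK Real.exp (fun _ => 0) ∧
      E.HasExpInt (fun x => -3 * β * x - 2 * γ₁ + α) (fun x => β * x ^ 2 + γ₁ * x + γ₀)
  | c2_5b α β γ₁ γ₀, E => E.HasDK Real.exp Real.exp ∧
      E.HasExpInt (fun x => β * Real.exp (-x) - 2 * γ₀ * Real.exp x - α)
        (fun x => β * Real.exp (-x) + γ₁ + γ₀ * Real.exp x)
  | c2_5c, E => E.Has Real.exp (fun _ => 1) (fun x => x⁻¹)
  | c2_6a, E => E.Has Real.exp (fun _ => 0) (fun _ => 1)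
  | c2_6b, E => E.Has Real.exp Real.exp (fun x => Real.exp (-2 * x))
  | c2_6c γ, E => E.Has Real.exp Real.exp
      (fun x => Real.exp (-2 * x) * (Real.exp (-x) + γ) ^ (-3 : ℤ))
  | c2_6d, E => E.Has Real.exp (fun _ => 0) (fun x => x ^ (-3 : ℤ))
  | c3_1 μ ν l, E => (E.J ⊆ Set.Ioi 0 ∨ μ = 0 ∧ ∃ n : ℕ, ν = n) ∧ l ≠ 0 ∧
      E.Has (fun u => u ^ μ) (fun u => u ^ ν) (fun x => |x| ^ l)
  | c3_2 μ ν, E => (E.J ⊆ Set.Ioi 0 ∨ μ = 0 ∧ ∃ n : ℕ, ν = n) ∧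
      E.Has (fun u => u ^ μ) (fun u => u ^ ν) (fun _ => 1)
  | c3_3 μ, E => E.J ⊆ Set.Ioi 0 ∧ E.Has (fun u => u ^ μ) Real.log (fun _ => 1)
  | c3_4 μ ε, E => E.J ⊆ Set.Ioi 0 ∧ μ ≠ 0 ∧ E.HasDK (fun u => u ^ μ) (fun u => ε * u ^ μ)
  | c3_5a μ α β γ₁ γ₀, E => E.J ⊆ Set.Ioi 0 ∧ μ ≠ 0 ∧ E.HasDK (fun u => u ^ μ) (fun _ => 0) ∧
      E.HasExpInt (fun x => -(4 + 3 * μ) * β * x - 2 * γ₁ + α)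
        (fun x => (1 + μ) * β * x ^ 2 + γ₁ * x + γ₀)
  | c3_5b μ α β γ₁ γ₀, E => E.J ⊆ Set.Ioi 0 ∧ μ ≠ 0 ∧
      E.HasDK (fun u => u ^ μ) (fun u => u ^ μ) ∧
      E.HasExpInt (fun x => (2 + μ) * β * Real.exp (-x) - 2 * γ₀ * Real.exp x - α)
        (fun x => (1 + μ) * β * Real.exp (-x) + γ₁ + γ₀ * Real.exp x)
  | c3_5c μ, E => E.J ⊆ Set.Ioi 0 ∧ μ ≠ 0 ∧ μ ≠ -3 / 2 ∧
      E.Has (fun u => u ^ μ) (fun _ => 1) (fun x => x⁻¹)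
  | c3_6a μ, E => E.J ⊆ Set.Ioi 0 ∧ μ ≠ 0 ∧ μ ≠ -4 / 3 ∧
      E.Has (fun u => u ^ μ) (fun _ => 0) (fun _ => 1)
  | c3_6b μ, E => E.J ⊆ Set.Ioi 0 ∧ μ ≠ 0 ∧ μ ≠ -4 / 3 ∧
      E.Has (fun u => u ^ μ) (fun u => u ^ μ) (fun x => Real.exp (-2 * x))
  | c3_6c γ, E => E.J ⊆ Set.Ioi 0 ∧
      E.Has (fun u => u⁻¹) (fun _ => 0) (fun x => Real.exp (γ * x))
  | c3_6d γ, E => E.J ⊆ Set.Ioi 0 ∧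
      E.Has (fun u => u⁻¹) (fun u => u⁻¹) (fun x => Real.exp (-2 * x + γ * Real.exp (-x)))
  | c3_6e μ, E => E.J ⊆ Set.Ioi 0 ∧ μ ≠ 0 ∧ μ ≠ -4 / 3 ∧ μ ≠ -1 ∧
      E.Has (fun u => u ^ μ) (fun _ => 0) (fun x => |x| ^ (-(4 + 3 * μ) / (1 + μ)))
  | c3_6f μ γ, E => E.J ⊆ Set.Ioi 0 ∧ μ ≠ 0 ∧ μ ≠ -4 / 3 ∧ μ ≠ -1 ∧
      E.Has (fun u => u ^ μ) (fun u => u ^ μ)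
        (fun x => Real.exp (-2 * x) * |Real.exp (-x) + γ| ^ (-(4 + 3 * μ) / (1 + μ)))
  | c3_6g, E => E.J ⊆ Set.Ioi 0 ∧
      E.Has (fun u => u ^ (-3 / 2 : ℝ)) (fun _ => 1) (fun x => x⁻¹)
  | c3_7a, E => E.J ⊆ Set.Ioi 0 ∧
      E.Has (fun u => u ^ (-4 / 3 : ℝ)) (fun _ => 0) (fun _ => 1)
  | c3_7b, E => E.J ⊆ Set.Ioi 0 ∧
      E.Has (fun u => u ^ (-4 / 3 : ℝ)) (fun u => u ^ (-4 / 3 : ℝ)) (fun x => Real.exp (-2 * x))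
  | c3_8, E => E.Has (fun _ => 1) (fun u => u) (fun _ => 1)

/-- The listed operators of a case; a triple stands for the coefficients at
`∂_t`, `∂_x`, `∂_u`. -/
def Case.ops : Case → List (ℝ × ℝ × ℝ → ℝ × ℝ × ℝ)
  | c1_1 => [dt]
  | c1_2a ε => [dt, op fun t _ _ => (ε * t, 1, 0)]
  | c1_2b γ => [dt, op fun t x _ => (γ * t, -Real.exp x, 0)]
  | c1_2c γ ν => [dt, op fun t x _ => ((ν + 2) * t, -(Real.exp (-x) + γ) * Real.exp x, 0)]
  | c1_2d ν => [dt, op fun t x _ => ((ν + 2) * t, x, 0)]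
  | c1_2e => [dt, op fun t x _ => (Real.exp (-t), -Real.exp (-t) * x, 0)]
  | c1_3a => [dt, op fun _ _ _ => (0, 1, 0), op fun t x _ => (2 * t, x, 0)]
  | c1_3b => [dt, op fun t _ _ => (2 * t, -1, 0), op fun _ x _ => (0, Real.exp x, 0)]
  | c2_1 μ ν l => [dt, op fun t x _ => ((l * μ - l * ν + μ - 2 * ν) * t, (μ - ν) * x, 1)]
  | c2_2 μ => [dt, op fun _ _ _ => (0, 1, 0), op fun t x _ => ((μ - 2) * t, (μ - 1) * x, 1)]
  | c2_3 => [dt, op fun _ _ _ => (0, 1, 0), op fun t x _ => (t, x - t, 1)]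
  | c2_4 _ => [dt, op fun t _ _ => (t, 0, -1)]
  | c2_5a α β γ₁ γ₀ => [dt, op fun t _ _ => (t, 0, -1),
      op fun t x _ => (α * t, β * x ^ 2 + γ₁ * x + γ₀, β * x)]
  | c2_5b α β γ₁ γ₀ => [dt, op fun t _ _ => (t, 0, -1),
      op fun t x _ =>
        (α * t, -(β * Real.exp (-x) + γ₁ + γ₀ * Real.exp x), β * Real.exp (-x))]
  | c2_5c => [dt, op fun _ x _ => (0, x, 1),
      op fun t x _ => (Real.exp (-t), -Real.exp (-t) * x, 0)]
  | c2_6a => [dt, op fun t _ _ => (t, 0, -1), op fun t x _ => (2 * t, x, 0),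
      op fun _ _ _ => (0, 1, 0)]
  | c2_6b => [dt, op fun t _ _ => (t, 0, -1), op fun t _ _ => (2 * t, -1, 0),
      op fun _ x _ => (0, Real.exp x, 0)]
  | c2_6c γ => [dt, op fun t _ _ => (t, 0, -1),
      op fun _ x _ => (0, (Real.exp (-x) + γ) * Real.exp x, 1),
      op fun _ x _ => (0, -(Real.exp (-x) + γ) ^ 2 * Real.exp x, Real.exp (-x) + γ)]
  | c2_6d => [dt, op fun t _ _ => (t, 0, -1), op fun _ x _ => (0, x, -1),
      op fun _ x _ => (0, x ^ 2, x)]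
  | c3_1 μ ν l => [dt,
      op fun t x u => ((μ + l * μ - 2 * ν - l * ν) * t, (μ - ν) * x, u)]
  | c3_2 μ ν => [dt, op fun _ _ _ => (0, 1, 0),
      op fun t x u => ((μ - 2 * ν) * t, (μ - ν) * x, u)]
  | c3_3 μ => [dt, op fun _ _ _ => (0, 1, 0), op fun t x u => (μ * t, μ * x - t, u)]
  | c3_4 μ _ => [dt, op fun t _ u => (μ * t, 0, -u)]
  | c3_5a μ α β γ₁ γ₀ => [dt, op fun t _ u => (μ * t, 0, -u),
      op fun t x u => (α * t, (1 + μ) * β * x ^ 2 + γ₁ * x + γ₀, β * x * u)]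
  | c3_5b μ α β γ₁ γ₀ => [dt, op fun t _ u => (μ * t, 0, -u),
      op fun t x u => (α * t, -((1 + μ) * β * Real.exp (-x) + γ₁ + γ₀ * Real.exp x),
        β * Real.exp (-x) * u)]
  | c3_5c μ => [dt, op fun t x _ => (Real.exp (-t), -Real.exp (-t) * x, 0),
      op fun _ x u => (0, μ * x, u)]
  | c3_6a μ => [dt, op fun t _ u => (μ * t, 0, -u), op fun _ _ _ => (0, 1, 0),
      op fun t x _ => (2 * t, x, 0)]
  | c3_6b μ => [dt, op fun t _ u => (μ * t, 0, -u), op fun t _ _ => (2 * t, -1, 0),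
      op fun _ x _ => (0, Real.exp x, 0)]
  | c3_6c γ => [dt, op fun t _ u => (t, 0, u), op fun _ _ u => (0, 1, -γ * u),
      op fun t x u => (2 * t, x, -γ * x * u)]
  | c3_6d γ => [dt, op fun t _ u => (t, 0, u), op fun _ x u => (0, Real.exp x, γ * u),
      op fun t x u => (2 * t, -1, -γ * Real.exp (-x) * u)]
  | c3_6e μ => [dt, op fun t _ u => (μ * t, 0, -u),
      op fun t x _ => ((2 + μ) * t, -(1 + μ) * x, 0),
      op fun _ x u => (0, (1 + μ) * x ^ 2, x * u)]
  | c3_6f μ γ => [dt, op fun t _ u => (μ * t, 0, -u),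
      op fun t x _ => ((2 + μ) * t, (1 + μ) * (Real.exp (-x) + γ) * Real.exp x, 0),
      op fun _ x u => (0, -(1 + μ) * (Real.exp (-x) + γ) ^ 2 * Real.exp x,
        (Real.exp (-x) + γ) * u)]
  | c3_6g => [dt, op fun t x _ => (Real.exp (-t), -Real.exp (-t) * x, 0),
      op fun _ x u => (0, 3 * x, -2 * u),
      op fun t x u => (0, Real.exp t * x ^ 2, -2 * Real.exp t * x * u)]
  | c3_7a => [dt, op fun t _ u => (4 * t, 0, 3 * u), op fun _ _ _ => (0, 1, 0),
      op fun t x _ => (2 * t, x, 0), op fun _ x u => (0, x ^ 2, -3 * x * u)]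
  | c3_7b => [dt, op fun t _ u => (4 * t, 0, 3 * u), op fun t _ _ => (2 * t, -1, 0),
      op fun _ x u => (0, Real.exp (-x), 3 * Real.exp (-x) * u),
      op fun _ x _ => (0, Real.exp x, 0)]
  | c3_8 => [dt, op fun _ _ _ => (0, 1, 0), op fun t x u => (2 * t, x, -u),
      op fun t _ _ => (0, t, -1), op fun t x u => (t ^ 2, t * x, -(t * u + x))]

/-- The normalization of parameters that can be reached by equivalence transformations. -/
def Case.Normalized : Case → Prop
  | c1_2a ε => ε = 0 ∨ ε = 1
  | c1_2b γ => γ = 1 ∨ γ = -1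
  | c1_2c γ _ => γ = 1 ∨ γ = -1
  | c2_1 μ ν _ => μ = 1 ∨ ν = 1
  | c2_4 ε => ε = 0 ∨ ε = 1
  | c3_4 _ ε => ε = 0 ∨ ε = 1
  | _ => True

/-- Parameter values for which an entry does not already have the form of another case with the
same number of operators (`D = K` up to scaling, or an exponent that disappears). -/
def Case.Irredundant : Case → Prop
  | c2_1 μ ν _ => μ ≠ ν
  | c2_2 μ => μ ≠ 1
  | c3_1 μ ν _ => μ ≠ ν
  | c3_2 μ ν => μ ≠ ν
  | c3_6c γ => γ ≠ 0
  | c3_6d γ => γ ≠ 0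
  | _ => True

/-- The entry `E` of the case `c` is not equivalent to an entry with a more extensive list of
operators. -/
def Case.Proper (c : Case) (E : Eqn) : Prop :=
  ∀ (c' : Case) (E' : Eqn), E'.Nonlinear → c'.Entry E' → Equivalent E E' →
    c'.ops.length ≤ c.ops.length

/-- `Φ` maps every nonlinear equation of the form `c` to a nonlinear equation of the form `c'`. -/
def Reduces (Φ : ℝ × ℝ × ℝ → ℝ × ℝ × ℝ) (c c' : Case) : Prop :=
  ∀ E : Eqn, E.Nonlinear → c.Entry E → ∃ E' : Eqn, E'.Nonlinear ∧ c'.Entry E' ∧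
    Transforms Φ E E'

/-- `Φ` maps every nonlinear equation of the form `c` to a nonlinear equation of the form `c'`
with the same `D` and with `K' = k D`. -/
def ReducesKD (Φ : ℝ × ℝ × ℝ → ℝ × ℝ × ℝ) (c c' : Case) (k : ℝ) : Prop :=
  ∀ E : Eqn, E.Nonlinear → c.Entry E → ∃ E' : Eqn, E'.Nonlinear ∧ c'.Entry E' ∧
    E'.J = E.J ∧ Set.EqOn E'.D E.D E.J ∧ (∀ u ∈ E.J, E'.K u = k * E.D u) ∧
    Transforms Φ E E'

end

end DiffConv

namespace DiffConv
noncomputable section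
open Real (exp log)
open Set (EqOn Ioi univ InjOn injOn_id)

variable {E E' : Eqn}

/-- Vector fields in `(t, x, u)`, and transformations of these variables. -/
abbrev VField := ℝ × ℝ × ℝ → ℝ × ℝ × ℝ

section
lemma zero_of_mul {a b : ℝ} (ha : a ≠ 0) (h : a * b = 0) : b = 0 := (mul_eq_zero.1 h).resolve_left ha

lemma _root_.HasDerivAt.congr_on {F : Type*} [NormedAddCommGroup F] [NormedSpace ℝ F]
    {S : Set ℝ} {g h : ℝ → F} {g' : F} {x : ℝ} (hg : HasDerivAt g g' x)
    (hS : IsOpen S) (hx : x ∈ S) (e : ∀ y ∈ S, h y = g y) : HasDerivAt h g' x :=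
  hg.congr_of_eventuallyEq (Filter.mem_of_superset (hS.mem_nhds hx) e)

lemma _root_.HasDerivAt.eq_zero_of_const {S : Set ℝ} {g : ℝ → ℝ} {g' c x : ℝ}
    (hg : HasDerivAt g g' x) (hS : IsOpen S) (hx : x ∈ S) (e : ∀ y ∈ S, g y = c) : g' = 0 :=
  hg.unique ((hasDerivAt_const x c).congr_on hS hx e)

/-! ### Partial derivatives of smooth functions -/

section Partial
variable {U : Set (ℝ × ℝ × ℝ)} {g : ℝ × ℝ × ℝ → ℝ}

lemma hasDerivAt_curve (hU : IsOpen U) (hg : ContDiffOn ℝ ∞ g U) {c : ℝ → ℝ × ℝ × ℝ}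
    {v : ℝ × ℝ × ℝ} {s : ℝ} (hp : c s ∈ U) (hc : HasDerivAt c v s) :
    HasDerivAt (fun s => g (c s)) (fderiv ℝ g (c s) v) s :=
  HasFDerivAt.comp_hasDerivAt s
    ((hg.contDiffAt (hU.mem_nhds hp)).differentiableAt (by simp)).hasFDerivAt hc

lemma hasDerivAt_pt (hU : IsOpen U) (hg : ContDiffOn ℝ ∞ g U) {p : ℝ × ℝ × ℝ} (hp : p ∈ U) :
    HasDerivAt (fun s => g (s, p.2.1, p.2.2)) (fderiv ℝ g p (1, 0, 0)) p.1 :=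
  hasDerivAt_curve hU hg hp ((hasDerivAt_id p.1).prodMk (hasDerivAt_const _ _))

lemma hasDerivAt_px (hU : IsOpen U) (hg : ContDiffOn ℝ ∞ g U) {p : ℝ × ℝ × ℝ} (hp : p ∈ U) :
    HasDerivAt (fun s => g (p.1, s, p.2.2)) (fderiv ℝ g p (0, 1, 0)) p.2.1 :=
  hasDerivAt_curve hU hg (c := fun s => (p.1, s, p.2.2)) hp
    ((hasDerivAt_const _ _).prodMk ((hasDerivAt_id p.2.1).prodMk (hasDerivAt_const _ _)))

lemma hasDerivAt_pu (hU : IsOpen U) (hg : ContDiffOn ℝ ∞ g U) {p : ℝ × ℝ × ℝ} (hp : p ∈ U) :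
    HasDerivAt (fun s => g (p.1, p.2.1, s)) (fderiv ℝ g p (0, 0, 1)) p.2.2 :=
  hasDerivAt_curve hU hg (c := fun s => (p.1, p.2.1, s)) hp
    ((hasDerivAt_const _ _).prodMk ((hasDerivAt_const _ _).prodMk (hasDerivAt_id p.2.2)))

lemma hasDerivAt_pt' (hU : IsOpen U) (hg : ContDiffOn ℝ ∞ g U) {t x u : ℝ} (hp : (t, x, u) ∈ U) :
    HasDerivAt (fun s => g (s, x, u)) (pt g (t, x, u)) t :=
  (hasDerivAt_pt hU hg hp).differentiableAt.hasDerivAt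

lemma hasDerivAt_px' (hU : IsOpen U) (hg : ContDiffOn ℝ ∞ g U) {t x u : ℝ} (hp : (t, x, u) ∈ U) :
    HasDerivAt (fun s => g (t, s, u)) (px g (t, x, u)) x :=
  (hasDerivAt_px hU hg hp).differentiableAt.hasDerivAt

lemma hasDerivAt_pu' (hU : IsOpen U) (hg : ContDiffOn ℝ ∞ g U) {t x u : ℝ} (hp : (t, x, u) ∈ U) :
    HasDerivAt (fun s => g (t, x, s)) (pu g (t, x, u)) u :=
  (hasDerivAt_pu hU hg hp).differentiableAt.hasDerivAt

lemma contDiffOn_fderiv_apply (hU : IsOpen U) (hg : ContDiffOn ℝ ∞ g U) (v : ℝ × ℝ × ℝ) :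
    ContDiffOn ℝ ∞ (fun p => fderiv ℝ g p v) U :=
  (hg.fderiv_of_isOpen hU (m := ∞) (by simp)).clm_apply contDiffOn_const

lemma contDiffOn_px (hU : IsOpen U) (hg : ContDiffOn ℝ ∞ g U) : ContDiffOn ℝ ∞ (px g) U :=
  (contDiffOn_fderiv_apply hU hg (0, 1, 0)).congr fun _ hp => (hasDerivAt_px hU hg hp).deriv

lemma contDiffOn_pu (hU : IsOpen U) (hg : ContDiffOn ℝ ∞ g U) : ContDiffOn ℝ ∞ (pu g) U :=
  (contDiffOn_fderiv_apply hU hg (0, 0, 1)).congr fun _ hp => (hasDerivAt_pu hU hg hp).deriv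

end Partial

/-! ### Functions of one variable on open intervals -/

lemma IsOpenInterval.preconnected {S : Set ℝ} (h : IsOpenInterval S) : IsPreconnected S :=
  h.2.1.isPreconnected

lemma eq_of_hasDerivAt_zero {S : Set ℝ} (hS : IsOpenInterval S) {g : ℝ → ℝ}
    (h : ∀ x ∈ S, HasDerivAt g 0 x) {x y : ℝ} (hx : x ∈ S) (hy : y ∈ S) : g x = g y := by
  obtain ⟨c, hc⟩ := hS.1.exists_is_const_of_deriv_eq_zero hS.preconnected
    (fun z hz => (h z hz).differentiableAt.differentiableWithinAt) (fun z hz => (h z hz).deriv)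
  rw [hc x hx, hc y hy]

lemma IsOpenInterval.exists_two {S : Set ℝ} (h : IsOpenInterval S) :
    ∃ x ∈ S, ∃ y ∈ S, x ≠ y := by
  obtain ⟨x, hx⟩ := h.2.2
  obtain ⟨ε, he, hb⟩ := Metric.isOpen_iff.1 h.1 x hx
  refine ⟨x, hx, x + ε / 2, hb ?_, by linarith⟩
  simp [abs_of_pos he, he]

/-! ### The determining equations -/

/-- `gt`, `gx`, `gxx` are partial derivatives of `g` on `T × I`. -/
structure Jet (T I : Set ℝ) (g gt gx gxx : ℝ → ℝ → ℝ) : Prop where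
  t : ∀ t ∈ T, ∀ x ∈ I, HasDerivAt (fun s => g s x) (gt t x) t
  x : ∀ t ∈ T, ∀ x ∈ I, HasDerivAt (g t) (gx t x) x
  xx : ∀ t ∈ T, ∀ x ∈ I, HasDerivAt (gx t) (gxx t x) x

/-- The logarithmic derivative of `f`. -/
def Eqn.φ (E : Eqn) (x : ℝ) : ℝ := deriv E.f x / E.f x

/-- The coefficients of the operator `τ(t) ∂_t + ξ(t,x) ∂_x + (α(t,x) u + β(t,x)) ∂_u`. -/
structure Field (E : Eqn) where
  (τ τ' : ℝ → ℝ)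
  (ξ ξt ξx ξxx α αt αx αxx β βt βx βxx : ℝ → ℝ → ℝ)
  jτ : ∀ t ∈ E.T, HasDerivAt τ (τ' t) t
  jξ : Jet E.T E.I ξ ξt ξx ξxx
  jα : Jet E.T E.I α αt αx αxx
  jβ : Jet E.T E.I β βt βx βxx

/-- A solution of the determining equations. -/
structure Sol (E : Eqn) extends Field E where
  eq1 : ∀ t ∈ E.T, ∀ x ∈ E.I, ∀ u ∈ E.J,
    (α t x * u + β t x) * deriv E.D u = (ξ t x * E.φ x - τ' t + 2 * ξx t x) * E.D u
  eq3 : ∀ t ∈ E.T, ∀ x ∈ E.I, ∀ u ∈ E.J,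
    (α t x * u + β t x) * deriv E.K u = (ξ t x * E.φ x - τ' t + ξx t x) * E.K u
      - E.f x * ξt t x - E.D u * (2 * αx t x - ξxx t x)
      - 2 * deriv E.D u * (αx t x * u + βx t x)
  eq4 : ∀ t ∈ E.T, ∀ x ∈ E.I, ∀ u ∈ E.J,
    E.f x * (αt t x * u + βt t x) = E.D u * (αxx t x * u + βxx t x)
      + E.K u * (αx t x * u + βx t x)

/-- The vector field. -/
def Field.Q {E : Eqn} (s : Field E) : VField :=
  op fun t x u => (s.τ t, s.ξ t x, s.α t x * u + s.β t x)

variable {E : Eqn} (hE : E.Nonlinear)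
include hE

lemma Eqn.Nonlinear.isOpen_dom : IsOpen E.dom :=
  hE.hT.1.prod (hE.hI.1.prod hE.hJ.1)

lemma Eqn.Nonlinear.hasDerivAt_D {u : ℝ} (hu : u ∈ E.J) :
    HasDerivAt E.D (deriv E.D u) u :=
  ((hE.smooth_D.contDiffAt (hE.hJ.1.mem_nhds hu)).differentiableAt (by simp)).hasDerivAt

lemma Eqn.Nonlinear.hasDerivAt_K {u : ℝ} (hu : u ∈ E.J) :
    HasDerivAt E.K (deriv E.K u) u :=
  ((hE.smooth_K.contDiffAt (hE.hJ.1.mem_nhds hu)).differentiableAt (by simp)).hasDerivAt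

lemma Eqn.Nonlinear.hasDerivAt_f {x : ℝ} (hx : x ∈ E.I) :
    HasDerivAt E.f (deriv E.f x) x :=
  ((hE.smooth_f.contDiffAt (hE.hI.1.mem_nhds hx)).differentiableAt (by simp)).hasDerivAt

lemma Eqn.Nonlinear.hasDerivAt_dD {u : ℝ} (hu : u ∈ E.J) :
    HasDerivAt (deriv E.D) (deriv (deriv E.D) u) u :=
  (((hE.smooth_D.deriv_of_isOpen hE.hJ.1 (m := ∞) (by simp)).contDiffAt
    (hE.hJ.1.mem_nhds hu)).differentiableAt (by simp)).hasDerivAt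

lemma Eqn.Nonlinear.f_mul_φ {x : ℝ} (hx : x ∈ E.I) :
    E.f x * E.φ x = deriv E.f x := by
  have := hE.f_ne x hx
  unfold Eqn.φ; field_simp

/-- The left-hand side of the infinitesimal invariance criterion. -/
def Eqn.invExpr (E : Eqn) (Q : VField) (p : ℝ × ℝ × ℝ) (ut ux utx uxx : ℝ) : ℝ :=
  let x := p.2.1
  let u := p.2.2
  let τ : ℝ × ℝ × ℝ → ℝ := fun q => (Q q).1
  let ξ : ℝ × ℝ × ℝ → ℝ := fun q => (Q q).2.1
  let η : ℝ × ℝ × ℝ → ℝ := fun q => (Q q).2.2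
  let ηt := totT η p ut - ut * totT τ p ut - ux * totT ξ p ut
  let ηx := totX η p ux - ut * totX τ p ux - ux * totX ξ p ux
  let ηxx := totXX η p ux uxx - ut * totXX τ p ux uxx - ux * totXX ξ p ux uxx
    - 2 * utx * totX τ p ux - 2 * uxx * totX ξ p ux
  ξ p * deriv E.f x * ut + E.f x * ηt
    - η p * (deriv E.D u * uxx + deriv (deriv E.D) u * ux ^ 2 + deriv E.K u * ux)
    - E.D u * ηxx - 2 * deriv E.D u * ux * ηx - E.K u * ηx

lemma partials_congr {g h : ℝ × ℝ × ℝ → ℝ} (e : ∀ p ∈ E.dom, g p = h p) : ∀ p ∈ E.dom,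
    pt g p = pt h p ∧ px g p = px h p ∧ pu g p = pu h p := fun _ hp =>
  ⟨Filter.EventuallyEq.deriv_eq (Filter.mem_of_superset (hE.hT.1.mem_nhds hp.1) fun _ ht =>
      e _ ⟨ht, hp.2⟩),
    Filter.EventuallyEq.deriv_eq (Filter.mem_of_superset (hE.hI.1.mem_nhds hp.2.1) fun _ hx =>
      e _ ⟨hp.1, hx, hp.2.2⟩),
    Filter.EventuallyEq.deriv_eq (Filter.mem_of_superset (hE.hJ.1.mem_nhds hp.2.2) fun _ hu =>
      e _ ⟨hp.1, hp.2.1, hu⟩)⟩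

lemma invExpr_congr {Q R : VField} (e : EqOn Q R E.dom) {p : ℝ × ℝ × ℝ}
    (hp : p ∈ E.dom) (ut ux utx uxx : ℝ) :
    E.invExpr Q p ut ux utx uxx = E.invExpr R p ut ux utx uxx := by
  have aux : ∀ {g h : ℝ × ℝ × ℝ → ℝ}, (∀ p ∈ E.dom, g p = h p) → totT g p ut = totT h p ut ∧
      totX g p ux = totX h p ux ∧ totXX g p ux uxx = totXX h p ux uxx := fun {g h} e => by
    have e1 := partials_congr hE e
    have e2 := partials_congr hE fun q hq => (e1 q hq).2.1
    have e3 := partials_congr hE fun q hq => (e1 q hq).2.2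
    simp only [totT, totX, totXX, e1 p hp, e2 p hp, e3 p hp, and_self]
  have a := aux fun q hq => congrArg (fun z => z.1) (e hq)
  have b := aux fun q hq => congrArg (fun z => z.2.1) (e hq)
  have c := aux fun q hq => congrArg (fun z => z.2.2) (e hq)
  simp only [Eqn.invExpr, a, b, c, e hp]

lemma invExpr_eq {τ τ' : ℝ → ℝ} {ξ ξt ξx ξxx : ℝ → ℝ → ℝ}
    (jτ : ∀ t ∈ E.T, HasDerivAt τ (τ' t) t) (jξ : Jet E.T E.I ξ ξt ξx ξxx) (η : ℝ × ℝ × ℝ → ℝ)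
    {t x u : ℝ} (ht : t ∈ E.T) (hx : x ∈ E.I) (ut ux utx uxx : ℝ) :
    E.invExpr (fun p => (τ p.1, ξ p.1 p.2.1, η p)) (t, x, u) ut ux utx uxx =
    ξ t x * E.φ x * E.f x * ut + E.f x * (pt η (t, x, u) + ut * pu η (t, x, u) - ut * τ' t - ux * ξt t x)
    - η (t, x, u) * (deriv E.D u * uxx + deriv (deriv E.D) u * ux ^ 2 + deriv E.K u * ux)
    - E.D u * (px (px η) (t, x, u) + 2 * ux * pu (px η) (t, x, u) + ux ^ 2 * pu (pu η) (t, x, u)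
      + uxx * pu η (t, x, u) - ux * ξxx t x - 2 * uxx * ξx t x)
    - (2 * deriv E.D u * ux + E.K u) * (px η (t, x, u) + ux * pu η (t, x, u) - ux * ξx t x) := by
  have h1 : pt (fun p => τ p.1) (t, x, u) = τ' t := (jτ t ht).deriv
  have h2 : pt (fun p => ξ p.1 p.2.1) (t, x, u) = ξt t x := (jξ.t t ht x hx).deriv
  have h3 : ∀ y ∈ E.I, px (fun p => ξ p.1 p.2.1) (t, y, u) = ξx t y := fun y hy =>
    (jξ.x t ht y hy).deriv
  have h4 : px (px fun p => ξ p.1 p.2.1) (t, x, u) = ξxx t x :=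
    ((jξ.xx t ht x hx).congr_on hE.hI.1 hx h3).deriv
  have h5 : px (fun p => τ p.1) = fun _ => 0 := by funext; simp [px]
  have h6 : pu (fun p => τ p.1) = fun _ => 0 := by funext; simp [pu]
  have h7 : pu (fun p => ξ p.1 p.2.1) = fun _ => 0 := by funext; simp [pu]
  have h8 : pu (px fun p => ξ p.1 p.2.1) = fun _ => 0 := by funext; simp [pu, px]
  have h9 : px (fun _ => (0 : ℝ)) = fun _ => 0 := by funext; simp [px]
  have h10 : pu (fun _ => (0 : ℝ)) = fun _ => 0 := by funext; simp [pu]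
  simp only [Eqn.invExpr, totT, totX, totXX, h1, h2, h3 x hx, h4, h5, h6, h7, h8, h9, h10,
    ← hE.f_mul_φ hx]
  ring

lemma Field.partials (s : Field E) : ∀ t ∈ E.T, ∀ x ∈ E.I, ∀ u : ℝ, ∀ η, η = (fun p => (s.Q p).2.2) →
    pt η (t, x, u) = s.αt t x * u + s.βt t x ∧ px η (t, x, u) = s.αx t x * u + s.βx t x ∧
    px (px η) (t, x, u) = s.αxx t x * u + s.βxx t x ∧ pu (px η) (t, x, u) = s.αx t x ∧
    pu η (t, x, u) = s.α t x ∧ pu (pu η) (t, x, u) = 0 := by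
  rintro t ht x hx u _ rfl
  have aff : ∀ a b v : ℝ, HasDerivAt (fun v => a * v + b) a v := fun a b v => by
    simpa using ((hasDerivAt_id v).const_mul a).add_const b
  have hx' : ∀ y ∈ E.I, ∀ v, px (fun p => (s.Q p).2.2) (t, y, v) = s.αx t y * v + s.βx t y :=
    fun y hy v => (((s.jα.x t ht y hy).mul_const v).add (s.jβ.x t ht y hy)).deriv
  have hu : ∀ v, pu (fun p => (s.Q p).2.2) (t, x, v) = s.α t x := fun v =>
    (aff (s.α t x) (s.β t x) v).deriv
  refine ⟨(((s.jα.t t ht x hx).mul_const u).add (s.jβ.t t ht x hx)).deriv, hx' x hx u,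
    ((((s.jα.xx t ht x hx).mul_const u).add (s.jβ.xx t ht x hx)).congr_on hE.hI.1 hx fun y hy =>
      hx' y hy u).deriv, ?_, hu u, ?_⟩
  · simp only [pu, hx' x hx]
    exact (aff _ _ u).deriv
  · change deriv (fun v => pu (fun p => (s.Q p).2.2) (t, x, v)) u = 0
    simp [hu]

/-- Solutions of the determining equations satisfy the invariance criterion. -/
theorem Sol.invariant (s : Sol E) : E.Invariant s.Q := by
  rintro ⟨t, x, u⟩ ⟨ht, hx, hu⟩ ut ux utx uxx
  simp only at ht hx hu
  intro x' u' _ _ _ _ _ _ hL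
  refine (invExpr_eq hE s.jτ s.jξ (fun p => (s.Q p).2.2) ht hx ut ux utx uxx).trans ?_
  obtain ⟨h1, h2, h3, h4, h5, h6⟩ := s.partials hE t ht x hx u _ rfl
  have e1u : s.α t x * deriv E.D u + (s.α t x * u + s.β t x) * deriv (deriv E.D) u
      = (s.ξ t x * E.φ x - s.τ' t + 2 * s.ξx t x) * deriv E.D u := by
    have h : HasDerivAt (fun v => s.α t x * v + s.β t x) (s.α t x) u := by
      simpa using ((hasDerivAt_id u).const_mul (s.α t x)).add_const (s.β t x)
    exact (h.mul (hE.hasDerivAt_dD hu)).unique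
      (((hE.hasDerivAt_D hu).const_mul _).congr_on hE.hJ.1 hu (s.eq1 t ht x hx))
  rw [h1, h2, h3, h4, h5, h6]
  simp only [x', u', Field.Q, op] at hL ⊢
  linear_combination (s.ξ t x * E.φ x + s.α t x - s.τ' t) * hL - uxx * s.eq1 t ht x hx u hu
    - ux ^ 2 * e1u - ux * s.eq3 t ht x hx u hu + s.eq4 t ht x hx u hu
end

section
lemma eq_of_deriv_eq_zero {S : Set ℝ} (hS : IsOpenInterval S) {g g' : ℝ → ℝ}
    (h : ∀ x ∈ S, HasDerivAt g (g' x) x) (h0 : ∀ x ∈ S, g' x = 0) {x y : ℝ} (hx : x ∈ S)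
    (hy : y ∈ S) : g x = g y :=
  eq_of_hasDerivAt_zero hS (fun z hz => by simpa [h0 z hz] using h z hz) hx hy

lemma eqOn_affine_of_hasDerivAt {S : Set ℝ} (hS : IsOpenInterval S) {g : ℝ → ℝ} {k : ℝ}
    (h : ∀ x ∈ S, HasDerivAt g k x) : ∃ c, ∀ x ∈ S, g x = k * x + c := by
  obtain ⟨x0, hx0⟩ := hS.2.2
  refine ⟨g x0 - k * x0, fun x hx => ?_⟩
  have h1 : ∀ z ∈ S, HasDerivAt (fun y => g y - k * y) (k - k * 1) z := fun z hz =>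
    (h z hz).sub ((hasDerivAt_id z).const_mul k)
  have := eq_of_hasDerivAt_zero hS (by simpa using h1) hx hx0
  linarith

variable {E : Eqn} (hE : E.Nonlinear)
include hE

lemma jet_of_smooth {g : ℝ × ℝ × ℝ → ℝ} (hg : ContDiffOn ℝ ∞ g E.dom) {u : ℝ} (hu : u ∈ E.J) :
    Jet E.T E.I (fun t x => g (t, x, u)) (fun t x => pt g (t, x, u)) (fun t x => px g (t, x, u))
      (fun t x => px (px g) (t, x, u)) :=
  ⟨fun _ ht _ hx => hasDerivAt_pt' hE.isOpen_dom hg ⟨ht, hx, hu⟩,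
    fun _ ht _ hx => hasDerivAt_px' hE.isOpen_dom hg ⟨ht, hx, hu⟩,
    fun _ ht _ hx => hasDerivAt_px' hE.isOpen_dom (contDiffOn_px hE.isOpen_dom hg) ⟨ht, hx, hu⟩⟩

lemma eq_of_pu_eq_zero {g : ℝ × ℝ × ℝ → ℝ} (hg : ContDiffOn ℝ ∞ g E.dom)
    (h : ∀ p ∈ E.dom, pu g p = 0) {t x u v : ℝ} (ht : t ∈ E.T) (hx : x ∈ E.I) (hu : u ∈ E.J)
    (hv : v ∈ E.J) : g (t, x, u) = g (t, x, v) :=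
  eq_of_deriv_eq_zero hE.hJ (g := fun u => g (t, x, u))
    (fun _ hw => hasDerivAt_pu' hE.isOpen_dom hg ⟨ht, hx, hw⟩) (fun _ hw => h _ ⟨ht, hx, hw⟩) hu hv

/-- The infinitesimal invariance criterion implies the determining equations. -/
theorem exists_sol_of_invariant {Q : VField}
    (hQ : ContDiffOn ℝ ∞ Q E.dom) (hinv : E.Invariant Q) :
    ∃ s : Sol E, EqOn Q s.Q E.dom := by
  have hU := hE.isOpen_dom
  obtain ⟨τ, ξ, η, rfl⟩ : ∃ τ ξ η : ℝ × ℝ × ℝ → ℝ, Q = fun q => (τ q, ξ q, η q) := ⟨_, _, _, rfl⟩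
  have hτ : ContDiffOn ℝ ∞ τ E.dom := hQ.fst
  have hξ : ContDiffOn ℝ ∞ ξ E.dom := hQ.snd.fst
  have hη : ContDiffOn ℝ ∞ η E.dom := hQ.snd.snd
  obtain ⟨x₀, hx₀⟩ := hE.hI.2.2
  obtain ⟨u₀, hu₀⟩ := hE.hJ.2.2
  have key : ∀ t x u c, (t, x, u) ∈ E.dom → E.f x * c = 1 → ∀ ux utx uxx : ℝ, E.invExpr (fun q => (τ q, ξ q, η q)) (t, x, u)
      ((E.D u * uxx + deriv E.D u * ux ^ 2 + E.K u * ux) * c) ux utx uxx = 0 :=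
    fun t x u c hp hc ux utx uxx => hinv (t, x, u) hp _ ux utx uxx (by
      linear_combination (E.D u * uxx + deriv E.D u * ux ^ 2 + E.K u * ux) * hc)
  have inv : ∀ x ∈ E.I, ∃ c, E.f x * c = 1 := fun x hx => ⟨(E.f x)⁻¹, mul_inv_cancel₀ (hE.f_ne x hx)⟩
  -- `τ` depends on `t` only
  have tau0 : ∀ p ∈ E.dom, px τ p = 0 ∧ pu τ p = 0 := by
    rintro ⟨t, x, u⟩ hp
    have hD := hE.D_ne u hp.2.2
    obtain ⟨c, hc⟩ := inv x hp.2.1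
    have a1 := key t x u c hp hc 0 1 0
    have a2 := key t x u c hp hc 0 0 0
    have b1 := key t x u c hp hc 1 1 0
    have b2 := key t x u c hp hc 1 0 0
    simp only [Eqn.invExpr, totT, totX, totXX] at a1 a2 b1 b2
    have h1 : px τ (t, x, u) = 0 := zero_of_mul hD (by linear_combination (a1 - a2) / 2)
    exact ⟨h1, zero_of_mul hD (by linear_combination (b1 - b2) / 2 - E.D u * h1)⟩
  have evz : ∀ (g : ℝ × ℝ × ℝ → ℝ), (∀ p ∈ E.dom, g p = 0) →
      ∀ p ∈ E.dom, px g p = 0 ∧ pu g p = 0 := fun g hg p hp => by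
    have := (partials_congr hE (h := fun _ => 0) hg p hp).2
    simpa [px, pu] using this
  have tau1 := evz _ fun p hp => (tau0 p hp).1
  have tau2 := evz _ fun p hp => (tau0 p hp).2
  -- `ξ` does not depend on `u`
  have xi0 : ∀ p ∈ E.dom, pu ξ p = 0 := by
    rintro ⟨t, x, u⟩ hp
    obtain ⟨c, hc⟩ := inv x hp.2.1
    have a1 := key t x u c hp hc 1 0 1
    have a2 := key t x u c hp hc 1 0 0
    have a3 := key t x u c hp hc 0 0 1
    have a4 := key t x u c hp hc 0 0 0
    simp only [Eqn.invExpr, totT, totX, totXX, (tau0 _ hp).1, (tau0 _ hp).2, (tau1 _ hp).1,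
      (tau1 _ hp).2, (tau2 _ hp).2] at a1 a2 a3 a4
    exact zero_of_mul (hE.D_ne u hp.2.2) (by
      linear_combination (a1 - a2 - a3 + a4) / 2 + E.D u * pu ξ (t, x, u) / 2 * hc)
  have hQ1 : EqOn (fun q => (τ q, ξ q, η q)) (fun p => (τ (p.1, x₀, u₀), ξ (p.1, p.2.1, u₀), η p)) E.dom := by
    rintro ⟨t, x, u⟩ ⟨ht, hx, hu⟩
    refine Prod.ext ?_ (Prod.ext (eq_of_pu_eq_zero hE hξ xi0 ht hx hu hu₀) rfl)
    exact (eq_of_pu_eq_zero hE hτ (fun p hp => (tau0 p hp).2) ht hx hu hu₀).trans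
      (eq_of_deriv_eq_zero hE.hI (g := fun x => τ (t, x, u₀)) (fun y hy =>
        hasDerivAt_px' hU hτ (x := y) ⟨ht, hy, hu₀⟩) (fun y hy => (tau0 (t, y, u₀) ⟨ht, hy, hu₀⟩).1)
        hx hx₀)
  have jτ := fun t ht => (jet_of_smooth hE hτ hu₀).t t ht x₀ hx₀
  have jξ := jet_of_smooth hE hξ hu₀
  -- the coefficients of the monomials
  have coef : ∀ t ∈ E.T, ∀ x ∈ E.I, ∀ u ∈ E.J,
      η (t, x, u) * deriv E.D u
        = (ξ (t, x, u₀) * E.φ x - pt τ (t, x₀, u₀) + 2 * px ξ (t, x, u₀)) * E.D u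
      ∧ deriv E.D u * (ξ (t, x, u₀) * E.φ x - pt τ (t, x₀, u₀) + 2 * px ξ (t, x, u₀)
          - pu η (t, x, u)) - η (t, x, u) * deriv (deriv E.D) u
          - E.D u * pu (pu η) (t, x, u) = 0
      ∧ η (t, x, u) * deriv E.K u
        = (ξ (t, x, u₀) * E.φ x - pt τ (t, x₀, u₀) + px ξ (t, x, u₀)) * E.K u
        - E.f x * pt ξ (t, x, u₀) - E.D u * (2 * pu (px η) (t, x, u) - px (px ξ) (t, x, u₀))
        - 2 * deriv E.D u * px η (t, x, u)
      ∧ E.f x * pt η (t, x, u) = E.D u * px (px η) (t, x, u) + E.K u * px η (t, x, u) := by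
    intro t ht x hx u hu
    obtain ⟨c, hc⟩ := inv x hx
    have k := fun ux uxx => (invExpr_eq hE jτ jξ η ht hx _ ux 0 uxx).symm.trans
      ((invExpr_congr hE hQ1 ⟨ht, hx, hu⟩ _ ux 0 uxx).symm.trans (key t x u c ⟨ht, hx, hu⟩ hc ux 0 uxx))
    have z0 := k 0 0
    have z1 := k 0 1
    have y1 := k 1 0
    have y2 := k (-1) 0
    set M := ξ (t, x, u₀) * E.φ x + pu η (t, x, u) - pt τ (t, x₀, u₀) with hM
    refine ⟨?_, ?_, ?_, ?_⟩
    · linear_combination z0 - z1 + M * E.D u * hc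
    · linear_combination (y1 + y2 - 2 * z0) / 2 - M * deriv E.D u * hc
    · linear_combination (y2 - y1) / 2 + M * E.K u * hc
    · linear_combination z0
  have etauu : ∀ p ∈ E.dom, pu (pu η) p = 0 := by
    rintro ⟨t, x, u⟩ ⟨ht, hx, hu⟩
    have h1 := ((hasDerivAt_pu' hU hη (t := t) (x := x) ⟨ht, hx, hu⟩).mul
      (hE.hasDerivAt_dD hu)).unique (((hE.hasDerivAt_D hu).const_mul _).congr_on hE.hJ.1 hu
        fun v hv => (coef t ht x hx v hv).1)
    exact zero_of_mul (hE.D_ne u hu) (by linear_combination -(coef t ht x hx u hu).2.1 - h1)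
  have hα := contDiffOn_pu hU hη
  have jα := jet_of_smooth hE hα hu₀
  have jη := jet_of_smooth hE hη hu₀
  let s : Field E := ⟨_, _, _, _, _, _, _, _, _, _, _, _, _, _, jτ, jξ, jα,
    ⟨fun t ht x hx => (jη.t t ht x hx).sub ((jα.t t ht x hx).mul_const u₀),
      fun t ht x hx => (jη.x t ht x hx).sub ((jα.x t ht x hx).mul_const u₀),
      fun t ht x hx => (jη.xx t ht x hx).sub ((jα.xx t ht x hx).mul_const u₀)⟩⟩
  have hη' : ∀ p ∈ E.dom, η p = (s.Q p).2.2 := by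
    rintro ⟨t, x, u⟩ ⟨ht, hx, hu⟩
    obtain ⟨c, hc⟩ := eqOn_affine_of_hasDerivAt hE.hJ (g := fun u => η (t, x, u))
      (k := pu η (t, x, u₀)) fun v hv => by
      rw [← eq_of_pu_eq_zero hE hα etauu ht hx hv hu₀]
      exact hasDerivAt_pu' hU hη ⟨ht, hx, hv⟩
    change η (t, x, u) = pu η (t, x, u₀) * u + (η (t, x, u₀) - pu η (t, x, u₀) * u₀)
    linear_combination hc u hu - hc u₀ hu₀
  have p1 := partials_congr hE hη'
  have p2 := partials_congr hE fun q hq => (p1 q hq).2.1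
  refine ⟨⟨s, fun t ht x hx u hu => ?_, fun t ht x hx u hu => ?_, fun t ht x hx u hu => ?_⟩,
    fun p hp => (hQ1 hp).trans (Prod.ext rfl (Prod.ext rfl (hη' p hp)))⟩ <;>
  · obtain ⟨c1, -, c3, c4⟩ := coef t ht x hx u hu
    obtain ⟨h1, h2, h3, h4, h5, h6⟩ := s.partials hE t ht x hx u _ rfl
    have hp : (t, x, u) ∈ E.dom := ⟨ht, hx, hu⟩
    rw [hη' _ hp] at c1 c3
    rw [(p1 _ hp).2.1, (p2 _ hp).2.2, h2, h4] at c3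
    rw [(p1 _ hp).1, (p1 _ hp).2.1, (p2 _ hp).2.1, h1, h2, h3] at c4
    first | exact c1 | exact c3 | exact c4
end

/-! ### The maximal invariance algebra as a linear space -/

section JetLemmas
variable {T I : Set ℝ} {g gt gx gxx h ht hx hxx : ℝ → ℝ → ℝ}

lemma Jet.add (j : Jet T I g gt gx gxx) (k : Jet T I h ht hx hxx) :
    Jet T I (fun t x => g t x + h t x) (fun t x => gt t x + ht t x) (fun t x => gx t x + hx t x)
      (fun t x => gxx t x + hxx t x) :=
  ⟨fun t h1 x h2 => (j.t t h1 x h2).add (k.t t h1 x h2),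
    fun t h1 x h2 => (j.x t h1 x h2).add (k.x t h1 x h2),
    fun t h1 x h2 => (j.xx t h1 x h2).add (k.xx t h1 x h2)⟩

lemma Jet.smul (j : Jet T I g gt gx gxx) (c : ℝ) :
    Jet T I (fun t x => c * g t x) (fun t x => c * gt t x) (fun t x => c * gx t x)
      (fun t x => c * gxx t x) :=
  ⟨fun t h1 x h2 => (j.t t h1 x h2).const_mul c, fun t h1 x h2 => (j.x t h1 x h2).const_mul c,
    fun t h1 x h2 => (j.xx t h1 x h2).const_mul c⟩

lemma Jet.unique (hT : IsOpen T) (hI : IsOpen I) (j : Jet T I g gt gx gxx)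
    (k : Jet T I h ht hx hxx) (e : ∀ t ∈ T, ∀ x ∈ I, g t x = h t x) {t x : ℝ} (h1 : t ∈ T)
    (h2 : x ∈ I) : gt t x = ht t x ∧ gx t x = hx t x ∧ gxx t x = hxx t x := by
  have ex : ∀ y ∈ I, gx t y = hx t y := fun y hy =>
    (j.x t h1 y hy).unique ((k.x t h1 y hy).congr_on hI hy (e t h1))
  exact ⟨(j.t t h1 x h2).unique ((k.t t h1 x h2).congr_on hT h1 fun z hz => e z hz x h2), ex x h2,
    (j.xx t h1 x h2).unique ((k.xx t h1 x h2).congr_on hI h2 ex)⟩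

lemma jet_const (c : ℝ) : Jet T I (fun _ _ => c) (fun _ _ => 0) (fun _ _ => 0) (fun _ _ => 0) :=
  ⟨fun _ _ _ _ => hasDerivAt_const _ _, fun _ _ _ _ => hasDerivAt_const _ _,
    fun _ _ _ _ => hasDerivAt_const _ _⟩

end JetLemmas

/-- The sum of a solution and a multiple of a solution. -/
def Sol.addSmul (s : Sol E) (c : ℝ) (r : Sol E) : Sol E where
  toField := ⟨_, _, _, _, _, _, _, _, _, _, _, _, _, _,
    fun t ht => (s.jτ t ht).add ((r.jτ t ht).const_mul c), s.jξ.add (r.jξ.smul c),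
    s.jα.add (r.jα.smul c), s.jβ.add (r.jβ.smul c)⟩
  eq1 t ht x hx u hu := by linear_combination s.eq1 t ht x hx u hu + c * r.eq1 t ht x hx u hu
  eq3 t ht x hx u hu := by linear_combination s.eq3 t ht x hx u hu + c * r.eq3 t ht x hx u hu
  eq4 t ht x hx u hu := by linear_combination s.eq4 t ht x hx u hu + c * r.eq4 t ht x hx u hu

lemma Sol.addSmul_Q (s r : Sol E) (c : ℝ) : (s.addSmul c r).Q = s.Q + c • r.Q :=
  funext fun p => Prod.ext rfl (Prod.ext rfl (by
    simp only [Field.Q, op, Sol.addSmul, Pi.add_apply, Pi.smul_apply, Prod.snd_add, Prod.smul_snd,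
      smul_eq_mul]
    ring))

/-- The zero solution. -/
def Sol.zero (E : Eqn) : Sol E where
  toField := ⟨0, 0, _, _, _, _, _, _, _, _, _, _, _, _, fun t _ => hasDerivAt_const t 0, jet_const 0,
    (jet_const 0), jet_const 0⟩
  eq1 := by simp
  eq3 := by simp
  eq4 := by simp

lemma Sol.zero_Q : (Sol.zero E).Q = 0 :=
  funext fun p => Prod.ext rfl (Prod.ext rfl (by simp [Sol.zero, Field.Q, op]))

lemma mem_maxAlg_iff (hE : E.Nonlinear) {X : E.dom → ℝ × ℝ × ℝ} :
    X ∈ E.maxAlg ↔ ∃ s : Sol E, ContDiffOn ℝ ∞ s.Q E.dom ∧ X = E.dom.domRestrict s.Q := by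
  constructor
  · rintro ⟨Q, hQ, hinv, rfl⟩
    obtain ⟨s, hs⟩ := exists_sol_of_invariant hE hQ hinv
    exact ⟨s, hQ.congr fun p hp => (hs hp).symm, funext fun p => hs p.2⟩
  · rintro ⟨s, hs, rfl⟩
    exact ⟨s.Q, hs, s.invariant hE, rfl⟩

/-- The maximal Lie invariance algebra as a subspace. -/
def Eqn.alg (E : Eqn) (hE : E.Nonlinear) : Submodule ℝ (E.dom → ℝ × ℝ × ℝ) where
  carrier := E.maxAlg
  add_mem' := by
    intro X Y hX hY
    obtain ⟨s, hs, rfl⟩ := (mem_maxAlg_iff hE).1 hX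
    obtain ⟨r, hr, rfl⟩ := (mem_maxAlg_iff hE).1 hY
    exact (mem_maxAlg_iff hE).2 ⟨s.addSmul 1 r, by rw [s.addSmul_Q, one_smul]; exact hs.add hr,
      by rw [s.addSmul_Q, one_smul]; rfl⟩
  zero_mem' := (mem_maxAlg_iff hE).2 ⟨.zero E, by rw [Sol.zero_Q]; exact contDiffOn_const,
    by rw [Sol.zero_Q]; rfl⟩
  smul_mem' := by
    intro c X hX
    obtain ⟨s, hs, rfl⟩ := (mem_maxAlg_iff hE).1 hX
    exact (mem_maxAlg_iff hE).2 ⟨(Sol.zero E).addSmul c s, by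
      rw [Sol.addSmul_Q, Sol.zero_Q, zero_add]; exact contDiffOn_const.smul hs,
      by rw [Sol.addSmul_Q, Sol.zero_Q, zero_add]; rfl⟩

/-- Linear combinations of a list of operators. -/
def comb (l : List VField) (k : Fin l.length → ℝ) :
    VField := fun p => ∑ i, k i • l.get i p

lemma fam_linearIndependent {l : List VField}
    (h : ∀ k : Fin l.length → ℝ, (∀ t ∈ E.T, ∀ x ∈ E.I, ∀ u ∈ E.J, comb l k (t, x, u) = 0) →
      k = 0) : LinearIndependent ℝ (E.fam l) := by
  rw [Fintype.linearIndependent_iff]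
  intro k hk
  have := h k fun t ht x hx u hu => by
    have := congrFun hk ⟨(t, x, u), ht, hx, hu⟩
    simpa [comb, Eqn.fam, Finset.sum_apply] using this
  exact fun i => congrFun this i

lemma rank_eq_of_isBasis (hE : E.Nonlinear) {l : List VField}
    (h : E.IsBasis l) : Module.rank ℝ (E.alg hE) = l.length := by
  have e : E.alg hE = Submodule.span ℝ (Set.range (E.fam l)) := SetLike.coe_injective h.2.symm
  rw [e, rank_span h.1, Cardinal.mk_range_eq _ h.1.injective]
  simp

lemma span_fam_le (hE : E.Nonlinear) {l : List VField}
    (h : ∀ i, E.fam l i ∈ E.maxAlg) : Submodule.span ℝ (Set.range (E.fam l)) ≤ E.alg hE :=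
  Submodule.span_le.2 (Set.range_subset_iff.2 h)

lemma isBasis_of_rank (hE : E.Nonlinear) {l : List VField}
    (h1 : LinearIndependent ℝ (E.fam l)) (h2 : ∀ i, E.fam l i ∈ E.maxAlg)
    (h : Module.rank ℝ (E.alg hE) ≤ l.length) : E.IsBasis l := by
  have : Module.Finite ℝ (E.alg hE) := Module.rank_lt_aleph0_iff.1
    (h.trans_lt (Cardinal.natCast_lt_aleph0))
  refine ⟨h1, ?_⟩
  have : Submodule.span ℝ (Set.range (E.fam l)) = E.alg hE := by
    apply Submodule.eq_of_le_of_finrank_le (span_fam_le hE h2)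
    rw [finrank_span_eq_card h1]
    simpa using Module.finrank_le_of_rank_le h
  rw [this]; rfl

lemma length_le_rank (hE : E.Nonlinear) {l : List VField}
    (h1 : LinearIndependent ℝ (E.fam l)) (h2 : ∀ i, E.fam l i ∈ E.maxAlg) :
    (l.length : Cardinal) ≤ Module.rank ℝ (E.alg hE) := by
  have := Submodule.rank_mono (span_fam_le hE h2)
  rw [rank_span h1, Cardinal.mk_range_eq _ h1.injective] at this
  simpa using this

/-! ### Equations with nonconstant `D` -/

/-- A solution of the determining equations of the form `τ ∂_t + ξ ∂_x + l (a u + b) ∂_u`,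
where `(a u + b) D' = c D`. -/
structure WSol (E : Eqn) (a b c : ℝ) where
  (τ τ' : ℝ → ℝ)
  (ξ ξt ξx ξxx l lt lx lxx : ℝ → ℝ → ℝ)
  jτ : ∀ t ∈ E.T, HasDerivAt τ (τ' t) t
  jξ : Jet E.T E.I ξ ξt ξx ξxx
  jl : Jet E.T E.I l lt lx lxx
  eq1 : ∀ t ∈ E.T, ∀ x ∈ E.I, c * l t x = ξ t x * E.φ x - τ' t + 2 * ξx t x
  eq3 : ∀ t ∈ E.T, ∀ x ∈ E.I, ∀ u ∈ E.J, l t x * ((a * u + b) * deriv E.K u) =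
    (c * l t x - ξx t x) * E.K u - E.f x * ξt t x + E.D u * (ξxx t x - 2 * (a + c) * lx t x)
  eq4 : ∀ t ∈ E.T, ∀ x ∈ E.I, ∀ u ∈ E.J, (a * u + b) *
    (E.f x * lt t x - E.D u * lxx t x - E.K u * lx t x) = 0

/-- The vector field of a solution. -/
def WSol.Q {a b c : ℝ} (s : WSol E a b c) : VField :=
  op fun t x u => (s.τ t, s.ξ t x, s.l t x * (a * u + b))

/-- `D` satisfies the first order equation `(a u + b) D' = c D`. -/
def Eqn.DEq (E : Eqn) (a b c : ℝ) : Prop := ∀ u ∈ E.J, (a * u + b) * deriv E.D u = c * E.D u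

/-- A `WSol` gives a solution of the determining equations; if `l` vanishes, there is no
condition on `D`. -/
def WSol.toSol {a b c : ℝ} (s : WSol E a b c)
    (h : E.DEq a b c ∨ ∀ t ∈ E.T, ∀ x ∈ E.I, s.l t x = 0 ∧ s.lx t x = 0) : Sol E where
  toField := ⟨_, _, _, _, _, _, _, _, _, _, _, _, _, _, s.jτ, s.jξ, s.jl.smul a, s.jl.smul b⟩
  eq1 t ht x hx u hu := by
    rcases h with h | h
    · linear_combination s.l t x * h u hu + E.D u * s.eq1 t ht x hx
    · linear_combination (a * u * deriv E.D u + b * deriv E.D u - c * E.D u) * (h t ht x hx).1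
        + E.D u * s.eq1 t ht x hx
  eq3 t ht x hx u hu := by
    rcases h with h | h
    · linear_combination s.eq3 t ht x hx u hu + E.K u * s.eq1 t ht x hx + 2 * s.lx t x * h u hu
    · linear_combination s.eq3 t ht x hx u hu + E.K u * s.eq1 t ht x hx
        + 2 * (a * u * deriv E.D u + b * deriv E.D u - c * E.D u) * (h t ht x hx).2
  eq4 t ht x hx u hu := by linear_combination s.eq4 t ht x hx u hu

lemma exists_wSol (hE : E.Nonlinear) {a b c : ℝ} (hc : c ≠ 0) (hD : E.DEq a b c) (s : Sol E) :
    ∃ r : WSol E a b c, EqOn s.Q r.Q E.dom := by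
  obtain ⟨v, hv, v', hv', hvv⟩ := hE.hJ.exists_two
  have hab : a ^ 2 + b ^ 2 ≠ 0 := fun h => by
    have ha : a = 0 := by nlinarith [sq_nonneg a, sq_nonneg b]
    have hb : b = 0 := by nlinarith [sq_nonneg a, sq_nonneg b]
    exact mul_ne_zero hc (hE.D_ne v hv) (by rw [← hD v hv, ha, hb]; ring)
  have hpar : ∀ t ∈ E.T, ∀ x ∈ E.I, c * s.α t x = a * (s.ξ t x * E.φ x - s.τ' t + 2 * s.ξx t x)
      ∧ c * s.β t x = b * (s.ξ t x * E.φ x - s.τ' t + 2 * s.ξx t x) := by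
    intro t ht x hx
    set A := s.ξ t x * E.φ x - s.τ' t + 2 * s.ξx t x
    have key : ∀ u ∈ E.J, c * (s.α t x * u + s.β t x) - A * (a * u + b) = 0 := fun u hu =>
      zero_of_mul (hE.D_ne u hu) (by
        linear_combination (a * u + b) * s.eq1 t ht x hx u hu - (s.α t x * u + s.β t x) * hD u hu)
    have h2 : c * s.α t x - a * A = 0 := zero_of_mul (sub_ne_zero.2 hvv) (by
      linear_combination key v hv - key v' hv')
    exact ⟨by linear_combination h2, by linear_combination key v hv - v * h2⟩
  have jl := (s.jα.smul (a / (a ^ 2 + b ^ 2))).add (s.jβ.smul (b / (a ^ 2 + b ^ 2)))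
  set l : ℝ → ℝ → ℝ := fun t x => a / (a ^ 2 + b ^ 2) * s.α t x + b / (a ^ 2 + b ^ 2) * s.β t x
    with hl
  have hαβ : ∀ t ∈ E.T, ∀ x ∈ E.I, s.α t x = a * l t x ∧ s.β t x = b * l t x := fun t ht x hx => by
    obtain ⟨h1, h2⟩ := hpar t ht x hx
    have h3 : a * s.β t x - b * s.α t x = 0 := zero_of_mul hc (by linear_combination a * h2 - b * h1)
    simp only [hl]
    constructor <;> field_simp
    · linear_combination -b * h3
    · linear_combination a * h3
  have uα := fun {t x} (ht : t ∈ E.T) (hx : x ∈ E.I) => s.jα.unique hE.hT.1 hE.hI.1 (jl.smul a)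
    (fun t ht x hx => (hαβ t ht x hx).1) ht hx
  have uβ := fun {t x} (ht : t ∈ E.T) (hx : x ∈ E.I) => s.jβ.unique hE.hT.1 hE.hI.1 (jl.smul b)
    (fun t ht x hx => (hαβ t ht x hx).2) ht hx
  have hl1 : ∀ t ∈ E.T, ∀ x ∈ E.I, c * l t x = s.ξ t x * E.φ x - s.τ' t + 2 * s.ξx t x :=
    fun t ht x hx => by
      obtain ⟨h1, h2⟩ := hpar t ht x hx
      obtain ⟨h3, h4⟩ := hαβ t ht x hx
      refine sub_eq_zero.1 (zero_of_mul hab ?_)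
      linear_combination a * h1 + b * h2 - c * a * h3 - c * b * h4
  refine ⟨⟨s.τ, s.τ', s.ξ, s.ξt, s.ξx, s.ξxx, l, _, _, _, s.jτ, s.jξ, jl, hl1,
    fun t ht x hx u hu => ?_, fun t ht x hx u hu => ?_⟩, ?_⟩
  · obtain ⟨-, e2, -⟩ := uα ht hx
    obtain ⟨-, e2', -⟩ := uβ ht hx
    obtain ⟨e0, e0'⟩ := hαβ t ht x hx
    linear_combination s.eq3 t ht x hx u hu - E.K u * hl1 t ht x hx - 2 *
      (a / (a ^ 2 + b ^ 2) * s.αx t x + b / (a ^ 2 + b ^ 2) * s.βx t x) * hD u hu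
      - deriv E.K u * (u * e0 + e0') - 2 * E.D u * e2 - 2 * deriv E.D u * (u * e2 + e2')
  · obtain ⟨e1, e2, e3⟩ := uα ht hx
    obtain ⟨e1', e2', e3'⟩ := uβ ht hx
    linear_combination s.eq4 t ht x hx u hu - E.f x * (u * e1 + e1') + E.D u * (u * e3 + e3')
      + E.K u * (u * e2 + e2')
  · rintro ⟨t, x, u⟩ ⟨ht, hx, hu⟩
    refine Prod.ext rfl (Prod.ext rfl ?_)
    simp only [Field.Q, WSol.Q, op, hαβ t ht x hx]
    ring

/-- `D` satisfies no first order equation `(a u + b) D' = c D`. -/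
def Eqn.Rigid (E : Eqn) : Prop := ∀ a b c, E.DEq a b c → a = 0 ∧ b = 0

lemma exists_wSol_of_rigid (hE : E.Nonlinear) (hR : E.Rigid) (s : Sol E) :
    ∃ r : WSol E 0 0 1, (∀ t x, r.l t x = 0) ∧ EqOn s.Q r.Q E.dom := by
  have h0 : ∀ t ∈ E.T, ∀ x ∈ E.I, s.α t x = 0 ∧ s.β t x = 0 := fun t ht x hx =>
    hR _ _ _ (s.eq1 t ht x hx)
  obtain ⟨v, hv⟩ := hE.hJ.2.2
  have hA : ∀ t ∈ E.T, ∀ x ∈ E.I, s.ξ t x * E.φ x - s.τ' t + 2 * s.ξx t x = 0 :=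
    fun t ht x hx => by
      refine zero_of_mul (hE.D_ne v hv) ?_
      linear_combination -s.eq1 t ht x hx v hv + deriv E.D v * (v * (h0 t ht x hx).1 + (h0 t ht x hx).2)
  refine ⟨⟨s.τ, s.τ', s.ξ, s.ξt, s.ξx, s.ξxx, fun _ _ => 0, fun _ _ => 0, fun _ _ => 0,
    fun _ _ => 0, s.jτ, s.jξ, jet_const 0, ?_, ?_, ?_⟩, fun _ _ => rfl, ?_⟩
  · intro t ht x hx
    linear_combination -hA t ht x hx
  · intro t ht x hx u hu
    have h3 := s.eq3 t ht x hx u hu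
    have e := (s.jα.unique hE.hT.1 hE.hI.1 (jet_const 0) (fun t ht x hx => (h0 t ht x hx).1) ht hx).2.1
    have e' := (s.jβ.unique hE.hT.1 hE.hI.1 (jet_const 0) (fun t ht x hx => (h0 t ht x hx).2) ht hx).2.1
    linear_combination h3 - deriv E.K u * (u * (h0 t ht x hx).1 + (h0 t ht x hx).2)
      + E.K u * hA t ht x hx - 2 * E.D u * e - 2 * deriv E.D u * (u * e + e')
  · intro t ht x hx u hu; ring
  · rintro ⟨t, x, u⟩ ⟨ht, hx, hu⟩
    refine Prod.ext rfl (Prod.ext rfl ?_)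
    simp [Field.Q, WSol.Q, op, h0 t ht x hx]

/-! ### Derivatives of the arbitrary elements -/

lemma deriv_eq_of_eqOn {S : Set ℝ} (hS : IsOpen S) {g h : ℝ → ℝ} {g' x : ℝ} (hx : x ∈ S)
    (e : EqOn g h S) (hh : HasDerivAt h g' x) : deriv g x = g' :=
  (hh.congr_of_eventuallyEq (e.eventuallyEq_of_mem (hS.mem_nhds hx))).deriv

lemma hasDerivAt_exp_mul (k x : ℝ) :
    HasDerivAt (fun y => exp (k * y)) (k * exp (k * x)) x := by
  have := ((hasDerivAt_id x).const_mul k).exp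
  simpa [mul_comm] using this

lemma hasDerivAt_exp_neg (x : ℝ) :
    HasDerivAt (fun y => exp (-y)) (-exp (-x)) x := by
  have := (hasDerivAt_id x).neg.exp
  simpa [mul_comm] using this

lemma Eqn.Nonlinear.φ_eq (hE : E.Nonlinear) {F F' : ℝ → ℝ}
    (e : ∀ x ∈ E.I, E.f x = exp (F x)) (hF : ∀ x ∈ E.I, HasDerivAt F (F' x) x) :
    ∀ x ∈ E.I, E.φ x = F' x := fun x hx => by
  rw [Eqn.φ, deriv_eq_of_eqOn hE.hI.1 hx e (hF x hx).exp, e x hx]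
  field_simp

lemma Eqn.Nonlinear.φ_const (hE : E.Nonlinear) {C : ℝ} (e : ∀ x ∈ E.I, E.f x = C) :
    ∀ x ∈ E.I, E.φ x = 0 := fun x hx => by
  rw [Eqn.φ, deriv_eq_of_eqOn hE.hI.1 hx e (hasDerivAt_const _ _), zero_div]

lemma abs_rpow_eq_exp {x : ℝ} (hx : x ≠ 0) (k : ℝ) : |x| ^ k = exp (k * log x) := by
  rw [Real.rpow_def_of_pos (abs_pos.2 hx), Real.log_abs, mul_comm]

lemma hasDerivAt_abs_rpow {x : ℝ} (hx : x ≠ 0) (k : ℝ) :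
    HasDerivAt (fun y => |y| ^ k) (k / x * |x| ^ k) x :=
  (((Real.hasDerivAt_log hx).const_mul k).exp.congr_on isOpen_ne hx fun _ hz =>
    abs_rpow_eq_exp hz k).congr_deriv (by rw [abs_rpow_eq_exp hx]; ring)

lemma hasDerivAt_zpow_self {x : ℝ} (hx : x ≠ 0) (n : ℤ) :
    HasDerivAt (fun y => y ^ n) (n / x * x ^ n) x :=
  (hasDerivAt_zpow n x (.inl hx)).congr_deriv (by rw [zpow_sub_one₀ hx]; ring)

/-- A variable in which `u_xx + κ u_x` has no first-order term. -/
structure Base (κ : ℝ) (y y' : ℝ → ℝ) : Prop where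
  hy : ∀ x, HasDerivAt y (y' x) x
  hy' : ∀ x, HasDerivAt y' (-κ * y' x) x
  ne : ∀ x, y' x ≠ 0
  smooth : ContDiff ℝ ∞ y

lemma base_id : Base 0 (fun x => x) (fun _ => 1) :=
  ⟨hasDerivAt_id, fun x => (hasDerivAt_const x 1).congr_deriv (by ring), fun _ => one_ne_zero,
    contDiff_id⟩

lemma base_exp (γ : ℝ) : Base 1 (fun x => exp (-x) + γ) (fun x => -exp (-x)) :=
  ⟨fun x => (hasDerivAt_exp_neg x).add_const γ, fun x => (hasDerivAt_exp_neg x).neg.congr_deriv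
    (by ring), fun x => neg_ne_zero.2 (Real.exp_pos _).ne', by fun_prop⟩

lemma exp_neg_two_mul (x : ℝ) : exp (-2 * x) = (-exp (-x)) ^ 2 := by
  rw [neg_sq, ← Real.exp_nat_mul]; congr 1; push_cast; ring

section
variable {κ : ℝ} {y y' : ℝ → ℝ} (B : Base κ y y')
include B

lemma Base.add (δ : ℝ) : Base κ (fun x => y x + δ) y' :=
  ⟨fun x => (B.hy x).add_const δ, B.hy', B.ne, B.smooth.add contDiff_const⟩

lemma Base.jet {T I : Set ℝ} {g g' g'' : ℝ → ℝ} (h1 : ∀ x ∈ I, HasDerivAt g (g' (y x)) (y x))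
    (h2 : ∀ x ∈ I, HasDerivAt g' (g'' (y x)) (y x)) :
    Jet T I (fun _ x => g (y x)) (fun _ _ => 0) (fun _ x => g' (y x) * y' x)
      (fun _ x => g'' (y x) * y' x ^ 2 - κ * (g' (y x) * y' x)) :=
  ⟨fun _ _ _ _ => hasDerivAt_const _ _, fun _ _ x hx => (h1 x hx).comp x (B.hy x),
    fun _ _ x hx => (((h2 x hx).comp x (B.hy x)).mul (B.hy' x)).congr_deriv
      (by rw [Function.comp]; ring)⟩

/-- The logarithmic derivative of `f = y' ^ 2 g(y)`. -/
lemma Base.φ_eq (hE : E.Nonlinear) {g g' : ℝ → ℝ} (hf : ∀ x ∈ E.I, E.f x = y' x ^ 2 * g (y x))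
    (hg : ∀ x ∈ E.I, g (y x) ≠ 0 → HasDerivAt g (g' (y x) * g (y x)) (y x)) :
    ∀ x ∈ E.I, g (y x) ≠ 0 ∧ E.φ x + 2 * κ = y' x * g' (y x) := fun x hx => by
  have h0 := hE.f_ne x hx
  rw [hf x hx] at h0
  have h1 := right_ne_zero_of_mul h0
  refine ⟨h1, ?_⟩
  rw [Eqn.φ, deriv_eq_of_eqOn hE.hI.1 hx hf (((B.hy' x).pow 2).mul ((hg x hx h1).comp x (B.hy x))),
    hf x hx]
  have := B.ne x
  simp only [Pi.pow_apply]
  field_simp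
  ring

lemma Base.φ_abs_rpow (hE : E.Nonlinear) {l : ℝ} (hl : l ≠ 0)
    (hf : ∀ x ∈ E.I, E.f x = y' x ^ 2 * |y x| ^ l) :
    ∀ x ∈ E.I, y x ≠ 0 ∧ E.φ x + 2 * κ = y' x * (l / y x) := fun x hx => by
  have h0 : ∀ x, |y x| ^ l ≠ 0 → y x ≠ 0 := fun x h h0 => h (by rw [h0, abs_zero, Real.zero_rpow hl])
  exact ((B.φ_eq hE hf (g := fun y => |y| ^ l) (g' := fun y => l / y) fun x _ h =>
    hasDerivAt_abs_rpow (h0 x h) l) x hx).imp_left (h0 x)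

lemma Base.φ_zpow (hE : E.Nonlinear) {n : ℤ} (hn : n ≠ 0)
    (hf : ∀ x ∈ E.I, E.f x = y' x ^ 2 * y x ^ n) :
    ∀ x ∈ E.I, y x ≠ 0 ∧ E.φ x + 2 * κ = y' x * (n / y x) := fun x hx =>
  have h0 : ∀ x, y x ^ n ≠ 0 → y x ≠ 0 := fun x h h0 => h (by rw [h0, zero_zpow n hn])
  ((B.φ_eq hE hf (g := fun y => y ^ n) (g' := fun y => n / y) fun x hx h =>
    hasDerivAt_zpow_self (h0 x h) n) x hx).imp_left (h0 x)

lemma Base.φ_exp (hE : E.Nonlinear) {k : ℝ}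
    (hf : ∀ x ∈ E.I, E.f x = y' x ^ 2 * exp (k * y x)) :
    ∀ x ∈ E.I, E.φ x + 2 * κ = y' x * k := fun x hx =>
  (B.φ_eq hE hf (g := fun y => exp (k * y)) (g' := fun _ => k) (fun x _ _ =>
    hasDerivAt_exp_mul k (y x)) x hx).2
end

/-- The function `K` is a power (or `D`). -/
lemma mul_deriv_rpow {J : Set ℝ} (hJ : IsOpen J) {g : ℝ → ℝ} {k : ℝ}
    (h : J ⊆ Ioi 0 ∨ ∃ n : ℕ, k = n) (e : EqOn g (fun u => u ^ k) J) {u : ℝ}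
    (hu : u ∈ J) : u * deriv g u = k * g u := by
  rcases h with h | ⟨n, rfl⟩
  · have hu0 : 0 < u := h hu
    rw [deriv_eq_of_eqOn hJ hu e (Real.hasDerivAt_rpow_const (Or.inl hu0.ne')), e hu]
    simp only
    rw [Real.rpow_sub_one hu0.ne']
    field_simp
  · have e' : EqOn g (fun u => u ^ n) J := fun v hv => by rw [e hv]; simp
    rw [deriv_eq_of_eqOn hJ hu e' (hasDerivAt_pow n u), e' hu]
    simp only
    cases n with
    | zero => simp
    | succ n => simp [pow_succ]; ring

lemma deriv_exp_mul {J : Set ℝ} (hJ : IsOpen J) {g : ℝ → ℝ} {k : ℝ}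
    (e : EqOn g (fun u => exp (k * u)) J) {u : ℝ} (hu : u ∈ J) :
    deriv g u = k * g u := by
  rw [deriv_eq_of_eqOn hJ hu e (hasDerivAt_exp_mul k u), e hu]

lemma deriv_const_of_eqOn {J : Set ℝ} (hJ : IsOpen J) {g : ℝ → ℝ} {k : ℝ}
    (e : EqOn g (fun _ => k) J) {u : ℝ} (hu : u ∈ J) : deriv g u = 0 :=
  deriv_eq_of_eqOn hJ hu e (hasDerivAt_const _ _)

/-! ### Operators of the algebra -/

lemma mem_maxAlg_of_sol (hE : E.Nonlinear) (s : Sol E) {F : ℝ → ℝ → ℝ → ℝ × ℝ × ℝ}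
    (hF : ContDiffOn ℝ ∞ (op F) E.dom) (h : ∀ t ∈ E.T, ∀ x ∈ E.I, ∀ u ∈ E.J,
      F t x u = (s.τ t, s.ξ t x, s.α t x * u + s.β t x)) :
    E.dom.domRestrict (op F) ∈ E.maxAlg := by
  have e : EqOn (op F) s.Q E.dom := fun p hp => h _ hp.1 _ hp.2.1 _ hp.2.2
  exact (mem_maxAlg_iff hE).2 ⟨s, hF.congr fun p hp => (e hp).symm, funext fun p => e p.2⟩

lemma mem_maxAlg_of_wSol (hE : E.Nonlinear) {a b c : ℝ} (s : WSol E a b c)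
    (hs : E.DEq a b c ∨ ∀ t ∈ E.T, ∀ x ∈ E.I, s.l t x = 0 ∧ s.lx t x = 0)
    {F : ℝ → ℝ → ℝ → ℝ × ℝ × ℝ}
    (hF : ContDiffOn ℝ ∞ (op F) E.dom) (h : ∀ t ∈ E.T, ∀ x ∈ E.I, ∀ u ∈ E.J,
      F t x u = (s.τ t, s.ξ t x, s.l t x * (a * u + b))) :
    E.dom.domRestrict (op F) ∈ E.maxAlg := by
  refine mem_maxAlg_of_sol hE (s.toSol hs) hF fun t ht x hx u hu => ?_
  rw [h t ht x hx u hu]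
  refine Prod.ext rfl (Prod.ext rfl ?_)
  simp only [WSol.toSol]; ring

/-- Operators with coefficients that are affine in `t`, `x`. -/
lemma affine_mem (hE : E.Nonlinear) (a b c k τ₁ τ₀ s σ₁ σ₀ : ℝ) {g : ℝ → ℝ}
    (hφ : ∀ x ∈ E.I, E.φ x = g x) (hD : k ≠ 0 → E.DEq a b c := by simp)
    (hK : ∀ x ∈ E.I, ∀ u ∈ E.J,
      k * ((a * u + b) * deriv E.K u) = (c * k - s) * E.K u - E.f x * σ₁ := by simp)
    (hf : ∀ x ∈ E.I, ∀ t ∈ E.T, c * k = (s * x + σ₁ * t + σ₀) * g x - τ₁ + 2 * s := by intros; ring)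
    {T X U : ℝ → ℝ → ℝ → ℝ} (h1 : ∀ t x u, T t x u = τ₁ * t + τ₀ := by intros; ring)
    (h2 : ∀ t x u, X t x u = s * x + σ₁ * t + σ₀ := by intros; ring)
    (h3 : ∀ t x u, U t x u = k * (a * u + b) := by intros; ring) :
    E.dom.domRestrict (op fun t x u => (T t x u, X t x u, U t x u)) ∈ E.maxAlg := by
  simp only [h1, h2, h3]
  exact mem_maxAlg_of_wSol hE (a := a) (b := b) (c := c)
    ⟨fun t => τ₁ * t + τ₀, fun _ => τ₁, fun t x => s * x + σ₁ * t + σ₀, fun _ _ => σ₁, fun _ _ => s,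
      fun _ _ => 0, fun _ _ => k, fun _ _ => 0, fun _ _ => 0, fun _ _ => 0,
      fun t _ => by simpa using ((hasDerivAt_id t).const_mul τ₁).add_const τ₀,
      ⟨fun t _ x _ => by
        simpa using (((hasDerivAt_id t).const_mul σ₁).const_add (s * x)).add_const σ₀,
      fun t _ x _ => by
        simpa using (((hasDerivAt_id x).const_mul s).add_const (σ₁ * t)).add_const σ₀,
      fun _ _ _ _ => hasDerivAt_const _ _⟩,
      jet_const k,
      fun t ht x hx => by rw [hφ x hx]; exact hf x hx t ht,
      fun t ht x hx u hu => by linear_combination hK x hx u hu,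
      fun t ht x hx u hu => by ring⟩
    (or_iff_not_imp_right.2 fun h => hD fun hk => h fun _ _ _ _ => ⟨hk, rfl⟩)
    (by unfold op; fun_prop) fun _ _ _ _ _ _ => rfl

lemma dt_mem (hE : E.Nonlinear) : E.dom.domRestrict dt ∈ E.maxAlg :=
  affine_mem hE 0 0 0 0 0 1 0 0 0 fun _ _ => rfl

/-- Operators for `K` proportional to `D`. -/
lemma Base.mem {κ : ℝ} {y y' : ℝ → ℝ} (B : Base κ y y') (hE : E.Nonlinear)
    (a b c τ₁ β g₁ g₀ l₀ : ℝ) (hK : ∀ u ∈ E.J, E.K u = κ * E.D u) {h : ℝ → ℝ}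
    (hφ : ∀ x ∈ E.I, E.φ x + 2 * κ = y' x * h x)
    (hD : E.DEq a b c ∨ β = 0 ∧ l₀ = 0 := by simp)
    (hf : ∀ x ∈ E.I, ((a + c) * β * y x ^ 2 + g₁ * y x + g₀) * h x
      = c * l₀ + τ₁ - (4 * a + 3 * c) * β * y x - 2 * g₁ := by intros; ring)
    {T X U : ℝ → ℝ → ℝ → ℝ} (h1 : ∀ t x u, T t x u = τ₁ * t := by intros; ring)
    (h2 : ∀ t x u, X t x u = ((a + c) * β * y x ^ 2 + g₁ * y x + g₀) / y' x := by
      intros; first | ring1 | (simp only [Real.exp_neg]; field_simp; try ring))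
    (h3 : ∀ t x u, U t x u = (β * y x + l₀) * (a * u + b) := by intros; ring) :
    E.dom.domRestrict (op fun t x u => (T t x u, X t x u, U t x u)) ∈ E.maxAlg := by
  have hs := B.smooth
  have hy' : y' = fun x => fderiv ℝ y x 1 := funext fun x => ((B.hy x).hasFDerivAt.fderiv ▸ by simp)
  have hs' : ContDiff ℝ ∞ y' := by
    rw [hy']; exact (hs.fderiv_right (m := ∞) (by simp)).clm_apply contDiff_const
  have h0 := B.ne
  have hq : ∀ x, HasDerivAt (fun x => (a + c) * β * y x ^ 2 + g₁ * y x + g₀)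
      ((2 * (a + c) * β * y x + g₁) * y' x) x := fun x =>
    (((((B.hy x).pow 2).const_mul _).add ((B.hy x).const_mul g₁)).add_const g₀).congr_deriv
      (by push_cast; ring)
  have hξ := fun x => ((hq x).div (B.hy' x) (h0 x)).congr_deriv (g' := 2 * (a + c) * β * y x + g₁
    + κ * (((a + c) * β * y x ^ 2 + g₁ * y x + g₀) / y' x)) (by have := h0 x; field_simp; ring)
  simp only [h1, h2, h3]
  refine mem_maxAlg_of_wSol hE (a := a) (b := b) (c := c)
    ⟨fun t => τ₁ * t, fun _ => τ₁, fun _ x => ((a + c) * β * y x ^ 2 + g₁ * y x + g₀) / y' x,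
      fun _ _ => 0, fun _ x => 2 * (a + c) * β * y x + g₁ + κ *
        (((a + c) * β * y x ^ 2 + g₁ * y x + g₀) / y' x), fun _ x => 2 * (a + c) * β * y' x +
        κ * (2 * (a + c) * β * y x + g₁ + κ * (((a + c) * β * y x ^ 2 + g₁ * y x + g₀) / y' x)),
      _, _, _, _, fun t _ => by simpa using ((hasDerivAt_id t).const_mul τ₁),
      ⟨fun _ _ _ _ => hasDerivAt_const _ _, fun _ _ x _ => hξ x,
        fun _ _ x _ => (((B.hy x).const_mul _).add_const g₁).add ((hξ x).const_mul κ)⟩,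
      B.jet (g := fun y => β * y + l₀) (g' := fun _ => β) (g'' := fun _ => 0) (fun x _ => by
        simpa using ((hasDerivAt_id (y x)).const_mul β).add_const l₀) fun _ _ => hasDerivAt_const _ _,
      fun t ht x hx => ?_, fun t ht x hx u hu => ?_, fun t ht x hx u hu => ?_⟩ ?_ ?_
      fun _ _ _ _ _ _ => rfl
  · rw [eq_sub_of_add_eq (hφ x hx)]
    have := h0 x
    field_simp
    linear_combination -y' x * hf x hx
  · rw [hK u hu, deriv_eq_of_eqOn hE.hJ.1 hu hK ((hE.hasDerivAt_D hu).const_mul κ)]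
    rcases hD with hD | ⟨rfl, rfl⟩
    · linear_combination (β * y x + l₀) * κ * hD u hu
    · ring
  · rw [hK u hu]; ring
  · refine hD.imp id ?_
    rintro ⟨rfl, rfl⟩ t _ x _
    simp
  · unfold op
    fun_prop (disch := simp [h0])

lemma Base.mem_of_div {κ : ℝ} {y y' : ℝ → ℝ} (B : Base κ y y') (hE : E.Nonlinear)
    (a b c τ₁ β g₁ l₀ : ℝ) (hK : ∀ u ∈ E.J, E.K u = κ * E.D u) {l : ℝ}
    (hφ : ∀ x ∈ E.I, y x ≠ 0 ∧ E.φ x + 2 * κ = y' x * (l / y x))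
    (hD : E.DEq a b c ∨ β = 0 ∧ l₀ = 0 := by simp)
    (hβ : (a + c) * β * l = -(4 * a + 3 * c) * β := by ring)
    (hl : g₁ * l = c * l₀ + τ₁ - 2 * g₁ := by ring)
    {T X U : ℝ → ℝ → ℝ → ℝ} (h1 : ∀ t x u, T t x u = τ₁ * t := by intros; ring)
    (h2 : ∀ t x u, X t x u = ((a + c) * β * y x ^ 2 + g₁ * y x) / y' x := by
      intros; first | ring1 | (simp only [Real.exp_neg]; field_simp; try ring))
    (h3 : ∀ t x u, U t x u = (β * y x + l₀) * (a * u + b) := by intros; ring) :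
    E.dom.domRestrict (op fun t x u => (T t x u, X t x u, U t x u)) ∈ E.maxAlg :=
  B.mem hE a b c τ₁ β g₁ 0 l₀ hK (fun x hx => (hφ x hx).2) hD (fun x hx => by
    have := (hφ x hx).1
    field_simp
    linear_combination y x * (y x * hβ + hl)) h1 (by simpa using h2) h3

/-- The scaling operator for `K` proportional to `D`. -/
lemma scaling_mem (hE : E.Nonlinear) {a b c ε : ℝ} (k : ℝ) (hD : E.DEq a b c)
    (hK : ∀ u ∈ E.J, E.K u = ε * E.D u) {T U : ℝ → ℝ → ℝ → ℝ}
    (h1 : ∀ t x u, T t x u = -k * c * t := by intros; ring)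
    (h3 : ∀ t x u, U t x u = k * (a * u + b) := by intros; ring) :
    E.dom.domRestrict (op fun t x u => (T t x u, 0, U t x u)) ∈ E.maxAlg :=
  affine_mem hE a b c k (-k * c) 0 0 0 0 (g := E.φ) (fun _ _ => rfl) (fun _ => hD)
    (fun x hx u hu => by
      rw [deriv_eq_of_eqOn hE.hJ.1 hu hK ((hE.hasDerivAt_D hu).const_mul ε), hK u hu]
      linear_combination k * ε * hD u hu) (h1 := fun t x u => by rw [h1, add_zero]) (h3 := h3)

lemma φ_inv (hE : E.Nonlinear) (hf : EqOn E.f (fun x => x⁻¹) E.I) :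
    ∀ x ∈ E.I, x ≠ 0 ∧ E.φ x = -1 / x := fun x hx => by
  simpa using base_id.φ_zpow hE (n := -1) (by norm_num) (fun x hx => by simpa using hf hx) x hx

/-- The additional operators for `K = 1`, `f = 1 / x`. -/
lemma expTime_mem (hE : E.Nonlinear) (hK : ∀ u ∈ E.J, E.K u = 1)
    (hf : EqOn E.f (fun x => x⁻¹) E.I) :
    E.dom.domRestrict (op fun t x _ => (exp (-t), -exp (-t) * x, 0)) ∈ E.maxAlg := by
  have hφ := φ_inv hE hf
  have jξ : Jet E.T E.I (fun t x => -exp (-t) * x) (fun t x => exp (-t) * x)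
      (fun t _ => -exp (-t)) (fun _ _ => 0) :=
    ⟨fun t _ x _ => by
      exact (((hasDerivAt_exp_neg t).neg.mul_const x)).congr_deriv (by ring),
     fun t _ x _ => by simpa using (hasDerivAt_id x).const_mul (-exp (-t)),
     fun _ _ x _ => hasDerivAt_const _ _⟩
  refine mem_maxAlg_of_wSol hE (a := 0) (b := 0) (c := 0)
    ⟨fun t => exp (-t), fun t => -exp (-t), _, _, _, _, _, _, _, _,
      fun t _ => hasDerivAt_exp_neg t, jξ, jet_const 0,
      fun t ht x hx => ?_, fun t ht x hx u hu => ?_, fun t ht x hx u hu => by ring⟩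
      (Or.inr fun _ _ _ _ => ⟨rfl, rfl⟩) ?_ ?_
  · obtain ⟨h0, h⟩ := hφ x hx; rw [h]; field_simp; ring
  · rw [hK u hu, hf hx]; have := (hφ x hx).1; field_simp; ring
  · unfold op; fun_prop
  · intros; simp

/-- The additional operator of the case `D = u ^ (-3/2)`, `K = 1`, `f = 1 / x`. -/
lemma expTime_quad_mem (hE : E.Nonlinear) (hD : E.DEq 1 0 (-3 / 2)) (hK : ∀ u ∈ E.J, E.K u = 1)
    (hf : EqOn E.f (fun x => x⁻¹) E.I) :
    E.dom.domRestrict (op fun t x u => (0, exp t * x ^ 2, -2 * exp t * x * u))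
      ∈ E.maxAlg := by
  have hφ := φ_inv hE hf
  have jξ : Jet E.T E.I (fun t x => exp t * x ^ 2) (fun t x => exp t * x ^ 2)
      (fun t x => 2 * exp t * x) (fun t _ => 2 * exp t) :=
    ⟨fun t _ x _ => (Real.hasDerivAt_exp t).mul_const _,
     fun t _ x _ => by
      exact ((hasDerivAt_pow 2 x).const_mul (exp t)).congr_deriv (by push_cast; ring),
     fun t _ x _ => by simpa using (hasDerivAt_id x).const_mul (2 * exp t)⟩
  have jl : Jet E.T E.I (fun t x => -2 * exp t * x) (fun t x => -2 * exp t * x)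
      (fun t _ => -2 * exp t) (fun _ _ => 0) :=
    ⟨fun t _ x _ => ((Real.hasDerivAt_exp t).const_mul (-2)).mul_const _,
     fun t _ x _ => by simpa using (hasDerivAt_id x).const_mul (-2 * exp t),
     fun t _ x _ => hasDerivAt_const _ _⟩
  refine mem_maxAlg_of_wSol hE (a := 1) (b := 0) (c := -3 / 2)
    ⟨fun t => 0, fun t => 0, _, _, _, _, _, _, _, _,
      fun t _ => hasDerivAt_const _ _, jξ, jl,
      fun t ht x hx => ?_, fun t ht x hx u hu => ?_, fun t ht x hx u hu => ?_⟩ (Or.inl hD) ?_ ?_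
  · obtain ⟨h0, h⟩ := hφ x hx; rw [h]; field_simp; ring
  · rw [hK u hu, hf hx, deriv_const_of_eqOn hE.hJ.1 hK hu]; have := (hφ x hx).1; field_simp; ring
  · rw [hK u hu, hf hx]; have := (hφ x hx).1; field_simp; ring
  · unfold op; fun_prop
  · intros; simp

/-- The additional operators of the Burgers equation. -/
lemma burgers_mem (hE : E.Nonlinear) (hD : ∀ u ∈ E.J, E.D u = 1) (hK : EqOn E.K (fun u => u) E.J)
    (hf : ∀ x ∈ E.I, E.f x = 1) :
    E.dom.domRestrict (op fun t _ _ => (0, t, -1)) ∈ E.maxAlg ∧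
    E.dom.domRestrict (op fun t x u => (t ^ 2, t * x, -(t * u + x))) ∈ E.maxAlg := by
  have hφ := hE.φ_const hf
  have hdK : ∀ u ∈ E.J, deriv E.K u = 1 := fun u hu =>
    deriv_eq_of_eqOn hE.hJ.1 hu hK (hasDerivAt_id u)
  have hdD : ∀ u ∈ E.J, deriv E.D u = 0 := fun u hu => deriv_const_of_eqOn hE.hJ.1 hD hu
  constructor
  · exact affine_mem hE 0 1 0 (-1) 0 0 0 1 0 hφ (fun _ u hu => by rw [hdD u hu]; ring)
      (fun x hx u hu => by rw [hdK u hu, hf x hx]; ring)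
  · refine mem_maxAlg_of_sol hE
      ⟨⟨fun t => t ^ 2, fun t => 2 * t, fun t x => t * x, fun t x => x, fun t x => t, fun _ _ => 0,
        fun t x => -t, fun _ _ => -1, fun _ _ => 0, fun _ _ => 0, fun t x => -x, fun _ _ => 0,
        fun _ _ => -1, fun _ _ => 0, fun t _ => by simpa using hasDerivAt_pow 2 t, ⟨?_, ?_, ?_⟩,
        ⟨?_, fun _ _ _ _ => hasDerivAt_const _ _, fun _ _ _ _ => hasDerivAt_const _ _⟩,
        ⟨fun _ _ _ _ => hasDerivAt_const _ _, fun _ _ x _ => (hasDerivAt_id x).neg,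
          fun _ _ _ _ => hasDerivAt_const _ _⟩⟩, ?_, ?_, ?_⟩ ?_ ?_
    · intro t _ x _; simpa using (hasDerivAt_id t).mul_const x
    · intro t _ x _; simpa using (hasDerivAt_id x).const_mul t
    · intro t _ x _; exact hasDerivAt_const _ _
    · intro t _ x _; exact (hasDerivAt_id t).neg
    · intro t _ x hx u hu; rw [hdD u hu, hφ x hx]; ring
    · intro t _ x hx u hu; rw [hdK u hu, hdD u hu, hφ x hx, hf x hx, hK hu, hD u hu]; ring
    · intro t _ x hx u hu; rw [hf x hx, hK hu, hD u hu]; ring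
    · unfold op; fun_prop
    · intros; simp; ring

/-! ### The listed operators: membership and linear independence -/

lemma cubic_eq_zero {S : Set ℝ} (hS : IsOpenInterval S) {Y : ℝ → ℝ} (hY : InjOn Y S)
    {a b c d : ℝ} (h : ∀ x ∈ S, a * Y x ^ 3 + b * Y x ^ 2 + c * Y x + d = 0) :
    a = 0 ∧ b = 0 ∧ c = 0 ∧ d = 0 := by
  have hinf : S.Infinite := by
    obtain ⟨x, hx⟩ := hS.2.2
    exact infinite_of_mem_nhds x (hS.1.mem_nhds hx)
  let p : Polynomial ℝ := Polynomial.C a * Polynomial.X ^ 3 + Polynomial.C b * Polynomial.X ^ 2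
    + Polynomial.C c * Polynomial.X + Polynomial.C d
  have hp : p = 0 := by
    refine Polynomial.eq_zero_of_infinite_isRoot p ((hinf.image hY).mono ?_)
    rintro _ ⟨x, hx, rfl⟩
    simpa [p, Polynomial.IsRoot] using h x hx
  have e : ∀ i, p.coeff i = 0 := fun i => by rw [hp]; simp
  refine ⟨?_, ?_, ?_, ?_⟩
  exacts [by simpa [p, Polynomial.coeff_X, Polynomial.coeff_C] using e 3,
    by simpa [p, Polynomial.coeff_X, Polynomial.coeff_C] using e 2,
    by simpa [p, Polynomial.coeff_X, Polynomial.coeff_C] using e 1,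
    by simpa [p, Polynomial.coeff_X, Polynomial.coeff_C] using e 0]

lemma quad_eq_zero {S : Set ℝ} (hS : IsOpenInterval S) {Y : ℝ → ℝ} (hY : InjOn Y S)
    {a b c : ℝ} (h : ∀ x ∈ S, a * Y x ^ 2 + b * Y x + c = 0) : a = 0 ∧ b = 0 ∧ c = 0 :=
  (cubic_eq_zero hS hY (a := 0) fun x hx => by linear_combination h x hx).2

lemma lin_eq_zero {S : Set ℝ} (hS : IsOpenInterval S) {Y : ℝ → ℝ} (hY : InjOn Y S)
    {b c : ℝ} (h : ∀ x ∈ S, b * Y x + c = 0) : b = 0 ∧ c = 0 :=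
  (quad_eq_zero hS hY (a := 0) (b := b) (c := c) fun x hx => by linear_combination h x hx).2

lemma fam_mem {l : List VField}
    (h : ∀ q ∈ l, E.dom.domRestrict q ∈ E.maxAlg) (i : Fin l.length) : E.fam l i ∈ E.maxAlg :=
  h _ (List.get_mem l i)

/-- The operators are linearly independent elements of the maximal invariance algebra. -/
def Eqn.Spec (E : Eqn) (l : List VField) : Prop :=
  LinearIndependent ℝ (E.fam l) ∧ ∀ i, E.fam l i ∈ E.maxAlg

section Spec
variable (hE : E.Nonlinear)
include hE

variable {t₀ u₀ : ℝ} (ht₀ : t₀ ∈ E.T) (hu₀ : u₀ ∈ E.J)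
include ht₀ hu₀

lemma spec_cons {l : List VField} (h : ∀ k : Fin l.length → ℝ, (∀ x ∈ E.I,
    ∑ i, k i * (l.get i (t₀, x, u₀)).2.1 = 0 ∧ ∑ i, k i * (l.get i (t₀, x, u₀)).2.2 = 0) →
    ∀ i, k i = 0) (m : ∀ q ∈ l, E.dom.domRestrict q ∈ E.maxAlg) : E.Spec (dt :: l) := by
  refine ⟨fam_linearIndependent fun k hk => ?_, fam_mem (List.forall_mem_cons.2 ⟨dt_mem hE, m⟩)⟩
  have h0 : ∀ x ∈ E.I, k 0 • dt (t₀, x, u₀) + ∑ i : Fin l.length, k i.succ • l.get i (t₀, x, u₀) = 0 :=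
    fun x hx => (Fin.sum_univ_succ _).symm.trans (hk t₀ ht₀ x hx u₀ hu₀)
  simp only [Prod.ext_iff, dt, op, Prod.fst_add, Prod.snd_add, Prod.fst_sum, Prod.snd_sum,
    Prod.smul_fst, Prod.smul_snd, smul_eq_mul, mul_zero, zero_add, Prod.fst_zero, Prod.snd_zero] at h0
  have h1 := h (fun i => k i.succ) fun x hx => (h0 x hx).2
  obtain ⟨x, hx⟩ := hE.hI.2.2
  exact funext fun i => Fin.cases (by simpa [h1] using (h0 x hx).1) h1 i

variable {τ₁ ξ₁ η₁ τ₂ ξ₂ η₂ τ₃ ξ₃ η₃ τ₄ ξ₄ η₄ : ℝ → ℝ → ℝ → ℝ}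
  (m₁ : E.dom.domRestrict (op fun t x u => (τ₁ t x u, ξ₁ t x u, η₁ t x u)) ∈ E.maxAlg)
  (m₂ : E.dom.domRestrict (op fun t x u => (τ₂ t x u, ξ₂ t x u, η₂ t x u)) ∈ E.maxAlg)
  (m₃ : E.dom.domRestrict (op fun t x u => (τ₃ t x u, ξ₃ t x u, η₃ t x u)) ∈ E.maxAlg)
  (m₄ : E.dom.domRestrict (op fun t x u => (τ₄ t x u, ξ₄ t x u, η₄ t x u)) ∈ E.maxAlg)
include m₁

lemma spec_two (h : ∀ k₁ : ℝ, (∀ x ∈ E.I, k₁ * ξ₁ t₀ x u₀ = 0 ∧ k₁ * η₁ t₀ x u₀ = 0) → k₁ = 0) :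
    E.Spec [dt, op fun t x u => (τ₁ t x u, ξ₁ t x u, η₁ t x u)] :=
  spec_cons hE ht₀ hu₀ (fun k hk => by
    simp only [List.length_cons, List.length_nil, Fin.forall_fin_succ, Fin.sum_univ_succ] at hk ⊢
    simpa using h (k 0) (by simpa [op] using hk)) (by simp [m₁])

include m₂

lemma spec_three (h : ∀ k₁ k₂ : ℝ, (∀ x ∈ E.I, k₁ * ξ₁ t₀ x u₀ + k₂ * ξ₂ t₀ x u₀ = 0 ∧
    k₁ * η₁ t₀ x u₀ + k₂ * η₂ t₀ x u₀ = 0) → k₁ = 0 ∧ k₂ = 0) :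
    E.Spec [dt, op fun t x u => (τ₁ t x u, ξ₁ t x u, η₁ t x u),
      op fun t x u => (τ₂ t x u, ξ₂ t x u, η₂ t x u)] :=
  spec_cons hE ht₀ hu₀ (fun k hk => by
    simp only [List.length_cons, List.length_nil, Fin.forall_fin_succ, Fin.sum_univ_succ] at hk ⊢
    simpa using h (k 0) (k 1) (by simpa [op] using hk)) (by simp [m₁, m₂])

include m₃

lemma spec_four (h : ∀ k₁ k₂ k₃ : ℝ, (∀ x ∈ E.I,
    k₁ * ξ₁ t₀ x u₀ + (k₂ * ξ₂ t₀ x u₀ + k₃ * ξ₃ t₀ x u₀) = 0 ∧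
    k₁ * η₁ t₀ x u₀ + (k₂ * η₂ t₀ x u₀ + k₃ * η₃ t₀ x u₀) = 0) → k₁ = 0 ∧ k₂ = 0 ∧ k₃ = 0) :
    E.Spec [dt, op fun t x u => (τ₁ t x u, ξ₁ t x u, η₁ t x u),
      op fun t x u => (τ₂ t x u, ξ₂ t x u, η₂ t x u),
      op fun t x u => (τ₃ t x u, ξ₃ t x u, η₃ t x u)] :=
  spec_cons hE ht₀ hu₀ (fun k hk => by
    simp only [List.length_cons, List.length_nil, Fin.forall_fin_succ, Fin.sum_univ_succ] at hk ⊢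
    simpa using h (k 0) (k 1) (k 2) (by simpa [op] using hk)) (by simp [m₁, m₂, m₃])

include m₄

lemma spec_five (h : ∀ k₁ k₂ k₃ k₄ : ℝ, (∀ x ∈ E.I,
    k₁ * ξ₁ t₀ x u₀ + (k₂ * ξ₂ t₀ x u₀ + (k₃ * ξ₃ t₀ x u₀ + k₄ * ξ₄ t₀ x u₀)) = 0 ∧
    k₁ * η₁ t₀ x u₀ + (k₂ * η₂ t₀ x u₀ + (k₃ * η₃ t₀ x u₀ + k₄ * η₄ t₀ x u₀)) = 0) →
    k₁ = 0 ∧ k₂ = 0 ∧ k₃ = 0 ∧ k₄ = 0) :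
    E.Spec [dt, op fun t x u => (τ₁ t x u, ξ₁ t x u, η₁ t x u),
      op fun t x u => (τ₂ t x u, ξ₂ t x u, η₂ t x u),
      op fun t x u => (τ₃ t x u, ξ₃ t x u, η₃ t x u),
      op fun t x u => (τ₄ t x u, ξ₄ t x u, η₄ t x u)] :=
  spec_cons hE ht₀ hu₀ (fun k hk => by
    simp only [List.length_cons, List.length_nil, Fin.forall_fin_succ, Fin.sum_univ_succ] at hk ⊢
    simpa using h (k 0) (k 1) (k 2) (k 3) (by simpa [op] using hk)) (by simp [m₁, m₂, m₃, m₄])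

end Spec

lemma Eqn.DEq_exp (hJ : IsOpen E.J) {μ : ℝ} (h : EqOn E.D (fun u => exp (μ * u)) E.J) :
    E.DEq 0 1 μ := fun u hu => by rw [deriv_exp_mul hJ h hu]; ring

lemma Eqn.DEq_exp_one (hJ : IsOpen E.J) (h : EqOn E.D exp E.J) : E.DEq 0 1 1 :=
  Eqn.DEq_exp hJ (h.trans fun u _ => by simp)

lemma Eqn.DEq_rpow (hJ : IsOpen E.J) {μ : ℝ} (h0 : E.J ⊆ Ioi 0 ∨ μ = 0)
    (h : EqOn E.D (fun u => u ^ μ) E.J) : E.DEq 1 0 μ := fun u hu => by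
  linear_combination mul_deriv_rpow hJ (h0.imp_right fun e => ⟨0, by simp [e]⟩) h hu

lemma Eqn.DEq_inv (hJ : IsOpen E.J) (h0 : E.J ⊆ Ioi 0)
    (h : EqOn E.D (fun u => u⁻¹) E.J) : E.DEq 1 0 (-1) :=
  Eqn.DEq_rpow hJ (.inl h0) (h.trans fun u _ => (Real.rpow_neg_one u).symm)

lemma Eqn.K_zero (hK : ∀ u ∈ E.J, E.K u = 0) : ∀ u ∈ E.J, E.K u = 0 * E.D u := by simpa

lemma Eqn.K_one {g : ℝ → ℝ} (hK : EqOn E.K g E.J) (hD : EqOn E.D g E.J) :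
    ∀ u ∈ E.J, E.K u = 1 * E.D u := fun u hu => by rw [hK hu, hD hu, one_mul]

lemma exists_ne_zero_mem (hJ : IsOpenInterval E.J) : ∃ u ∈ E.J, u ≠ 0 := by
  obtain ⟨x, hx, y, hy, h⟩ := hJ.exists_two
  by_cases hx0 : x = 0
  · exact ⟨y, hy, fun e => h (by rw [hx0, e])⟩
  · exact ⟨x, hx, hx0⟩

lemma exponent_ne_zero {μ : ℝ} (h₁ : μ ≠ -4 / 3) (h₂ : μ ≠ -1) :
    1 + μ ≠ 0 ∧ -(4 + 3 * μ) / (1 + μ) ≠ 0 :=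
  have h : 1 + μ ≠ 0 := fun h => h₂ (by linarith)
  ⟨h, div_ne_zero (neg_ne_zero.2 fun h => h₁ (by linarith)) h⟩

set_option maxHeartbeats 4000000 in
/-- The listed operators are linearly independent elements of the maximal invariance algebra. -/
theorem ops_spec (hE : E.Nonlinear) (c : Case) (hc : c.Entry E) : E.Spec c.ops := by
  obtain ⟨t₀, ht₀⟩ := hE.hT.2.2
  obtain ⟨x₀, hx₀⟩ := hE.hI.2.2
  obtain ⟨u₀, hu₀, hu0⟩ := exists_ne_zero_mem hE.hJ
  have hexp : ∀ x, exp (-x) * exp x = 1 := fun x => by rw [← Real.exp_add]; simp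
  have he := fun x => (Real.exp_pos x).ne'
  have qI : ∀ {a b c : ℝ}, _ := @quad_eq_zero _ hE.hI (fun x => x) fun _ _ _ _ h => h
  have qE : ∀ {a b c : ℝ}, _ := @quad_eq_zero _ hE.hI (fun x => exp (-x))
    fun _ _ _ _ h => neg_injective (Real.exp_injective h)
  have hφ₁ : (∀ x ∈ E.I, E.f x = 1) → ∀ x ∈ E.I, E.φ x + 2 * 0 = 1 * 0 := fun hf x hx => by
    rw [hE.φ_const hf x hx]; ring
  have hφ₃ : ∀ {γ}, (∀ x ∈ E.I, E.f x = exp (-2 * x + γ * exp (-x))) →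
      ∀ x ∈ E.I, E.φ x + 2 * 1 = -exp (-x) * γ := fun {γ} hf =>
    (base_exp 0).φ_exp hE fun x hx => by rw [hf x hx, Real.exp_add, exp_neg_two_mul, add_zero]
  have hφ₂ : (∀ x ∈ E.I, E.f x = exp (-2 * x)) → ∀ x ∈ E.I, E.φ x + 2 * 1 = -exp (-x) * 0 :=
    fun hf => hφ₃ (by simpa using hf)
  cases c <;> dsimp only [Case.Entry, Eqn.Has, Eqn.HasDK, Eqn.HasExpInt, EqOn] at hc
  case c1_1 => exact spec_cons hE ht₀ hu₀ (l := []) (fun k _ i => i.elim0) (by simp)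
  case c1_2a ε =>
    exact spec_two hE ht₀ hu₀ (affine_mem hE 0 0 0 0 ε 0 0 0 1 (hE.φ_eq hc fun x _ =>
      (hasDerivAt_id' x).const_mul ε)) fun k h => by simpa using (h x₀ hx₀).1
  case c1_2b γ =>
    obtain ⟨hγ, -, hK, hf⟩ := hc
    exact spec_two hE ht₀ hu₀ ((base_exp 0).mem hE 0 0 0 γ 0 0 1 0 (by simpa using hK) (hφ₃ hf))
      fun k h => by simpa using (h x₀ hx₀).1
  case c1_2c γ ν =>
    obtain ⟨hγ, hν, -, hK, hf⟩ := hc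
    have hφ := (base_exp γ).φ_abs_rpow hE hν fun x hx => by rw [hf hx, exp_neg_two_mul]
    exact spec_two hE ht₀ hu₀ ((base_exp γ).mem_of_div hE 0 0 0 (ν + 2) 0 1 0 (by simpa using hK) hφ)
      fun k h => (mul_eq_zero.1 (h x₀ hx₀).1).resolve_right (mul_ne_zero (neg_ne_zero.2 (hφ x₀ hx₀).1) (he _))
  case c1_2d ν =>
    obtain ⟨hν, -, hK, hf⟩ := hc
    have hφ := base_id.φ_abs_rpow hE hν fun x hx => by simpa using hf hx
    exact spec_two hE ht₀ hu₀ (base_id.mem_of_div hE 0 0 0 (ν + 2) 0 1 0 (by simpa using hK) hφ)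
      fun k h => by simpa [(hφ x₀ hx₀).1] using (h x₀ hx₀).1
  case c1_2e =>
    obtain ⟨-, hK, hf⟩ := hc
    exact spec_two hE ht₀ hu₀ (expTime_mem hE hK hf) fun k h => by
      simpa [(φ_inv hE hf x₀ hx₀).1] using (h x₀ hx₀).1
  case c1_3a =>
    obtain ⟨-, hK, hf⟩ := hc
    replace hK := Eqn.K_zero hK
    exact spec_three hE ht₀ hu₀ (base_id.mem hE 0 0 0 0 0 0 1 0 hK (hφ₁ hf))
      (base_id.mem hE 0 0 0 2 0 1 0 0 hK (hφ₁ hf)) fun k₁ k₂ h =>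
      (qI (a := 0) fun x hx => by linear_combination (h x hx).1).2.symm
  case c1_3b =>
    obtain ⟨-, hK, hf⟩ := hc
    have hK : ∀ u ∈ E.J, E.K u = 1 * E.D u := by simpa using hK
    exact spec_three hE ht₀ hu₀ ((base_exp 0).mem hE 0 0 0 2 0 1 0 0 hK (hφ₂ hf))
      ((base_exp 0).mem hE 0 0 0 0 0 0 (-1) 0 hK (hφ₂ hf)) fun k₁ k₂ h => by
      simpa using (qE (a := 0) (b := -k₁) (c := k₂) fun x hx => by
        linear_combination exp (-x) * (h x hx).1 - k₂ * hexp x).2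
  case c2_1 μ ν l =>
    obtain ⟨hl, hD, hK, hf⟩ := hc
    have hφ := base_id.φ_abs_rpow hE hl fun x hx => by simpa using hf hx
    exact spec_two hE ht₀ hu₀ (affine_mem hE 0 1 μ 1 (l * μ - l * ν + μ - 2 * ν) 0 (μ - ν) 0 0
      (g := fun x => l / x) (fun x hx => by simpa using (hφ x hx).2)
      (fun _ => Eqn.DEq_exp hE.hJ.1 hD) (fun x hx u hu => by rw [deriv_exp_mul hE.hJ.1 hK hu]; ring)
      (fun x hx t _ => by have := (hφ x hx).1; field_simp; ring)) fun k h => by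
      simpa using (h x₀ hx₀).2
  case c2_2 μ =>
    obtain ⟨hD, hK, hf⟩ := hc
    exact spec_three hE ht₀ hu₀ (affine_mem hE 0 0 0 0 0 0 0 0 1 (hE.φ_const hf))
      (affine_mem hE 0 1 μ 1 (μ - 2) 0 (μ - 1) 0 0 (hE.φ_const hf)
        (fun _ => Eqn.DEq_exp hE.hJ.1 hD) fun x hx u hu => by
        rw [deriv_exp_mul (k := 1) hE.hJ.1 (by simpa [EqOn] using hK) hu]; ring) fun k₁ k₂ h =>
      have ⟨h1, h2⟩ := h x₀ hx₀
      ⟨by linear_combination h1 - (μ - 1) * x₀ * h2, by linear_combination h2⟩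
  case c2_3 =>
    obtain ⟨hD, hK, hf⟩ := hc
    exact spec_three hE ht₀ hu₀ (affine_mem hE 0 0 0 0 0 0 0 0 1 (hE.φ_const hf))
      (affine_mem hE 0 1 1 1 1 0 1 (-1) 0 (hE.φ_const hf) (fun _ => Eqn.DEq_exp_one hE.hJ.1 hD)
        fun x hx u hu => by
        rw [deriv_eq_of_eqOn hE.hJ.1 hu hK (hasDerivAt_id u), hf hx]; ring) fun k₁ k₂ h =>
      have ⟨h1, h2⟩ := h x₀ hx₀
      ⟨by linear_combination h1 - (x₀ - t₀) * h2, by linear_combination h2⟩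
  case c2_4 ε =>
    obtain ⟨hD, hK⟩ := hc
    exact spec_two hE ht₀ hu₀ (scaling_mem hE (-1) (Eqn.DEq_exp_one hE.hJ.1 hD) (ε := ε)
      fun u hu => by rw [hK hu, hD hu]) fun k h => by simpa using (h x₀ hx₀).2
  case c2_5a α β γ₁ γ₀ =>
    obtain ⟨⟨hD, hK⟩, F, hF⟩ := hc
    replace hK := Eqn.K_zero hK
    replace hD := Eqn.DEq_exp_one hE.hJ.1 hD
    have hφ := hE.φ_eq (fun x hx => (hF x hx).2.2) fun x hx => (hF x hx).2.1
    exact spec_three hE ht₀ hu₀ (scaling_mem hE (-1) hD hK) (base_id.mem hE 0 1 1 α β γ₁ γ₀ 0 hK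
      (h := E.φ) (by simp) (.inl hD) fun x hx => by
        rw [hφ x hx, mul_div_assoc', div_eq_iff (hF x hx).1]; ring) fun k₁ k₂ h =>
      have ⟨h1, h2⟩ := h x₀ hx₀
      have h3 : k₂ = 0 := by simpa [(hF x₀ hx₀).1] using h1
      ⟨by linear_combination β * x₀ * h3 - h2, h3⟩
  case c2_5b α β γ₁ γ₀ =>
    obtain ⟨⟨hD, hK⟩, F, hF⟩ := hc
    replace hK := Eqn.K_one hK hD
    replace hD := Eqn.DEq_exp_one hE.hJ.1 hD
    have hφ := hE.φ_eq (fun x hx => (hF x hx).2.2) fun x hx => (hF x hx).2.1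
    exact spec_three hE ht₀ hu₀ (scaling_mem hE (-1) hD hK) ((base_exp 0).mem hE 0 1 1 α β γ₁ γ₀ 0 hK
      (h := fun x => (E.φ x + 2 * 1) / -exp (-x)) (fun x _ => by simp; field_simp) (.inl hD)
      fun x hx => by
        have h := (hF x hx).1
        rw [hφ x hx, div_add' _ _ _ h, div_div, mul_div_assoc',
          div_eq_iff (mul_ne_zero h (neg_ne_zero.2 (he _)))]
        linear_combination (α - 3 * β * exp (-x) - 2 * γ₁) * γ₀ * hexp x) fun k₁ k₂ h =>
      have ⟨h1, h2⟩ := h x₀ hx₀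
      have h3 : k₂ = 0 := by
        rw [mul_zero, zero_add] at h1
        exact (mul_eq_zero.1 h1).resolve_right (neg_ne_zero.2 (hF x₀ hx₀).1)
      ⟨by linear_combination β * exp (-x₀) * h3 - h2, h3⟩
  case c2_5c =>
    obtain ⟨hD, hK, hf⟩ := hc
    have hφ := φ_inv hE hf
    exact spec_three hE ht₀ hu₀ (affine_mem hE 0 1 1 1 0 0 1 0 0 (fun x hx => (hφ x hx).2)
      (fun _ => Eqn.DEq_exp_one hE.hJ.1 hD) (fun x hx u hu => by
        rw [deriv_const_of_eqOn hE.hJ.1 hK hu]; ring) fun x hx t _ => by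
        have := (hφ x hx).1; field_simp; ring) (expTime_mem hE hK hf) fun k₁ k₂ h =>
      have ⟨h1, h2⟩ := h x₀ hx₀
      have h3 : k₁ = 0 := by linear_combination h2
      ⟨h3, by simpa [h3, (hφ x₀ hx₀).1] using h1⟩
  case c2_6a =>
    obtain ⟨hD, hK, hf⟩ := hc
    replace hK := Eqn.K_zero hK
    exact spec_four hE ht₀ hu₀ (scaling_mem hE (-1) (Eqn.DEq_exp_one hE.hJ.1 hD) hK)
      (base_id.mem hE 0 0 0 2 0 1 0 0 hK (hφ₁ hf)) (base_id.mem hE 0 0 0 0 0 0 1 0 hK (hφ₁ hf))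
      fun k₁ k₂ k₃ h => ⟨by linear_combination -(h x₀ hx₀).2,
        (qI (a := 0) fun x hx => by linear_combination (h x hx).1).2⟩
  case c2_6b =>
    obtain ⟨hD, hK, hf⟩ := hc
    replace hK := Eqn.K_one hK hD
    exact spec_four hE ht₀ hu₀ (scaling_mem hE (-1) (Eqn.DEq_exp_one hE.hJ.1 hD) hK)
      ((base_exp 0).mem hE 0 0 0 2 0 1 0 0 hK (hφ₂ hf))
      ((base_exp 0).mem hE 0 0 0 0 0 0 (-1) 0 hK (hφ₂ hf))
      fun k₁ k₂ k₃ h => ⟨by linear_combination -(h x₀ hx₀).2, by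
        simpa using (qE (a := 0) (b := -k₂) (c := k₃) fun x hx => by
          linear_combination exp (-x) * (h x hx).1 - k₃ * hexp x).2⟩
  case c2_6c γ =>
    obtain ⟨hD, hK, hf⟩ := hc
    replace hK := Eqn.K_one hK hD
    replace hD := Eqn.DEq_exp_one hE.hJ.1 hD
    have hφ := (base_exp γ).φ_zpow hE (n := -3) (by norm_num) fun x hx => by
      rw [hf hx, exp_neg_two_mul]
    exact spec_four hE ht₀ hu₀ (scaling_mem hE (-1) hD hK)
      ((base_exp γ).mem_of_div hE 0 1 1 0 0 (-1) 1 hK hφ (.inl hD) (by norm_num) (by norm_num))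
      ((base_exp γ).mem_of_div hE 0 1 1 0 1 0 0 hK hφ (.inl hD) (by norm_num) (by norm_num))
      fun k₁ k₂ k₃ h => by
      have ⟨h1, h2, h3⟩ := qE (a := 0) (b := -k₃) (c := k₂ - k₃ * γ) fun x hx =>
        zero_of_mul (mul_ne_zero (hφ x hx).1 (he x)) (by linear_combination (h x hx).1)
      have h4 : k₂ = 0 := by linear_combination h3 - γ * h2
      exact ⟨by linear_combination -(h x₀ hx₀).2 + h4 - (exp (-x₀) + γ) * h2, h4,
        neg_eq_zero.1 h2⟩
  case c2_6d =>
    obtain ⟨hD, hK, hf⟩ := hc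
    replace hK := Eqn.K_zero hK
    replace hD := Eqn.DEq_exp_one hE.hJ.1 hD
    have hφ := base_id.φ_zpow hE (n := -3) (by norm_num) fun x hx => by simpa using hf hx
    exact spec_four hE ht₀ hu₀ (scaling_mem hE (-1) hD hK)
      (base_id.mem_of_div hE 0 1 1 0 0 1 (-1) hK hφ (.inl hD) (by norm_num) (by norm_num))
      (base_id.mem_of_div hE 0 1 1 0 1 0 0 hK hφ (.inl hD) (by norm_num) (by norm_num))
      fun k₁ k₂ k₃ h => by
      have ⟨h1, h2, h3⟩ := qI (a := k₃) (b := k₂) (c := 0) fun x hx => by linear_combination (h x hx).1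
      exact ⟨by linear_combination -(h x₀ hx₀).2 - h2 + x₀ * h1, h2, h1⟩
  case c3_1 μ ν l =>
    obtain ⟨hJ, hl, hD, hK, hf⟩ := hc
    have hφ := base_id.φ_abs_rpow hE hl fun x hx => by simpa using hf hx
    exact spec_two hE ht₀ hu₀ (affine_mem hE 1 0 μ 1 (μ + l * μ - 2 * ν - l * ν) 0 (μ - ν) 0 0
      (g := fun x => l / x) (fun x hx => by simpa using (hφ x hx).2)
      (fun _ => Eqn.DEq_rpow hE.hJ.1 (hJ.imp id And.left) hD) (fun x hx u hu => by
        linear_combination mul_deriv_rpow hE.hJ.1 (hJ.imp id And.right) hK hu)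
      (fun x hx t _ => by have := (hφ x hx).1; field_simp; ring)) fun k h => by
      simpa [hu0] using (h x₀ hx₀).2
  case c3_2 μ ν =>
    obtain ⟨hJ, hD, hK, hf⟩ := hc
    exact spec_three hE ht₀ hu₀ (affine_mem hE 0 0 0 0 0 0 0 0 1 (hE.φ_const hf))
      (affine_mem hE 1 0 μ 1 (μ - 2 * ν) 0 (μ - ν) 0 0 (hE.φ_const hf)
        (fun _ => Eqn.DEq_rpow hE.hJ.1 (hJ.imp id And.left) hD) fun x hx u hu => by
        linear_combination mul_deriv_rpow hE.hJ.1 (hJ.imp id And.right) hK hu) fun k₁ k₂ h =>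
      have h2 : k₂ = 0 := by simpa [hu0] using (h x₀ hx₀).2
      ⟨by linear_combination (h x₀ hx₀).1 - (μ - ν) * x₀ * h2, h2⟩
  case c3_3 μ =>
    obtain ⟨hJ, hD, hK, hf⟩ := hc
    exact spec_three hE ht₀ hu₀ (affine_mem hE 0 0 0 0 0 0 0 0 1 (hE.φ_const hf))
      (affine_mem hE 1 0 μ 1 μ 0 μ (-1) 0 (hE.φ_const hf)
        (fun _ => Eqn.DEq_rpow hE.hJ.1 (.inl hJ) hD) fun x hx u hu => by
        have hu' : u ≠ 0 := (hJ hu).ne'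
        rw [deriv_eq_of_eqOn hE.hJ.1 hu hK (Real.hasDerivAt_log hu'), hf hx]
        field_simp; ring) fun k₁ k₂ h =>
      have h2 : k₂ = 0 := by simpa [hu0] using (h x₀ hx₀).2
      ⟨by linear_combination (h x₀ hx₀).1 - (μ * x₀ - t₀) * h2, h2⟩
  case c3_4 μ ε =>
    obtain ⟨hJ, hμ, hD, hK⟩ := hc
    exact spec_two hE ht₀ hu₀ (scaling_mem hE (-1) (Eqn.DEq_rpow hE.hJ.1 (.inl hJ) hD) (ε := ε)
      fun u hu => by rw [hK hu, hD hu]) fun k h => by simpa [hu0] using (h x₀ hx₀).2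
  case c3_5a μ α β γ₁ γ₀ =>
    obtain ⟨hJ, hμ, ⟨hD, hK⟩, F, hF⟩ := hc
    replace hK := Eqn.K_zero hK
    replace hD := Eqn.DEq_rpow hE.hJ.1 (.inl hJ) hD
    have hφ := hE.φ_eq (fun x hx => (hF x hx).2.2) fun x hx => (hF x hx).2.1
    exact spec_three hE ht₀ hu₀ (scaling_mem hE (-1) hD hK) (base_id.mem hE 1 0 μ α β γ₁ γ₀ 0 hK
      (h := E.φ) (by simp) (.inl hD) fun x hx => by
        rw [hφ x hx, mul_div_assoc', div_eq_iff (hF x hx).1]; ring) fun k₁ k₂ h =>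
      have ⟨h1, h2⟩ := h x₀ hx₀
      have h3 : k₂ = 0 := by simpa [(hF x₀ hx₀).1] using h1
      ⟨by simpa [h3, hu0] using h2, h3⟩
  case c3_5b μ α β γ₁ γ₀ =>
    obtain ⟨hJ, hμ, ⟨hD, hK⟩, F, hF⟩ := hc
    replace hK := Eqn.K_one hK hD
    replace hD := Eqn.DEq_rpow hE.hJ.1 (.inl hJ) hD
    have hφ := hE.φ_eq (fun x hx => (hF x hx).2.2) fun x hx => (hF x hx).2.1
    exact spec_three hE ht₀ hu₀ (scaling_mem hE (-1) hD hK) ((base_exp 0).mem hE 1 0 μ α β γ₁ γ₀ 0 hK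
      (h := fun x => (E.φ x + 2 * 1) / -exp (-x)) (fun x _ => by simp; field_simp) (.inl hD)
      fun x hx => by
        have h := (hF x hx).1
        rw [hφ x hx, div_add' _ _ _ h, div_div, mul_div_assoc',
          div_eq_iff (mul_ne_zero h (neg_ne_zero.2 (he _)))]
        linear_combination (α - (4 + 3 * μ) * β * exp (-x) - 2 * γ₁) * γ₀ * hexp x) fun k₁ k₂ h =>
      have ⟨h1, h2⟩ := h x₀ hx₀
      have h3 : k₂ = 0 := by
        rw [mul_zero, zero_add] at h1
        exact (mul_eq_zero.1 h1).resolve_right (neg_ne_zero.2 (hF x₀ hx₀).1)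
      ⟨by simpa [h3, hu0] using h2, h3⟩
  case c3_5c μ =>
    obtain ⟨hJ, hμ, -, hD, hK, hf⟩ := hc
    have hφ := φ_inv hE hf
    exact spec_three hE ht₀ hu₀ (expTime_mem hE hK hf) (affine_mem hE 1 0 μ 1 0 0 μ 0 0
      (fun x hx => (hφ x hx).2) (fun _ => Eqn.DEq_rpow hE.hJ.1 (.inl hJ) hD) (fun x hx u hu => by
        rw [deriv_const_of_eqOn hE.hJ.1 hK hu]; ring) fun x hx t _ => by
        have := (hφ x hx).1; field_simp; ring) fun k₁ k₂ h =>
      have ⟨h1, h2⟩ := h x₀ hx₀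
      have h3 : k₂ = 0 := by simpa [hu0] using h2
      ⟨by simpa [h3, (hφ x₀ hx₀).1] using h1, h3⟩
  case c3_6a μ =>
    obtain ⟨hJ, hμ, -, hD, hK, hf⟩ := hc
    replace hK := Eqn.K_zero hK
    exact spec_four hE ht₀ hu₀ (scaling_mem hE (-1) (Eqn.DEq_rpow hE.hJ.1 (.inl hJ) hD) hK)
      (base_id.mem hE 0 0 0 0 0 0 1 0 hK (hφ₁ hf)) (base_id.mem hE 0 0 0 2 0 1 0 0 hK (hφ₁ hf))
      fun k₁ k₂ k₃ h => ⟨by simpa [hu0] using (h x₀ hx₀).2,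
        (qI (a := 0) fun x hx => by linear_combination (h x hx).1).2.symm⟩
  case c3_6b μ =>
    obtain ⟨hJ, hμ, -, hD, hK, hf⟩ := hc
    replace hK := Eqn.K_one hK hD
    exact spec_four hE ht₀ hu₀ (scaling_mem hE (-1) (Eqn.DEq_rpow hE.hJ.1 (.inl hJ) hD) hK)
      ((base_exp 0).mem hE 0 0 0 2 0 1 0 0 hK (hφ₂ hf))
      ((base_exp 0).mem hE 0 0 0 0 0 0 (-1) 0 hK (hφ₂ hf))
      fun k₁ k₂ k₃ h => ⟨by simpa [hu0] using (h x₀ hx₀).2, by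
        simpa using (qE (a := 0) (b := -k₂) (c := k₃) fun x hx => by
          linear_combination exp (-x) * (h x hx).1 - k₃ * hexp x).2⟩
  case c3_6c γ =>
    obtain ⟨hJ, hD, hK, hf⟩ := hc
    replace hK := Eqn.K_zero hK
    replace hD := Eqn.DEq_inv hE.hJ.1 hJ hD
    have hφ : ∀ x ∈ E.I, E.φ x + 2 * 0 = 1 * γ := base_id.φ_exp hE fun x hx => by simpa using hf hx
    exact spec_four hE ht₀ hu₀ (scaling_mem hE 1 hD hK)
      (base_id.mem hE 1 0 (-1) 0 0 0 1 (-γ) hK hφ (.inl hD))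
      (base_id.mem hE 1 0 (-1) 2 (-γ) 1 0 0 hK hφ (.inl hD)) fun k₁ k₂ k₃ h => by
      have ⟨_, h1, h2⟩ := qI (a := 0) (b := k₃) (c := k₂) fun x hx => by
        linear_combination (h x hx).1
      exact ⟨by simpa [h1, h2, hu0] using (h x₀ hx₀).2, h2, h1⟩
  case c3_6d γ =>
    obtain ⟨hJ, hD, hK, hf⟩ := hc
    replace hK := Eqn.K_one hK hD
    replace hD := Eqn.DEq_inv hE.hJ.1 hJ hD
    exact spec_four hE ht₀ hu₀ (scaling_mem hE 1 hD hK)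
      ((base_exp 0).mem hE 1 0 (-1) 0 0 0 (-1) γ hK (hφ₃ hf) (.inl hD))
      ((base_exp 0).mem hE 1 0 (-1) 2 (-γ) 1 0 0 hK (hφ₃ hf) (.inl hD)) fun k₁ k₂ k₃ h => by
      have ⟨h1, h2⟩ := (qE (a := 0) (b := -k₃) (c := k₂) fun x hx => by
        linear_combination exp (-x) * (h x hx).1 - k₂ * hexp x).2
      rw [neg_eq_zero] at h1
      exact ⟨by simpa [h1, h2, hu0] using (h x₀ hx₀).2, h2, h1⟩
  case c3_6e μ =>
    obtain ⟨hJ, hμ, hμ1, hμ2, hD, hK, hf⟩ := hc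
    have ⟨hm, hl⟩ := exponent_ne_zero hμ1 hμ2
    replace hK := Eqn.K_zero hK
    replace hD := Eqn.DEq_rpow hE.hJ.1 (.inl hJ) hD
    have hφ := base_id.φ_abs_rpow hE hl fun x hx => by simpa using hf hx
    exact spec_four hE ht₀ hu₀ (scaling_mem hE (-1) hD hK)
      (base_id.mem_of_div hE 0 0 0 (2 + μ) 0 (-(1 + μ)) 0 hK hφ (hl := by field_simp; ring))
      (base_id.mem_of_div hE 1 0 μ 0 1 0 0 hK hφ (.inl hD) (by field_simp)) fun k₁ k₂ k₃ h => by
      have ⟨h1, h2, h3⟩ := qI (a := k₃) (b := -k₂) (c := 0) fun x hx =>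
        zero_of_mul hm (by linear_combination (h x hx).1)
      rw [neg_eq_zero] at h2
      exact ⟨by simpa [h1, h2, hu0] using (h x₀ hx₀).2, h2, h1⟩
  case c3_6f μ γ =>
    obtain ⟨hJ, hμ, hμ1, hμ2, hD, hK, hf⟩ := hc
    have ⟨hm, hl⟩ := exponent_ne_zero hμ1 hμ2
    replace hK := Eqn.K_one hK hD
    replace hD := Eqn.DEq_rpow hE.hJ.1 (.inl hJ) hD
    have hφ := (base_exp γ).φ_abs_rpow hE hl fun x hx => by rw [hf hx, exp_neg_two_mul]
    exact spec_four hE ht₀ hu₀ (scaling_mem hE (-1) hD hK)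
      ((base_exp γ).mem_of_div hE 0 0 0 (2 + μ) 0 (-(1 + μ)) 0 hK hφ (hl := by field_simp; ring))
      ((base_exp γ).mem_of_div hE 1 0 μ 0 1 0 0 hK hφ (.inl hD) (by field_simp)) fun k₁ k₂ k₃ h => by
      have ⟨h1, h2, h3⟩ := qE (a := 0) (b := -k₃) (c := k₂ - k₃ * γ) fun x hx =>
        zero_of_mul (mul_ne_zero hm (mul_ne_zero (hφ x hx).1 (he x)))
          (by linear_combination (h x hx).1)
      have h4 : k₂ = 0 := by linear_combination h3 - γ * h2
      rw [neg_eq_zero] at h2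
      exact ⟨by simpa [h2, h4, hu0] using (h x₀ hx₀).2, h4, h2⟩
  case c3_6g =>
    obtain ⟨hJ, hD, hK, hf⟩ := hc
    have hφ := φ_inv hE hf
    replace hD := Eqn.DEq_rpow hE.hJ.1 (.inl hJ) hD
    exact spec_four hE ht₀ hu₀ (expTime_mem hE hK hf) (affine_mem hE 1 0 (-3 / 2) (-2) 0 0 3 0 0
      (fun x hx => (hφ x hx).2) (fun _ => hD) (fun x hx u hu => by
        rw [deriv_const_of_eqOn hE.hJ.1 hK hu]; ring) fun x hx t _ => by
        have := (hφ x hx).1; field_simp; ring) (expTime_quad_mem hE hD hK hf) fun k₁ k₂ k₃ h => by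
      have ⟨h1, h2, h3⟩ := qI (a := 0) (b := k₃ * exp t₀)
        (c := 3 * k₂ - exp (-t₀) * k₁) fun x hx =>
        zero_of_mul (hφ x hx).1 (by linear_combination (h x hx).1)
      have h4 : k₃ = 0 := by simpa using h2
      have h5 : k₂ = 0 := by simpa [h4, hu0] using (h x₀ hx₀).2
      exact ⟨by simpa [h5] using h3, h5, h4⟩
  case c3_7a =>
    obtain ⟨hJ, hD, hK, hf⟩ := hc
    replace hK := Eqn.K_zero hK
    replace hD := Eqn.DEq_rpow hE.hJ.1 (.inl hJ) hD
    exact spec_five hE ht₀ hu₀ (scaling_mem hE 3 hD hK) (base_id.mem hE 0 0 0 0 0 0 1 0 hK (hφ₁ hf))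
      (base_id.mem hE 0 0 0 2 0 1 0 0 hK (hφ₁ hf))
      (base_id.mem hE 1 0 (-4 / 3) 0 (-3) 0 0 0 hK (hφ₁ hf) (.inl hD)) fun k₁ k₂ k₃ k₄ h => by
      have ⟨h1, h2, h3⟩ := qI (a := k₄) (b := k₃) (c := k₂) fun x hx => by
        linear_combination (h x hx).1
      exact ⟨by simpa [h1, hu0] using (h x₀ hx₀).2, h3, h2, h1⟩
  case c3_7b =>
    obtain ⟨hJ, hD, hK, hf⟩ := hc
    replace hK := Eqn.K_one hK hD
    replace hD := Eqn.DEq_rpow hE.hJ.1 (.inl hJ) hD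
    exact spec_five hE ht₀ hu₀ (scaling_mem hE 3 hD hK)
      ((base_exp 0).mem hE 0 0 0 2 0 1 0 0 hK (hφ₂ hf))
      ((base_exp 0).mem hE 1 0 (-4 / 3) 0 3 0 0 0 hK (hφ₂ hf) (.inl hD))
      ((base_exp 0).mem hE 0 0 0 0 0 0 (-1) 0 hK (hφ₂ hf)) fun k₁ k₂ k₃ k₄ h => by
      have ⟨h1, h2, h3⟩ := qE (a := k₃) (b := -k₂) (c := k₄) fun x hx => by
        linear_combination exp (-x) * (h x hx).1 - k₄ * hexp x
      exact ⟨by simpa [h1, hu0] using (h x₀ hx₀).2, neg_eq_zero.1 h2, h1, h3⟩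
  case c3_8 =>
    obtain ⟨hD, hK, hf⟩ := hc
    have ⟨m₃, m₄⟩ := burgers_mem hE hD hK hf
    exact spec_five hE ht₀ hu₀ (affine_mem hE 0 0 0 0 0 0 0 0 1 (hE.φ_const hf))
      (affine_mem hE 1 0 0 (-1) 2 0 1 0 0 (hE.φ_const hf) (fun _ u hu => by
        rw [deriv_const_of_eqOn hE.hJ.1 hD hu]; ring) fun x hx u hu => by
        rw [deriv_eq_of_eqOn hE.hJ.1 hu hK (hasDerivAt_id u), hK hu]; ring) m₃ m₄
      fun k₁ k₂ k₃ k₄ h => by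
      have ⟨_, h1, h2⟩ := qI (a := 0) (b := k₂ + k₄ * t₀) (c := k₁ + k₃ * t₀) fun x hx => by
        linear_combination (h x hx).1
      have ⟨_, h3, h4⟩ := qI (a := 0) (b := -k₄) (c := -k₂ * u₀ - k₃ - k₄ * t₀ * u₀)
        fun x hx => by linear_combination (h x hx).2
      have h5 : k₂ = 0 := by linear_combination h1 + t₀ * h3
      have h6 : k₃ = 0 := by linear_combination -h4 - u₀ * h5 + t₀ * u₀ * h3
      exact ⟨by linear_combination h2 - t₀ * h6, h5, h6, neg_eq_zero.1 h3⟩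

section
/-! ### Equivalence transformations -/

/-- `E'` is the image of `E` under the transformation with the given parameters. -/
structure GRel (E E' : Eqn) (a b p q r s m : ℝ) : Prop where
  ha : a ≠ 0
  hp : p ≠ 0
  hr : r ≠ 0
  hm : m ≠ 0
  hT : ∀ t, a * t + b ∈ E'.T ↔ t ∈ E.T
  hI : ∀ x, p * x + q ∈ E'.I ↔ x ∈ E.I
  hJ : ∀ u, r * u + s ∈ E'.J ↔ u ∈ E.J
  hf : ∀ x ∈ E.I, E'.f (p * x + q) = a * m / p ^ 2 * E.f x
  hD : ∀ u ∈ E.J, E'.D (r * u + s) = m * E.D u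
  hK : ∀ u ∈ E.J, E'.K (r * u + s) = m / p * E.K u

variable {E E' E'' : Eqn} {a b p q r s m a' b' p' q' r' s' m' : ℝ}

lemma exists_affine (ha : a ≠ 0) (b y : ℝ) : ∃ x, a * x + b = y :=
  ⟨(y - b) / a, by field_simp; ring⟩

lemma affine_inv (ha : a ≠ 0) (b x : ℝ) : a⁻¹ * (a * x + b) + -b / a = x := by field_simp; ring

lemma eq_image_affine_iff {S S' : Set ℝ} (ha : a ≠ 0) :
    S' = (fun t => a * t + b) '' S ↔ ∀ t, a * t + b ∈ S' ↔ t ∈ S := by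
  have hi : Function.Injective fun t => a * t + b := fun x y h => by simpa [ha] using h
  refine ⟨by rintro rfl t; exact hi.mem_set_image, fun h => Set.ext fun y => ?_⟩
  obtain ⟨x, rfl⟩ := exists_affine ha b y
  rw [h, ← hi.mem_set_image (s := S)]

lemma gEquiv_iff : GEquiv E E' ↔ ∃ a b p q r s m, GRel E E' a b p q r s m :=
  ⟨fun ⟨a, b, p, q, r, s, m, h1, h2, h3, h4, h5, h6, h7, h⟩ =>
    ⟨a, b, p, q, r, s, m, h1, h2, h3, h4, (eq_image_affine_iff h1).1 h5,
      (eq_image_affine_iff h2).1 h6, (eq_image_affine_iff h3).1 h7, h.1, h.2.1, h.2.2⟩,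
   fun ⟨a, b, p, q, r, s, m, h1, h2, h3, h4, h5, h6, h7, h8, h9, h⟩ =>
    ⟨a, b, p, q, r, s, m, h1, h2, h3, h4, (eq_image_affine_iff h1).2 h5,
      (eq_image_affine_iff h2).2 h6, (eq_image_affine_iff h3).2 h7, h8, h9, h⟩⟩

lemma GRel.gEquiv (h : GRel E E' a b p q r s m) : GEquiv E E' :=
  gEquiv_iff.2 ⟨_, _, _, _, _, _, _, h⟩

lemma GRel.exI (h : GRel E E' a b p q r s m) {y : ℝ} (hy : y ∈ E'.I) : ∃ x ∈ E.I, p * x + q = y := by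
  obtain ⟨x, rfl⟩ := exists_affine h.hp q y
  exact ⟨x, (h.hI x).1 hy, rfl⟩

lemma GRel.exJ (h : GRel E E' a b p q r s m) {y : ℝ} (hy : y ∈ E'.J) : ∃ x ∈ E.J, r * x + s = y := by
  obtain ⟨x, rfl⟩ := exists_affine h.hr s y
  exact ⟨x, (h.hJ x).1 hy, rfl⟩

lemma GRel.symm (h : GRel E E' a b p q r s m) :
    GRel E' E a⁻¹ (-b / a) p⁻¹ (-q / p) r⁻¹ (-s / r) m⁻¹ := by
  have key : ∀ {a b : ℝ} {S S' : Set ℝ}, a ≠ 0 → (∀ t, a * t + b ∈ S' ↔ t ∈ S) →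
      ∀ t, a⁻¹ * t + -b / a ∈ S ↔ t ∈ S' := fun {a b _ _} ha h t => by
    obtain ⟨x, rfl⟩ := exists_affine ha b t
    rw [affine_inv ha, h]
  obtain ⟨ha, hp, hr, hm, hT, hI, hJ, hf, hD, hK⟩ := id h
  refine ⟨inv_ne_zero ha, inv_ne_zero hp, inv_ne_zero hr, inv_ne_zero hm, key ha hT, key hp hI,
    key hr hJ, fun x hx => ?_, fun u hu => ?_, fun u hu => ?_⟩
  · obtain ⟨y, hy, rfl⟩ := h.exI hx
    rw [affine_inv hp, hf y hy]; field_simp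
  · obtain ⟨y, hy, rfl⟩ := h.exJ hu
    rw [affine_inv hr, hD y hy]; field_simp
  · obtain ⟨y, hy, rfl⟩ := h.exJ hu
    rw [affine_inv hr, hK y hy]; field_simp

lemma GRel.trans (h : GRel E E' a b p q r s m) (h' : GRel E' E'' a' b' p' q' r' s' m') :
    GRel E E'' (a' * a) (a' * b + b') (p' * p) (p' * q + q') (r' * r) (r' * s + s') (m' * m) := by
  have e : ∀ a b a' b' x : ℝ, a' * a * x + (a' * b + b') = a' * (a * x + b) + b' := by intros; ring
  have hp := h.hp
  have hp' := h'.hp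
  refine ⟨mul_ne_zero h'.ha h.ha, mul_ne_zero hp' hp, mul_ne_zero h'.hr h.hr, mul_ne_zero h'.hm h.hm,
    fun t => by rw [e, h'.hT, h.hT], fun t => by rw [e, h'.hI, h.hI], fun t => by rw [e, h'.hJ, h.hJ],
    fun x hx => ?_, fun u hu => ?_, fun u hu => ?_⟩
  · rw [e, h'.hf _ ((h.hI x).2 hx), h.hf x hx]; field_simp
  · rw [e, h'.hD _ ((h.hJ u).2 hu), h.hD u hu]; ring
  · rw [e, h'.hK _ ((h.hJ u).2 hu), h.hK u hu]; field_simp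

lemma GEquiv.refl (E : Eqn) : GEquiv E E :=
  GRel.gEquiv (a := 1) (b := 0) (p := 1) (q := 0) (r := 1) (s := 0) (m := 1)
    ⟨one_ne_zero, one_ne_zero, one_ne_zero, one_ne_zero, by simp, by simp, by simp, by simp, by simp,
      by simp⟩

lemma GEquiv.symm (h : GEquiv E E') : GEquiv E' E :=
  let ⟨_, _, _, _, _, _, _, h⟩ := gEquiv_iff.1 h
  h.symm.gEquiv

lemma GEquiv.trans (h : GEquiv E E') (h' : GEquiv E' E'') : GEquiv E E'' :=
  let ⟨_, _, _, _, _, _, _, h⟩ := gEquiv_iff.1 h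
  let ⟨_, _, _, _, _, _, _, h'⟩ := gEquiv_iff.1 h'
  (h.trans h').gEquiv

lemma Eqn.shiftK_zero (E : Eqn) : E.shiftK 0 = E := by simp [Eqn.shiftK]

lemma Eqn.shiftK_shiftK (E : Eqn) (κ κ' : ℝ) : (E.shiftK κ).shiftK κ' = E.shiftK (κ + κ') := by
  simp [Eqn.shiftK, add_assoc]

lemma GEquiv.equivalent (h : GEquiv E E') : Equivalent E E' := ⟨0, .inl rfl, by rwa [E.shiftK_zero]⟩

lemma GRel.equivalent (h : GRel E E' a b p q r s m) : Equivalent E E' := h.gEquiv.equivalent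

lemma GRel.shift (h : GRel E E' a b p q r s m) (κ : ℝ) :
    GRel (E.shiftK κ) (E'.shiftK (m / p * κ)) a b p q r s m :=
  { h with hK := fun u hu => by simp only [Eqn.shiftK]; rw [h.hK u hu]; ring }

lemma GEquiv.f_const (h : GEquiv E E') : (∃ c, ∀ x ∈ E.I, E.f x = c) → ∃ c, ∀ x ∈ E'.I, E'.f x = c := by
  obtain ⟨a, b, p, q, r, s, m, h⟩ := gEquiv_iff.1 h
  refine fun ⟨c, hc⟩ => ⟨a * m / p ^ 2 * c, fun x hx => ?_⟩
  obtain ⟨y, hy, rfl⟩ := h.exI hx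
  rw [h.hf y hy, hc y hy]

lemma Equivalent.trans (h : Equivalent E E') (h' : Equivalent E' E'') : Equivalent E E'' := by
  obtain ⟨κ, hκ, h⟩ := h
  obtain ⟨κ', hκ', h'⟩ := h'
  obtain ⟨a, b, p, q, r, s, m, g⟩ := gEquiv_iff.1 h
  refine ⟨κ + p / m * κ', ?_, ?_⟩
  · rcases hκ' with rfl | hc
    · simpa using hκ
    · exact .inr (h.symm.f_const hc)
  · have h1 := g.shift (p / m * κ')
    rw [Eqn.shiftK_shiftK, show m / p * (p / m * κ') = κ' by field_simp [g.hm, g.hp]] at h1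
    exact h1.gEquiv.trans h'

lemma Equivalent.symm (h : Equivalent E E') : Equivalent E' E := by
  obtain ⟨κ, hκ, h⟩ := h
  obtain ⟨a, b, p, q, r, s, m, g⟩ := gEquiv_iff.1 h
  have h1 := g.shift (-κ)
  rw [Eqn.shiftK_shiftK, add_neg_cancel, E.shiftK_zero] at h1
  exact ⟨m / p * -κ, hκ.imp (fun h => by simp [h]) h.f_const, h1.symm.gEquiv⟩

lemma equivalent_shiftK {κ c : ℝ} (hc : ∀ x ∈ E.I, E.f x = c) : Equivalent E (E.shiftK κ) :=
  ⟨κ, Or.inr ⟨c, hc⟩, GEquiv.refl _⟩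

lemma Eqn.Nonlinear.shiftK (hE : E.Nonlinear) (κ : ℝ) : (E.shiftK κ).Nonlinear where
  __ := hE
  smooth_K := hE.smooth_K.add contDiffOn_const
  nonlin := let ⟨u, hu, h⟩ := hE.nonlin
    ⟨u, hu, h.imp id fun h => by simpa [Eqn.shiftK] using h⟩

/-- The image of an equation under an equivalence transformation. -/
def Eqn.act (E : Eqn) (a b p q r s m : ℝ) : Eqn where
  T := {t | (t - b) / a ∈ E.T}
  I := {x | (x - q) / p ∈ E.I}
  J := {u | (u - s) / r ∈ E.J}
  f x := a * m / p ^ 2 * E.f ((x - q) / p)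
  D u := m * E.D ((u - s) / r)
  K u := m / p * E.K ((u - s) / r)

lemma Eqn.act_rel (E : Eqn) (ha : a ≠ 0) (hp : p ≠ 0) (hr : r ≠ 0) (hm : m ≠ 0) (b q s : ℝ) :
    GRel E (E.act a b p q r s m) a b p q r s m := by
  constructor <;> simp [Eqn.act, ha, hp, hr, hm]

lemma IsOpenInterval.of_affine {S S' : Set ℝ} (hS : IsOpenInterval S') (ha : a ≠ 0)
    (h : ∀ t, a * t + b ∈ S' ↔ t ∈ S) : IsOpenInterval S := by
  obtain rfl : (fun t => a * t + b) ⁻¹' S' = S := Set.ext h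
  refine ⟨hS.1.preimage (by fun_prop), convex_iff_ordConnected.1 ?_, ?_⟩
  · intro x hx y hy c d hc hd hcd
    have := convex_iff_ordConnected.2 hS.2.1 hx hy hc hd hcd
    simp only [Set.mem_preimage, smul_eq_mul] at this ⊢
    convert this using 1
    linear_combination -b * hcd
  · obtain ⟨y, hy⟩ := hS.2.2
    obtain ⟨x, rfl⟩ := exists_affine ha b y
    exact ⟨x, hy⟩

lemma deriv_affine {S : Set ℝ} (hS : IsOpen S) {g g' : ℝ → ℝ} (hr : r ≠ 0)
    (h : ∀ u ∈ S, g' (r * u + s) = m * g u) {u : ℝ} (hu : u ∈ S) :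
    deriv g' (r * u + s) = m / r * deriv g u := by
  have e := Filter.EventuallyEq.deriv_eq (Filter.mem_of_superset (hS.mem_nhds hu) h)
  rw [deriv_const_mul_field, deriv_comp_mul_left r (fun u => g' (u + s)), deriv_comp_add_const,
    smul_eq_mul] at e
  field_simp
  linear_combination e

lemma GRel.nonlinear (h : GRel E E' a b p q r s m) (hE : E'.Nonlinear) : E.Nonlinear := by
  have key : ∀ {r s m : ℝ} {g g' : ℝ → ℝ} {S S' : Set ℝ}, m ≠ 0 → (∀ t, r * t + s ∈ S' ↔ t ∈ S) →
      ContDiffOn ℝ ∞ g' S' → (∀ u ∈ S, g' (r * u + s) = m * g u) → ContDiffOn ℝ ∞ g S :=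
    fun {r s m g g' S S'} hm hS hg h => (contDiffOn_const (c := m⁻¹).mul (hg.comp (s := S)
      (f := fun u => r * u + s) (by fun_prop) fun u hu => (hS u).2 hu)).congr fun u hu => by
        simp [h u hu, hm]
  have hmp := div_ne_zero h.hm h.hp
  have hf := div_ne_zero (mul_ne_zero h.ha h.hm) (pow_ne_zero 2 h.hp)
  have hJ := hE.hJ.of_affine h.hr h.hJ
  refine ⟨hE.hT.of_affine h.ha h.hT, hE.hI.of_affine h.hp h.hI, hJ,
    key hf h.hI hE.smooth_f h.hf, key h.hm h.hJ hE.smooth_D h.hD, key hmp h.hJ hE.smooth_K h.hK,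
    fun x hx h0 => hE.f_ne _ ((h.hI x).2 hx) (by simp [h.hf x hx, h0]),
    fun u hu h0 => hE.D_ne _ ((h.hJ u).2 hu) (by simp [h.hD u hu, h0]), ?_⟩
  obtain ⟨v, hv, hn⟩ := hE.nonlin
  obtain ⟨u, hu, rfl⟩ := h.exJ hv
  rw [deriv_affine hJ.1 h.hr h.hD hu, deriv_affine hJ.1 h.hr h.hK hu] at hn
  exact ⟨u, hu, hn.imp right_ne_zero_of_mul right_ne_zero_of_mul⟩

section Derivs
variable (h : GRel E E' a b p q r s m) (hE : E.Nonlinear)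
include h hE

lemma GRel.deriv_D {u : ℝ} (hu : u ∈ E.J) : deriv E'.D (r * u + s) = m / r * deriv E.D u :=
  deriv_affine hE.hJ.1 h.hr h.hD hu

lemma GRel.deriv_K {u : ℝ} (hu : u ∈ E.J) : deriv E'.K (r * u + s) = m / p / r * deriv E.K u :=
  deriv_affine hE.hJ.1 h.hr h.hK hu

lemma GRel.φ_eq {x : ℝ} (hx : x ∈ E.I) : E'.φ (p * x + q) = E.φ x / p := by
  have ha := h.ha
  have hp := h.hp
  have hm := h.hm
  have hf := hE.f_ne x hx
  rw [Eqn.φ, deriv_affine hE.hI.1 hp h.hf hx, h.hf x hx, Eqn.φ]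
  field_simp

end Derivs

lemma hasDerivAt_affine {g : ℝ → ℝ} {g' x : ℝ} (h : HasDerivAt g g' (a * x + b)) :
    HasDerivAt (fun y => g (a * y + b)) (a * g') x :=
  (h.comp x (((hasDerivAt_id x).const_mul a).add_const b)).congr_deriv (by ring)

lemma Jet.comp_affine {T I T' I' : Set ℝ} {g gt gx gxx : ℝ → ℝ → ℝ} (j : Jet T' I' g gt gx gxx)
    (hT : ∀ t, a * t + b ∈ T' ↔ t ∈ T) (hI : ∀ x, p * x + q ∈ I' ↔ x ∈ I) :
    Jet T I (fun t x => g (a * t + b) (p * x + q)) (fun t x => a * gt (a * t + b) (p * x + q))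
      (fun t x => p * gx (a * t + b) (p * x + q))
      (fun t x => p * (p * gxx (a * t + b) (p * x + q))) where
  t t ht x hx := hasDerivAt_affine (g := fun t => g t (p * x + q)) (j.t _ ((hT t).2 ht) _ ((hI x).2 hx))
  x t ht x hx := hasDerivAt_affine (j.x _ ((hT t).2 ht) _ ((hI x).2 hx))
  xx t ht x hx := (hasDerivAt_affine (j.xx _ ((hT t).2 ht) _ ((hI x).2 hx))).const_mul p

/-- The pull-back of a solution of the determining equations. -/
def Sol.map (σ : Sol E') (hE : E.Nonlinear) (h : GRel E E' a b p q r s m) : Sol E where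
  toField := ⟨fun t => a⁻¹ * σ.τ (a * t + b), _, fun t x => p⁻¹ * σ.ξ (a * t + b) (p * x + q), _, _, _,
    fun t x => σ.α (a * t + b) (p * x + q), _, _, _,
    fun t x => r⁻¹ * σ.β (a * t + b) (p * x + q) + s / r * σ.α (a * t + b) (p * x + q), _, _, _,
    fun t ht => (hasDerivAt_affine (σ.jτ _ ((h.hT t).2 ht))).const_mul _,
    (σ.jξ.comp_affine h.hT h.hI).smul p⁻¹, σ.jα.comp_affine h.hT h.hI,
    ((σ.jβ.comp_affine h.hT h.hI).smul r⁻¹).add ((σ.jα.comp_affine h.hT h.hI).smul (s / r))⟩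
  eq1 t ht x hx u hu := by
    have e := σ.eq1 _ ((h.hT t).2 ht) _ ((h.hI x).2 hx) _ ((h.hJ u).2 hu)
    have := h.ha; have := h.hp; have := h.hr; have := h.hm
    rw [h.deriv_D hE hu, h.φ_eq hE hx, h.hD u hu] at e
    field_simp at e ⊢
    linear_combination e
  eq3 t ht x hx u hu := by
    have e := σ.eq3 _ ((h.hT t).2 ht) _ ((h.hI x).2 hx) _ ((h.hJ u).2 hu)
    have := h.ha; have := h.hp; have := h.hr; have := h.hm
    rw [h.deriv_D hE hu, h.deriv_K hE hu, h.φ_eq hE hx, h.hD u hu, h.hK u hu, h.hf x hx] at e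
    field_simp at e ⊢
    linear_combination e
  eq4 t ht x hx u hu := by
    have e := σ.eq4 _ ((h.hT t).2 ht) _ ((h.hI x).2 hx) _ ((h.hJ u).2 hu)
    have := h.ha; have := h.hp; have := h.hr; have := h.hm
    rw [h.hD u hu, h.hK u hu, h.hf x hx] at e
    field_simp at e ⊢
    linear_combination e

lemma GRel.mem_dom (h : GRel E E' a b p q r s m) (z : E.dom) :
    (a * z.1.1 + b, p * z.1.2.1 + q, r * z.1.2.2 + s) ∈ E'.dom :=
  ⟨(h.hT _).2 z.2.1, (h.hI _).2 z.2.2.1, (h.hJ _).2 z.2.2.2⟩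

/-- The pull-back of vector fields. -/
def GRel.pull (h : GRel E E' a b p q r s m) : (E'.dom → ℝ × ℝ × ℝ) →ₗ[ℝ] (E.dom → ℝ × ℝ × ℝ) :=
  ((a⁻¹ • LinearMap.id).prodMap ((p⁻¹ • LinearMap.id).prodMap (r⁻¹ • LinearMap.id))).compLeft _ ∘ₗ
    LinearMap.funLeft ℝ (ℝ × ℝ × ℝ) fun z => ⟨_, h.mem_dom z⟩

lemma GRel.pull_injective (h : GRel E E' a b p q r s m) : Function.Injective h.pull := by
  intro X Y hXY
  funext ⟨⟨t, x, u⟩, ht, hx, hu⟩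
  obtain ⟨t, rfl⟩ := exists_affine h.ha b t
  obtain ⟨x, rfl⟩ := exists_affine h.hp q x
  obtain ⟨u, rfl⟩ := exists_affine h.hr s u
  have e := congrFun hXY ⟨(t, x, u), (h.hT _).1 ht, (h.hI _).1 hx, (h.hJ _).1 hu⟩
  simpa [GRel.pull, h.ha, h.hp, h.hr, Prod.ext_iff, LinearMap.funLeft] using e

lemma GRel.pull_mem (h : GRel E E' a b p q r s m) (hE : E.Nonlinear) (hE' : E'.Nonlinear)
    {X : E'.dom → ℝ × ℝ × ℝ} (hX : X ∈ E'.maxAlg) : h.pull X ∈ E.maxAlg := by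
  obtain ⟨σ, hσ, rfl⟩ := (mem_maxAlg_iff hE').1 hX
  have e : (σ.map hE h).Q = fun z => (a⁻¹ * (σ.Q (a * z.1 + b, p * z.2.1 + q, r * z.2.2 + s)).1,
      p⁻¹ * (σ.Q (a * z.1 + b, p * z.2.1 + q, r * z.2.2 + s)).2.1,
      r⁻¹ * (σ.Q (a * z.1 + b, p * z.2.1 + q, r * z.2.2 + s)).2.2) := funext fun z => by
    have hr := h.hr
    refine Prod.ext rfl (Prod.ext rfl ?_)
    simp only [Field.Q, op, Sol.map]
    field_simp
    ring
  refine (mem_maxAlg_iff hE).2 ⟨σ.map hE h, ?_, by rw [e]; rfl⟩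
  have hc : ContDiffOn ℝ ∞ (fun z : ℝ × ℝ × ℝ => σ.Q (a * z.1 + b, p * z.2.1 + q, r * z.2.2 + s))
    E.dom := hσ.comp (by fun_prop) fun z hz => h.mem_dom ⟨z, hz⟩
  rw [e]
  exact (contDiffOn_const.mul hc.fst).prodMk ((contDiffOn_const.mul hc.snd.fst).prodMk
    (contDiffOn_const.mul hc.snd.snd))

lemma GRel.rank_le (h : GRel E E' a b p q r s m) (hE : E.Nonlinear) (hE' : E'.Nonlinear) :
    Module.rank ℝ (E'.alg hE') ≤ Module.rank ℝ (E.alg hE) :=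
  LinearMap.rank_le_of_injective (h.pull.restrict (p := E'.alg hE') (q := E.alg hE)
    fun _ hX => h.pull_mem hE hE' hX) fun _ _ hXY =>
      Subtype.ext (h.pull_injective (congrArg Subtype.val hXY))

lemma GEquiv.rank_eq (h : GEquiv E E') (hE : E.Nonlinear) (hE' : E'.Nonlinear) :
    Module.rank ℝ (E.alg hE) = Module.rank ℝ (E'.alg hE') := by
  obtain ⟨a, b, p, q, r, s, m, h⟩ := gEquiv_iff.1 h
  exact le_antisymm (h.symm.rank_le hE' hE) (h.rank_le hE hE')
end

/-! ### Symmetries with affine coefficients -/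

/-- The function is constant on the set. -/
def ConstOn (g : ℝ → ℝ) (S : Set ℝ) : Prop := ∃ c, ∀ x ∈ S, g x = c

/-- `K` is a linear combination of `D` and `1`. -/
def Eqn.KinSpan (E : Eqn) : Prop := ∃ p q, ∀ u ∈ E.J, E.K u = p * E.D u + q

/-- The vector field is affine up to the `t`-dependence:
`τ(t) ∂_t + (a₁ x + σ(t)) ∂_x + (α u + β) ∂_u`. -/
structure AffData (E : Eqn) (Q : VField) (α β a₁ κ ρ : ℝ)
    (τ τ' : ℝ → ℝ) (ξ ξt : ℝ → ℝ → ℝ) : Prop where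
  jτ : ∀ t ∈ E.T, HasDerivAt τ (τ' t) t
  jt : ∀ t ∈ E.T, ∀ x ∈ E.I, HasDerivAt (fun s => ξ s x) (ξt t x) t
  jx : ∀ t ∈ E.T, ∀ x ∈ E.I, HasDerivAt (ξ t) a₁ x
  hQ : ∀ t ∈ E.T, ∀ x ∈ E.I, ∀ u ∈ E.J, Q (t, x, u) = (τ t, ξ t x, α * u + β)
  hξt : ∀ t ∈ E.T, ∀ x ∈ E.I, E.f x * ξt t x = κ
  hρ : ∀ t ∈ E.T, ∀ x ∈ E.I, ξ t x * E.φ x - τ' t + 2 * a₁ = ρ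
  hD : ∀ u ∈ E.J, (α * u + β) * deriv E.D u = ρ * E.D u
  hK : ∀ u ∈ E.J, (α * u + β) * deriv E.K u = (ρ - a₁) * E.K u - κ

/-- All symmetries are affine up to the `t`-dependence. -/
def Eqn.AllAff (E : Eqn) : Prop := ∀ s : Sol E, ∃ α β a₁ κ ρ τ τ' ξ ξt,
  AffData E s.Q α β a₁ κ ρ τ τ' ξ ξt

lemma const_indep {J : Set ℝ} {K : ℝ → ℝ} (hK : ¬ ConstOn K J) {A C : ℝ}
    (h : ∀ u ∈ J, A * K u + C = 0) : A = 0 ∧ C = 0 := by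
  obtain rfl : A = 0 := by
    by_contra hA
    exact hK ⟨-C / A, fun u hu => by field_simp; linear_combination h u hu⟩
  refine ⟨rfl, ?_⟩
  by_contra hC
  exact hK ⟨0, fun u hu => absurd (by linear_combination h u hu) hC⟩

lemma span_indep {J : Set ℝ} {D K : ℝ → ℝ} (hD : ¬ ConstOn D J)
    (hK : ¬ ∃ p q, ∀ u ∈ J, K u = p * D u + q) {A B C : ℝ}
    (h : ∀ u ∈ J, A * K u + B * D u + C = 0) : A = 0 ∧ B = 0 ∧ C = 0 := by
  obtain rfl : A = 0 := by
    by_contra hA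
    exact hK ⟨-B / A, -C / A, fun u hu => by field_simp; linear_combination h u hu⟩
  exact ⟨rfl, const_indep hD fun u hu => by linear_combination h u hu⟩

/-- A function of two variables whose derivatives vanish. -/
lemma Jet.const {T I : Set ℝ} (hT : IsOpenInterval T) (hI : IsOpenInterval I)
    {g gt gx gxx : ℝ → ℝ → ℝ} (j : Jet T I g gt gx gxx)
    (ht : ∀ t ∈ T, ∀ x ∈ I, gt t x = 0) (hx : ∀ t ∈ T, ∀ x ∈ I, gx t x = 0) :
    ∃ k, ∀ t ∈ T, ∀ x ∈ I, g t x = k := by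
  obtain ⟨t0, ht0⟩ := hT.2.2
  obtain ⟨x0, hx0⟩ := hI.2.2
  refine ⟨g t0 x0, fun t h1 x h2 => ?_⟩
  rw [eq_of_deriv_eq_zero hI (j.x t h1) (hx t h1) h2 hx0]
  exact eq_of_deriv_eq_zero hT (g := fun s => g s x0) (fun s hs => j.t s hs x0 hx0)
    (fun s hs => ht s hs x0 hx0) h1 ht0

lemma WSol.lx_eq_zero {a b c : ℝ} (hE : E.Nonlinear) (s : WSol E a b c)
    (h : ∀ t ∈ E.T, ∀ x ∈ E.I, s.l t x = 0) :
    ∀ t ∈ E.T, ∀ x ∈ E.I, s.lt t x = 0 ∧ s.lx t x = 0 ∧ s.lxx t x = 0 := fun _ ht _ hx =>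
  s.jl.unique hE.hT.1 hE.hI.1 (jet_const 0) h ht hx

/-- Either the weight `a u + b` has no zeros or `l` vanishes. -/
def WSol.Ok {a b c : ℝ} (s : WSol E a b c) : Prop :=
  E.DEq a b c ∧ (∀ u ∈ E.J, a * u + b ≠ 0) ∨ ∀ t ∈ E.T, ∀ x ∈ E.I, s.l t x = 0

lemma WSol.Ok.eq4 {a b c : ℝ} {s : WSol E a b c} (hE : E.Nonlinear) (h : s.Ok) :
    ∀ t ∈ E.T, ∀ x ∈ E.I, ∀ u ∈ E.J,
      E.f x * s.lt t x - E.D u * s.lxx t x - E.K u * s.lx t x = 0 := fun t ht x hx u hu => by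
  rcases h with ⟨-, h⟩ | h
  · exact zero_of_mul (h u hu) (s.eq4 t ht x hx u hu)
  · obtain ⟨h1, h2, h3⟩ := s.lx_eq_zero hE h t ht x hx
    rw [h1, h2, h3]; ring

lemma WSol.affData {a b c k : ℝ} (hE : E.Nonlinear) (s : WSol E a b c) (hs : s.Ok)
    (hl : ∀ t ∈ E.T, ∀ x ∈ E.I, s.l t x = k) {a₁ κ : ℝ}
    (hx : ∀ t ∈ E.T, ∀ x ∈ E.I, s.ξx t x = a₁) (hκ : ∀ t ∈ E.T, ∀ x ∈ E.I, E.f x * s.ξt t x = κ) :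
    AffData E s.Q (a * k) (b * k) a₁ κ (c * k) s.τ s.τ' s.ξ s.ξt := by
  obtain ⟨t0, ht0⟩ := hE.hT.2.2
  obtain ⟨x0, hx0⟩ := hE.hI.2.2
  have hlx := (s.jl.x t0 ht0 x0 hx0).eq_zero_of_const hE.hI.1 hx0 (hl t0 ht0)
  have hxx := (s.jξ.xx t0 ht0 x0 hx0).eq_zero_of_const hE.hI.1 hx0 (hx t0 ht0)
  refine ⟨s.jτ, s.jξ.t, fun t ht x hx' => hx t ht x hx' ▸ s.jξ.x t ht x hx', ?_, hκ, ?_, ?_, ?_⟩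
  · intro t ht x hx u hu
    refine Prod.ext rfl (Prod.ext rfl ?_)
    simp only [WSol.Q, op, hl t ht x hx]; ring
  · intro t ht x hx'
    have := s.eq1 t ht x hx'
    rwa [hl t ht x hx', hx t ht x hx', eq_comm] at this
  · intro u hu
    rcases hs with ⟨h, -⟩ | h
    · linear_combination k * h u hu
    · rw [← hl t0 ht0 x0 hx0, h t0 ht0 x0 hx0]; ring
  · intro u hu
    have := s.eq3 t0 ht0 x0 hx0 u hu
    rw [hl t0 ht0 x0 hx0, hx t0 ht0 x0 hx0, hκ t0 ht0 x0 hx0, hxx, hlx] at this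
    linear_combination this

lemma AffData.congr {Q Q' : VField} {α β a₁ κ ρ : ℝ} {τ τ' : ℝ → ℝ}
    {ξ ξt : ℝ → ℝ → ℝ} (h : AffData E Q α β a₁ κ ρ τ τ' ξ ξt) (e : EqOn Q' Q E.dom) :
    AffData E Q' α β a₁ κ ρ τ τ' ξ ξt :=
  { h with hQ := fun t ht x hx u hu => by rw [e ⟨ht, hx, hu⟩]; exact h.hQ t ht x hx u hu }

/-- Independence of `K, D, 1` forces affine symmetries. -/
lemma WSol.exists_affData {a b c : ℝ} (hE : E.Nonlinear) (hD : ¬ ConstOn E.D E.J)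
    (hK : ¬ E.KinSpan) (s : WSol E a b c) (hs : s.Ok) : ∃ α β a₁ κ ρ τ τ' ξ ξt,
      AffData E s.Q α β a₁ κ ρ τ τ' ξ ξt := by
  obtain ⟨t0, ht0⟩ := hE.hT.2.2
  obtain ⟨x0, hx0⟩ := hE.hI.2.2
  have e4 := hs.eq4 hE
  have h0 : ∀ t ∈ E.T, ∀ x ∈ E.I, s.lt t x = 0 ∧ s.lx t x = 0 := fun t ht x hx => by
    obtain ⟨h1, -, h3⟩ := span_indep hD hK (A := s.lx t x) (B := s.lxx t x)
      (C := -(E.f x * s.lt t x)) fun u hu => by linear_combination -e4 t ht x hx u hu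
    exact ⟨zero_of_mul (hE.f_ne x hx) (neg_eq_zero.1 h3), h1⟩
  obtain ⟨k, hk⟩ := s.jl.const hE.hT hE.hI (fun t ht x hx => (h0 t ht x hx).1)
    (fun t ht x hx => (h0 t ht x hx).2)
  have key : ∀ t ∈ E.T, ∀ x ∈ E.I, s.ξx t x = s.ξx t0 x0 ∧
      E.f x * s.ξt t x = E.f x0 * s.ξt t0 x0 := fun t ht x hx => by
    obtain ⟨h1, -, h3⟩ := span_indep hD hK (A := s.ξx t x - s.ξx t0 x0)
      (B := s.ξxx t0 x0 - s.ξxx t x) (C := E.f x * s.ξt t x - E.f x0 * s.ξt t0 x0) fun u hu => by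
        have h1 := s.eq3 t ht x hx u hu
        have h2 := s.eq3 t0 ht0 x0 hx0 u hu
        rw [hk t ht x hx, (h0 t ht x hx).2] at h1
        rw [hk t0 ht0 x0 hx0, (h0 t0 ht0 x0 hx0).2] at h2
        linear_combination h1 - h2
    exact ⟨sub_eq_zero.1 h1, sub_eq_zero.1 h3⟩
  exact ⟨_, _, _, _, _, _, _, _, _, s.affData hE hs hk (fun t ht x hx => (key t ht x hx).1)
    (fun t ht x hx => (key t ht x hx).2)⟩

lemma eq_zero_of_injOn_mul {S : Set ℝ} (hS : IsOpen S) {Y G : ℝ → ℝ} (hY : InjOn Y S) {δ : ℝ}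
    (hG : ContinuousOn G S) (h : ∀ x ∈ S, (Y x + δ) * G x = 0) : ∀ x ∈ S, G x = 0 := fun x hx => by
  by_cases h0 : Y x + δ = 0
  · have hev : ∀ᶠ v in nhdsWithin x {x}ᶜ, G v = 0 := by
      filter_upwards [nhdsWithin_le_nhds (hS.mem_nhds hx), self_mem_nhdsWithin] with v hv hv'
      exact zero_of_mul (fun h1 => hv' (hY hv hx (by linarith))) (h v hv)
    exact tendsto_nhds_unique (((hG.continuousAt (hS.mem_nhds hx)).tendsto.mono_left
      nhdsWithin_le_nhds).congr' hev) tendsto_const_nhds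
  · exact zero_of_mul h0 (h x hx)

lemma eq_zero_of_lin_mul {S : Set ℝ} (hS : IsOpen S) {G : ℝ → ℝ} {a b : ℝ} (hab : a ≠ 0 ∨ b ≠ 0)
    (hG : ContinuousOn G S) (h : ∀ x ∈ S, (a * x + b) * G x = 0) : ∀ x ∈ S, G x = 0 := by
  by_cases ha : a = 0
  · subst ha
    exact fun x hx => zero_of_mul (hab.resolve_left (by simp)) (by simpa using h x hx)
  · exact eq_zero_of_injOn_mul hS (Y := fun x => a * x) (fun x _ y _ => mul_left_cancel₀ ha) hG h

lemma Eqn.Nonlinear.continuousOn_dD (hE : E.Nonlinear) : ContinuousOn (deriv E.D) E.J :=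
  fun _ hu => (hE.hasDerivAt_dD hu).continuousAt.continuousWithinAt

lemma Eqn.Nonlinear.constOn_D_of_deriv (hE : E.Nonlinear) (h : ∀ u ∈ E.J, deriv E.D u = 0) :
    ConstOn E.D E.J :=
  let ⟨_, h0⟩ := hE.hJ.2.2
  ⟨_, fun _ hx => eq_of_deriv_eq_zero hE.hJ (fun _ hv => hE.hasDerivAt_D hv) h hx h0⟩

/-- For nonconstant `D`, either some equation `(a u + b) D' = c D` with `c ≠ 0` holds,
or `D` is rigid. -/
lemma Eqn.Nonlinear.exists_DEq_or_rigid (hE : E.Nonlinear) (hD : ¬ ConstOn E.D E.J) :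
    (∃ a b c, c ≠ 0 ∧ E.DEq a b c) ∨ E.Rigid := by
  refine or_iff_not_imp_right.2 fun h => ?_
  simp only [Eqn.Rigid, not_forall] at h
  obtain ⟨a, b, c, h, hab⟩ := h
  refine ⟨a, b, c, ?_, h⟩
  rintro rfl
  exact hD (hE.constOn_D_of_deriv (eq_zero_of_lin_mul hE.hJ.1 (not_and_or.1 hab) hE.continuousOn_dD
    fun v hv => by rw [h v hv, zero_mul]))

lemma Eqn.DEq.ne_zero {a b c : ℝ} (hE : E.Nonlinear) (hc : c ≠ 0) (h : E.DEq a b c) :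
    ∀ u ∈ E.J, a * u + b ≠ 0 := fun u hu h0 => by
  have := h u hu
  rw [h0, zero_mul] at this
  exact mul_ne_zero hc (hE.D_ne u hu) this.symm

/-- Every symmetry comes from a `WSol` if `D` is not constant. -/
lemma exists_ok (hE : E.Nonlinear) (hD : ¬ ConstOn E.D E.J) (s : Sol E) :
    ∃ (a b c : ℝ) (r : WSol E a b c), c ≠ 0 ∧ r.Ok ∧ EqOn s.Q r.Q E.dom := by
  rcases hE.exists_DEq_or_rigid hD with ⟨a, b, c, hc, h⟩ | h
  · obtain ⟨r, hr⟩ := exists_wSol hE hc h s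
    exact ⟨a, b, c, r, hc, Or.inl ⟨h, h.ne_zero hE hc⟩, hr⟩
  · obtain ⟨r, hr, e⟩ := exists_wSol_of_rigid hE h s
    exact ⟨0, 0, 1, r, one_ne_zero, Or.inr fun t _ x _ => hr t x, e⟩

lemma allAff_of_not_kinSpan (hE : E.Nonlinear) (hD : ¬ ConstOn E.D E.J) (hK : ¬ E.KinSpan) :
    E.AllAff := fun s => by
  obtain ⟨a, b, c, r, -, hr, e⟩ := exists_ok hE hD s
  obtain ⟨α, β, a₁, κ, ρ, τ, τ', ξ, ξt, h⟩ := r.exists_affData hE hD hK hr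
  exact ⟨α, β, a₁, κ, ρ, τ, τ', ξ, ξt, h.congr e⟩

/-! #### Constant `D` -/

/-- A function `K` with `(u + n) K = A u + B` on an interval. -/
lemma mobius_deriv {J : Set ℝ} (hJ : IsOpen J) {K K' : ℝ → ℝ} (hK : ∀ u ∈ J, HasDerivAt K (K' u) u)
    {n A m : ℝ} (h : ∀ u ∈ J, (u + n) * K u = A * (u + n) + m) :
    ∀ u ∈ J, (u + n) ^ 2 * K' u = -m := fun u hu => by
  have h1 : HasDerivAt (fun v => (v + n) * K v) (1 * K u + (u + n) * K' u) u :=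
    ((hasDerivAt_id u).add_const n).mul (hK u hu)
  have h3 := h1.unique (((((hasDerivAt_id u).add_const n).const_mul A).add_const m).congr_on hJ hu h)
  linear_combination (u + n) * h3 - h u hu

lemma exists_mobius (hE : E.Nonlinear) (hK : ¬ ∃ p q, ∀ u ∈ E.J, E.K u = p * u + q) {k n A B : ℝ}
    (h0 : k ≠ 0 ∨ n ≠ 0) (h : ∀ u ∈ E.J, (k * u + n) * E.K u = A * u + B) :
    k ≠ 0 ∧ ∃ C m, m ≠ 0 ∧ ∀ u ∈ E.J, (u + n / k) * E.K u = C * (u + n / k) + m := by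
  have hk : k ≠ 0 := by
    rintro rfl
    have hn := h0.resolve_left (by simp)
    exact hK ⟨A / n, B / n, fun u hu => by field_simp; linear_combination h u hu⟩
  refine ⟨hk, A / k, (B - A * (n / k)) / k, fun hm => ?_, fun u hu => ?_⟩
  · field_simp at hm
    refine hK ⟨0, A / k, fun u hu => ?_⟩
    have := eq_zero_of_lin_mul hE.hJ.1 h0 (G := fun u => k * E.K u - A)
      ((hE.smooth_K.continuousOn.const_mul k).sub continuousOn_const) (fun u hu => by
        linear_combination k * h u hu + hm) u hu
    field_simp; linarith
  · field_simp
    linear_combination k * h u hu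

lemma allAff_of_const (hE : E.Nonlinear) {d : ℝ} (hD : ∀ u ∈ E.J, E.D u = d)
    (hK : ¬ ∃ p q, ∀ u ∈ E.J, E.K u = p * u + q) : E.AllAff := fun s => by
  obtain ⟨t0, ht0⟩ := hE.hT.2.2
  obtain ⟨x0, hx0⟩ := hE.hI.2.2
  obtain ⟨u0, hu0⟩ := hE.hJ.2.2
  have hD' : ∀ u ∈ E.J, deriv E.D u = 0 := fun u hu => deriv_const_of_eqOn hE.hJ.1 hD hu
  have hd : d ≠ 0 := hD u0 hu0 ▸ hE.D_ne u0 hu0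
  have hKc : ¬ ConstOn E.K E.J := fun ⟨c, hc⟩ => hK ⟨0, c, fun u hu => by rw [hc u hu]; ring⟩
  have e1 : ∀ t ∈ E.T, ∀ x ∈ E.I, s.ξ t x * E.φ x - s.τ' t + 2 * s.ξx t x = 0 := fun t ht x hx => by
    have := s.eq1 t ht x hx u0 hu0
    rw [hD' u0 hu0, hD u0 hu0, mul_zero] at this
    exact (mul_eq_zero.1 this.symm).resolve_right hd
  have e3 : ∀ t ∈ E.T, ∀ x ∈ E.I, ∀ u ∈ E.J, (s.α t x * u + s.β t x) * deriv E.K u =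
      -s.ξx t x * E.K u - (E.f x * s.ξt t x + d * (2 * s.αx t x - s.ξxx t x)) :=
    fun t ht x hx u hu => by
      have := s.eq3 t ht x hx u hu
      rw [hD' u hu, hD u hu] at this
      linear_combination this + E.K u * e1 t ht x hx
  have e4 : ∀ t ∈ E.T, ∀ x ∈ E.I, ∀ u ∈ E.J, E.f x * (s.αt t x * u + s.βt t x) =
      d * (s.αxx t x * u + s.βxx t x) + E.K u * (s.αx t x * u + s.βx t x) :=
    fun t ht x hx u hu => hD u hu ▸ s.eq4 t ht x hx u hu
  have h0 : ∀ t ∈ E.T, ∀ x ∈ E.I, s.αx t x = 0 ∧ s.βx t x = 0 := by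
    intro t ht x hx
    by_contra hαβ
    obtain ⟨hα, A, m, hm, hmob⟩ := exists_mobius hE hK (A := E.f x * s.αt t x - d * s.αxx t x)
      (B := E.f x * s.βt t x - d * s.βxx t x) (not_and_or.1 hαβ) fun u hu => by
        linear_combination -e4 t ht x hx u hu
    obtain ⟨n, hn⟩ : ∃ n, n = s.βx t x / s.αx t x := ⟨_, rfl⟩
    rw [← hn] at hmob
    have injn : InjOn (fun u : ℝ => u + n) E.J := fun u _ v _ h => by simpa using h
    have hβα : ∀ t' ∈ E.T, ∀ x' ∈ E.I, s.β t' x' = n * s.α t' x' := fun t' ht' x' hx' => by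
      obtain ⟨-, -, h3⟩ := quad_eq_zero hE.hJ injn
        (a := s.ξx t' x' * A + (E.f x' * s.ξt t' x' + d * (2 * s.αx t' x' - s.ξxx t' x')))
        (b := s.ξx t' x' * m - m * s.α t' x') (c := -m * (s.β t' x' - n * s.α t' x')) fun u hu => by
          linear_combination (u + n) ^ 2 * e3 t' ht' x' hx' u hu - (s.α t' x' * u + s.β t' x') *
            mobius_deriv hE.hJ.1 (fun u hu => hE.hasDerivAt_K hu) hmob u hu
            - s.ξx t' x' * (u + n) * hmob u hu
      exact sub_eq_zero.1 (zero_of_mul (neg_ne_zero.2 hm) h3)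
    obtain ⟨h1, h2, h3⟩ := s.jβ.unique hE.hT.1 hE.hI.1 (s.jα.smul n) hβα ht hx
    obtain ⟨-, h5⟩ := lin_eq_zero hE.hJ injn (b := E.f x * s.αt t x - d * s.αxx t x - s.αx t x * A)
      (c := -(s.αx t x * m)) fun u hu => by
        have := e4 t ht x hx u hu
        rw [h1, h2, h3] at this
        linear_combination this + s.αx t x * hmob u hu
    exact mul_ne_zero hα hm (neg_eq_zero.1 h5)
  have ht' : ∀ t ∈ E.T, ∀ x ∈ E.I, s.αt t x = 0 ∧ s.βt t x = 0 := fun t ht x hx =>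
    lin_eq_zero hE.hJ (Y := fun u => u) (injOn_id _) fun u hu => by
      have := e4 t ht x hx u hu
      rw [(h0 t ht x hx).1, (h0 t ht x hx).2,
        (s.jα.xx t ht x hx).eq_zero_of_const hE.hI.1 hx fun y hy => (h0 t ht y hy).1,
        (s.jβ.xx t ht x hx).eq_zero_of_const hE.hI.1 hx fun y hy => (h0 t ht y hy).2] at this
      exact zero_of_mul (hE.f_ne x hx) (by linear_combination this)
  obtain ⟨α, hα⟩ := s.jα.const hE.hT hE.hI (fun t ht x hx => (ht' t ht x hx).1)
    (fun t ht x hx => (h0 t ht x hx).1)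
  obtain ⟨β, hβ⟩ := s.jβ.const hE.hT hE.hI (fun t ht x hx => (ht' t ht x hx).2)
    (fun t ht x hx => (h0 t ht x hx).2)
  have e5 : ∀ t ∈ E.T, ∀ x ∈ E.I, ∀ u ∈ E.J, (α * u + β) * deriv E.K u =
      -s.ξx t x * E.K u - (E.f x * s.ξt t x - d * s.ξxx t x) := fun t ht x hx u hu => by
    have := e3 t ht x hx u hu
    rw [hα t ht x hx, hβ t ht x hx, (h0 t ht x hx).1] at this
    linear_combination this
  have key : ∀ t ∈ E.T, ∀ x ∈ E.I, s.ξx t x = s.ξx t0 x0 ∧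
      E.f x * s.ξt t x - d * s.ξxx t x = E.f x0 * s.ξt t0 x0 - d * s.ξxx t0 x0 := fun t ht x hx => by
    obtain ⟨h1, h3⟩ := const_indep hKc (A := s.ξx t x - s.ξx t0 x0)
      (C := E.f x * s.ξt t x - d * s.ξxx t x - (E.f x0 * s.ξt t0 x0 - d * s.ξxx t0 x0))
      fun u hu => by linear_combination e5 t ht x hx u hu - e5 t0 ht0 x0 hx0 u hu
    exact ⟨sub_eq_zero.1 h1, sub_eq_zero.1 h3⟩
  have hξxx : ∀ t ∈ E.T, ∀ x ∈ E.I, s.ξxx t x = 0 := fun t ht x hx =>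
    (s.jξ.xx t ht x hx).eq_zero_of_const hE.hI.1 hx fun y hy => (key t ht y hy).1
  refine ⟨α, β, s.ξx t0 x0, E.f x0 * s.ξt t0 x0, 0, s.τ, s.τ', s.ξ, s.ξt, s.jτ, s.jξ.t,
    fun t ht x hx => (key t ht x hx).1 ▸ s.jξ.x t ht x hx, fun t ht x hx u hu => ?_,
    fun t ht x hx => ?_, fun t ht x hx => (key t ht x hx).1 ▸ e1 t ht x hx,
    fun u hu => by rw [hD' u hu]; ring, fun u hu => ?_⟩
  · simp only [Field.Q, op, hα t ht x hx, hβ t ht x hx]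
  · have := (key t ht x hx).2
    rw [hξxx t ht x hx, hξxx t0 ht0 x0 hx0] at this
    linear_combination this
  · have := e5 t0 ht0 x0 hx0 u hu
    rw [hξxx t0 ht0 x0 hx0] at this
    linear_combination this

/-! #### Consequences for constant and nonconstant `f` -/

section AffData
variable {Q : VField} {α β a₁ κ ρ : ℝ} {τ τ' : ℝ → ℝ} {ξ ξt : ℝ → ℝ → ℝ}

lemma AffData.f_const (h : AffData E Q α β a₁ κ ρ τ τ' ξ ξt) (hE : E.Nonlinear) {c₀ : ℝ}
    (hf : ∀ x ∈ E.I, E.f x = c₀) : ∃ τ₀ σ₀, ∀ t ∈ E.T, ∀ x ∈ E.I, ∀ u ∈ E.J,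
      Q (t, x, u) = ((2 * a₁ - ρ) * t + τ₀, a₁ * x + κ / c₀ * t + σ₀, α * u + β) := by
  obtain ⟨t0, ht0⟩ := hE.hT.2.2
  obtain ⟨x0, hx0⟩ := hE.hI.2.2
  have hc : c₀ ≠ 0 := hf x0 hx0 ▸ hE.f_ne x0 hx0
  have hτ' : ∀ t ∈ E.T, τ' t = 2 * a₁ - ρ := fun t ht => by
    have := h.hρ t ht x0 hx0
    rw [hE.φ_const hf _ hx0] at this
    linarith
  obtain ⟨τ₀, hτ⟩ := eqOn_affine_of_hasDerivAt hE.hT (fun t ht => hτ' t ht ▸ h.jτ t ht)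
  obtain ⟨σ₀, hσ⟩ := eqOn_affine_of_hasDerivAt hE.hT (g := fun t => ξ t x0) (k := κ / c₀)
    (fun t ht => (h.jt t ht x0 hx0).congr_deriv (by
      have := h.hξt t ht x0 hx0
      rw [hf x0 hx0] at this
      field_simp; linarith))
  refine ⟨τ₀, σ₀ - a₁ * x0, fun t ht x hx u hu => ?_⟩
  rw [h.hQ t ht x hx u hu, hτ t ht]
  obtain ⟨c, hc⟩ := eqOn_affine_of_hasDerivAt hE.hI (h.jx t ht)
  refine Prod.ext rfl (Prod.ext ?_ rfl)
  change ξ t x = a₁ * x + κ / c₀ * t + (σ₀ - a₁ * x0)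
  linear_combination hc x hx - hc x0 hx0 + hσ t ht

lemma AffData.f_nonconst (h : AffData E Q α β a₁ κ ρ τ τ' ξ ξt) (hE : E.Nonlinear)
    (hf : ¬ ConstOn E.f E.I) : κ = 0 ∧ ∃ τ₁ τ₀ σ₀, (∀ t ∈ E.T, ∀ x ∈ E.I, ∀ u ∈ E.J,
      Q (t, x, u) = (τ₁ * t + τ₀, a₁ * x + σ₀, α * u + β)) ∧
      ∀ x ∈ E.I, (a₁ * x + σ₀) * E.φ x = τ₁ + ρ - 2 * a₁ := by
  obtain ⟨t0, ht0⟩ := hE.hT.2.2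
  obtain ⟨x0, hx0⟩ := hE.hI.2.2
  have hdiff : ∀ x ∈ E.I, ∀ t ∈ E.T, ξ t x = ξ t x0 + a₁ * (x - x0) := fun x hx t ht => by
    obtain ⟨c, hc⟩ := eqOn_affine_of_hasDerivAt hE.hI (h.jx t ht)
    rw [hc x hx, hc x0 hx0]; ring
  have hκ : κ = 0 := by
    by_contra hκ
    refine hf ⟨E.f x0, fun x hx => ?_⟩
    have h1 : ξt t0 x = ξt t0 x0 := (h.jt t0 ht0 x hx).unique
      (((h.jt t0 ht0 x0 hx0).add_const (a₁ * (x - x0))).congr_on hE.hT.1 ht0 (hdiff x hx))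
    have h2 := h.hξt t0 ht0 x hx
    have h3 := h.hξt t0 ht0 x0 hx0
    have hne : ξt t0 x0 ≠ 0 := fun h0 => hκ (by rw [← h3, h0, mul_zero])
    rw [h1] at h2
    exact mul_right_cancel₀ hne (h2.trans h3.symm)
  subst hκ
  have hξt : ∀ t ∈ E.T, ∀ x ∈ E.I, ξt t x = 0 := fun t ht x hx =>
    zero_of_mul (hE.f_ne x hx) (h.hξt t ht x hx)
  have hξ : ∀ t ∈ E.T, ∀ x ∈ E.I, ξ t x = a₁ * x + (ξ t0 x0 - a₁ * x0) := fun t ht x hx => by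
    have : ξ t x0 = ξ t0 x0 := eq_of_deriv_eq_zero hE.hT (g := fun t => ξ t x0)
      (fun t ht => h.jt t ht x0 hx0) (fun t ht => hξt t ht x0 hx0) ht ht0
    rw [hdiff x hx t ht, this]; ring
  have hτ' : ∀ t ∈ E.T, τ' t = τ' t0 := fun t ht => by
    have h1 := h.hρ t ht x0 hx0
    have h2 := h.hρ t0 ht0 x0 hx0
    rw [hξ t ht x0 hx0] at h1
    rw [hξ t0 ht0 x0 hx0] at h2
    linarith
  obtain ⟨τ₀, hτ⟩ := eqOn_affine_of_hasDerivAt hE.hT (fun t ht => hτ' t ht ▸ h.jτ t ht)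
  refine ⟨rfl, τ' t0, τ₀, ξ t0 x0 - a₁ * x0, fun t ht x hx u hu => ?_, fun x hx => ?_⟩
  · rw [h.hQ t ht x hx u hu, hτ t ht, hξ t ht x hx]
  · have := h.hρ t0 ht0 x hx
    rw [hξ t0 ht0 x hx] at this
    linear_combination this

end AffData

/-! ### Bounds for the dimension of the algebra -/

lemma Eqn.Nonlinear.continuousOn_dK (hE : E.Nonlinear) : ContinuousOn (deriv E.K) E.J :=
  (hE.smooth_K.deriv_of_isOpen hE.hJ.1 (m := ∞) (by simp)).continuousOn

lemma Eqn.Nonlinear.continuousOn_φ (hE : E.Nonlinear) : ContinuousOn E.φ E.I :=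
  (hE.smooth_f.deriv_of_isOpen hE.hI.1 (m := ∞) (by simp)).continuousOn.div
    hE.smooth_f.continuousOn hE.f_ne

lemma Eqn.Nonlinear.constOn_f_of_φ (hE : E.Nonlinear) (h : ∀ x ∈ E.I, E.φ x = 0) :
    ConstOn E.f E.I :=
  let ⟨_, h0⟩ := hE.hI.2.2
  ⟨_, fun _ hx => eq_of_deriv_eq_zero hE.hI (fun _ hv => hE.hasDerivAt_f hv)
    (fun v hv => by rw [← hE.f_mul_φ hv, h v hv, mul_zero]) hx h0⟩

lemma Eqn.Nonlinear.constOn_K_of_deriv (hE : E.Nonlinear) (h : ∀ u ∈ E.J, deriv E.K u = 0) :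
    ConstOn E.K E.J :=
  let ⟨_, h0⟩ := hE.hJ.2.2
  ⟨_, fun _ hx => eq_of_deriv_eq_zero hE.hJ (fun _ hv => hE.hasDerivAt_K hv) h hx h0⟩

section RankLe
variable (hE : E.Nonlinear) {q₁ q₂ q₃ q₄ : VField}
include hE

lemma rank_le_of_comb (l : List VField)
    (h : ∀ s : Sol E, ∃ k, ∀ t ∈ E.T, ∀ x ∈ E.I, ∀ u ∈ E.J, s.Q (t, x, u) = comb l k (t, x, u)) :
    Module.rank ℝ (E.alg hE) ≤ l.length := by
  have hle : E.alg hE ≤ Submodule.span ℝ (Set.range (E.fam l)) := by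
    intro X hX
    obtain ⟨s, hs, rfl⟩ := (mem_maxAlg_iff hE).1 hX
    obtain ⟨k, hk⟩ := h s
    refine (Submodule.mem_span_range_iff_exists_fun ℝ).2 ⟨k, funext fun p => ?_⟩
    simpa [comb, Eqn.fam, Finset.sum_apply] using (hk _ p.2.1 _ p.2.2.1 _ p.2.2.2).symm
  refine (Submodule.rank_mono hle).trans ((rank_span_le _).trans ?_)
  simpa using (Cardinal.mk_range_le (f := E.fam l))

lemma rank_le_one (h : ∀ s : Sol E, ∃ k₀ : ℝ, ∀ t ∈ E.T, ∀ x ∈ E.I, ∀ u ∈ E.J,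
    s.Q (t, x, u) = (k₀, 0, 0)) : Module.rank ℝ (E.alg hE) ≤ (1 : ℕ) :=
  rank_le_of_comb hE [dt] fun s => let ⟨k₀, h⟩ := h s
    ⟨![k₀], fun t ht x hx u hu => by simp [h t ht x hx u hu, comb, dt, op]⟩

lemma rank_le_two (h : ∀ s : Sol E, ∃ k₀ k₁ : ℝ, ∀ t ∈ E.T, ∀ x ∈ E.I, ∀ u ∈ E.J,
    s.Q (t, x, u) = (k₀, 0, 0) + k₁ • q₁ (t, x, u)) : Module.rank ℝ (E.alg hE) ≤ (2 : ℕ) :=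
  rank_le_of_comb hE [dt, q₁] fun s => let ⟨k₀, k₁, h⟩ := h s
    ⟨![k₀, k₁], fun t ht x hx u hu => by simp [h t ht x hx u hu, comb, Fin.sum_univ_two, dt, op]⟩

lemma rank_le_three (h : ∀ s : Sol E, ∃ k₀ k₁ k₂ : ℝ, ∀ t ∈ E.T, ∀ x ∈ E.I, ∀ u ∈ E.J,
    s.Q (t, x, u) = (k₀, 0, 0) + k₁ • q₁ (t, x, u) + k₂ • q₂ (t, x, u)) :
    Module.rank ℝ (E.alg hE) ≤ (3 : ℕ) :=
  rank_le_of_comb hE [dt, q₁, q₂] fun s => let ⟨k₀, k₁, k₂, h⟩ := h s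
    ⟨![k₀, k₁, k₂], fun t ht x hx u hu => by
      simp [h t ht x hx u hu, comb, Fin.sum_univ_three, dt, op]⟩

lemma rank_le_four (h : ∀ s : Sol E, ∃ k₀ k₁ k₂ k₃ : ℝ, ∀ t ∈ E.T, ∀ x ∈ E.I, ∀ u ∈ E.J,
    s.Q (t, x, u) = (k₀, 0, 0) + k₁ • q₁ (t, x, u) + k₂ • q₂ (t, x, u) + k₃ • q₃ (t, x, u)) :
    Module.rank ℝ (E.alg hE) ≤ (4 : ℕ) :=
  rank_le_of_comb hE [dt, q₁, q₂, q₃] fun s => let ⟨k₀, k₁, k₂, k₃, h⟩ := h s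
    ⟨![k₀, k₁, k₂, k₃], fun t ht x hx u hu => by
      simp [h t ht x hx u hu, comb, Fin.sum_univ_four, dt, op]⟩

lemma rank_le_five (h : ∀ s : Sol E, ∃ k₀ k₁ k₂ k₃ k₄ : ℝ, ∀ t ∈ E.T, ∀ x ∈ E.I, ∀ u ∈ E.J,
    s.Q (t, x, u) = (k₀, 0, 0) + k₁ • q₁ (t, x, u) + k₂ • q₂ (t, x, u) + k₃ • q₃ (t, x, u)
      + k₄ • q₄ (t, x, u)) : Module.rank ℝ (E.alg hE) ≤ (5 : ℕ) :=
  rank_le_of_comb hE [dt, q₁, q₂, q₃, q₄] fun s => let ⟨k₀, k₁, k₂, k₃, k₄, h⟩ := h s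
    ⟨![k₀, k₁, k₂, k₃, k₄], fun t ht x hx u hu => by
      simp [h t ht x hx u hu, comb, Fin.sum_univ_five, dt, op]⟩

end RankLe

/-! ### Affine symmetries: nonconstant `f` -/

/-- If `K` is not proportional to `D`, a common logarithmic derivative is impossible. -/
lemma weight_eq_zero (hE : E.Nonlinear) (hKD : ¬ ∃ p, ∀ u ∈ E.J, E.K u = p * E.D u) {α β ρ : ℝ}
    (h1 : ∀ u ∈ E.J, (α * u + β) * deriv E.D u = ρ * E.D u)
    (h2 : ∀ u ∈ E.J, (α * u + β) * deriv E.K u = ρ * E.K u) : α = 0 ∧ β = 0 := by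
  by_contra hab
  have hW : ∀ u ∈ E.J, E.D u * deriv E.K u - E.K u * deriv E.D u = 0 :=
    eq_zero_of_lin_mul hE.hJ.1 (not_and_or.1 hab) ((hE.smooth_D.continuousOn.mul hE.continuousOn_dK).sub
      (hE.smooth_K.continuousOn.mul hE.continuousOn_dD)) fun u hu => by
        linear_combination E.D u * h2 u hu - E.K u * h1 u hu
  obtain ⟨u0, hu0⟩ := hE.hJ.2.2
  refine hKD ⟨E.K u0 / E.D u0, fun u hu => ?_⟩
  have := eq_of_deriv_eq_zero hE.hJ (g := fun u => E.K u / E.D u) (fun v hv =>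
    (hE.hasDerivAt_K hv).div (hE.hasDerivAt_D hv) (hE.D_ne v hv))
    (fun v hv => by rw [show deriv E.K v * E.D v - E.K v * deriv E.D v = 0 by
      linear_combination hW v hv, zero_div]) hu hu0
  have hd := hE.D_ne u hu
  rw [← this]; field_simp

/-- The possible algebras if all symmetries are affine and `f` is not constant. -/
lemma rank_of_allAff_nonconst (hE : E.Nonlinear) (hA : E.AllAff) (hf : ¬ ConstOn E.f E.I)
    (hKD : ¬ ∃ p, ∀ u ∈ E.J, E.K u = p * E.D u) :
    Module.rank ℝ (E.alg hE) ≤ (1 : ℕ) ∨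
    (Module.rank ℝ (E.alg hE) ≤ (2 : ℕ) ∧ ∃ ε, ε ≠ 0 ∧ ∀ x ∈ E.I, E.φ x = ε) ∨
    (Module.rank ℝ (E.alg hE) ≤ (2 : ℕ) ∧ ∃ δ l, l ≠ 0 ∧
      (∀ x ∈ E.I, x + δ ≠ 0 ∧ E.φ x = l / (x + δ)) ∧
      ∃ α β ρ a₁ : ℝ, a₁ ≠ 0 ∧ (α ≠ 0 ∨ β ≠ 0) ∧
        (∀ u ∈ E.J, (α * u + β) * deriv E.D u = ρ * E.D u) ∧
        ∀ u ∈ E.J, (α * u + β) * deriv E.K u = (ρ - a₁) * E.K u) := by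
  obtain ⟨t0, ht0⟩ := hE.hT.2.2
  obtain ⟨u0, hu0⟩ := hE.hJ.2.2
  -- the form of a symmetry
  have form : ∀ s : Sol E, ∃ α β a₁ ρ τ₁ τ₀ σ₀, (∀ t ∈ E.T, ∀ x ∈ E.I, ∀ u ∈ E.J,
      s.Q (t, x, u) = (τ₁ * t + τ₀, a₁ * x + σ₀, α * u + β)) ∧
      (∀ x ∈ E.I, (a₁ * x + σ₀) * E.φ x = τ₁ + ρ - 2 * a₁) ∧
      (∀ u ∈ E.J, (α * u + β) * deriv E.D u = ρ * E.D u) ∧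
      (∀ u ∈ E.J, (α * u + β) * deriv E.K u = (ρ - a₁) * E.K u) ∧
      (a₁ = 0 → α = 0 ∧ β = 0 ∧ ρ = 0) := fun s => by
    obtain ⟨α, β, a₁, κ, ρ, τ, τ', ξ, ξt, h⟩ := hA s
    obtain ⟨rfl, τ₁, τ₀, σ₀, h1, h2⟩ := h.f_nonconst hE hf
    refine ⟨α, β, a₁, ρ, τ₁, τ₀, σ₀, h1, h2, h.hD, fun u hu => by rw [h.hK u hu]; ring,
      fun ha => ?_⟩
    subst ha
    obtain ⟨rfl, rfl⟩ := weight_eq_zero hE hKD h.hD fun u hu => by rw [h.hK u hu]; ring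
    exact ⟨rfl, rfl, zero_of_mul (hE.D_ne u0 hu0) (by linear_combination -h.hD u0 hu0)⟩
  choose α β a₁ ρ τ₁ τ₀ σ₀ hQ hφ hD hK h0 using form
  by_cases hall : ∀ s, a₁ s = 0
  · by_cases hσ : ∀ s, σ₀ s = 0
    · left
      refine rank_le_one hE fun s => ⟨τ₀ s, fun t ht x hx u hu => ?_⟩
      have h1 := hφ s x hx
      obtain ⟨e1, e2, e3⟩ := h0 s (hall s)
      have h3 : τ₁ s = 0 := by rw [hall s, hσ s, e3] at h1; linarith
      rw [hQ s t ht x hx u hu, hall s, hσ s, e1, e2, h3]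
      simp
    · right; left
      push Not at hσ
      obtain ⟨s0, hs0⟩ := hσ
      have hφ0 : ∀ x ∈ E.I, E.φ x = τ₁ s0 / σ₀ s0 := fun x hx => by
        have := hφ s0 x hx
        rw [hall s0, (h0 s0 (hall s0)).2.2] at this
        field_simp; linarith
      refine ⟨rank_le_two hE (q₁ := op fun t _ _ => (τ₁ s0 / σ₀ s0 * t, 1, 0)) fun s =>
        ⟨τ₀ s, σ₀ s, fun t ht x hx u hu => ?_⟩, _, fun he => hf (hE.constOn_f_of_φ fun x hx => ?_),
        hφ0⟩
      · have h1 := hφ s x hx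
        obtain ⟨e1, e2, e3⟩ := h0 s (hall s)
        rw [hall s, e3, hφ0 x hx] at h1
        rw [hQ s t ht x hx u hu, hall s, e1, e2]
        refine Prod.ext ?_ (Prod.ext ?_ ?_) <;> simp [op]
        linear_combination -t * h1
      · rw [hφ0 x hx, he]
  · right; right
    push Not at hall
    obtain ⟨s0, hs0⟩ := hall
    obtain ⟨δ, hδ⟩ : ∃ δ, a₁ s0 * δ = σ₀ s0 := ⟨_, mul_div_cancel₀ _ hs0⟩
    obtain ⟨l, hl⟩ : ∃ l, a₁ s0 * l = τ₁ s0 + ρ s0 - 2 * a₁ s0 := ⟨_, mul_div_cancel₀ _ hs0⟩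
    have hφ0 : ∀ x ∈ E.I, (x + δ) * E.φ x = l := fun x hx =>
      mul_left_cancel₀ hs0 (by linear_combination hφ s0 x hx - hl + E.φ x * hδ)
    have hl0 : l ≠ 0 := fun hl0 => hf (hE.constOn_f_of_φ (eq_zero_of_lin_mul hE.hI.1 (a := 1) (b := δ)
      (by simp) hE.continuousOn_φ fun x hx => by rw [one_mul, hφ0 x hx, hl0]))
    have hne : ∀ x ∈ E.I, x + δ ≠ 0 := fun x hx h => hl0 (by rw [← hφ0 x hx, h, zero_mul])
    refine ⟨rank_le_two hE (q₁ := s0.Q) fun s => ?_, δ, l, hl0, fun x hx => ⟨hne x hx, ?_⟩,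
      α s0, β s0, ρ s0, a₁ s0, hs0, ?_, hD s0, hK s0⟩
    · obtain ⟨k, hk⟩ : ∃ k, k * a₁ s0 = a₁ s := ⟨_, div_mul_cancel₀ _ hs0⟩
      obtain ⟨s', hc⟩ : ∃ s' : Sol E, s'.Q = s.Q + -k • s0.Q := ⟨_, s.addSmul_Q s0 (-k)⟩
      obtain ⟨ha, hσ⟩ := lin_eq_zero hE.hI (Y := fun x => x) (injOn_id _) (b := a₁ s')
        (c := σ₀ s' - (σ₀ s - k * σ₀ s0)) fun x hx => by
          have h1 := congrArg (fun z => z.2.1) (congrFun hc (t0, x, u0))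
          simp [hQ _ t0 ht0 x hx u0 hu0] at h1
          linear_combination h1 - x * hk
      obtain ⟨e1, e2, e3⟩ := h0 s' ha
      obtain ⟨h2, h3⟩ := lin_eq_zero hE.hI (Y := fun x => x) (injOn_id _) (b := τ₁ s')
        (c := τ₁ s' * δ - σ₀ s' * l) fun x hx => by
          have h1 := hφ s' x hx
          rw [ha, e3] at h1
          linear_combination σ₀ s' * hφ0 x hx - (x + δ) * h1
      have h3 : σ₀ s' = 0 := zero_of_mul hl0 (by rw [h2] at h3; linear_combination -h3)
      refine ⟨τ₀ s', k, fun t ht x hx u hu => ?_⟩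
      have h4 := congrFun hc (t, x, u)
      rw [hQ s' t ht x hx u hu, ha, e1, e2, h2, h3, Pi.add_apply, Pi.smul_apply, neg_smul,
        ← sub_eq_add_neg] at h4
      rw [← sub_eq_iff_eq_add, ← h4]
      simp
    · have := hne x hx
      field_simp
      linarith [hφ0 x hx]
    · by_contra hab
      push Not at hab
      refine hKD ⟨0, fun u hu => ?_⟩
      have h1 := hD s0 u hu
      have h2 := hK s0 u hu
      rw [hab.1, hab.2] at h1 h2
      have h3 : ρ s0 = 0 := zero_of_mul (hE.D_ne u hu) (by linear_combination -h1)
      rw [zero_mul]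
      exact zero_of_mul hs0 (by rw [h3] at h2; linear_combination h2)

/-! ### Affine symmetries: constant `f` -/

/-- `D, K` cannot satisfy two such equations with independent weights. -/
lemma weight_unique (hE : E.Nonlinear) (hDK : ¬ (ConstOn E.D E.J ∧ ∃ p q, ∀ u ∈ E.J, E.K u = p * u + q))
    {ρ a κ ρ' a' κ' : ℝ}
    (h1 : ∀ u ∈ E.J, deriv E.D u = ρ * E.D u)
    (h2 : ∀ u ∈ E.J, deriv E.K u = (ρ - a) * E.K u - κ)
    (h3 : ∀ u ∈ E.J, u * deriv E.D u = ρ' * E.D u)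
    (h4 : ∀ u ∈ E.J, u * deriv E.K u = (ρ' - a') * E.K u - κ') : False := by
  obtain ⟨rfl, r2⟩ := lin_eq_zero hE.hJ (Y := fun u => u) (injOn_id _) (b := ρ) (c := -ρ')
    fun u hu => zero_of_mul (hE.D_ne u hu) (by linear_combination h3 u hu - u * h1 u hu)
  obtain rfl := neg_eq_zero.1 r2
  refine hDK ⟨hE.constOn_D_of_deriv fun u hu => by rw [h1 u hu]; ring, ?_⟩
  by_contra hK
  have ha : a ≠ 0 := by
    rintro rfl
    obtain ⟨c, hc⟩ := eqOn_affine_of_hasDerivAt hE.hJ (g := E.K) (k := -κ) fun v hv =>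
      (hE.hasDerivAt_K hv).congr_deriv (by rw [h2 v hv]; ring)
    exact hK ⟨_, _, hc⟩
  obtain ⟨-, C, m, hm, hmob⟩ := exists_mobius hE hK (k := a) (n := -a') (A := -κ) (B := κ') (.inl ha)
    fun u hu => by linear_combination u * h2 u hu - h4 u hu
  obtain ⟨-, -, hz⟩ := quad_eq_zero hE.hJ (Y := fun u => u + -a' / a)
    (fun u _ v _ h => by simpa using h) (a := a * C + κ) (b := a * m) (c := -m) fun u hu => by
      have e1 := mobius_deriv hE.hJ.1 (fun u hu => hE.hasDerivAt_K hu) hmob u hu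
      rw [h2 u hu] at e1
      linear_combination -e1 - a * (u + -a' / a) * hmob u hu
  exact hm (neg_eq_zero.1 hz)

/-- The possible algebras if all symmetries are affine and `f` is constant. -/
lemma rank_of_allAff_const (hE : E.Nonlinear) (hA : E.AllAff) {c₀ : ℝ}
    (hf : ∀ x ∈ E.I, E.f x = c₀) (hKc : ¬ ConstOn E.K E.J)
    (hDK : ¬ (ConstOn E.D E.J ∧ ∃ p q, ∀ u ∈ E.J, E.K u = p * u + q)) :
    Module.rank ℝ (E.alg hE) ≤ (2 : ℕ) ∨
    (Module.rank ℝ (E.alg hE) ≤ (3 : ℕ) ∧ ∃ α β ρ ν κ : ℝ, (α ≠ 0 ∨ β ≠ 0) ∧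
        (∀ u ∈ E.J, (α * u + β) * deriv E.D u = ρ * E.D u) ∧
        ∀ u ∈ E.J, (α * u + β) * deriv E.K u = ν * E.K u - κ) := by
  obtain ⟨t0, ht0⟩ := hE.hT.2.2
  obtain ⟨x0, hx0⟩ := hE.hI.2.2
  obtain ⟨u0, hu0⟩ := hE.hJ.2.2
  have form : ∀ s : Sol E, ∃ α β a₁ ρ κ τ₁ τ₀ σ₁ σ₀, (∀ t ∈ E.T, ∀ x ∈ E.I, ∀ u ∈ E.J,
      s.Q (t, x, u) = (τ₁ * t + τ₀, a₁ * x + σ₁ * t + σ₀, α * u + β)) ∧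
      (∀ u ∈ E.J, (α * u + β) * deriv E.D u = ρ * E.D u) ∧
      (∀ u ∈ E.J, (α * u + β) * deriv E.K u = (ρ - a₁) * E.K u - κ) ∧
      (α = 0 → β = 0 → a₁ = 0 ∧ τ₁ = 0 ∧ σ₁ = 0) := fun s => by
    obtain ⟨α, β, a₁, κ, ρ, τ, τ', ξ, ξt, h⟩ := hA s
    obtain ⟨τ₀, σ₀, h1⟩ := h.f_const hE hf
    refine ⟨α, β, a₁, ρ, κ, 2 * a₁ - ρ, τ₀, κ / c₀, σ₀, h1, h.hD, h.hK, ?_⟩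
    rintro rfl rfl
    obtain rfl : ρ = 0 := zero_of_mul (hE.D_ne u0 hu0) (by linear_combination -h.hD u0 hu0)
    obtain ⟨e1, e2⟩ := const_indep hKc (A := -a₁) (C := -κ) fun u hu => by
      linear_combination -h.hK u hu
    rw [neg_eq_zero.1 e1, neg_eq_zero.1 e2]
    simp
  choose α β a₁ ρ κ τ₁ τ₀ σ₁ σ₀ hQ hD hK h0 using form
  by_cases hall : ∀ s, α s = 0 ∧ β s = 0
  · left
    refine rank_le_two hE (q₁ := op fun _ _ _ => (0, 1, 0)) fun s => ⟨τ₀ s, σ₀ s,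
      fun t ht x hx u hu => ?_⟩
    obtain ⟨e1, e2, e3⟩ := h0 s (hall s).1 (hall s).2
    rw [hQ s t ht x hx u hu, e1, e2, e3, (hall s).1, (hall s).2]
    simp [op]
  · right
    push Not at hall
    obtain ⟨s0, hs0⟩ := hall
    have hne : α s0 ≠ 0 ∨ β s0 ≠ 0 := not_or_of_imp hs0
    refine ⟨rank_le_three hE (q₁ := op fun _ _ _ => (0, 1, 0)) (q₂ := s0.Q) fun s => ?_,
      α s0, β s0, ρ s0, ρ s0 - a₁ s0, κ s0, hne, hD s0, hK s0⟩
    -- proportionality of the weights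
    have hdet : α s0 * β s - α s * β s0 = 0 := by
      by_contra hdet
      obtain ⟨Δ, hΔ⟩ : ∃ Δ, Δ * (α s0 * β s - α s * β s0) = 1 := ⟨_, inv_mul_cancel₀ hdet⟩
      exact weight_unique hE hDK (ρ := Δ * (α s0 * ρ s - α s * ρ s0))
        (a := Δ * (α s0 * a₁ s - α s * a₁ s0)) (κ := Δ * (α s0 * κ s - α s * κ s0))
        (ρ' := Δ * (β s * ρ s0 - β s0 * ρ s)) (a' := Δ * (β s * a₁ s0 - β s0 * a₁ s))
        (κ' := Δ * (β s * κ s0 - β s0 * κ s))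
        (fun u hu => by linear_combination Δ * (α s0 * hD s u hu - α s * hD s0 u hu) - deriv E.D u * hΔ)
        (fun u hu => by linear_combination Δ * (α s0 * hK s u hu - α s * hK s0 u hu) - deriv E.K u * hΔ)
        (fun u hu => by
          linear_combination Δ * (β s * hD s0 u hu - β s0 * hD s u hu) - u * deriv E.D u * hΔ)
        (fun u hu => by
          linear_combination Δ * (β s * hK s0 u hu - β s0 * hK s u hu) - u * deriv E.K u * hΔ)
    obtain ⟨k, hk1, hk2⟩ : ∃ k, α s = k * α s0 ∧ β s = k * β s0 := by
      rcases hne with h | h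
      · exact ⟨α s / α s0, by field_simp, by field_simp; linarith⟩
      · exact ⟨β s / β s0, by field_simp; linarith, by field_simp⟩
    obtain ⟨s', hc⟩ : ∃ s' : Sol E, s'.Q = s.Q + -k • s0.Q := ⟨_, s.addSmul_Q s0 (-k)⟩
    obtain ⟨e1, e2⟩ := lin_eq_zero hE.hJ (Y := fun u => u) (injOn_id _) (b := α s') (c := β s')
      fun u hu => by
        have h1 := congrArg (fun z => z.2.2) (congrFun hc (t0, x0, u))
        simp [hQ _ t0 ht0 x0 hx0 u hu, hk1, hk2] at h1
        linear_combination h1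
    obtain ⟨e3, e4, e5⟩ := h0 s' e1 e2
    refine ⟨τ₀ s', σ₀ s', k, fun t ht x hx u hu => ?_⟩
    have h4 := congrFun hc (t, x, u)
    rw [hQ s' t ht x hx u hu, e1, e2, e3, e4, e5, Pi.add_apply, Pi.smul_apply, neg_smul,
      ← sub_eq_add_neg] at h4
    rw [← sub_eq_iff_eq_add, ← h4]
    simp [op]

/-! ### Linear combinations of `D` and `1` as convection coefficients -/

lemma exp_ode {S : Set ℝ} (hS : IsOpenInterval S) {h h' : ℝ → ℝ} {k : ℝ}
    (hd : ∀ x ∈ S, HasDerivAt h (h' x) x) (e : ∀ x ∈ S, h' x = k * h x) :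
    ∃ C, ∀ x ∈ S, h x = C * exp (k * x) := by
  obtain ⟨x0, hx0⟩ := hS.2.2
  refine ⟨h x0 * exp (-k * x0), fun x hx => ?_⟩
  have := eq_of_deriv_eq_zero hS (g := fun x => h x * exp (-k * x))
    (fun y hy => (hd y hy).mul (hasDerivAt_exp_mul (-k) y))
    (fun y hy => by rw [e y hy]; ring) hx hx0
  rw [← this, mul_assoc, ← Real.exp_add]
  simp

lemma coeff_deriv {T I : Set ℝ} (hT : IsOpen T) {g gt : ℝ → ℝ → ℝ} {l m Y : ℝ → ℝ}
    (hg : ∀ t ∈ T, ∀ x ∈ I, HasDerivAt (fun s => g s x) (gt t x) t)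
    (e : ∀ t ∈ T, ∀ x ∈ I, g t x = l t * Y x + m t) {x y : ℝ} (hx : x ∈ I) (hy : y ∈ I)
    (hxy : Y x ≠ Y y) : ∃ l' m' : ℝ → ℝ, (∀ t ∈ T, HasDerivAt l (l' t) t) ∧
      (∀ t ∈ T, HasDerivAt m (m' t) t) ∧ ∀ t ∈ T, ∀ x ∈ I, gt t x = l' t * Y x + m' t := by
  have hne : Y x - Y y ≠ 0 := sub_ne_zero.2 hxy
  have hl : ∀ t ∈ T, HasDerivAt l ((gt t x - gt t y) / (Y x - Y y)) t := fun t ht =>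
    (((hg t ht x hx).sub (hg t ht y hy)).div_const (Y x - Y y)).congr_on hT ht fun s hs => by
      simp only [Pi.sub_apply, e s hs x hx, e s hs y hy]
      field_simp; ring
  have hm : ∀ t ∈ T, HasDerivAt m (gt t x - (gt t x - gt t y) / (Y x - Y y) * Y x) t := fun t ht =>
    ((hg t ht x hx).sub ((hl t ht).mul_const (Y x))).congr_on hT ht fun s hs => by
      simp only [Pi.sub_apply, e s hs x hx]
      ring
  exact ⟨_, _, hl, hm, fun t ht z hz => (hg t ht z hz).unique
    ((((hl t ht).mul_const (Y z)).add (hm t ht)).congr_on hT ht fun s hs => e s hs z hz)⟩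

/-- The determining equations if `D` is constant and `K` is affine. -/
lemma Sol.affine_K (s : Sol E) (hE : E.Nonlinear) {d k₁ k₀ : ℝ} (hD : ∀ u ∈ E.J, E.D u = d)
    (hK : ∀ u ∈ E.J, E.K u = k₁ * u + k₀) (hk : k₁ ≠ 0) {t x : ℝ} (ht : t ∈ E.T) (hx : x ∈ E.I) :
    s.ξ t x * E.φ x - s.τ' t + 2 * s.ξx t x = 0 ∧ s.ξx t x = -s.α t x ∧
      k₁ * s.β t x = s.α t x * k₀ - E.f x * s.ξt t x ∧ s.αx t x = 0 ∧
      E.f x * s.αt t x = k₁ * s.βx t x ∧ E.f x * s.βt t x = d * s.βxx t x + k₀ * s.βx t x := by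
  obtain ⟨u0, hu0⟩ := hE.hJ.2.2
  have hD' : ∀ u ∈ E.J, deriv E.D u = 0 := fun u hu => deriv_const_of_eqOn hE.hJ.1 hD hu
  have hK' : ∀ u ∈ E.J, deriv E.K u = k₁ := fun u hu =>
    deriv_eq_of_eqOn hE.hJ.1 hu hK (((hasDerivAt_id u).const_mul k₁).add_const k₀
      |>.congr_deriv (by ring))
  have e1 : ∀ y ∈ E.I, s.ξ t y * E.φ y - s.τ' t + 2 * s.ξx t y = 0 := fun y hy =>
    zero_of_mul (hE.D_ne u0 hu0) (by
      have := s.eq1 t ht y hy u0 hu0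
      rw [hD' u0 hu0] at this
      linear_combination -this)
  have e4 : ∀ y ∈ E.I, s.αx t y = 0 ∧ E.f y * s.αt t y = d * s.αxx t y + k₁ * s.βx t y ∧
      E.f y * s.βt t y = d * s.βxx t y + k₀ * s.βx t y := fun y hy => by
    obtain ⟨h1, h2, h3⟩ := quad_eq_zero hE.hJ (Y := fun u => u) (injOn_id _)
      (a := -(k₁ * s.αx t y)) (b := E.f y * s.αt t y - d * s.αxx t y - k₁ * s.βx t y - k₀ * s.αx t y)
      (c := E.f y * s.βt t y - d * s.βxx t y - k₀ * s.βx t y) fun u hu => by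
        have := s.eq4 t ht y hy u hu
        rw [hD u hu, hK u hu] at this
        linear_combination this
    have h4 := zero_of_mul hk (neg_eq_zero.1 h1)
    rw [h4] at h2
    exact ⟨h4, by linarith, by linarith⟩
  have e3 : ∀ y ∈ E.I, s.ξx t y = -s.α t y ∧ k₁ * s.β t y = -s.ξx t y * k₀
      - E.f y * s.ξt t y - d * (2 * s.αx t y - s.ξxx t y) := fun y hy => by
    obtain ⟨h1, h2⟩ := lin_eq_zero hE.hJ (Y := fun u => u) (injOn_id _)
      (b := k₁ * (s.ξx t y + s.α t y)) (c := k₁ * s.β t y - (-s.ξx t y * k₀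
      - E.f y * s.ξt t y - d * (2 * s.αx t y - s.ξxx t y))) fun u hu => by
        have := s.eq3 t ht y hy u hu
        rw [hD' u hu, hD u hu, hK' u hu, hK u hu] at this
        linear_combination this + (k₁ * u + k₀) * e1 y hy
    exact ⟨eq_neg_of_add_eq_zero_left (zero_of_mul hk h1), by linarith⟩
  obtain ⟨h1, h2, h3⟩ := e4 x hx
  obtain ⟨h4, h5⟩ := e3 x hx
  have hαxx := (s.jα.xx t ht x hx).eq_zero_of_const hE.hI.1 hx fun y hy => (e4 y hy).1
  have hξxx := (s.jξ.xx t ht x hx).unique (((s.jα.x t ht x hx).neg).congr_on hE.hI.1 hx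
    fun y hy => (e3 y hy).1)
  rw [hξxx, h1, h4] at h5
  rw [hαxx] at h2
  exact ⟨e1 x hx, h4, by linarith, h1, by linarith, h3⟩

/-- `D` constant, `K` affine, `f` not constant. -/
lemma allAff_of_affine (hE : E.Nonlinear) (hf : ¬ ConstOn E.f E.I) {d k₁ k₀ : ℝ}
    (hD : ∀ u ∈ E.J, E.D u = d) (hK : ∀ u ∈ E.J, E.K u = k₁ * u + k₀) (hk : k₁ ≠ 0) :
    E.AllAff := fun s => by
  obtain ⟨x0, hx0⟩ := hE.hI.2.2
  have e := fun t ht x hx => s.affine_K hE hD hK hk (t := t) (x := x) ht hx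
  have hαc : ∀ t ∈ E.T, ∀ x ∈ E.I, s.α t x = s.α t x0 := fun t ht x hx =>
    eq_of_deriv_eq_zero hE.hI (s.jα.x t ht) (fun y hy => (e t ht y hy).2.2.2.1) hx hx0
  have hξ : ∀ t ∈ E.T, ∀ x ∈ E.I, s.ξ t x = -s.α t x0 * x + (s.ξ t x0 + s.α t x0 * x0) :=
    fun t ht x hx => by
      obtain ⟨c, hc⟩ := eqOn_affine_of_hasDerivAt hE.hI (g := s.ξ t) (k := -s.α t x0)
        fun y hy => (s.jξ.x t ht y hy).congr_deriv (by rw [(e t ht y hy).2.1, hαc t ht y hy])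
      rw [hc x hx, hc x0 hx0]; ring
  obtain ⟨x1, hx1, x2, hx2, hx12⟩ := hE.hI.exists_two
  obtain ⟨A', B', hA', hB', hξt⟩ := coeff_deriv hE.hT.1 s.jξ.t (Y := fun x => x) hξ hx1 hx2 hx12
  have hαt : ∀ t ∈ E.T, ∀ x ∈ E.I, s.αt t x = -A' t := fun t ht x hx =>
    (s.jα.t t ht x hx).unique ((hA' t ht).neg.congr_on hE.hT.1 ht fun y hy => by
      rw [Pi.neg_apply, neg_neg, hαc y hy x hx])
  have hAB : ∀ t ∈ E.T, A' t = 0 ∧ B' t = 0 := fun t ht => by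
    by_contra hne
    refine hf (hE.constOn_f_of_φ (eq_zero_of_lin_mul hE.hI.1 (not_and_or.1 hne) hE.continuousOn_φ
      fun x hx => zero_of_mul (hE.f_ne x hx) ?_))
    have h3 := ((s.jβ.x t ht x hx).const_mul k₁).unique
      ((((hE.hasDerivAt_f hx).mul (((hasDerivAt_id x).const_mul (A' t)).add_const (B' t))).const_sub
        (s.α t x0 * k₀)).congr_on hE.hI.1 hx fun y hy => by
          rw [(e t ht y hy).2.2.1, hξt t ht y hy, hαc t ht y hy]; rfl)
    have h4 := (e t ht x hx).2.2.2.2.1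
    rw [hαt t ht x hx] at h4
    simp only [id] at h3
    linear_combination h3 + h4 + (A' t * x + B' t) * hE.f_mul_φ hx
  have hξt0 : ∀ t ∈ E.T, ∀ x ∈ E.I, s.ξt t x = 0 := fun t ht x hx => by
    rw [hξt t ht x hx, (hAB t ht).1, (hAB t ht).2]; ring
  obtain ⟨α, hα⟩ := s.jα.const hE.hT hE.hI
    (fun t ht x hx => by rw [hαt t ht x hx, (hAB t ht).1, neg_zero])
    (fun t ht x hx => (e t ht x hx).2.2.2.1)
  have hβ : ∀ t ∈ E.T, ∀ x ∈ E.I, s.β t x = α * k₀ / k₁ := fun t ht x hx => by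
    have h := (e t ht x hx).2.2.1
    rw [hξt0 t ht x hx, hα t ht x hx] at h
    field_simp; linarith
  have hξx : ∀ t ∈ E.T, ∀ x ∈ E.I, s.ξx t x = -α := fun t ht x hx => by
    rw [← hα t ht x hx, (e t ht x hx).2.1]
  exact ⟨α, α * k₀ / k₁, -α, 0, 0, s.τ, s.τ', s.ξ, s.ξt, s.jτ, s.jξ.t,
    fun t ht x hx => hξx t ht x hx ▸ s.jξ.x t ht x hx,
    fun t ht x hx u hu => by simp only [Field.Q, op, hα t ht x hx, hβ t ht x hx],
    fun t ht x hx => by rw [hξt0 t ht x hx, mul_zero],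
    fun t ht x hx => hξx t ht x hx ▸ (e t ht x hx).1,
    fun u hu => by rw [deriv_const_of_eqOn hE.hJ.1 hD hu]; ring, fun u hu => by
      rw [deriv_eq_of_eqOn hE.hJ.1 hu hK (((hasDerivAt_id u).const_mul k₁).add_const k₀), hK u hu]
      field_simp; ring⟩

/-- The Burgers equation. -/
lemma rank_burgers (hE : E.Nonlinear) (hD : ∀ u ∈ E.J, E.D u = 1)
    (hK : EqOn E.K (fun u => u) E.J) (hf : ∀ x ∈ E.I, E.f x = 1) :
    Module.rank ℝ (E.alg hE) ≤ (5 : ℕ) := by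
  obtain ⟨t0, ht0⟩ := hE.hT.2.2
  obtain ⟨x0, hx0⟩ := hE.hI.2.2
  refine rank_le_five hE (q₁ := op fun _ _ _ => (0, 1, 0)) (q₂ := op fun t x u => (2 * t, x, -u))
    (q₃ := op fun t _ _ => (0, t, -1)) (q₄ := op fun t x u => (t ^ 2, t * x, -(t * u + x)))
    fun s => ?_
  have e : ∀ t ∈ E.T, ∀ x ∈ E.I, s.τ' t = 2 * s.ξx t x ∧ s.ξx t x = -s.α t x ∧
      s.β t x = -s.ξt t x ∧ s.αx t x = 0 ∧ s.αt t x = s.βx t x ∧ s.βt t x = s.βxx t x :=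
    fun t ht x hx => by
      have h := s.affine_K hE hD (k₁ := 1) (k₀ := 0) (fun u hu => by rw [hK hu]; ring) one_ne_zero ht hx
      rw [hf x hx, hE.φ_const hf x hx] at h
      obtain ⟨h1, h2, h3, h4, h5, h6⟩ := h
      exact ⟨by linarith, h2, by linarith, h4, by linarith, by linarith⟩
  have hαc : ∀ t ∈ E.T, ∀ x ∈ E.I, s.α t x = s.α t x0 := fun t ht x hx =>
    eq_of_deriv_eq_zero hE.hI (s.jα.x t ht) (fun y hy => (e t ht y hy).2.2.2.1) hx hx0
  have hβx : ∀ t ∈ E.T, ∀ x ∈ E.I, s.βx t x = s.αt t x0 := fun t ht x hx => by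
    rw [← (e t ht x hx).2.2.2.2.1]
    exact (s.jα.t t ht x hx).unique ((s.jα.t t ht x0 hx0).congr_on hE.hT.1 ht
      fun y hy => hαc y hy x hx)
  have hβc : ∀ t ∈ E.T, ∀ x ∈ E.I, s.β t x = s.β t0 x := fun t ht x hx =>
    eq_of_deriv_eq_zero hE.hT (g := fun t => s.β t x) (fun r hr => s.jβ.t r hr x hx)
      (fun r hr => by rw [(e r hr x hx).2.2.2.2.2,
        (s.jβ.xx r hr x hx).eq_zero_of_const hE.hI.1 hx (hβx r hr)]) ht ht0
  have hαt0 : ∀ t ∈ E.T, s.αt t x0 = s.αt t0 x0 := fun t ht => by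
    rw [← hβx t ht x0 hx0, ← hβx t0 ht0 x0 hx0]
    exact (s.jβ.x t ht x0 hx0).unique ((s.jβ.x t0 ht0 x0 hx0).congr_on hE.hI.1 hx0 (hβc t ht))
  set a₂ := -s.αt t0 x0 with ha₂
  obtain ⟨a, hα⟩ := eqOn_affine_of_hasDerivAt hE.hT (g := fun t => s.α t x0) (k := -a₂)
    fun t ht => (s.jα.t t ht x0 hx0).congr_deriv (by rw [hαt0 t ht, ha₂, neg_neg])
  obtain ⟨b, hβ⟩ := eqOn_affine_of_hasDerivAt hE.hI (g := fun x => s.β t0 x) (k := -a₂)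
    fun x hx => (s.jβ.x t0 ht0 x hx).congr_deriv (by rw [hβx t0 ht0 x hx, ha₂, neg_neg])
  have hξx : ∀ t ∈ E.T, ∀ x ∈ E.I, s.ξx t x = a₂ * t - a := fun t ht x hx => by
    linear_combination (e t ht x hx).2.1 - hαc t ht x hx - hα t ht
  have hξt : ∀ t ∈ E.T, ∀ x ∈ E.I, s.ξt t x = a₂ * x - b := fun t ht x hx => by
    linear_combination (e t ht x hx).2.2.1 - hβc t ht x hx - hβ x hx
  obtain ⟨k, hk⟩ := eqOn_affine_of_hasDerivAt hE.hT (g := fun t => s.ξ t x0)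
    fun y hy => hξt y hy x0 hx0 ▸ s.jξ.t y hy x0 hx0
  have hτ := fun t ht => (eq_of_deriv_eq_zero hE.hT
    (g := fun t => s.τ t - (a₂ * t ^ 2 - 2 * a * t)) (g' := fun x => 0)
    (fun y hy => ((s.jτ y hy).sub ((((hasDerivAt_id y).pow 2).const_mul a₂).sub
      ((hasDerivAt_id y).const_mul (2 * a)))).congr_deriv
      (by rw [(e y hy x0 hx0).1, hξx y hy x0 hx0]; simp; ring)) (fun _ _ => rfl) ht ht0 :
        s.τ t - (a₂ * t ^ 2 - 2 * a * t) = s.τ t0 - (a₂ * t0 ^ 2 - 2 * a * t0))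
  refine ⟨s.τ t0 - (a₂ * t0 ^ 2 - 2 * a * t0), k + a * x0, -a, -b, a₂, fun t ht x hx u hu => ?_⟩
  obtain ⟨c, hc⟩ := eqOn_affine_of_hasDerivAt hE.hI fun y hy => hξx t ht y hy ▸ s.jξ.x t ht y hy
  refine Prod.ext ?_ (Prod.ext ?_ ?_) <;> simp only [Field.Q, op, Prod.fst_add, Prod.snd_add,
    Prod.smul_fst, Prod.smul_snd, smul_eq_mul]
  · linear_combination hτ t ht
  · linear_combination hc x hx - hc x0 hx0 + hk t ht
  · linear_combination u * hαc t ht x hx + u * hα t ht + hβc t ht x hx + hβ x hx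

section Span
variable {a b c : ℝ}

/-- The determining equations for `K = p D + q`. -/
lemma WSol.span_eqs (hE : E.Nonlinear) (hD : ¬ ConstOn E.D E.J) {p q : ℝ}
    (hK : ∀ u ∈ E.J, E.K u = p * E.D u + q) (s : WSol E a b c) (hs : s.Ok) :
    ∀ t ∈ E.T, ∀ x ∈ E.I, s.lxx t x = -p * s.lx t x ∧ E.f x * s.lt t x = q * s.lx t x ∧
      s.ξxx t x = p * s.ξx t x + 2 * (a + c) * s.lx t x ∧
      E.f x * s.ξt t x = q * (c * s.l t x - s.ξx t x) := by
  intro t ht x hx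
  have hDi : ∀ {A C : ℝ}, (∀ u ∈ E.J, A * E.D u + C = 0) → A = 0 ∧ C = 0 := const_indep hD
  have hK' : ∀ u ∈ E.J, deriv E.K u = p * deriv E.D u := fun u hu =>
    deriv_eq_of_eqOn hE.hJ.1 hu (h := fun u => p * E.D u + q) hK
      (((hE.hasDerivAt_D hu).const_mul p).add_const q)
  obtain ⟨h1, h2⟩ := hDi (A := -(s.lxx t x + p * s.lx t x))
    (C := E.f x * s.lt t x - q * s.lx t x) fun u hu => by
      have := hs.eq4 hE t ht x hx u hu
      rw [hK u hu] at this
      linear_combination this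
  obtain ⟨h3, h4⟩ := hDi (A := -p * s.ξx t x + s.ξxx t x - 2 * (a + c) * s.lx t x)
    (C := q * (c * s.l t x - s.ξx t x) - E.f x * s.ξt t x) fun u hu => by
      have h := s.eq3 t ht x hx u hu
      rw [hK u hu, hK' u hu] at h
      rcases hs with ⟨hd, -⟩ | h0
      · linear_combination -h + s.l t x * p * hd u hu
      · rw [h0 t ht x hx] at h ⊢
        linear_combination -h
  refine ⟨by linarith, by linarith, by linarith, by linarith⟩

/-- The coefficients of the symmetries are polynomials in the variable `y`. -/
structure WSol.Coeffs (s : WSol E a b c) (κ q : ℝ) (y y' β β' l l' g g' h h' : ℝ → ℝ) : Prop where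
  hβ : ∀ t ∈ E.T, HasDerivAt β (β' t) t
  hl : ∀ t ∈ E.T, HasDerivAt l (l' t) t
  hg : ∀ t ∈ E.T, HasDerivAt g (g' t) t
  hh : ∀ t ∈ E.T, HasDerivAt h (h' t) t
  eq_l : ∀ t ∈ E.T, ∀ x ∈ E.I, s.l t x = β t * y x + l t
  eq_ξx : ∀ t ∈ E.T, ∀ x ∈ E.I, s.ξx t x = κ * s.ξ t x + 2 * (a + c) * β t * y x + g t
  eq_ξ : ∀ t ∈ E.T, ∀ x ∈ E.I, s.ξ t x * y' x = (a + c) * β t * y x ^ 2 + g t * y x + h t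
  e1 : ∀ t ∈ E.T, ∀ x ∈ E.I, ((a + c) * β t * y x ^ 2 + g t * y x + h t) * (E.φ x + 2 * κ) =
    y' x * (c * (β t * y x + l t) + s.τ' t - 2 * (2 * (a + c) * β t * y x + g t))
  e2 : ∀ t ∈ E.T, ∀ x ∈ E.I, E.f x * (β' t * y x + l' t) = q * β t * y' x
  e3 : ∀ t ∈ E.T, ∀ x ∈ E.I, E.f x * ((a + c) * β' t * y x ^ 2 + g' t * y x + h' t) =
    q * y' x * (c * (β t * y x + l t) - 2 * (a + c) * β t * y x - g t)
      - q * κ * ((a + c) * β t * y x ^ 2 + g t * y x + h t)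

lemma Base.inj {κ : ℝ} {y y' : ℝ → ℝ} (B : Base κ y y') : Function.Injective y :=
  .of_lt_imp_ne fun a b hab e => by
    obtain ⟨c, -, hc⟩ := exists_hasDerivAt_eq_zero hab B.smooth.continuous.continuousOn e
      fun x _ => B.hy x
    exact B.ne c hc

lemma Base.exists_affine {κ : ℝ} {y y' : ℝ → ℝ} (B : Base κ y y') {S : Set ℝ}
    (hS : IsOpenInterval S) {g : ℝ → ℝ} {k : ℝ} (h : ∀ x ∈ S, HasDerivAt g (k * y' x) x) :
    ∃ c, ∀ x ∈ S, g x = k * y x + c := by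
  obtain ⟨c, hc⟩ := eqOn_affine_of_hasDerivAt hS (g := fun x => g x - k * y x) (k := 0)
    fun x hx => ((h x hx).sub ((B.hy x).const_mul k)).congr_deriv (by ring)
  exact ⟨c, fun x hx => by linear_combination hc x hx⟩

lemma WSol.exists_coeffs (hE : E.Nonlinear) (hD : ¬ ConstOn E.D E.J) {κ q : ℝ} {y y' : ℝ → ℝ}
    (B : Base κ y y') (hK : ∀ u ∈ E.J, E.K u = κ * E.D u + q) (s : WSol E a b c) (hs : s.Ok) :
    ∃ β β' l l' g g' h h', s.Coeffs κ q y y' β β' l l' g g' h h' := by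
  have eqs := s.span_eqs hE hD hK hs
  have key : ∀ t ∈ E.T, ∃ β l g h : ℝ, ∀ x ∈ E.I, s.lx t x = β * y' x ∧ s.l t x = β * y x + l ∧
      s.ξx t x = κ * s.ξ t x + 2 * (a + c) * β * y x + g ∧
      s.ξ t x * y' x = (a + c) * β * y x ^ 2 + g * y x + h := fun t ht => by
    obtain ⟨β, hβ⟩ := eqOn_affine_of_hasDerivAt hE.hI (g := fun x => s.lx t x / y' x) (k := 0)
      fun x hx => ((s.jl.xx t ht x hx).div (B.hy' x) (B.ne x)).congr_deriv (by
        rw [(eqs t ht x hx).1]; ring)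
    have hβ' : ∀ x ∈ E.I, s.lx t x = β * y' x := fun x hx => by
      have := hβ x hx
      have := B.ne x
      field_simp at *
      linarith
    obtain ⟨l, hl⟩ := B.exists_affine hE.hI fun x hx => hβ' x hx ▸ s.jl.x t ht x hx
    obtain ⟨g, hg⟩ := B.exists_affine hE.hI (g := fun x => s.ξx t x - κ * s.ξ t x)
      (k := 2 * (a + c) * β) fun x hx => ((s.jξ.xx t ht x hx).sub
        ((s.jξ.x t ht x hx).const_mul κ)).congr_deriv (by
          rw [(eqs t ht x hx).2.2.1, hβ' x hx]; ring)
    obtain ⟨h, hh⟩ := B.exists_affine hE.hI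
      (g := fun x => s.ξ t x * y' x - (a + c) * β * y x ^ 2) (k := g) fun x hx =>
        (((s.jξ.x t ht x hx).mul (B.hy' x)).sub (((B.hy x).pow 2).const_mul
          ((a + c) * β))).congr_deriv (by push_cast; linear_combination y' x * hg x hx)
    exact ⟨β, l, g, h, fun x hx => ⟨hβ' x hx, hl x hx, by linear_combination hg x hx,
      by linear_combination hh x hx⟩⟩
  choose! β l g h hk using key
  obtain ⟨x1, hx1, x2, hx2, hx12⟩ := hE.hI.exists_two
  have hy := B.inj.ne hx12
  obtain ⟨β', l', hβ, hl, hlt⟩ := coeff_deriv hE.hT.1 s.jl.t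
    (l := β) (m := l) (Y := y) (fun t ht x hx => (hk t ht x hx).2.1)
    hx1 hx2 hy
  obtain ⟨g', h', hg, hh, hξt⟩ := coeff_deriv hE.hT.1
    (g := fun t x => s.ξ t x * y' x - (a + c) * β t * y x ^ 2) (l := g) (m := h) (Y := y)
    (fun t ht x hx => ((s.jξ.t t ht x hx).mul_const (y' x)).sub
      (((hβ t ht).const_mul (a + c)).mul_const (y x ^ 2)))
    (fun t ht x hx => by linear_combination (hk t ht x hx).2.2.2) hx1 hx2 hy
  refine ⟨β, β', l, l', g, g', h, h', hβ, hl, hg, hh, fun t ht x hx => (hk t ht x hx).2.1,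
    fun t ht x hx => (hk t ht x hx).2.2.1, fun t ht x hx => (hk t ht x hx).2.2.2,
    fun t ht x hx => ?_, fun t ht x hx => ?_, fun t ht x hx => ?_⟩ <;>
  obtain ⟨k1, k2, k3, k4⟩ := hk t ht x hx
  · have := s.eq1 t ht x hx
    rw [k2, k3] at this
    linear_combination -y' x * this - (E.φ x + 2 * κ) * k4
  · rw [← hlt t ht x hx, (eqs t ht x hx).2.1, k1]; ring
  · have := (eqs t ht x hx).2.2.2
    rw [k2, k3] at this
    linear_combination y' x * this - E.f x * hξt t ht x hx - q * κ * k4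

/-- `K = D + q` with `q ≠ 0` and nonconstant `f`: all symmetries are affine. -/
lemma allAff_of_span (hE : E.Nonlinear) (hD : ¬ ConstOn E.D E.J) (hf : ¬ ConstOn E.f E.I) {q : ℝ}
    (hq : q ≠ 0) (hK : ∀ u ∈ E.J, E.K u = E.D u + q) : E.AllAff := fun s₀ => by
  obtain ⟨a, b, c, s, hc, hs, hQ⟩ := exists_ok hE hD s₀
  obtain ⟨z, hz, hz0, inj, hB⟩ : ∃ z : ℝ → ℝ, (∀ x, HasDerivAt z (-z x) x) ∧ (∀ x, z x ≠ 0) ∧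
      InjOn z E.I ∧ Base 1 z (fun x => -z x) :=
    ⟨fun x => exp (-x), hasDerivAt_exp_neg, fun x => Real.exp_ne_zero _,
      by simpa using (base_exp 0).inj.injOn, by simpa using base_exp 0⟩
  obtain ⟨β, β', l, l', g, g', h, h', H⟩ := s.exists_coeffs hE hD hB (q := q) (by simpa using hK) hs
  obtain ⟨x1, hx1⟩ := hE.hI.2.2
  obtain ⟨t0, ht0⟩ := hE.hT.2.2
  have zero_deriv : ∀ {g g' : ℝ → ℝ}, (∀ t ∈ E.T, HasDerivAt g (g' t) t) → (∀ t ∈ E.T, g t = 0) →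
      ∀ t ∈ E.T, g' t = 0 := fun h h0 t ht => (h t ht).eq_zero_of_const hE.hT.1 ht h0
  have hβ0 : ∀ t ∈ E.T, β t = 0 := by
    by_contra! hne
    obtain ⟨t, ht, hβt⟩ := hne
    have hl1 : l' t ≠ 0 := fun hl => hf ⟨-q * β t / β' t, fun x hx => by
      have := H.e2 t ht x hx
      rw [hl] at this
      have e : E.f x * β' t = -q * β t := mul_right_cancel₀ (hz0 x) (by linear_combination this)
      rw [eq_div_iff fun h => mul_ne_zero (neg_ne_zero.2 hq) hβt (by rw [← e, h, mul_zero]), e]⟩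
    obtain ⟨k, hk⟩ : ∃ k, β' t = k * l' t := ⟨_, (div_mul_cancel₀ _ hl1).symm⟩
    obtain ⟨C, hC⟩ : ∃ C, -q * β t = C * l' t := ⟨_, (div_mul_cancel₀ _ hl1).symm⟩
    have hC0 : C ≠ 0 := fun h => mul_ne_zero (neg_ne_zero.2 hq) hβt (by rw [hC, h, zero_mul])
    have hfC : ∀ x ∈ E.I, E.f x * (k * z x + 1) = C * z x := fun x hx =>
      mul_left_cancel₀ hl1 (by linear_combination H.e2 t ht x hx - E.f x * z x * hk + z x * hC)
    have hφ : ∀ x ∈ E.I, E.φ x * (k * z x + 1) = -1 := fun x hx => by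
      have h1 := (((hE.hasDerivAt_f hx).mul (((hz x).const_mul k).add_const 1)).sub
        ((hz x).const_mul C)).eq_zero_of_const hE.hI.1 hx (c := 0) fun x hx => by
          simp [hfC x hx]
      rw [← hE.f_mul_φ hx] at h1
      have h2 := hfC x hx
      refine mul_left_cancel₀ (hE.f_ne x hx) (mul_left_cancel₀ (mul_ne_zero hC0 (hz0 x)) ?_)
      linear_combination C * z x * h1 + C * z x * h2
    have hh0 : ∀ t ∈ E.T, h t = 0 := fun t ht =>
      (cubic_eq_zero hE.hI inj (a := 2 * k * (a + c) * β t + k * (c * β t - 4 * (a + c) * β t))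
        (b := (a + c) * β t + 2 * k * g t + c * β t - 4 * (a + c) * β t
          + k * (c * l t + s.τ' t - 2 * g t))
        (c := g t + 2 * k * h t + (c * l t + s.τ' t - 2 * g t)) fun x hx => by
          linear_combination (k * z x + 1) * H.e1 t ht x hx
            - ((a + c) * β t * z x ^ 2 + g t * z x + h t) * hφ x hx).2.2.2
    have hh'0 := zero_deriv H.hh hh0
    refine hl1 (zero_deriv H.hl (fun t ht => ?_) t ht)
    have := (cubic_eq_zero hE.hI inj (a := C * (a + c) * β' t + q * k * (c - (a + c)) * β t)
      (b := C * g' t + q * (k * c * l t + (c - (a + c)) * β t)) (c := q * (c * l t)) (d := 0)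
      fun x hx => by
        have h3 := H.e3 t ht x hx
        rw [hh0 t ht, hh'0 t ht] at h3
        linear_combination (k * z x + 1) * h3
          - ((a + c) * β' t * z x ^ 2 + g' t * z x) * hfC x hx).2.2.1
    exact zero_of_mul hc (zero_of_mul hq this)
  have hβ'0 := zero_deriv H.hβ hβ0
  have hl'0 : ∀ t ∈ E.T, l' t = 0 := fun t ht => zero_of_mul (hE.f_ne x1 hx1) (by
    simpa [hβ0 t ht, hβ'0 t ht] using H.e2 t ht x1 hx1)
  obtain ⟨k, hk⟩ : ∃ k, ∀ t ∈ E.T, l t = k :=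
    ⟨_, fun t ht => eq_of_deriv_eq_zero hE.hT H.hl hl'0 ht ht0⟩
  have r3 : ∀ t ∈ E.T, ∀ x ∈ E.I, E.f x * (g' t * z x + h' t) = -q * (c * k * z x + h t) :=
    fun t ht x hx => by
      have := H.e3 t ht x hx
      rw [hβ0 t ht, hβ'0 t ht, hk t ht] at this
      linear_combination this
  have hh0 : ∀ t ∈ E.T, h t = 0 := fun t ht => by
    by_contra hne
    have r4 : ∀ x ∈ E.I, E.f x * (E.φ x * (g' t * z x + h' t) - g' t * z x) = q * c * k * z x :=
      fun x hx => by
        have := (((hE.hasDerivAt_f hx).mul (((hz x).const_mul (g' t)).add_const (h' t))).sub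
          ((((hz x).const_mul (c * k)).add_const (h t)).const_mul (-q))).eq_zero_of_const
            hE.hI.1 hx (c := 0) fun x hx => by simp [r3 t ht x hx]
        rw [← hE.f_mul_φ hx] at this
        linear_combination this
    obtain ⟨m, hm⟩ : ∃ m, m = c * k + s.τ' t := ⟨_, rfl⟩
    have r5 := cubic_eq_zero hE.hI inj (a := c * k * g' t * (m + g t) - c * k * g t * g' t)
      (b := h t * g' t * (m + g t) + c * k * (m * h' t + 3 * h t * g' t)
        - c * k * (g t * h' t + h t * g' t)) (c := h t * (m * h' t + 3 * h t * g' t)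
        + 2 * c * k * h t * h' t - c * k * h t * h' t) (d := 2 * h t * h t * h' t) fun x hx => by
        have h1 := H.e1 t ht x hx
        rw [hβ0 t ht, hk t ht] at h1
        refine mul_left_cancel₀ hq ?_
        linear_combination (g' t * z x + h' t) * ((g t * z x + h t) * r4 x hx
          - E.f x * (g' t * z x + h' t) * h1 - E.f x * (g' t * z x + h' t) * z x * hm)
          + ((g' t * z x + h' t) * (m * z x + 2 * h t) + g' t * z x * (g t * z x + h t)) * r3 t ht x hx
    have hh' : h' t = 0 := zero_of_mul (mul_ne_zero (mul_ne_zero two_ne_zero hne) hne) r5.2.2.2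
    have hg' : g' t = 0 := by
      have := r5.2.2.1
      rw [hh'] at this
      exact zero_of_mul (mul_ne_zero (mul_ne_zero three_ne_zero hne) hne) (by linear_combination this)
    refine hne (lin_eq_zero hE.hI inj (b := c * k) fun x hx => zero_of_mul (neg_ne_zero.2 hq) ?_).2
    rw [← r3 t ht x hx, hg', hh']; ring
  have hh'0 := zero_deriv H.hh hh0
  have r6 : ∀ x ∈ E.I, E.f x * g' t0 = -q * c * k := fun x hx => mul_right_cancel₀ (hz0 x) (by
    have := r3 t0 ht0 x hx
    rw [hh0 t0 ht0, hh'0 t0 ht0] at this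
    linear_combination this)
  obtain rfl : k = 0 := by
    by_contra hk0
    have h0 : -q * c * k ≠ 0 := mul_ne_zero (mul_ne_zero (neg_ne_zero.2 hq) hc) hk0
    exact hf ⟨_, fun x hx => eq_div_of_mul_eq (right_ne_zero_of_mul (r6 x1 hx1 ▸ h0)) (r6 x hx)⟩
  have hl0 : ∀ t ∈ E.T, ∀ x ∈ E.I, s.l t x = 0 := fun t ht x hx => by
    rw [H.eq_l t ht x hx, hβ0 t ht, hk t ht]; ring
  have hξx : ∀ t ∈ E.T, ∀ x ∈ E.I, s.ξx t x = 0 := fun t ht x hx => by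
    have h1 := H.eq_ξ t ht x hx
    rw [hβ0 t ht, hh0 t ht] at h1
    have : s.ξ t x = -g t := mul_right_cancel₀ (hz0 x) (by linear_combination -h1)
    rw [H.eq_ξx t ht x hx, this, hβ0 t ht]; ring
  refine ⟨_, _, _, _, _, _, _, _, _, (s.affData hE hs (κ := 0) hl0 hξx fun t ht x hx => ?_).congr hQ⟩
  rw [(s.span_eqs hE hD (p := 1) (q := q) (by simpa using hK) hs t ht x hx).2.2.2, hl0 t ht x hx,
    hξx t ht x hx]
  ring

/-- `K = q ≠ 0` and nonconstant `f`: all symmetries are affine, except for `f ~ 1 / (x + δ)`. -/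
lemma allAff_of_const_K (hE : E.Nonlinear) (hD : ¬ ConstOn E.D E.J) (hf : ¬ ConstOn E.f E.I) {q : ℝ}
    (hq : q ≠ 0) (hK : ∀ u ∈ E.J, E.K u = q)
    (hfC : ¬ ∃ C δ : ℝ, C ≠ 0 ∧ ∀ x ∈ E.I, E.f x * (x + δ) = C) : E.AllAff := fun s₀ => by
  obtain ⟨a, b, c, s, hc, hs, hQ⟩ := exists_ok hE hD s₀
  have hK' : ∀ u ∈ E.J, E.K u = 0 * E.D u + q := by simpa using hK
  obtain ⟨β, β', l, l', g, g', h, h', H⟩ := s.exists_coeffs hE hD base_id hK' hs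
  obtain ⟨x1, hx1⟩ := hE.hI.2.2
  obtain ⟨t0, ht0⟩ := hE.hT.2.2
  have hmob : ∀ A B C : ℝ, C ≠ 0 → (∀ x ∈ E.I, E.f x * (A * x + B) = C) → False := by
    intro A B C hC h
    rcases eq_or_ne A 0 with rfl | hA
    · simp only [zero_mul, zero_add] at h
      exact hf ⟨_, fun x hx => eq_div_of_mul_eq (right_ne_zero_of_mul (h x1 hx1 ▸ hC)) (h x hx)⟩
    · exact hfC ⟨C / A, B / A, div_ne_zero hC hA, fun x hx => by
        have := h x hx; field_simp; linear_combination this⟩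
  have hβ0 : ∀ t ∈ E.T, β t = 0 := fun t ht => by
    by_contra hne
    exact hmob _ _ _ (mul_ne_zero hq hne) fun x hx => (H.e2 t ht x hx).trans (mul_one _)
  have hβ'0 : ∀ t ∈ E.T, β' t = 0 := fun t ht => (H.hβ t ht).eq_zero_of_const hE.hT.1 ht hβ0
  have hl'0 : ∀ t ∈ E.T, l' t = 0 := fun t ht => zero_of_mul (hE.f_ne x1 hx1) (by
    simpa [hβ0 t ht, hβ'0 t ht] using H.e2 t ht x1 hx1)
  have hl : ∀ t ∈ E.T, ∀ x ∈ E.I, s.l t x = l t0 := fun t ht x hx => by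
    rw [H.eq_l t ht x hx, hβ0 t ht, eq_of_deriv_eq_zero hE.hT H.hl hl'0 ht ht0]; ring
  have hA : ∀ t ∈ E.T, ∀ x ∈ E.I, s.ξx t x = c * l t0 := fun t ht x hx => by
    rw [H.eq_ξx t ht x hx, hβ0 t ht, ← eq_of_deriv_eq_zero hE.hT H.hl hl'0 ht ht0]
    by_contra hne
    refine hmob (g' t) (h' t) (q * (c * l t - g t)) (mul_ne_zero hq fun h => hne (by
      linear_combination -h)) fun y hy => ?_
    have := H.e3 t ht y hy
    rw [hβ0 t ht, hβ'0 t ht] at this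
    linear_combination this
  refine ⟨_, _, _, _, _, _, _, _, _, (s.affData hE hs (κ := 0) hl hA fun t ht x hx => ?_).congr hQ⟩
  rw [(s.span_eqs hE hD hK' hs t ht x hx).2.2.2, hl t ht x hx, hA t ht x hx]; ring

/-- The form of the symmetries for `K = 1`, `f = 1 / x`. -/
lemma WSol.form_inv (hE : E.Nonlinear) (hD : ¬ ConstOn E.D E.J)
    (hK : ∀ u ∈ E.J, E.K u = 1) (hf : EqOn E.f (fun x => x⁻¹) E.I) (s : WSol E a b c)
    (hs : s.Ok) : ∃ τ₀ κ L l : ℝ, L * (3 * (a + c) - c) = 0 ∧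
      (∀ t ∈ E.T, ∀ x ∈ E.I, s.l t x = L * exp t * x + l) ∧
      ∀ t ∈ E.T, ∀ x ∈ E.I, ∀ u ∈ E.J,
      s.Q (t, x, u) = (-κ * exp (-t) + τ₀,
        (a + c) * L * exp t * x ^ 2 + (c * l + κ * exp (-t)) * x,
        (L * exp t * x + l) * (a * u + b)) := by
  obtain ⟨β, β', l, l', g, g', h, h', H⟩ := s.exists_coeffs hE hD base_id (q := 1)
    (by simpa using hK) hs
  obtain ⟨t0, ht0⟩ := hE.hT.2.2
  have inj := injOn_id E.I
  have q2 : ∀ t ∈ E.T, β' t = 1 * β t ∧ l' t = 0 := fun t ht => by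
    obtain ⟨h1, h2⟩ := lin_eq_zero hE.hI (Y := fun x => x) inj (b := β' t - β t) (c := l' t) fun x hx => by
      have := H.e2 t ht x hx
      have h0 := (φ_inv hE hf x hx).1
      rw [hf hx] at this
      dsimp only at this
      field_simp at this
      linear_combination this
    exact ⟨by linear_combination h1, h2⟩
  obtain ⟨L, hL⟩ := exp_ode hE.hT H.hβ fun t ht => (q2 t ht).1
  simp only [one_mul] at hL
  have hlc : ∀ t ∈ E.T, l t = l t0 := fun t ht =>
    eq_of_deriv_eq_zero hE.hT H.hl (fun t ht => (q2 t ht).2) ht ht0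
  have q1 : ∀ t ∈ E.T, L * (3 * (a + c) - c) = 0 ∧ s.τ' t = g t - c * l t0 ∧ h t = 0 ∧
      g' t = -1 * (g t - c * l t0) := fun t ht => by
    obtain ⟨h1, h2, h3⟩ := quad_eq_zero hE.hI (Y := fun x => x) inj
      (a := exp t * (L * (3 * (a + c) - c))) (b := g t - s.τ' t - c * l t0) (c := -h t)
      fun x hx => by
        have h1 := H.e1 t ht x hx
        obtain ⟨h0, h2⟩ := φ_inv hE hf x hx
        rw [h2, hL t ht, hlc t ht] at h1
        field_simp at h1
        linear_combination h1
    obtain ⟨-, h4, -⟩ := quad_eq_zero hE.hI (Y := fun x => x) inj (a := (3 * (a + c) - c) * β t)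
      (b := g' t - (c * l t0 - g t)) (c := h' t) fun x hx => by
        have h1 := H.e3 t ht x hx
        have h0 := (φ_inv hE hf x hx).1
        rw [hf hx, (q2 t ht).1, hlc t ht] at h1
        dsimp only at h1
        field_simp at h1
        linear_combination h1
    exact ⟨zero_of_mul (Real.exp_ne_zero _) h1, by linarith, neg_eq_zero.1 h3, by linarith⟩
  obtain ⟨κ, hκ⟩ := exp_ode hE.hT (fun t ht => (H.hg t ht).sub_const (c * l t0))
    fun t ht => (q1 t ht).2.2.2
  simp only [neg_one_mul] at hκ
  obtain ⟨τ₀, hτ⟩ := eqOn_affine_of_hasDerivAt hE.hT (g := fun t => s.τ t + κ * exp (-t))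
    (k := 0) fun t ht => ((s.jτ t ht).add ((hasDerivAt_exp_neg t).const_mul κ)).congr_deriv
      (by rw [(q1 t ht).2.1]; linear_combination hκ t ht)
  have hl : ∀ t ∈ E.T, ∀ x ∈ E.I, s.l t x = L * exp t * x + l t0 := fun t ht x hx => by
    rw [H.eq_l t ht x hx, hL t ht, hlc t ht]
  refine ⟨τ₀, κ, L, l t0, (q1 t0 ht0).1, hl, fun t ht x hx u hu => ?_⟩
  have h1 := H.eq_ξ t ht x hx
  rw [hL t ht, (q1 t ht).2.2.1] at h1
  refine Prod.ext ?_ (Prod.ext ?_ ?_)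
  · simp only [WSol.Q, op]; linear_combination hτ t ht
  · simp only [WSol.Q, op]; linear_combination h1 + x * hκ t ht
  · simp only [WSol.Q, op, hl t ht x hx]

/-- The form of the symmetries for `K` proportional to `D`. -/
lemma WSol.form (hE : E.Nonlinear) (hD : ¬ ConstOn E.D E.J) {κ : ℝ} {y y' : ℝ → ℝ}
    (B : Base κ y y') (hK : ∀ u ∈ E.J, E.K u = κ * E.D u) (s : WSol E a b c) (hs : s.Ok) :
    ∃ τ₀ τ₁ β g₁ g₀ l₀ : ℝ, (∀ t ∈ E.T, ∀ x ∈ E.I, s.l t x = β * y x + l₀) ∧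
      (∀ t ∈ E.T, ∀ x ∈ E.I, ∀ u ∈ E.J, s.Q (t, x, u) = (τ₁ * t + τ₀,
        ((a + c) * β * y x ^ 2 + g₁ * y x + g₀) / y' x, (β * y x + l₀) * (a * u + b))) ∧
      ∀ x ∈ E.I, ((a + c) * β * y x ^ 2 + g₁ * y x + g₀) * ((E.φ x + 2 * κ) / y' x) =
        c * l₀ + τ₁ - (4 * a + 3 * c) * β * y x - 2 * g₁ := by
  obtain ⟨β, β', l, l', g, g', h, h', H⟩ := s.exists_coeffs hE hD B (q := 0) (by simpa using hK) hs
  obtain ⟨x0, hx0⟩ := hE.hI.2.2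
  obtain ⟨t0, ht0⟩ := hE.hT.2.2
  have z2 : ∀ t ∈ E.T, β' t = 0 ∧ l' t = 0 := fun t ht =>
    lin_eq_zero hE.hI B.inj.injOn fun x hx => zero_of_mul (hE.f_ne x hx)
      (by simpa using H.e2 t ht x hx)
  have z3 : ∀ t ∈ E.T, g' t = 0 ∧ h' t = 0 := fun t ht =>
    lin_eq_zero hE.hI B.inj.injOn fun x hx => zero_of_mul (hE.f_ne x hx)
      (by simpa [(z2 t ht).1] using H.e3 t ht x hx)
  have k : ∀ t ∈ E.T, β t = β t0 ∧ l t = l t0 ∧ g t = g t0 ∧ h t = h t0 := fun t ht =>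
    ⟨eq_of_deriv_eq_zero hE.hT H.hβ (fun t ht => (z2 t ht).1) ht ht0,
      eq_of_deriv_eq_zero hE.hT H.hl (fun t ht => (z2 t ht).2) ht ht0,
      eq_of_deriv_eq_zero hE.hT H.hg (fun t ht => (z3 t ht).1) ht ht0,
      eq_of_deriv_eq_zero hE.hT H.hh (fun t ht => (z3 t ht).2) ht ht0⟩
  have hτ' : ∀ t ∈ E.T, s.τ' t = s.τ' t0 := fun t ht => by
    have h1 := H.e1 t ht x0 hx0
    obtain ⟨k1, k2, k3, k4⟩ := k t ht
    rw [k1, k2, k3, k4, H.e1 t0 ht0 x0 hx0] at h1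
    linarith [mul_left_cancel₀ (B.ne x0) h1]
  obtain ⟨τ₀, hτ⟩ := eqOn_affine_of_hasDerivAt hE.hT (fun t ht => hτ' t ht ▸ s.jτ t ht)
  refine ⟨τ₀, s.τ' t0, β t0, g t0, h t0, l t0, fun t ht x hx => by
    rw [H.eq_l t ht x hx, (k t ht).1, (k t ht).2.1], fun t ht x hx u hu => ?_, fun x hx => ?_⟩
  · obtain ⟨k1, k2, k3, k4⟩ := k t ht
    simp only [WSol.Q, op, hτ t ht, eq_div_of_mul_eq (B.ne x) (H.eq_ξ t ht x hx),
      H.eq_l t ht x hx, k1, k2, k3, k4]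
  · rw [← mul_div_assoc, H.e1 t0 ht0 x hx, mul_div_cancel_left₀ _ (B.ne x)]; ring

end Span

/-! ### Reduction to the list -/

/-- Either the algebra is minimal, or the equation is equivalent to an entry of the list whose
operators form a basis. -/
def Eqn.Classified (E : Eqn) : Prop := ∀ hE : E.Nonlinear,
  Module.rank ℝ (E.alg hE) ≤ (1 : ℕ) ∨
  ∃ (c : Case) (E' : Eqn), c ≠ Case.c1_1 ∧ E'.Nonlinear ∧ c.Entry E' ∧ c.Normalized ∧
    Equivalent E E' ∧ E'.IsBasis c.ops

lemma Eqn.Classified.of_gEquiv (h : GEquiv E E') (hE : E.Nonlinear) (hc : E'.Classified) :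
    E.Classified := fun _ => by
  obtain ⟨a, b, p, q, r, s, m, h'⟩ := gEquiv_iff.1 h
  have hE' := h'.symm.nonlinear hE
  rcases hc hE' with h1 | ⟨c, E'', h1, h2, h3, h4, h5, h6⟩
  · exact .inl ((h.rank_eq hE hE').trans_le h1)
  · exact .inr ⟨c, E'', h1, h2, h3, h4, h.equivalent.trans h5, h6⟩

lemma Eqn.Nonlinear.classified_of_entry (hE : E.Nonlinear) {c : Case} (hc : c ≠ Case.c1_1)
    (hN : c.Normalized) (he : c.Entry E) (hr : Module.rank ℝ (E.alg hE) ≤ c.ops.length) :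
    E.Classified := fun _ =>
  let ⟨h1, h2⟩ := ops_spec hE c he
  .inr ⟨c, E, hc, hE, he, hN, (GEquiv.refl E).equivalent, isBasis_of_rank hE h1 h2 hr⟩

lemma classified_of_gEquiv (hE : E.Nonlinear) (h : GEquiv E E') {c : Case} (hc : c ≠ Case.c1_1)
    (hN : c.Normalized) (he : c.Entry E') (hr : Module.rank ℝ (E.alg hE) ≤ c.ops.length) :
    E.Classified :=
  let ⟨_, _, _, _, _, _, _, h'⟩ := gEquiv_iff.1 h
  have hE' := h'.symm.nonlinear hE
  .of_gEquiv h hE (hE'.classified_of_entry hc hN he ((h.rank_eq hE hE').symm.trans_le hr))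

lemma exists_gRel (hE : E.Nonlinear) {a p r m : ℝ} (q s : ℝ) (ha : a ≠ 0) (hp : p ≠ 0) (hr : r ≠ 0)
    (hm : m ≠ 0) : ∃ E', E'.Nonlinear ∧ GRel E E' a 0 p q r s m :=
  ⟨_, (E.act_rel ha hp hr hm 0 q s).symm.nonlinear hE, E.act_rel ha hp hr hm 0 q s⟩

lemma classified_of_translation (hE : E.Nonlinear) {c : Case} (hc : c ≠ Case.c1_1)
    (hN : c.Normalized) {C : ℝ} (hC : C ≠ 0) (q : ℝ) {g : ℝ → ℝ} (hg : ∀ x ∈ E.I, E.f x = C * g x)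
    (hr : Module.rank ℝ (E.alg hE) ≤ c.ops.length)
    (he : ∀ T I f, (∀ x ∈ I, x - q ∈ E.I) → (∀ x ∈ I, f x = g (x - q)) →
      c.Entry { E with T := T, I := I, f := f }) : E.Classified := by
  refine classified_of_gEquiv hE (GRel.gEquiv (a := C⁻¹) (b := 0) (p := 1) (q := q) (r := 1) (s := 0)
    (m := 1) ⟨inv_ne_zero hC, one_ne_zero, one_ne_zero, one_ne_zero, fun t => ?_, fun x => ?_,
      by simp, fun x _ => ?_, by simp, by simp⟩) hc hN
    (he {t | C * t ∈ E.T} {x | x - q ∈ E.I} (fun x => C⁻¹ * E.f (x - q)) (fun _ h => h) fun x hx => by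
      rw [hg _ hx, inv_mul_cancel_left₀ hC]) hr
  · simp [hC]
  · simp
  · simp

lemma Eqn.Nonlinear.f_eq_mul (hE : E.Nonlinear) {g : ℝ → ℝ} (h0 : ∀ x ∈ E.I, g x ≠ 0)
    (hg : ∀ x ∈ E.I, HasDerivAt g (E.φ x * g x) x) : ∃ C ≠ 0, ∀ x ∈ E.I, E.f x = C * g x := by
  obtain ⟨x₀, h₀⟩ := hE.hI.2.2
  refine ⟨E.f x₀ / g x₀, div_ne_zero (hE.f_ne _ h₀) (h0 _ h₀), fun x hx => ?_⟩
  have := eq_of_deriv_eq_zero hE.hI (g := fun x => E.f x / g x) (fun x hx =>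
    (hE.hasDerivAt_f hx).div (hg x hx) (h0 x hx)) (fun x hx => by
      rw [← hE.f_mul_φ hx]; ring) hx h₀
  rw [← this, div_mul_cancel₀ _ (h0 x hx)]

lemma Eqn.Nonlinear.exists_pos (hE : E.Nonlinear) : ∃ a : ℝ, a ≠ 0 ∧ ∀ x ∈ E.I, 0 < a * E.f x := by
  obtain ⟨x₀, h₀⟩ := hE.hI.2.2
  refine ⟨E.f x₀, hE.f_ne _ h₀, fun x hx => ?_⟩
  by_contra h
  have hc : ContinuousOn (fun x => E.f x₀ * E.f x) E.I :=
    continuousOn_const.mul hE.smooth_f.continuousOn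
  obtain ⟨y, hy, h0⟩ := hE.hI.preconnected.intermediate_value hx h₀ hc
    ⟨not_lt.1 h, mul_self_nonneg _⟩
  exact mul_ne_zero (hE.f_ne _ h₀) (hE.f_ne _ hy) h0

lemma classified_of_f_exp (hE : E.Nonlinear) {ε C : ℝ} (hC : C ≠ 0)
    (hf : ∀ x ∈ E.I, E.f x = C * exp (ε * x)) (hr : Module.rank ℝ (E.alg hE) ≤ (2 : ℕ)) :
    E.Classified := by
  by_cases h0 : ε = 0
  · exact classified_of_translation hE (c := .c1_2a 0) (by simp) (.inl rfl) hC 0 hf hr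
      fun T I f _ hf x hx => by simp [hf x hx, h0]
  · obtain ⟨E', hE', h⟩ := exists_gRel hE (a := ε ^ 2 / C) 0 0 (div_ne_zero (pow_ne_zero 2 h0) hC) h0
      one_ne_zero one_ne_zero
    refine classified_of_gEquiv hE h.gEquiv (c := .c1_2a 1) (by simp) (.inr rfl) (fun x hx => ?_) hr
    obtain ⟨y, hy, rfl⟩ := h.exI hx
    rw [h.hf y hy, hf y hy]
    simp only [one_mul, add_zero]
    field_simp

/-! ### Symmetries for `K = 0` and `K = D` -/

section Relation
variable {S : Set ℝ} (hS : IsOpenInterval S) {Y ψ : ℝ → ℝ} (hY : InjOn Y S)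
  (hψ : ContinuousOn ψ S)

/-- The relation `(n β Y² + g₁ Y + g₀) ψ = A - k β Y - 2 g₁`. -/
def QuadRel (S : Set ℝ) (Y ψ : ℝ → ℝ) (n k A β g₁ g₀ : ℝ) : Prop :=
  ∀ x ∈ S, (n * β * Y x ^ 2 + g₁ * Y x + g₀) * ψ x = A - k * β * Y x - 2 * g₁

include hS hY

lemma QuadRel.of_zero (h0 : ∀ x ∈ S, ψ x = 0) {n k A β g₁ g₀ : ℝ}
    (h : QuadRel S Y ψ n k A β g₁ g₀) : k * β = 0 ∧ A = 2 * g₁ := by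
  have := lin_eq_zero hS hY (b := k * β) (c := 2 * g₁ - A) fun x hx => by
    have := h x hx; rw [h0 x hx] at this; linear_combination this
  exact ⟨this.1, by linarith [this.2]⟩

lemma QuadRel.of_const {γ : ℝ} (hγ : ∀ x ∈ S, ψ x = γ) {n k A β g₁ g₀ : ℝ}
    (h : QuadRel S Y ψ n k A β g₁ g₀) :
    n * β * γ = 0 ∧ g₁ * γ + k * β = 0 ∧ g₀ * γ = A - 2 * g₁ := by
  have := quad_eq_zero hS hY (a := n * β * γ) (b := g₁ * γ + k * β) (c := g₀ * γ - (A - 2 * g₁))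
    fun x hx => by have := h x hx; rw [hγ x hx] at this; linear_combination this
  exact ⟨this.1, this.2.1, by linarith [this.2.2]⟩

lemma QuadRel.of_inv {σ δ : ℝ} (hσ : ∀ x ∈ S, Y x + δ ≠ 0 ∧ ψ x = σ / (Y x + δ)) {n k A β g₁ g₀ : ℝ}
    (h : QuadRel S Y ψ n k A β g₁ g₀) :
    (n * σ + k) * β = 0 ∧ g₁ * σ = A - 2 * g₁ - k * β * δ ∧ g₀ * σ = (A - 2 * g₁) * δ := by
  have := quad_eq_zero hS hY (a := (n * σ + k) * β) (b := g₁ * σ - (A - 2 * g₁ - k * β * δ))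
    (c := g₀ * σ - (A - 2 * g₁) * δ) fun x hx => by
      have := h x hx; have h0 := (hσ x hx).1
      rw [(hσ x hx).2] at this; field_simp at this; linear_combination this
  exact ⟨this.1, by linarith [this.2.1], by linarith [this.2.2]⟩

omit hY in
lemma QuadRel.of_quad_zero {n k A : ℝ} (h : QuadRel S Y ψ n k A 0 0 0) : A = 0 := by
  obtain ⟨x, hx⟩ := hS.2.2
  have := h x hx; simpa using this.symm

include hψ

lemma linRel_cases (n k : ℝ) : (∀ x ∈ S, ψ x = 0) ∨ (∃ γ ≠ 0, ∀ x ∈ S, ψ x = γ) ∨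
    (∃ σ δ, σ ≠ 0 ∧ ∀ x ∈ S, Y x + δ ≠ 0 ∧ ψ x = σ / (Y x + δ)) ∨
    ∀ A g₁ g₀, QuadRel S Y ψ n k A 0 g₁ g₀ → A = 0 ∧ g₁ = 0 ∧ g₀ = 0 := by
  by_cases h : ∀ A g₁ g₀, QuadRel S Y ψ n k A 0 g₁ g₀ → A = 0 ∧ g₁ = 0 ∧ g₀ = 0
  · exact .inr (.inr (.inr h))
  push Not at h
  obtain ⟨A, g₁, g₀, h, hg⟩ := h
  by_cases h1 : g₁ = 0
  · subst h1
    have h0 : g₀ ≠ 0 := fun h0 => by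
      subst h0; exact hg (h.of_quad_zero hS) rfl rfl
    have e : ∀ x ∈ S, ψ x = A / g₀ := fun x hx => by
      have := h x hx; field_simp; linear_combination this
    by_cases hA : A / g₀ = 0
    · exact .inl fun x hx => (e x hx).trans hA
    · exact .inr (.inl ⟨_, hA, e⟩)
  · have e : ∀ x ∈ S, (Y x + g₀ / g₁) * ψ x = (A - 2 * g₁) / g₁ := fun x hx => by
      have := h x hx; field_simp; linear_combination this
    by_cases hA : (A - 2 * g₁) / g₁ = 0
    · exact .inl (eq_zero_of_injOn_mul hS.1 hY hψ fun x hx => (e x hx).trans hA)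
    · refine .inr (.inr (.inl ⟨_, g₀ / g₁, hA, fun x hx => ?_⟩))
      have h0 : Y x + g₀ / g₁ ≠ 0 := fun h0 => hA (by rw [← e x hx, h0, zero_mul])
      exact ⟨h0, by rw [eq_div_iff h0, ← e x hx]; ring⟩

lemma quadRel_cases (hYc : ContinuousOn Y S) {n k : ℝ} (hnk : n ≠ 0 ∨ k ≠ 0) : (∀ x ∈ S, ψ x = 0) ∨
    (n ≠ 0 ∧ k ≠ 0 ∧ ∃ δ, ∀ x ∈ S, Y x + δ ≠ 0 ∧ ψ x = -(k / n) / (Y x + δ)) ∨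
    (n = 0 ∧ ∃ γ ≠ 0, ∀ x ∈ S, ψ x = γ) ∨
    (∃ A β g₁ g₀, QuadRel S Y ψ n k A β g₁ g₀ ∧
      (∀ x ∈ S, n * β * Y x ^ 2 + g₁ * Y x + g₀ ≠ 0) ∧
      ∀ A' β' g₁' g₀', QuadRel S Y ψ n k A' β' g₁' g₀' →
        ∃ κ, A' = κ * A ∧ β' = κ * β ∧ g₁' = κ * g₁ ∧ g₀' = κ * g₀) ∨
    ∀ A β g₁ g₀, QuadRel S Y ψ n k A β g₁ g₀ → A = 0 ∧ β = 0 ∧ g₁ = 0 ∧ g₀ = 0 := by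
  rcases linRel_cases hS hY hψ n k with h | ⟨γ, hγ, h⟩ | ⟨σ, δ, hσ, h⟩ | h
  · exact .inl h
  · by_cases hn : n = 0
    · exact .inr (.inr (.inl ⟨hn, γ, hγ, h⟩))
    · refine .inr (.inr (.inr (.inl ⟨γ, 0, 0, 1, fun x hx => ?_, fun x _ => by simp,
        fun A β g₁ g₀ hR => ?_⟩)))
      · rw [h x hx]; ring
      · obtain ⟨h1, h2, h3⟩ := hR.of_const hS hY h
        have hβ : β = 0 := by simpa [hn, hγ] using h1
        subst hβ
        have hg : g₁ = 0 := by simpa [hγ] using h2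
        exact ⟨g₀, by rw [h3, hg]; ring, by ring, by rw [hg]; ring, by ring⟩
  · by_cases hn : n * σ + k = 0
    · have hn0 : n ≠ 0 := fun h0 => by simp [h0] at hn hnk; exact hnk hn
      have hk0 : k ≠ 0 := fun h0 => by simp [h0, hn0, hσ] at hn
      refine .inr (.inl ⟨hn0, hk0, δ, fun x hx => ⟨(h x hx).1, (h x hx).2.trans ?_⟩⟩)
      congr 1; field_simp; linear_combination hn
    · refine .inr (.inr (.inr (.inl ⟨2 + σ, 0, 1, δ, fun x hx => ?_, fun x hx => ?_,
        fun A β g₁ g₀ hR => ?_⟩)))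
      · have := (h x hx).1; rw [(h x hx).2]; field_simp; ring
      · simpa using (h x hx).1
      · obtain ⟨h1, h2, h3⟩ := hR.of_inv hS hY h
        have hβ : β = 0 := by simpa [hn] using h1
        subst hβ
        refine ⟨g₁, by linarith, by ring, by ring, mul_right_cancel₀ hσ ?_⟩
        rw [h3]; linear_combination -δ * h2
  · by_cases hR : ∃ A g₁ g₀, QuadRel S Y ψ n k A 1 g₁ g₀
    · obtain ⟨A, g₁, g₀, hR⟩ := hR
      refine .inr (.inr (.inr (.inl ⟨A, 1, g₁, g₀, hR, fun x₀ h₀ hz => ?_,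
        fun A' β' g₁' g₀' hR' => ?_⟩)))
      · have e0 := hR x₀ h₀
        rw [hz] at e0
        have e : ∀ x ∈ S, (Y x + -Y x₀) * ((n * Y x + (g₁ + n * Y x₀)) * ψ x + k) = 0 :=
          fun x hx => by linear_combination hR x hx - e0 - ψ x * hz
        have e' : ∀ x ∈ S, (n * Y x + (g₁ + n * Y x₀)) * ψ x + k = 0 := eq_zero_of_injOn_mul hS.1 hY (((continuousOn_const.mul hYc).add
          continuousOn_const).mul hψ |>.add continuousOn_const) e
        obtain ⟨-, h2, h3⟩ := h (2 * n - k) n (g₁ + n * Y x₀) fun x hx => by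
          linear_combination e' x hx
        subst h2
        obtain ⟨h4, -, -⟩ := h (-k) 0 0 fun x hx => by
          have := e' x hx; simp only [h3] at this; linear_combination this
        simp at h4
        simp [h4] at hnk
      · have := h (A' - β' * A) (g₁' - β' * g₁) (g₀' - β' * g₀) fun x hx => by
          linear_combination hR' x hx - β' * hR x hx
        exact ⟨β', by linarith [this.1], by ring, by linarith [this.2.1], by linarith [this.2.2]⟩
    · refine .inr (.inr (.inr (.inr fun A β g₁ g₀ hR' => ?_)))
      have hβ : β = 0 := by
        by_contra hβ
        refine hR ⟨A / β, g₁ / β, g₀ / β, fun x hx => ?_⟩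
        have := hR' x hx
        field_simp; linear_combination this
      subst hβ
      obtain ⟨h1, h2, h3⟩ := h A g₁ g₀ hR'
      exact ⟨h1, rfl, h2, h3⟩

end Relation

section Base
variable {κ : ℝ} {y y' : ℝ → ℝ} (B : Base κ y y') (hE : E.Nonlinear)
include B hE

lemma Base.continuousOn_ψ : ContinuousOn (fun x => (E.φ x + 2 * κ) / y' x) E.I :=
  (hE.continuousOn_φ.add continuousOn_const).div
    (fun x _ => (B.hy' x).continuousAt.continuousWithinAt) fun x _ => B.ne x

omit hE in
lemma Base.eq_mul_of_ψ {x c : ℝ} (h : (E.φ x + 2 * κ) / y' x = c) : E.φ x + 2 * κ = y' x * c := by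
  rw [← h, mul_div_cancel₀ _ (B.ne x)]

lemma Base.f_eq {g g' : ℝ → ℝ} (hg : ∀ x ∈ E.I, g (y x) ≠ 0 ∧
      HasDerivAt g (g' (y x) * g (y x)) (y x) ∧ (E.φ x + 2 * κ) / y' x = g' (y x)) :
    ∃ C ≠ 0, ∀ x ∈ E.I, E.f x = C * (y' x ^ 2 * g (y x)) :=
  hE.f_eq_mul (fun x hx => mul_ne_zero (pow_ne_zero 2 (B.ne x)) (hg x hx).1) fun x hx => by
    obtain ⟨-, h1, h2⟩ := hg x hx
    refine (((B.hy' x).pow 2).mul (h1.comp x (B.hy x))).congr_deriv ?_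
    rw [eq_sub_of_add_eq (B.eq_mul_of_ψ h2), Function.comp, Pi.pow_apply]
    push_cast
    ring

lemma Base.f_const (h : ∀ x ∈ E.I, (E.φ x + 2 * κ) / y' x = 0) :
    ∃ C ≠ 0, ∀ x ∈ E.I, E.f x = C * y' x ^ 2 := by
  simpa using B.f_eq hE (g := fun _ => 1) (g' := fun _ => 0) fun x hx =>
    ⟨one_ne_zero, by simpa using hasDerivAt_const _ _, h x hx⟩

lemma Base.f_exp {γ : ℝ} (h : ∀ x ∈ E.I, (E.φ x + 2 * κ) / y' x = γ) :
    ∃ C ≠ 0, ∀ x ∈ E.I, E.f x = C * (y' x ^ 2 * exp (γ * y x)) :=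
  B.f_eq hE (g := fun y => exp (γ * y)) (g' := fun _ => γ) fun x hx =>
    ⟨Real.exp_ne_zero _, hasDerivAt_exp_mul γ _, h x hx⟩

lemma Base.f_abs_rpow {σ : ℝ} (h : ∀ x ∈ E.I, y x ≠ 0 ∧ (E.φ x + 2 * κ) / y' x = σ / y x) :
    ∃ C ≠ 0, ∀ x ∈ E.I, E.f x = C * (y' x ^ 2 * |y x| ^ σ) :=
  B.f_eq hE (g := fun y => |y| ^ σ) (g' := fun y => σ / y) fun x hx =>
    ⟨(Real.rpow_pos_of_pos (abs_pos.2 (h x hx).1) _).ne', hasDerivAt_abs_rpow (h x hx).1 σ, (h x hx).2⟩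

lemma Base.f_zpow {n : ℤ} (h : ∀ x ∈ E.I, y x ≠ 0 ∧ (E.φ x + 2 * κ) / y' x = n / y x) :
    ∃ C ≠ 0, ∀ x ∈ E.I, E.f x = C * (y' x ^ 2 * y x ^ n) :=
  B.f_eq hE (g := fun y => y ^ n) (g' := fun y => n / y) fun x hx =>
    ⟨zpow_ne_zero n (h x hx).1, hasDerivAt_zpow_self (h x hx).1 n, (h x hx).2⟩

lemma Base.linear_cases (hD : ¬ ConstOn E.D E.J) (hK : ∀ u ∈ E.J, E.K u = κ * E.D u) (h : E.Rigid) :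
    ((∃ C ≠ 0, ∀ x ∈ E.I, E.f x = C * y' x ^ 2) ∧ Module.rank ℝ (E.alg hE) ≤ (3 : ℕ)) ∨
    ((∃ γ ≠ 0, ∃ C ≠ 0, ∀ x ∈ E.I, E.f x = C * (y' x ^ 2 * exp (γ * y x))) ∧
      Module.rank ℝ (E.alg hE) ≤ (2 : ℕ)) ∨
    ((∃ σ δ : ℝ, σ ≠ 0 ∧ ∃ C ≠ 0, ∀ x ∈ E.I, E.f x = C * (y' x ^ 2 * |y x + δ| ^ σ)) ∧
      Module.rank ℝ (E.alg hE) ≤ (2 : ℕ)) ∨ Module.rank ℝ (E.alg hE) ≤ (1 : ℕ) := by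
  have hY : InjOn y E.I := B.inj.injOn
  have hψ := B.continuousOn_ψ hE
  have h : ∀ s : Sol E, ∃ τ₀ A g₁ g₀ : ℝ, QuadRel E.I y (fun x => (E.φ x + 2 * κ) / y' x) 1 3 A 0 g₁ g₀ ∧ ∀ t ∈ E.T, ∀ x ∈ E.I,
      ∀ u ∈ E.J, s.Q (t, x, u) = (A * t + τ₀, (g₁ * y x + g₀) / y' x, 0) := fun s => by
    obtain ⟨r, hl, hr⟩ := exists_wSol_of_rigid hE h s
    obtain ⟨τ₀, τ₁, β, g₁, g₀, l₀, h1, hQ, hf⟩ := r.form hE hD B hK (.inr fun t _ x _ => hl t x)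
    obtain ⟨t₀, ht⟩ := hE.hT.2.2
    obtain ⟨rfl, rfl⟩ := lin_eq_zero hE.hI hY fun x hx => by rw [← h1 t₀ ht x hx, hl]
    refine ⟨τ₀, τ₁, g₁, g₀, fun x hx => by linear_combination hf x hx, fun t ht x hx u hu => ?_⟩
    rw [hr ⟨ht, hx, hu⟩, hQ t ht x hx u hu]; simp
  rcases linRel_cases hE.hI hY hψ 1 3 with h0 | ⟨γ, hγ, h0⟩ | ⟨σ, δ, hσ, h0⟩ | h0
  · refine .inl ⟨B.f_const hE h0, rank_le_three hE (q₁ := op fun t x _ => (2 * t, y x / y' x, 0))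
      (q₂ := op fun _ x _ => (0, 1 / y' x, 0)) fun s => ?_⟩
    obtain ⟨τ₀, A, g₁, g₀, hR, hQ⟩ := h s
    refine ⟨τ₀, g₁, g₀, fun t ht x hx u hu => (hQ t ht x hx u hu).trans ?_⟩
    rw [(hR.of_zero hE.hI hY h0).2]
    ext <;> simp [op] <;> ring
  · refine .inr (.inl ⟨⟨γ, hγ, B.f_exp hE h0⟩, rank_le_two hE (q₁ := op fun t x _ => (γ * t, 1 / y' x, 0))
      fun s => ?_⟩)
    obtain ⟨τ₀, A, g₁, g₀, hR, hQ⟩ := h s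
    refine ⟨τ₀, g₀, fun t ht x hx u hu => (hQ t ht x hx u hu).trans ?_⟩
    obtain ⟨-, h1, h2⟩ := hR.of_const hE.hI hY h0
    have : g₁ = 0 := by simpa [hγ] using h1
    rw [show A = g₀ * γ by rw [h2, this]; ring, this]
    ext <;> simp [op] <;> ring
  · refine .inr (.inr (.inl ⟨⟨σ, δ, hσ, (B.add δ).f_abs_rpow hE h0⟩, rank_le_two hE
      (q₁ := op fun t x _ => ((2 + σ) * t, (y x + δ) / y' x, 0)) fun s => ?_⟩))
    obtain ⟨τ₀, A, g₁, g₀, hR, hQ⟩ := h s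
    refine ⟨τ₀, g₁, fun t ht x hx u hu => (hQ t ht x hx u hu).trans ?_⟩
    obtain ⟨-, h1, h2⟩ := hR.of_inv hE.hI hY h0
    have e : g₀ = δ * g₁ := mul_right_cancel₀ hσ (by rw [h2]; linear_combination -δ * h1)
    rw [show A = (2 + σ) * g₁ by linarith, e]
    ext <;> simp [op] <;> ring
  · refine .inr (.inr (.inr (rank_le_one hE fun s => ?_)))
    obtain ⟨τ₀, A, g₁, g₀, hR, hQ⟩ := h s
    obtain ⟨h1, h2, h3⟩ := h0 A g₁ g₀ hR
    exact ⟨τ₀, fun t ht x hx u hu => (hQ t ht x hx u hu).trans (by simp [h1, h2, h3])⟩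

lemma Base.quadratic_cases (hD : ¬ ConstOn E.D E.J) (hK : ∀ u ∈ E.J, E.K u = κ * E.D u) {a b c : ℝ}
    (hc : c ≠ 0) (h : E.DEq a b c) :
    ((∃ C ≠ 0, ∀ x ∈ E.I, E.f x = C * y' x ^ 2) ∧ Module.rank ℝ (E.alg hE) ≤ (5 : ℕ) ∧
      (4 * a + 3 * c ≠ 0 → Module.rank ℝ (E.alg hE) ≤ (4 : ℕ))) ∨
    (a + c ≠ 0 ∧ 4 * a + 3 * c ≠ 0 ∧
      (∃ δ, ∀ x ∈ E.I, y x + δ ≠ 0 ∧ (E.φ x + 2 * κ) / y' x = -((4 * a + 3 * c) / (a + c)) / (y x + δ)) ∧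
      Module.rank ℝ (E.alg hE) ≤ (4 : ℕ)) ∨
    (a + c = 0 ∧ (∃ γ, ∃ C ≠ 0, ∀ x ∈ E.I, E.f x = C * (y' x ^ 2 * exp (γ * y x))) ∧ Module.rank ℝ (E.alg hE) ≤ (4 : ℕ)) ∨
    ((∃ A β g₁ g₀, ∀ x ∈ E.I, (a + c) * β * y x ^ 2 + g₁ * y x + g₀ ≠ 0 ∧
      ((a + c) * β * y x ^ 2 + g₁ * y x + g₀) * ((E.φ x + 2 * κ) / y' x) =
        A - (4 * a + 3 * c) * β * y x - 2 * g₁) ∧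
      Module.rank ℝ (E.alg hE) ≤ (3 : ℕ)) ∨
    Module.rank ℝ (E.alg hE) ≤ (2 : ℕ) := by
  have hY : InjOn y E.I := B.inj.injOn
  have hψ := B.continuousOn_ψ hE
  have h : ∀ s : Sol E, ∃ τ₀ τ₁ A β g₁ g₀ : ℝ, QuadRel E.I y (fun x => (E.φ x + 2 * κ) / y' x) (a + c) (4 * a + 3 * c) A β g₁ g₀ ∧
      ∀ t ∈ E.T, ∀ x ∈ E.I, ∀ u ∈ E.J, s.Q (t, x, u) = (τ₁ * t + τ₀, ((a + c) * β * y x ^ 2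
        + g₁ * y x + g₀) / y' x, (β * y x + (A - τ₁) / c) * (a * u + b)) := fun s => by
    obtain ⟨r, hr⟩ := exists_wSol hE hc h s
    obtain ⟨τ₀, τ₁, β, g₁, g₀, l₀, -, hQ, hf⟩ := r.form hE hD B hK (.inl ⟨h, h.ne_zero hE hc⟩)
    refine ⟨τ₀, τ₁, c * l₀ + τ₁, β, g₁, g₀, hf, fun t ht x hx u hu => ?_⟩
    rw [hr ⟨ht, hx, hu⟩, hQ t ht x hx u hu, add_sub_cancel_right, mul_div_cancel_left₀ _ hc]
  have hnk : a + c ≠ 0 ∨ 4 * a + 3 * c ≠ 0 := by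
    by_contra! h
    exact hc (by linarith)
  let q₁ : VField := op fun t _ u => (t, 0, -(a * u + b) / c)
  rcases quadRel_cases hE.hI hY hψ B.smooth.continuous.continuousOn hnk with h0 | ⟨hn, hk, δ, h0⟩ | ⟨hn, γ, hγ, h0⟩ |
    ⟨A₀, β₀, m₁, m₀, hR₀, hP, h0⟩ | h0
  · refine .inl ⟨B.f_const hE h0, rank_le_five hE (q₁ := q₁)
      (q₂ := op fun t x u => (0, y x / y' x, 2 / c * (a * u + b)))
      (q₃ := op fun _ x _ => (0, 1 / y' x, 0))
      (q₄ := op fun _ x u => (0, ((a + c) * y x ^ 2) / y' x, y x * (a * u + b))) fun s => ?_,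
      fun hk => rank_le_four hE (q₁ := q₁)
      (q₂ := op fun t x u => (0, y x / y' x, 2 / c * (a * u + b)))
      (q₃ := op fun _ x _ => (0, 1 / y' x, 0)) fun s => ?_⟩
    · obtain ⟨τ₀, τ₁, A, β, g₁, g₀, hR, hQ⟩ := h s
      refine ⟨τ₀, τ₁, g₁, g₀, β, fun t ht x hx u hu => (hQ t ht x hx u hu).trans ?_⟩
      rw [(hR.of_zero hE.hI hY h0).2]
      ext <;> simp [op, q₁] <;> ring
    · obtain ⟨τ₀, τ₁, A, β, g₁, g₀, hR, hQ⟩ := h s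
      refine ⟨τ₀, τ₁, g₁, g₀, fun t ht x hx u hu => (hQ t ht x hx u hu).trans ?_⟩
      obtain ⟨h1, h2⟩ := hR.of_zero hE.hI hY h0
      rw [h2, (mul_eq_zero.1 h1).resolve_left hk]
      ext <;> simp [op, q₁] <;> ring
  · refine .inr (.inl ⟨hn, hk, ⟨δ, h0⟩, rank_le_four hE (q₁ := q₁)
      (q₂ := op fun t x u => (0, (y x + δ) / y' x,
        (2 - (4 * a + 3 * c) / (a + c)) / c * (a * u + b)))
      (q₃ := op fun _ x u => (0, ((a + c) * (y x ^ 2 - δ ^ 2)) / y' x,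
        (y x + (4 * a + 3 * c) * δ / c) * (a * u + b))) fun s => ?_⟩)
    obtain ⟨τ₀, τ₁, A, β, g₁, g₀, hR, hQ⟩ := h s
    refine ⟨τ₀, τ₁, g₁, β, fun t ht x hx u hu => (hQ t ht x hx u hu).trans ?_⟩
    obtain ⟨-, h1, h2⟩ := hR.of_inv hE.hI hY h0
    have e1 : A = (2 - (4 * a + 3 * c) / (a + c)) * g₁ + (4 * a + 3 * c) * δ * β := by linarith
    have e2 : g₀ = δ * g₁ - (a + c) * δ ^ 2 * β := by
      have h3 : (4 * a + 3 * c) / (a + c) ≠ 0 := div_ne_zero hk hn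
      refine mul_right_cancel₀ (neg_ne_zero.2 h3) ?_
      rw [h2, e1]; field_simp; ring
    rw [e1, e2]
    ext <;> simp [op, q₁] <;> ring
  · have hk : 4 * a + 3 * c ≠ 0 := hnk.resolve_left fun h => h hn
    refine .inr (.inr (.inl ⟨hn, ⟨γ, B.f_exp hE h0⟩, rank_le_four hE (q₁ := q₁)
      (q₂ := op fun t x u => (0, y x / y' x, (2 / c - γ / (4 * a + 3 * c) * y x) * (a * u + b)))
      (q₃ := op fun _ x u => (0, 1 / y' x, γ / c * (a * u + b))) fun s => ?_⟩))
    obtain ⟨τ₀, τ₁, A, β, g₁, g₀, hR, hQ⟩ := h s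
    refine ⟨τ₀, τ₁, g₁, g₀, fun t ht x hx u hu => (hQ t ht x hx u hu).trans ?_⟩
    obtain ⟨-, h1, h2⟩ := hR.of_const hE.hI hY h0
    rw [show A = γ * g₀ + 2 * g₁ by linarith,
      show β = -γ / (4 * a + 3 * c) * g₁ by field_simp; linarith, hn]
    ext <;> simp [op, q₁] <;> ring
  · refine .inr (.inr (.inr (.inl ⟨⟨A₀, β₀, m₁, m₀, fun x hx => ⟨hP x hx, hR₀ x hx⟩⟩, rank_le_three hE (q₁ := q₁)
      (q₂ := op fun t x u => (0, ((a + c) * β₀ * y x ^ 2 + m₁ * y x + m₀) / y' x,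
        (β₀ * y x + A₀ / c) * (a * u + b))) fun s => ?_⟩)))
    obtain ⟨τ₀, τ₁, A, β, g₁, g₀, hR, hQ⟩ := h s
    obtain ⟨κ, h1, h2, h3, h4⟩ := h0 _ _ _ _ hR
    refine ⟨τ₀, τ₁, κ, fun t ht x hx u hu => (hQ t ht x hx u hu).trans ?_⟩
    rw [h1, h2, h3, h4]
    ext <;> simp [op, q₁] <;> ring
  · refine .inr (.inr (.inr (.inr (rank_le_two hE (q₁ := q₁) fun s => ?_))))
    obtain ⟨τ₀, τ₁, A, β, g₁, g₀, hR, hQ⟩ := h s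
    obtain ⟨h1, h2, h3, h4⟩ := h0 _ _ _ _ hR
    refine ⟨τ₀, τ₁, fun t ht x hx u hu => (hQ t ht x hx u hu).trans ?_⟩
    rw [h1, h2, h3, h4]
    ext <;> simp [op, q₁] <;> ring

end Base

lemma Eqn.Nonlinear.hasDerivAt_log_f (hE : E.Nonlinear) {a x : ℝ} (ha : 0 < a * E.f x)
    (hx : x ∈ E.I) : HasDerivAt (fun x => log (a * E.f x)) (E.φ x) x := by
  refine (((hE.hasDerivAt_f hx).const_mul a).log ha.ne').congr_deriv ?_
  rw [Eqn.φ, mul_div_mul_left _ _ (left_ne_zero_of_mul ha.ne')]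

lemma classified_of_expInt (hE : E.Nonlinear) {c : Case} (hc : c ≠ Case.c1_1)
    (hN : c.Normalized) {num den : ℝ → ℝ} (h : ∀ x ∈ E.I, den x ≠ 0 ∧ den x * E.φ x = num x)
    (hr : Module.rank ℝ (E.alg hE) ≤ c.ops.length)
    (he : ∀ T I f, Eqn.HasExpInt { E with T := T, I := I, f := f } num den →
      c.Entry { E with T := T, I := I, f := f }) : E.Classified := by
  obtain ⟨a, ha, hp⟩ := hE.exists_pos
  refine classified_of_translation hE hc hN (C := a⁻¹) (inv_ne_zero ha) 0
    (g := fun x => a * E.f x) (fun x _ => by field_simp) hr fun T I f hI hf =>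
    he T I f ⟨fun x => log (a * E.f x), fun x hx => ?_⟩
  have hx' : x ∈ E.I := by simpa using hI x hx
  obtain ⟨h1, h2⟩ := h x hx'
  exact ⟨h1, by rw [← h2, mul_div_cancel_left₀ _ h1]; exact hE.hasDerivAt_log_f (hp x hx') hx',
    by simp [hf x hx, Real.exp_log (hp x hx')]⟩

lemma exp_neg_mul_exp (x : ℝ) : exp (-x) * exp x = 1 := by rw [← Real.exp_add]; simp

lemma exp_neg_sq (x : ℝ) : exp (-x) ^ 2 = exp (-(2 * x)) := by
  rw [← Real.exp_nat_mul]; congr 1; push_cast; ring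

lemma base_exp_zero : Base 1 (fun x => exp (-x)) (fun x => -exp (-x)) := by
  simpa using base_exp 0

/-- The exponent of `f` in terms of `exp (-x)` and `exp x`. -/
lemma expForm {φ x n k A β g₁ g₀ : ℝ} (h0 : n * β * exp (-x) ^ 2 + g₁ * exp (-x) + g₀ ≠ 0)
    (h : (n * β * exp (-x) ^ 2 + g₁ * exp (-x) + g₀) * ((φ + 2 * 1) / -exp (-x)) =
      A - k * β * exp (-x) - 2 * g₁) :
    n * β * exp (-x) + g₁ + g₀ * exp x ≠ 0 ∧
      (n * β * exp (-x) + g₁ + g₀ * exp x) * φ =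
        (k - 2 * n) * β * exp (-x) - 2 * g₀ * exp x - A := by
  have e := exp_neg_mul_exp x
  refine ⟨fun hz => h0 (by linear_combination exp (-x) * hz - g₀ * e), ?_⟩
  rw [mul_div_assoc', div_eq_iff (neg_ne_zero.2 (Real.exp_ne_zero _))] at h
  linear_combination exp x * h + (-(n * β * exp (-x) + g₁) * (φ + 2)
    + (k * β * exp (-x) + 2 * g₁ - A)) * e

lemma classified_rigid_zero (hE : E.Nonlinear) (hD : ¬ ConstOn E.D E.J)
    (hK : ∀ u ∈ E.J, E.K u = 0) (h : E.Rigid) : E.Classified := by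
  rcases base_id.linear_cases hE hD (by simpa) h with ⟨⟨C, hC, hf⟩, hr⟩ | ⟨⟨γ, -, C, hC, hf⟩, hr⟩ |
    ⟨⟨σ, δ, hσ, C, hC, hf⟩, hr⟩ | hr
  · exact classified_of_translation hE (c := .c1_3a) (by simp) trivial hC 0 hf hr
      fun T I f _ hf => ⟨fun _ _ => rfl, hK, fun x hx => by simp [hf x hx]⟩
  · exact classified_of_f_exp hE hC (by simpa using hf) hr
  · exact classified_of_translation hE (c := .c1_2d σ) (by simp) trivial hC δ hf hr
      fun T I f _ hf => ⟨hσ, fun _ _ => rfl, hK, fun x hx => by simp [hf x hx]⟩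
  · exact fun _ => .inl hr

lemma classified_rigid_eq (hE : E.Nonlinear) (hD : ¬ ConstOn E.D E.J)
    (hK : EqOn E.K E.D E.J) (h : E.Rigid) : E.Classified := by
  have hsgn : ∀ {γ : ℝ}, γ ≠ 0 → γ * exp (-log γ) = 1 ∨
      γ * exp (-log γ) = -1 := fun {γ} h => by
    rw [Real.exp_neg]
    rcases lt_or_gt_of_ne h with h' | h'
    · exact .inr (by rw [Real.exp_log_of_neg h']; field_simp)
    · exact .inl (by rw [Real.exp_log h']; field_simp)
  rcases base_exp_zero.linear_cases hE hD (fun u hu => by simp [hK hu]) h with ⟨⟨C, hC, hf⟩, hr⟩ |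
    ⟨⟨γ, hγ, C, hC, hf⟩, hr⟩ | ⟨⟨σ, δ, hσ, C, hC, hf⟩, hr⟩ | hr
  · exact classified_of_translation hE (c := .c1_3b) (by simp) trivial hC 0 hf hr
      fun T I f _ hf => ⟨fun _ _ => rfl, hK, fun x hx => by simp [hf x hx, exp_neg_sq]⟩
  · refine classified_of_translation hE (c := .c1_2b (γ * exp (-log γ))) (by simp)
      (hsgn hγ) (mul_ne_zero hC (Real.exp_ne_zero (2 * -log γ))) (-log γ)
      (g := fun x => exp (-2 * (x + -log γ) + γ * exp (-x)))
      (fun x hx => by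
        rw [hf x hx, ← exp_neg_two_mul, mul_assoc, ← Real.exp_add, ← Real.exp_add]; ring_nf) hr
      fun T I f _ hf => ⟨mul_ne_zero hγ (Real.exp_ne_zero _), fun _ _ => rfl, hK, fun x hx => ?_⟩
    dsimp only
    rw [hf x hx, sub_add_cancel, mul_assoc γ, ← Real.exp_add]
    ring_nf
  · rcases eq_or_ne δ 0 with rfl | hδ
    · refine classified_of_f_exp hE (ε := -2 - σ) hC (fun x hx => ?_) hr
      rw [hf x hx, add_zero, Real.abs_exp, ← exp_neg_two_mul, ← Real.exp_mul, ← Real.exp_add]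
      ring_nf
    · have hγ := hsgn hδ
      obtain ⟨q, hq⟩ : ∃ q, q = log δ := ⟨_, rfl⟩
      rw [← hq] at hγ
      refine classified_of_translation hE (c := .c1_2c (δ * exp (-q)) σ) (by simp)
        hγ (C := C * (exp (2 * q) * exp q ^ σ))
        (mul_ne_zero hC (mul_ne_zero (Real.exp_ne_zero _)
          (Real.rpow_pos_of_pos (Real.exp_pos _) _).ne')) q
        (g := fun x => exp (-2 * (x + q)) * |exp (-(x + q)) + δ * exp (-q)| ^ σ)
        (fun x hx => ?_) hr
        fun T I f _ hf => ⟨mul_ne_zero hδ (Real.exp_ne_zero _), hσ, fun _ _ => rfl, hK,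
          fun x hx => by simp only [hf x hx, sub_add_cancel]⟩
      have e : exp (-x) + δ = exp q * (exp (-(x + q)) + δ * exp (-q)) := by
        rw [mul_add, ← Real.exp_add, mul_left_comm, ← Real.exp_add]; simp
      rw [hf x hx, e, abs_mul, Real.abs_exp, Real.mul_rpow (Real.exp_pos _).le (abs_nonneg _),
        ← exp_neg_two_mul, show -2 * x = 2 * q + -2 * (x + q) by ring, Real.exp_add]
      ring
  · exact fun _ => .inl hr

lemma classified_exp_zero (hE : E.Nonlinear) (hD : EqOn E.D exp E.J)
    (hDc : ¬ ConstOn E.D E.J) (hK : ∀ u ∈ E.J, E.K u = 0) : E.Classified := by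
  rcases base_id.quadratic_cases hE hDc (by simpa) one_ne_zero (Eqn.DEq_exp_one hE.hJ.1 hD) with
    ⟨⟨C, hC, hf⟩, -, hr⟩ | ⟨-, -, ⟨δ, h0⟩, hr⟩ | ⟨h, -⟩ | ⟨⟨A, β, g₁, g₀, h0⟩, hr⟩ | hr
  · exact classified_of_translation hE (c := .c2_6a) (by simp) trivial hC 0 hf (hr (by norm_num))
      fun T I f _ hf => ⟨hD, hK, fun x hx => by simp [hf x hx]⟩
  · obtain ⟨C, hC, hf⟩ := (base_id.add δ).f_zpow hE (n := -3) (by norm_num at h0 ⊢; exact h0)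
    exact classified_of_translation hE (c := .c2_6d) (by simp) trivial hC δ hf hr
      fun T I f _ hf => ⟨hD, hK, fun x hx => by simp [hf x hx]⟩
  · norm_num at h
  · exact classified_of_expInt hE (c := .c2_5a A β g₁ g₀) (by simp) trivial (fun x hx => by
      obtain ⟨h1, h2⟩ := h0 x hx
      norm_num at h1 h2
      exact ⟨h1, by linear_combination h2⟩) hr fun T I f h => ⟨⟨hD, hK⟩, h⟩
  · exact hE.classified_of_entry (c := .c2_4 0) (by simp) (.inl rfl) ⟨hD, fun u hu => by simp [hK u hu]⟩ hr

lemma classified_exp_eq (hE : E.Nonlinear) (hD : EqOn E.D exp E.J)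
    (hDc : ¬ ConstOn E.D E.J) (hK : EqOn E.K E.D E.J) : E.Classified := by
  have hK' := hK.trans hD
  rcases base_exp_zero.quadratic_cases hE hDc (fun u hu => by simp [hK hu]) one_ne_zero
    (Eqn.DEq_exp_one hE.hJ.1 hD) with
    ⟨⟨C, hC, hf⟩, -, hr⟩ | ⟨-, -, ⟨δ, h0⟩, hr⟩ | ⟨h, -⟩ | ⟨⟨A, β, g₁, g₀, h0⟩, hr⟩ | hr
  · exact classified_of_translation hE (c := .c2_6b) (by simp) trivial hC 0 hf (hr (by norm_num))
      fun T I f _ hf => ⟨hD, hK', fun x hx => by simp [hf x hx, exp_neg_sq]⟩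
  · obtain ⟨C, hC, hf⟩ := (base_exp δ).f_zpow hE (n := -3) (by norm_num at h0 ⊢; exact h0)
    exact classified_of_translation hE (c := .c2_6c δ) (by simp) trivial hC 0 hf hr
      fun T I f _ hf => ⟨hD, hK', fun x hx => by simp [hf x hx, exp_neg_sq]⟩
  · norm_num at h
  · exact classified_of_expInt hE (c := .c2_5b A β g₁ g₀) (by simp) trivial (fun x hx => by
      have := expForm (h0 x hx).1 (h0 x hx).2
      norm_num at this
      exact this) hr fun T I f h => ⟨⟨hD, hK'⟩, h⟩
  · exact hE.classified_of_entry (c := .c2_4 1) (by simp) (.inr rfl) ⟨hD, fun u hu => by simp [hK' hu]⟩ hr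

lemma classified_pow_zero (hE : E.Nonlinear) (hJ0 : E.J ⊆ Ioi 0) {μ : ℝ} (hμ : μ ≠ 0)
    (hD : EqOn E.D (fun u => u ^ μ) E.J)
    (hDc : ¬ ConstOn E.D E.J) (hK : ∀ u ∈ E.J, E.K u = 0) : E.Classified := by
  rcases base_id.quadratic_cases hE hDc (by simpa) hμ (Eqn.DEq_rpow hE.hJ.1 (.inl hJ0) hD) with
    ⟨⟨C, hC, hf⟩, hr5, hr⟩ | ⟨hn, hk, ⟨δ, h0⟩, hr⟩ | ⟨hn, ⟨γ, C, hC, hf⟩, hr⟩ |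
    ⟨⟨A, β, g₁, g₀, h0⟩, hr⟩ | hr
  · by_cases hμ' : μ = -4 / 3
    · subst hμ'
      exact classified_of_translation hE (c := .c3_7a) (by simp) trivial hC 0 hf hr5
        fun T I f _ hf => ⟨hJ0, hD, hK, fun x hx => by simp [hf x hx]⟩
    · exact classified_of_translation hE (c := .c3_6a μ) (by simp) trivial hC 0 hf
        (hr fun h => hμ' (by linarith)) fun T I f _ hf =>
          ⟨hJ0, hμ, hμ', hD, hK, fun x hx => by simp [hf x hx]⟩
  · obtain ⟨C, hC, hf⟩ := (base_id.add δ).f_abs_rpow hE (by simpa only [← neg_div] using h0)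
    exact classified_of_translation hE (c := .c3_6e μ) (by simp) trivial hC δ hf hr
      fun T I f _ hf => ⟨hJ0, hμ, fun h => hk (by rw [h]; norm_num),
        fun h => hn (by rw [h]; norm_num), hD, hK, fun x hx => by simp [hf x hx]⟩
  · obtain rfl : μ = -1 := by linarith
    exact classified_of_translation hE (c := .c3_6c γ) (by simp) trivial hC 0 hf hr
      fun T I f _ hf => ⟨hJ0, fun u hu => (hD hu).trans (Real.rpow_neg_one u), hK,
        fun x hx => by simp [hf x hx]⟩
  · exact classified_of_expInt hE (c := .c3_5a μ A β g₁ g₀) (by simp) trivial (fun x hx => by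
      obtain ⟨h1, h2⟩ := h0 x hx
      exact ⟨h1, by linear_combination h2⟩) hr fun T I f h => ⟨hJ0, hμ, ⟨hD, hK⟩, h⟩
  · exact hE.classified_of_entry (c := .c3_4 μ 0) (by simp) (.inl rfl)
      ⟨hJ0, hμ, hD, fun u hu => by simp [hK u hu]⟩ hr

lemma classified_pow_eq (hE : E.Nonlinear) (hJ0 : E.J ⊆ Ioi 0) {μ : ℝ} (hμ : μ ≠ 0)
    (hD : EqOn E.D (fun u => u ^ μ) E.J)
    (hDc : ¬ ConstOn E.D E.J) (hK : EqOn E.K E.D E.J) : E.Classified := by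
  have hK' := hK.trans hD
  rcases base_exp_zero.quadratic_cases hE hDc (fun u hu => by simp [hK hu]) hμ
    (Eqn.DEq_rpow hE.hJ.1 (.inl hJ0) hD) with
    ⟨⟨C, hC, hf⟩, hr5, hr⟩ | ⟨hn, hk, ⟨δ, h0⟩, hr⟩ | ⟨hn, ⟨γ, C, hC, hf⟩, hr⟩ |
    ⟨⟨A, β, g₁, g₀, h0⟩, hr⟩ | hr
  · by_cases hμ' : μ = -4 / 3
    · subst hμ'
      exact classified_of_translation hE (c := .c3_7b) (by simp) trivial hC 0 hf hr5
        fun T I f _ hf => ⟨hJ0, hD, hK', fun x hx => by simp [hf x hx, exp_neg_sq]⟩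
    · exact classified_of_translation hE (c := .c3_6b μ) (by simp) trivial hC 0 hf
        (hr fun h => hμ' (by linarith)) fun T I f _ hf =>
          ⟨hJ0, hμ, hμ', hD, hK', fun x hx => by simp [hf x hx, exp_neg_sq]⟩
  · obtain ⟨C, hC, hf⟩ := (base_exp δ).f_abs_rpow hE (by simpa only [← neg_div] using h0)
    exact classified_of_translation hE (c := .c3_6f μ δ) (by simp) trivial hC 0 hf hr
      fun T I f _ hf => ⟨hJ0, hμ, fun h => hk (by rw [h]; norm_num),
        fun h => hn (by rw [h]; norm_num), hD, hK', fun x hx => by simp [hf x hx, exp_neg_sq]⟩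
  · obtain rfl : μ = -1 := by linarith
    have hD' := fun u hu => (hD hu).trans (Real.rpow_neg_one u)
    exact classified_of_translation hE (c := .c3_6d γ) (by simp) trivial hC 0 hf hr
      fun T I f _ hf => ⟨hJ0, hD', fun u hu => (hK hu).trans (hD' u hu),
        fun x hx => by simp [hf x hx, Real.exp_add, exp_neg_sq]⟩
  · exact classified_of_expInt hE (c := .c3_5b μ A β g₁ g₀) (by simp) trivial (fun x hx => by
      obtain ⟨h1, h2⟩ := expForm (h0 x hx).1 (h0 x hx).2
      exact ⟨h1, by linear_combination h2⟩) hr fun T I f h => ⟨hJ0, hμ, ⟨hD, hK'⟩, h⟩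
  · exact hE.classified_of_entry (c := .c3_4 μ 1) (by simp) (.inr rfl)
      ⟨hJ0, hμ, hD, fun u hu => by simp [hK' hu]⟩ hr

/-! ### Solving for the coefficients -/

section Ode
variable {J : Set ℝ} (hJ : IsOpenInterval J)
include hJ

lemma pow_ode {g g' : ℝ → ℝ} {r s σ : ℝ} (hg : ∀ u ∈ J, HasDerivAt g (g' u) u)
    (hp : ∀ u ∈ J, 0 < r * u + s) (h : ∀ u ∈ J, (r * u + s) * g' u = r * σ * g u) :
    ∃ C, ∀ u ∈ J, g u = C * (r * u + s) ^ σ := by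
  obtain ⟨u₀, h₀⟩ := hJ.2.2
  refine ⟨g u₀ * (r * u₀ + s) ^ (-σ), fun u hu => ?_⟩
  have := eq_of_deriv_eq_zero hJ (g := fun u => g u * (r * u + s) ^ (-σ))
    (fun u hu => (hg u hu).mul ((((hasDerivAt_id u).const_mul r).add_const s).rpow_const (p := -σ)
      (.inl (hp u hu).ne'))) (fun u hu => by
      simp only [id]
      rw [show (r * u + s) ^ (-σ) = (r * u + s) ^ (-σ - 1) * (r * u + s) by
        rw [← Real.rpow_add_one (hp u hu).ne']; ring_nf]
      linear_combination (r * u + s) ^ (-σ - 1) * h u hu) hu h₀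
  rw [← this, mul_assoc, ← Real.rpow_add (hp u hu)]; simp

lemma eq_zero_of_neg_weight {g g' : ℝ → ℝ} {u₀ ν : ℝ} (h₀ : u₀ ∈ J) (hν : ν < 0)
    (hg : ∀ u ∈ J, HasDerivAt g (g' u) u) (h : ∀ u ∈ J, (u - u₀) * g' u = ν * g u) :
    ∀ u ∈ J, g u = 0 := by
  have h0 : g u₀ = 0 := by simpa [hν.ne] using (h u₀ h₀).symm
  intro u hu
  by_contra hgu
  have hs : ∀ s ∈ Set.Icc (0 : ℝ) 1, u₀ + s * (u - u₀) ∈ J := fun s hs =>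
    hJ.2.1.convex.add_smul_sub_mem h₀ hu hs
  have hd : ∀ s ∈ Set.Icc (0 : ℝ) 1, HasDerivAt (fun s => g (u₀ + s * (u - u₀)) ^ 2)
      (2 * g (u₀ + s * (u - u₀)) * (g' (u₀ + s * (u - u₀)) * (u - u₀))) s := fun s h =>
    (((hg _ (hs s h)).comp s (((hasDerivAt_id s).mul_const (u - u₀)).const_add u₀)).pow 2).congr_deriv
      (by simp)
  obtain ⟨s, hs', e⟩ := exists_hasDerivAt_eq_slope _ _ zero_lt_one
    (fun s h => (hd s h).continuousAt.continuousWithinAt)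
    fun s h => hd s (Set.Ioo_subset_Icc_self h)
  have h1 := h _ (hs s (Set.Ioo_subset_Icc_self hs'))
  simp only [zero_mul, add_zero, h0, one_mul, add_sub_cancel] at e
  have h2 : s * g u ^ 2 = 2 * ν * g (u₀ + s * (u - u₀)) ^ 2 := by
    linear_combination -s * e + 2 * g (u₀ + s * (u - u₀)) * h1
  nlinarith [mul_pos hs'.1 (pow_pos (sq_pos_of_ne_zero hgu) 1), sq_nonneg (g (u₀ + s * (u - u₀)))]

lemma monomial_of_weight {u₀ : ℝ} (h₀ : u₀ ∈ J) (n : ℕ) : ∀ (ν : ℝ) (g : ℝ → ℝ), ν < n →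
    ContDiffOn ℝ ∞ g J → (∀ u ∈ J, (u - u₀) * deriv g u = ν * g u) →
    (∀ u ∈ J, g u = 0) ∨ ∃ m : ℕ, ν = m ∧ ∃ k, ∀ u ∈ J, g u = k * (u - u₀) ^ m := by
  have hdiff : ∀ {g : ℝ → ℝ}, ContDiffOn ℝ ∞ g J → ∀ u ∈ J, HasDerivAt g (deriv g u) u :=
    fun hg u hu => ((hg.differentiableOn (by simp)).differentiableAt
      (hJ.1.mem_nhds hu)).hasDerivAt
  induction n with
  | zero =>
    intro ν g hν hg h
    exact .inl (eq_zero_of_neg_weight hJ h₀ (by simpa using hν) (hdiff hg) h)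
  | succ n ih =>
    intro ν g hν hg h
    have hg' : ContDiffOn ℝ ∞ (deriv g) J := hg.deriv_of_isOpen hJ.1 (by simp)
    have h' : ∀ u ∈ J, (u - u₀) * deriv (deriv g) u = (ν - 1) * deriv g u := fun u hu => by
      have := ((((hasDerivAt_id u).sub_const u₀).mul (hdiff hg' u hu)).congr_on hJ.1 hu fun v hv =>
        (h v hv).symm).unique ((hdiff hg u hu).const_mul ν)
      simp only [id] at this
      linear_combination this
    rcases ih (ν - 1) (deriv g) (by push_cast at hν; linarith) hg' h' with h0 | ⟨m, hm, k, hk⟩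
    · by_cases hν0 : ν = 0
      · exact .inr ⟨0, by simp [hν0], g u₀, fun u hu => by
          simpa using eq_of_deriv_eq_zero hJ (hdiff hg) h0 hu h₀⟩
      · exact .inl fun u hu => by simpa [h0 u hu, hν0] using (h u hu).symm
    · have hm' : ν = m + 1 := by linarith
      have hν0 : ν ≠ 0 := by rw [hm']; positivity
      refine .inr ⟨m + 1, by rw [hm']; push_cast; ring, k / ν, fun u hu => ?_⟩
      have := h u hu
      rw [hk u hu] at this
      field_simp
      linear_combination -this

end Ode

lemma exists_sign {J : Set ℝ} (hJ : IsOpenInterval J) {s : ℝ} (h0 : ∀ u ∈ J, u + s ≠ 0) :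
    ∃ r : ℝ, (r = 1 ∨ r = -1) ∧ ∀ u ∈ J, 0 < r * u + r * s := by
  obtain ⟨u₀, h₀⟩ := hJ.2.2
  have hc : ContinuousOn (fun u => u + s) J := by fun_prop
  rcases lt_or_gt_of_ne (h0 u₀ h₀) with h | h
  · refine ⟨-1, .inr rfl, fun u hu => ?_⟩
    by_contra hn
    obtain ⟨v, hv, e⟩ := hJ.preconnected.intermediate_value h₀ hu hc ⟨h.le, by linarith⟩
    exact h0 v hv e
  · refine ⟨1, .inl rfl, fun u hu => ?_⟩
    by_contra hn
    obtain ⟨v, hv, e⟩ := hJ.preconnected.intermediate_value hu h₀ hc ⟨by linarith, h.le⟩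
    exact h0 v hv e

lemma Eqn.Nonlinear.not_const (hE : E.Nonlinear) {d k : ℝ} (hD : ∀ u ∈ E.J, E.D u = d)
    (hK : ∀ u ∈ E.J, E.K u = k) : False := by
  obtain ⟨u, hu, h⟩ := hE.nonlin
  simp [deriv_const_of_eqOn hE.hJ.1 hD hu, deriv_const_of_eqOn hE.hJ.1 hK hu] at h

/-- Joint solutions of the weight equations for `D` and `K`, up to scaling. -/
lemma weight_normal (hE : E.Nonlinear) {α β ρ ν : ℝ} (hαβ : α ≠ 0 ∨ β ≠ 0)
    (h1 : ∀ u ∈ E.J, (α * u + β) * deriv E.D u = ρ * E.D u)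
    (h2 : ∀ u ∈ E.J, (α * u + β) * deriv E.K u = ν * E.K u)
    (hK : ∃ u ∈ E.J, E.K u ≠ 0) : ∃ p r s m μ ν : ℝ, p ≠ 0 ∧ r ≠ 0 ∧ m ≠ 0 ∧
    ((ν = 1 ∨ ν = 0 ∧ μ = 1) ∧ s = 0 ∧ (∀ u ∈ E.J, m * E.D u = exp (μ * (r * u + s))) ∧
      (∀ u ∈ E.J, m / p * E.K u = exp (ν * (r * u + s))) ∨
    (∀ u ∈ E.J, m * E.D u = (r * u + s) ^ μ) ∧ (∀ u ∈ E.J, m / p * E.K u = (r * u + s) ^ ν) ∧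
      ((∀ u ∈ E.J, 0 < r * u + s) ∨ μ = 0 ∧ ∃ n : ℕ, ν = n)) := by
  obtain ⟨u₀, h₀, hK₀⟩ := hK
  have hD₀ := hE.D_ne u₀ h₀
  have key : ∀ {g : ℝ → ℝ} {d : ℝ} {w : ℝ → ℝ}, g u₀ ≠ 0 → (∀ u ∈ E.J, g u = d * w u) → d ≠ 0 :=
    fun h e h0 => h (by rw [e u₀ h₀, h0, zero_mul])
  have hD' := fun u (hu : u ∈ E.J) => hE.hasDerivAt_D hu
  have hK' := fun u (hu : u ∈ E.J) => hE.hasDerivAt_K hu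
  have fin : ∀ {d k : ℝ} {w v : ℝ → ℝ}, d ≠ 0 → k ≠ 0 → (∀ u ∈ E.J, E.D u = d * w u) →
      (∀ u ∈ E.J, E.K u = k * v u) → (∀ u ∈ E.J, d⁻¹ * E.D u = w u) ∧
      ∀ u ∈ E.J, d⁻¹ / (k / d) * E.K u = v u := fun hd hk h h' =>
    ⟨fun u hu => by rw [h u hu]; field_simp, fun u hu => by rw [h' u hu]; field_simp⟩
  rcases eq_or_ne α 0 with rfl | hα
  · have hβ : β ≠ 0 := hαβ.resolve_left (by simp)
    obtain ⟨d, hd⟩ := exp_ode hE.hJ (k := ρ / β) hD'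
      fun u hu => by have := h1 u hu; field_simp; linear_combination this
    obtain ⟨k, hk⟩ := exp_ode hE.hJ (k := ν / β) hK'
      fun u hu => by have := h2 u hu; field_simp; linear_combination this
    have hd0 := key hD₀ hd
    have hk0 := key hK₀ hk
    obtain ⟨r, hr, hn⟩ : ∃ r : ℝ, r ≠ 0 ∧ (ν / β / r = 1 ∨ ν / β / r = 0 ∧ ρ / β / r = 1) := by
      rcases eq_or_ne (ν / β) 0 with hν | hν
      · refine ⟨ρ / β, fun hρ => ?_, .inr ⟨by rw [hν, zero_div], div_self fun hρ => ?_⟩⟩ <;>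
          exact hE.not_const (d := d) (k := k) (fun v hv => by simp [hd v hv, hρ])
            fun v hv => by simp [hk v hv, hν]
      · exact ⟨_, hν, .inl (div_self hν)⟩
    have e : ∀ k u, k / r * (r * u + 0) = k * u := fun k u => by field_simp; ring
    obtain ⟨f1, f2⟩ := fin hd0 hk0 hd hk
    exact ⟨k / d, r, 0, d⁻¹, ρ / β / r, ν / β / r, div_ne_zero hk0 hd0, hr, inv_ne_zero hd0,
      .inl ⟨hn, rfl, by simpa only [e] using f1, by simpa only [e] using f2⟩⟩
  · have h1' : ∀ u ∈ E.J, (u + β / α) * deriv E.D u = ρ / α * E.D u := fun u hu => by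
      have := h1 u hu; field_simp; linear_combination this
    have h2' : ∀ u ∈ E.J, (u + β / α) * deriv E.K u = ν / α * E.K u := fun u hu => by
      have := h2 u hu; field_simp; linear_combination this
    by_cases hz : ∀ u ∈ E.J, u + β / α ≠ 0
    · obtain ⟨r, hr, hp⟩ := exists_sign hE.hJ hz
      have hr0 : r ≠ 0 := by rcases hr with rfl | rfl <;> norm_num
      obtain ⟨d, hd⟩ := pow_ode hE.hJ hD' hp (σ := ρ / α) fun u hu => by linear_combination r * h1' u hu
      obtain ⟨k, hk⟩ := pow_ode hE.hJ hK' hp (σ := ν / α) fun u hu => by linear_combination r * h2' u hu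
      have hd0 := key hD₀ hd
      have hk0 := key hK₀ hk
      obtain ⟨f1, f2⟩ := fin hd0 hk0 hd hk
      exact ⟨_, r, _, d⁻¹, _, _, div_ne_zero hk0 hd0, hr0, inv_ne_zero hd0, .inr ⟨f1, f2, .inl hp⟩⟩
    · push Not at hz
      obtain ⟨u₁, hu₁, hz⟩ := hz
      have hρ : ρ / α = 0 := zero_of_mul (hE.D_ne _ hu₁) (by rw [mul_comm, ← h1' u₁ hu₁, hz, zero_mul])
      obtain ⟨d, hd⟩ := hE.constOn_D_of_deriv (eq_zero_of_lin_mul hE.hJ.1 (a := 1) (b := β / α)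
        (by simp) hE.continuousOn_dD fun u hu => by
          have := h1' u hu; rw [hρ, zero_mul] at this; linear_combination this)
      have e : u₁ = -(β / α) := by linarith
      obtain ⟨n, hn⟩ := exists_nat_gt (ν / α)
      rcases monomial_of_weight hE.hJ hu₁ n (ν / α) E.K hn hE.smooth_K (fun u hu => by
        rw [e, sub_neg_eq_add]; exact h2' u hu) with h0 | ⟨m, hm, k, hk⟩
      · exact absurd (h0 u₀ h₀) hK₀
      · have hd0 : d ≠ 0 := hd u₀ h₀ ▸ hD₀
        have hk0 := key hK₀ hk
        obtain ⟨f1, f2⟩ := fin (w := fun _ => 1) hd0 hk0 (by simpa using hd) hk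
        exact ⟨_, 1, β / α, d⁻¹, 0, ν / α, div_ne_zero hk0 hd0, one_ne_zero, inv_ne_zero hd0,
          .inr ⟨by simpa using f1, fun u hu => by
            rw [f2 u hu, hm, Real.rpow_natCast, e]; ring, .inr ⟨rfl, m, hm⟩⟩⟩

/-- Normal forms of a nonconstant `D` with a weight. -/
lemma Eqn.DEq.normal (hE : E.Nonlinear) (hD : ¬ ConstOn E.D E.J) {a b c : ℝ} (hc : c ≠ 0)
    (h : E.DEq a b c) : ∃ r s m : ℝ, r ≠ 0 ∧ m ≠ 0 ∧ ((∀ u ∈ E.J, m * E.D u = exp (r * u + s)) ∨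
      ∃ μ : ℝ, μ ≠ 0 ∧ ∀ u ∈ E.J, 0 < r * u + s ∧ m * E.D u = (r * u + s) ^ μ) := by
  obtain ⟨u₀, h₀⟩ := hE.hJ.2.2
  have hab : a ≠ 0 ∨ b ≠ 0 := by
    by_contra! h0
    have := h u₀ h₀
    simp [h0.1, h0.2, hc, hE.D_ne u₀ h₀] at this
  have hE' : Eqn.Nonlinear { E with K := E.D } := { hE with
    smooth_K := hE.smooth_D
    nonlin := by
      by_contra! h0
      exact hD (hE.constOn_D_of_deriv fun u hu => (h0 u hu).1) }
  obtain ⟨p, r, s, m, μ, ν, -, hr, hm, hn⟩ := weight_normal hE' hab h h ⟨u₀, h₀, hE.D_ne u₀ h₀⟩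
  have hμ : ∀ {w : ℝ → ℝ}, (∀ u ∈ E.J, m * E.D u = w u) → ¬ ∀ u, w u = 1 := fun h e =>
    hD ⟨m⁻¹, fun u hu => eq_inv_of_mul_eq_one_right ((h u hu).trans (e u))⟩
  rcases hn with ⟨-, rfl, h1, -⟩ | ⟨h1, -, h2⟩
  · exact ⟨μ * r, 0, m, mul_ne_zero (fun h0 => hμ h1 fun u => by simp [h0]) hr, hm, .inl fun u hu => by
      rw [h1 u hu]; ring_nf⟩
  · have hμ' : μ ≠ 0 := fun h0 => hμ h1 fun u => by simp [h0]
    exact ⟨r, s, m, hr, hm, .inr ⟨μ, hμ', fun u hu =>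
      ⟨(h2.resolve_right fun h => hμ' h.1) u hu, h1 u hu⟩⟩⟩

/-! ### The classification -/

section Rel
variable {a b p q r s m : ℝ} (h : GRel E E' a b p q r s m)
include h

lemma GRel.eqOn_D {d : ℝ → ℝ} (e : ∀ u ∈ E.J, m * E.D u = d (r * u + s)) :
    EqOn E'.D d E'.J := fun y hy => by
  obtain ⟨u, hu, rfl⟩ := h.exJ hy
  rw [h.hD u hu, e u hu]

lemma GRel.eqOn_K {d : ℝ → ℝ} (e : ∀ u ∈ E.J, m / p * E.K u = d (r * u + s)) :
    EqOn E'.K d E'.J := fun y hy => by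
  obtain ⟨u, hu, rfl⟩ := h.exJ hy
  rw [h.hK u hu, e u hu]

lemma GRel.eqOn_f {d : ℝ → ℝ} (e : ∀ x ∈ E.I, a * m / p ^ 2 * E.f x = d (p * x + q)) :
    EqOn E'.f d E'.I := fun y hy => by
  obtain ⟨x, hx, rfl⟩ := h.exI hy
  rw [h.hf x hx, e x hx]

lemma GRel.subset_Ioi (e : ∀ u ∈ E.J, 0 < r * u + s) : E'.J ⊆ Ioi 0 := fun y hy => by
  obtain ⟨u, hu, rfl⟩ := h.exJ hy
  exact e u hu

lemma GRel.constOn_D (hD : ConstOn E'.D E'.J) : ConstOn E.D E.J := by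
  obtain ⟨d, hd⟩ := hD
  refine ⟨d / m, fun u hu => ?_⟩
  rw [← hd (r * u + s) ((h.hJ u).2 hu), h.hD u hu, mul_div_cancel_left₀ _ h.hm]

lemma GRel.constOn_f (hf : ConstOn E'.f E'.I) : ConstOn E.f E.I :=
  h.symm.gEquiv.f_const hf

lemma GRel.classified (hE : E.Nonlinear) (hc : E'.Classified) : E.Classified :=
  hc.of_gEquiv h.gEquiv hE

lemma GRel.classified_entry (hE : E.Nonlinear) {c : Case} (hc : c ≠ Case.c1_1)
    (hN : c.Normalized) (hr : Module.rank ℝ (E.alg hE) ≤ c.ops.length) (he : c.Entry E') :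
    E.Classified :=
  classified_of_gEquiv hE h.gEquiv hc hN he hr

end Rel

lemma classified_prop (hE : E.Nonlinear) (hD : ¬ ConstOn E.D E.J) {k : ℝ}
    (hK : ∀ u ∈ E.J, E.K u = k * E.D u) : E.Classified := by
  obtain ⟨p, hp, e⟩ : ∃ p : ℝ, p ≠ 0 ∧ (k = 0 ∨ k / p = 1) := by
    by_cases h : k = 0
    · exact ⟨1, one_ne_zero, .inl h⟩
    · exact ⟨k, h, .inr (div_self h)⟩
  have key : ∀ {E' : Eqn} {r s m : ℝ}, GRel E E' 1 0 p 0 r s m →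
      (∀ u ∈ E'.J, E'.K u = 0) ∨ EqOn E'.K E'.D E'.J := fun {E'} r s m h => by
    rcases e with e | e
    · refine .inl fun u hu => h.eqOn_K (d := fun _ => 0) (fun u hu => ?_) hu
      rw [hK u hu, e]; ring
    · rw [div_eq_iff hp, one_mul] at e
      refine .inr ?_
      intro y hy
      obtain ⟨u, hu, rfl⟩ := h.exJ hy
      have := h.hp
      rw [h.hD u hu, h.hK u hu, hK u hu, e]; field_simp
  rcases hE.exists_DEq_or_rigid hD with ⟨a, b, c, hc, h⟩ | hR
  · obtain ⟨r, s, m, hr, hm, hn⟩ := h.normal hE hD hc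
    obtain ⟨E', hE', h'⟩ := exists_gRel hE 0 s one_ne_zero hp hr hm
    have hD' : ¬ ConstOn E'.D E'.J := fun h => hD (h'.constOn_D h)
    refine h'.classified hE ?_
    rcases hn with hn | ⟨μ, hμ, hn⟩
    · have e := h'.eqOn_D (d := exp) hn
      exact (key h').elim (classified_exp_zero hE' e hD') (classified_exp_eq hE' e hD')
    · have e := h'.eqOn_D (d := fun u => u ^ μ) fun u hu => (hn u hu).2
      have e0 := h'.subset_Ioi fun u hu => (hn u hu).1
      exact (key h').elim (classified_pow_zero hE' e0 hμ e hD')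
        (classified_pow_eq hE' e0 hμ e hD')
  · obtain ⟨E', hE', h'⟩ := exists_gRel hE 0 0 one_ne_zero hp one_ne_zero one_ne_zero
    have hD' : ¬ ConstOn E'.D E'.J := fun h => hD (h'.constOn_D h)
    have hR' : E'.Rigid := fun a b c h => hR a b c fun u hu => by
      have := h (1 * u + 0) ((h'.hJ u).2 hu)
      rw [h'.deriv_D hE hu, h'.hD u hu] at this
      simpa using this
    refine h'.classified hE ?_
    exact (key h').elim (fun h => classified_rigid_zero hE' hD' h hR')
      (fun h => classified_rigid_eq hE' hD' h hR')

lemma classified_of_allAff (hE : E.Nonlinear) (hA : E.AllAff) (hf : ¬ ConstOn E.f E.I)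
    (hKD : ¬ ∃ p, ∀ u ∈ E.J, E.K u = p * E.D u) : E.Classified := by
  have hK0 : ∃ u ∈ E.J, E.K u ≠ 0 := by
    by_contra! h
    exact hKD ⟨0, fun u hu => by rw [h u hu]; ring⟩
  rcases rank_of_allAff_nonconst hE hA hf hKD with hr | ⟨hr, ε, -, hε⟩ |
    ⟨hr, δ, l, hl, hφ, α, β, ρ', a₁, -, hαβ, h1, h2⟩
  · exact fun _ => .inl hr
  · obtain ⟨C, hC, hf⟩ := base_id.f_exp hE (by simpa using hε)
    exact classified_of_f_exp hE hC (by simpa using hf) hr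
  · obtain ⟨C, hC, hfC⟩ := (base_id.add δ).f_abs_rpow hE (by simpa using hφ)
    obtain ⟨p, r, s, m, μ, ν, hp, hr0, hm, hn⟩ := weight_normal hE hαβ h1 h2 hK0
    have hpl := (Real.rpow_pos_of_pos (abs_pos.2 hp) l).ne'
    obtain ⟨E', hE', h'⟩ := exists_gRel hE (a := p ^ 2 * |p| ^ l / (m * C)) (p * δ) s
      (div_ne_zero (mul_ne_zero (pow_ne_zero 2 hp) hpl) (mul_ne_zero hm hC)) hp hr0 hm
    have e : EqOn E'.f (fun x => |x| ^ l) E'.I := h'.eqOn_f fun x hx => by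
      rw [hfC x hx, ← mul_add, abs_mul, Real.mul_rpow (abs_nonneg _) (abs_nonneg _)]
      field_simp
    rcases hn with ⟨hn, -, hD, hK⟩ | ⟨hD, hK, hJ⟩
    · exact h'.classified_entry hE (c := .c2_1 μ ν l) (by simp) (by tauto) hr
        ⟨hl, h'.eqOn_D hD, h'.eqOn_K hK, e⟩
    · exact h'.classified_entry hE (c := .c3_1 μ ν l) (by simp) trivial hr
        ⟨hJ.imp h'.subset_Ioi id, hl, h'.eqOn_D hD, h'.eqOn_K hK, e⟩

/-- The equations without a linear dependence between the coefficients. -/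
def Eqn.Generic (E : Eqn) : Prop := ¬ ConstOn E.D E.J ∧ ¬ E.KinSpan ∨
  (∃ d, ∀ u ∈ E.J, E.D u = d) ∧ ¬ ∃ p q, ∀ u ∈ E.J, E.K u = p * u + q

lemma Eqn.Generic.allAff (h : E.Generic) (hE : E.Nonlinear) : E.AllAff := by
  rcases h with ⟨h1, h2⟩ | ⟨⟨d, h1⟩, h2⟩
  · exact allAff_of_not_kinSpan hE h1 h2
  · exact allAff_of_const hE h1 h2

lemma Eqn.Generic.K_nonconst (h : E.Generic) : ¬ ConstOn E.K E.J := fun ⟨c, hc⟩ => by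
  rcases h with ⟨-, h2⟩ | ⟨-, h2⟩
  · exact h2 ⟨0, c, fun u hu => by simp [hc u hu]⟩
  · exact h2 ⟨0, c, fun u hu => by simp [hc u hu]⟩

lemma Eqn.Generic.not_affine (h : E.Generic) :
    ¬ (ConstOn E.D E.J ∧ ∃ p q, ∀ u ∈ E.J, E.K u = p * u + q) := fun ⟨h1, h2⟩ => by
  rcases h with h | h
  · exact h.1 h1
  · exact h.2 h2

lemma Eqn.Generic.not_prop (h : E.Generic) : ¬ ∃ p, ∀ u ∈ E.J, E.K u = p * E.D u :=
  fun ⟨p, hp⟩ => by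
    rcases h with ⟨-, h2⟩ | ⟨⟨d, hd⟩, h2⟩
    · exact h2 ⟨p, 0, fun u hu => by simp [hp u hu]⟩
    · exact h2 ⟨0, p * d, fun u hu => by simp [hp u hu, hd u hu]⟩

lemma Eqn.Generic.shiftK (h : E.Generic) (κ : ℝ) : (E.shiftK κ).Generic := by
  refine h.imp (.imp_right fun h ⟨p, q, e⟩ => h ⟨p, q - κ, fun u hu => ?_⟩)
    (.imp_right fun h ⟨p, q, e⟩ => h ⟨p, q - κ, fun u hu => ?_⟩) <;>
  · have := e u hu
    simp only [Eqn.shiftK] at this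
    linarith

lemma two_le_rank (hE : E.Nonlinear) {c : ℝ} (hf : ∀ x ∈ E.I, E.f x = c) :
    (2 : ℕ) ≤ Module.rank ℝ (E.alg hE) := by
  obtain ⟨t, ht⟩ := hE.hT.2.2
  obtain ⟨u, hu⟩ := hE.hJ.2.2
  obtain ⟨x, hx⟩ := hE.hI.2.2
  have h := spec_two hE ht hu (affine_mem hE 0 0 0 0 0 0 0 0 1 (hE.φ_const hf) (T := fun _ _ _ => 0)
    (X := fun _ _ _ => 1) (U := fun _ _ _ => 0)) fun k h => by simpa using (h x hx).1
  exact length_le_rank hE h.1 h.2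

lemma classified_of_shiftK (hE : E.Nonlinear) {c : ℝ} (hf : ∀ x ∈ E.I, E.f x = c) {κ : ℝ}
    (h : (E.shiftK κ).Classified) : E.Classified := fun _ => by
  rcases h (hE.shiftK κ) with h1 | ⟨c, E', h1, h2, h3, h4, h5, h6⟩
  · have := (two_le_rank (hE.shiftK κ) hf).trans h1
    norm_num at this
  · exact .inr ⟨c, E', h1, h2, h3, h4, (equivalent_shiftK hf).trans h5, h6⟩

lemma Eqn.Nonlinear.const_ne_zero (hE : E.Nonlinear) {c : ℝ} (hf : ∀ x ∈ E.I, E.f x = c) :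
    c ≠ 0 := by
  obtain ⟨x, hx⟩ := hE.hI.2.2
  exact hf x hx ▸ hE.f_ne x hx

lemma Eqn.Generic.classified_of_weight (hG : E.Generic) (hE : E.Nonlinear) {c : ℝ}
    (hf : ∀ x ∈ E.I, E.f x = c) {α β ρ ν : ℝ} (hαβ : α ≠ 0 ∨ β ≠ 0)
    (h1 : ∀ u ∈ E.J, (α * u + β) * deriv E.D u = ρ * E.D u)
    (h2 : ∀ u ∈ E.J, (α * u + β) * deriv E.K u = ν * E.K u) : E.Classified := by
  have hr : Module.rank ℝ (E.alg hE) ≤ (3 : ℕ) := by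
    rcases rank_of_allAff_const hE (hG.allAff hE) hf hG.K_nonconst hG.not_affine with h | h
    · exact h.trans (by norm_num)
    · exact h.1
  have hK0 : ∃ u ∈ E.J, E.K u ≠ 0 := by
    by_contra! h
    exact hG.K_nonconst ⟨0, h⟩
  have hc := hE.const_ne_zero hf
  obtain ⟨p, r, s, m, μ, ν, hp, hr0, hm, hn⟩ := weight_normal hE hαβ h1 h2 hK0
  obtain ⟨E', hE', h'⟩ := exists_gRel hE (a := p ^ 2 / (m * c)) 0 s
    (div_ne_zero (pow_ne_zero 2 hp) (mul_ne_zero hm hc)) hp hr0 hm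
  have e : EqOn E'.f (fun _ => 1) E'.I := h'.eqOn_f fun x hx => by rw [hf x hx]; field_simp
  rcases hn with ⟨hn, -, hD, hK⟩ | ⟨hD, hK, hJ⟩
  · obtain rfl : ν = 1 := hn.resolve_right fun h => hG.K_nonconst ⟨(m / p)⁻¹, fun u hu =>
      eq_inv_of_mul_eq_one_right (by rw [hK u hu, h.1]; simp)⟩
    exact h'.classified_entry hE (c := .c2_2 μ) (by simp) trivial hr
      ⟨h'.eqOn_D hD, h'.eqOn_K (by simpa only [one_mul] using hK), e⟩
  · exact h'.classified_entry hE (c := .c3_2 μ ν) (by simp) trivial hr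
      ⟨hJ.imp h'.subset_Ioi id, h'.eqOn_D hD, h'.eqOn_K hK, e⟩

/-- The case of a logarithmic or linear convection coefficient. -/
lemma Eqn.Generic.classified_of_log_weight (hG : E.Generic) (hE : E.Nonlinear) {c : ℝ}
    (hf : ∀ x ∈ E.I, E.f x = c) {α β ρ κ : ℝ} (hαβ : α ≠ 0 ∨ β ≠ 0)
    (h1 : ∀ u ∈ E.J, (α * u + β) * deriv E.D u = ρ * E.D u)
    (h2 : ∀ u ∈ E.J, (α * u + β) * deriv E.K u = -κ) : E.Classified := by
  have hκ : κ ≠ 0 := fun h0 => hG.K_nonconst (hE.constOn_K_of_deriv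
    (eq_zero_of_lin_mul hE.hJ.1 hαβ hE.continuousOn_dK fun u hu => by rw [h2 u hu, h0, neg_zero]))
  have hz : ∀ u ∈ E.J, α * u + β ≠ 0 := fun u hu h0 => hκ (by
    have := h2 u hu; rw [h0] at this; linarith)
  have hc := hE.const_ne_zero hf
  have key : ∀ {C p r s m : ℝ} {k : Case}, k ≠ .c1_1 → k.Normalized →
      3 = k.ops.length → p ≠ 0 → r ≠ 0 → m ≠ 0 →
      (∀ {E'}, GRel (E.shiftK (-C)) E' (p ^ 2 / (m * c)) 0 p 0 r s m →
        EqOn E'.f (fun _ => 1) E'.I → k.Entry E') → E.Classified :=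
    fun {C p r s m k} hk hN hl hp hr hm he => by
      have hE₁ := hE.shiftK (-C)
      have hG₁ := hG.shiftK (-C)
      refine classified_of_shiftK hE hf (κ := -C) ?_
      obtain ⟨E', -, h'⟩ := exists_gRel hE₁ (a := p ^ 2 / (m * c)) 0 s
        (div_ne_zero (pow_ne_zero 2 hp) (mul_ne_zero hm hc)) hp hr hm
      refine h'.classified_entry hE₁ hk hN (hl ▸ ?_) (he h' (h'.eqOn_f fun x hx => ?_))
      · exact (rank_of_allAff_const hE₁ (hG₁.allAff hE₁) hf hG₁.K_nonconst hG₁.not_affine).elim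
          (·.trans (by norm_num)) (·.1)
      · rw [show (E.shiftK (-C)).f x = c from hf x hx]; field_simp
  obtain ⟨u₀, h₀⟩ := hE.hJ.2.2
  by_cases hα : α = 0
  · subst hα
    have hβ : β ≠ 0 := by simpa using hz u₀ h₀
    obtain ⟨d, hD⟩ := exp_ode hE.hJ (h := E.D) (k := ρ / β) (fun u hu => hE.hasDerivAt_D hu)
      fun u hu => by have := h1 u hu; field_simp; linear_combination this
    obtain ⟨C, hK⟩ := eqOn_affine_of_hasDerivAt hE.hJ (g := E.K) (k := -κ / β) fun u hu =>
      (hE.hasDerivAt_K hu).congr_deriv (by have := h2 u hu; field_simp; linear_combination this)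
    have hd : d ≠ 0 := fun h => hE.D_ne u₀ h₀ (by rw [hD u₀ h₀, h, zero_mul])
    have hρ : ρ / β ≠ 0 := fun h => hG.not_affine
      ⟨⟨d, fun u hu => by rw [hD u hu, h]; simp⟩, _, _, hK⟩
    have hp : -κ / β / (ρ / β * d) ≠ 0 := div_ne_zero (div_ne_zero (neg_ne_zero.2 hκ) hβ)
      (mul_ne_zero hρ hd)
    refine key (C := C) (s := 0) (k := .c2_3) (by simp) trivial rfl hp hρ (inv_ne_zero hd) fun h' e =>
      ⟨h'.eqOn_D fun u hu => ?_, h'.eqOn_K fun u hu => ?_, e⟩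
    · rw [show (E.shiftK (-C)).D u = E.D u from rfl, hD u hu]; field_simp; simp
    · have hρ' : ρ ≠ 0 := fun h => hρ (by simp [h])
      rw [show (E.shiftK (-C)).K u = E.K u + -C from rfl, hK u hu]; field_simp; ring
  · obtain ⟨r, hr, hp⟩ := exists_sign hE.hJ (s := β / α) fun u hu h0 => hz u hu (by
      field_simp at h0; linear_combination h0)
    have hr0 : r ≠ 0 := by rcases hr with rfl | rfl <;> norm_num
    obtain ⟨d, hD⟩ := pow_ode hE.hJ (fun u hu => hE.hasDerivAt_D hu) hp (σ := ρ / α)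
      fun u hu => by
        have : (u + β / α) * deriv E.D u = ρ / α * E.D u := by
          field_simp; linear_combination h1 u hu
        linear_combination r * this
    have hd : d ≠ 0 := fun h => hE.D_ne u₀ h₀ (by rw [hD u₀ h₀, h, zero_mul])
    have hl : ∀ u ∈ E.J, HasDerivAt (fun u => log (r * u + r * (β / α)))
        (r / (r * u + r * (β / α))) u := fun u hu => by
      simpa using (((hasDerivAt_id u).const_mul r).add_const (r * (β / α))).log (hp u hu).ne'
    have hK : ∀ u ∈ E.J, E.K u = -κ / α * log (r * u + r * (β / α)) +
        (E.K u₀ + κ / α * log (r * u₀ + r * (β / α))) := fun u hu => by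
      have := eq_of_deriv_eq_zero hE.hJ
        (g := fun u => E.K u + κ / α * log (r * u + r * (β / α)))
        (fun u hu => (hE.hasDerivAt_K hu).add ((hl u hu).const_mul (κ / α))) (fun u hu => by
          have h3 := hz u hu
          have h4 : u + β / α ≠ 0 := fun h => h3 (by field_simp at h; linear_combination h)
          have h5 := h2 u hu
          rw [show r * u + r * (β / α) = r * (u + β / α) by ring, div_mul_cancel_left₀ hr0,
            show u + β / α = (α * u + β) / α by field_simp]
          field_simp
          linear_combination h5) hu h₀
      rw [← sub_eq_iff_eq_add', ← this]; ring
    set C := E.K u₀ + κ / α * log (r * u₀ + r * (β / α))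
    have hp' : -κ / α / d ≠ 0 := div_ne_zero (div_ne_zero (neg_ne_zero.2 hκ) hα) hd
    refine key (C := C) (s := r * (β / α)) (k := .c3_3 (ρ / α)) (by simp) trivial rfl hp' hr0
      (inv_ne_zero hd) fun h' e =>
      ⟨h'.subset_Ioi hp, h'.eqOn_D fun u hu => ?_, h'.eqOn_K fun u hu => ?_, e⟩
    · rw [show (E.shiftK (-C)).D u = E.D u from rfl, hD u hu]; field_simp
    · rw [show (E.shiftK (-C)).K u = E.K u + -C from rfl, hK u hu]; field_simp; ring

lemma Eqn.Generic.classified (hG : E.Generic) (hE : E.Nonlinear) : E.Classified := by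
  by_cases hf : ConstOn E.f E.I
  · obtain ⟨c, hf⟩ := hf
    rcases rank_of_allAff_const hE (hG.allAff hE) hf hG.K_nonconst hG.not_affine with h |
      ⟨-, α, β, ρ, ν, κ, hαβ, h1, h2⟩
    · exact classified_of_f_exp hE (ε := 0) (hE.const_ne_zero hf) (by simpa using hf) h
    · by_cases hν : ν = 0
      · exact hG.classified_of_log_weight hE hf hαβ h1 (κ := κ) fun u hu => by
          rw [h2 u hu, hν]; ring
      · refine classified_of_shiftK hE hf ((hG.shiftK (-κ / ν)).classified_of_weight
          (hE.shiftK _) hf hαβ h1 (ν := ν) fun u hu => ?_)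
        have e : deriv (E.shiftK (-κ / ν)).K u = deriv E.K u := deriv_add_const _
        rw [e, h2 u hu]
        simp only [Eqn.shiftK]
        field_simp; ring
  · exact classified_of_allAff hE (hG.allAff hE) hf hG.not_prop

def expTimeOp : VField :=
  op fun t x _ => (-exp (-t), exp (-t) * x, 0)

lemma Sol.form_inv (hE : E.Nonlinear) (hD : ¬ ConstOn E.D E.J) (hK : ∀ u ∈ E.J, E.K u = 1)
    (hf : EqOn E.f (fun x => x⁻¹) E.I) {a b c : ℝ} (hc : c ≠ 0) (hw : E.DEq a b c) (s : Sol E) :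
    ∃ τ₀ κ l L : ℝ, L * (3 * (a + c) - c) = 0 ∧ ∀ t ∈ E.T, ∀ x ∈ E.I, ∀ u ∈ E.J, s.Q (t, x, u) =
      (τ₀, 0, 0) + κ • expTimeOp (t, x, u) +
        l • (0, c * x, a * u + b) +
        L • (0, (a + c) * exp t * x ^ 2, exp t * x * (a * u + b)) := by
  obtain ⟨w, hw'⟩ := exists_wSol hE hc hw s
  obtain ⟨τ₀, κ, L, l, hL, -, hQ⟩ := w.form_inv hE hD hK hf (.inl ⟨hw, hw.ne_zero hE hc⟩)
  refine ⟨τ₀, κ, l, L, hL, fun t ht x hx u hu => ?_⟩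
  rw [hw' ⟨ht, hx, hu⟩, hQ t ht x hx u hu]
  ext <;> simp [op, expTimeOp] <;> ring

lemma classified_inv (hE : E.Nonlinear) (hD : ¬ ConstOn E.D E.J) (hK : ∀ u ∈ E.J, E.K u = 1)
    (hf : EqOn E.f (fun x => x⁻¹) E.I) : E.Classified := by
  rcases hE.exists_DEq_or_rigid hD with ⟨a, b, c, hc, h⟩ | hR
  · obtain ⟨r, s, m, hr, hm, hn⟩ := h.normal hE hD hc
    obtain ⟨E', hE', h'⟩ := exists_gRel hE 0 s one_ne_zero hm hr hm
    have hK' : ∀ u ∈ E'.J, E'.K u = 1 := h'.eqOn_K (d := fun _ => 1) fun u hu => by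
      rw [hK u hu, div_self hm, one_mul]
    have hf' : EqOn E'.f (fun x => x⁻¹) E'.I := h'.eqOn_f fun x hx => by
      have := (φ_inv hE hf x hx).1
      rw [hf hx]; field_simp; ring
    have hD' : ¬ ConstOn E'.D E'.J := fun h => hD (h'.constOn_D h)
    refine h'.classified hE ?_
    rcases hn with hn | ⟨μ, hμ, hn⟩
    · have e := h'.eqOn_D (d := exp) hn
      have hform := Sol.form_inv hE' hD' hK' hf' one_ne_zero (Eqn.DEq_exp_one hE'.hJ.1 e)
      refine hE'.classified_of_entry (c := .c2_5c) (by simp) trivial ⟨e, hK', hf'⟩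
        (rank_le_three hE' (q₁ := expTimeOp) (q₂ := op fun _ x _ => (0, x, 1)) fun s => ?_)
      obtain ⟨τ₀, κ, l, L, hL, hQ⟩ := hform s
      refine ⟨τ₀, κ, l, fun t ht x hx u hu => (hQ t ht x hx u hu).trans ?_⟩
      obtain rfl : L = 0 := by norm_num at hL; exact hL
      simp [op]
    · have e := h'.eqOn_D (d := fun u => u ^ μ) fun u hu => (hn u hu).2
      have e0 := h'.subset_Ioi fun u hu => (hn u hu).1
      have hform := Sol.form_inv hE' hD' hK' hf' hμ (Eqn.DEq_rpow hE'.hJ.1 (.inl e0) e)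
      by_cases h32 : μ = -3 / 2
      · subst h32
        refine hE'.classified_of_entry (c := .c3_6g) (by simp) trivial ⟨e0, e, hK', hf'⟩
          (rank_le_four hE' (q₁ := expTimeOp) (q₂ := op fun _ x u => (0, -3 / 2 * x, u))
            (q₃ := op fun t x u => (0, -1 / 2 * exp t * x ^ 2, exp t * x * u))
            fun s => ?_)
        obtain ⟨τ₀, κ, l, L, hL, hQ⟩ := hform s
        refine ⟨τ₀, κ, l, L, fun t ht x hx u hu => (hQ t ht x hx u hu).trans ?_⟩
        norm_num [op]
      · refine hE'.classified_of_entry (c := .c3_5c μ) (by simp) trivial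
          ⟨e0, hμ, h32, e, hK', hf'⟩
          (rank_le_three hE' (q₁ := expTimeOp) (q₂ := op fun _ x u => (0, μ * x, u)) fun s => ?_)
        obtain ⟨τ₀, κ, l, L, hL, hQ⟩ := hform s
        refine ⟨τ₀, κ, l, fun t ht x hx u hu => (hQ t ht x hx u hu).trans ?_⟩
        obtain rfl : L = 0 := (mul_eq_zero.1 hL).resolve_right fun h => h32 (by linarith)
        simp [op]
  · refine hE.classified_of_entry (c := .c1_2e) (by simp) trivial ⟨fun _ _ => rfl, hK, hf⟩
      (rank_le_two hE (q₁ := expTimeOp) fun s => ?_)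
    obtain ⟨w, hl, hw⟩ := exists_wSol_of_rigid hE hR s
    obtain ⟨τ₀, κ, L, l, -, hL, hQ⟩ := w.form_inv hE hD hK hf (.inr fun t _ x _ => hl t x)
    refine ⟨τ₀, κ, fun t ht x hx u hu => ?_⟩
    obtain ⟨h1, h2⟩ := lin_eq_zero hE.hI (Y := fun x => x) (injOn_id _)
      fun x hx => (hL t ht x hx).symm.trans (hl t x)
    rw [hw ⟨ht, hx, hu⟩, hQ t ht x hx u hu, h1, h2]
    ext <;> simp [expTimeOp, op, h1] <;> ring

lemma exists_burgers (hE : E.Nonlinear) {c d k₁ k₀ : ℝ} (hf : ∀ x ∈ E.I, E.f x = c)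
    (hd : ∀ u ∈ E.J, E.D u = d) (hK : ∀ u ∈ E.J, E.K u = k₁ * u + k₀) (hk : k₁ ≠ 0) :
    ∃ E', E'.Nonlinear ∧ GRel E E' (d / c) 0 1 0 (d⁻¹ * k₁) (d⁻¹ * k₀) d⁻¹ ∧
      Case.c3_8.Entry E' := by
  have hc := hE.const_ne_zero hf
  have hd0 : d ≠ 0 := by
    obtain ⟨u, hu⟩ := hE.hJ.2.2
    exact hd u hu ▸ hE.D_ne u hu
  obtain ⟨E', hE', h'⟩ := exists_gRel hE 0 (d⁻¹ * k₀) (div_ne_zero hd0 hc) one_ne_zero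
    (mul_ne_zero (inv_ne_zero hd0) hk) (inv_ne_zero hd0)
  refine ⟨E', hE', h', h'.eqOn_D fun u hu => ?_, h'.eqOn_K fun u hu => ?_,
    h'.eqOn_f fun x hx => ?_⟩
  · rw [hd u hu, inv_mul_cancel₀ hd0]
  · rw [hK u hu]; ring
  · rw [hf x hx]; field_simp

/-- Every equation is covered by the list. -/
theorem Eqn.Nonlinear.classified (hE : E.Nonlinear) : E.Classified := by
  by_cases hD : ConstOn E.D E.J
  · obtain ⟨d, hd⟩ := hD
    by_cases hK : ∃ p q, ∀ u ∈ E.J, E.K u = p * u + q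
    · obtain ⟨k₁, k₀, hK⟩ := hK
      have hk : k₁ ≠ 0 := fun h => hE.not_const hd (k := k₀) fun v hv => by simp [hK v hv, h]
      by_cases hf : ConstOn E.f E.I
      · obtain ⟨c, hf⟩ := hf
        obtain ⟨E', hE', h', he⟩ := exists_burgers hE hf hd hK hk
        exact h'.classified hE (hE'.classified_of_entry (c := .c3_8) (by simp) trivial
          he (rank_burgers hE' he.1 he.2.1 he.2.2))
      · refine classified_of_allAff hE (allAff_of_affine hE hf hd hK hk) hf fun ⟨p, hp⟩ => hk
          (lin_eq_zero hE.hJ (Y := fun u => u) (injOn_id _) (c := k₀ - p * d) fun u hu => by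
            linear_combination hp u hu - hK u hu + p * hd u hu).1
    · exact Eqn.Generic.classified (.inr ⟨⟨d, hd⟩, hK⟩) hE
  · by_cases hK : E.KinSpan
    · obtain ⟨p, q, hK⟩ := hK
      by_cases hq : q = 0
      · exact classified_prop hE hD (k := p) fun u hu => by rw [hK u hu, hq, add_zero]
      by_cases hf : ConstOn E.f E.I
      · obtain ⟨c, hf⟩ := hf
        exact classified_of_shiftK hE hf (κ := -q) (classified_prop (hE.shiftK _) hD (k := p)
          fun u hu => by
            rw [show (E.shiftK (-q)).K u = E.K u + -q from rfl, hK u hu]; exact add_neg_cancel_right _ _)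
      have hKD : ¬ ∃ k, ∀ u ∈ E.J, E.K u = k * E.D u := fun ⟨k, hk⟩ => hq
        (const_indep hD (A := p - k) fun u hu => by linear_combination hk u hu - hK u hu).2
      by_cases hp : p = 0
      · subst hp
        have hK' : ∀ u ∈ E.J, E.K u = q := fun u hu => by rw [hK u hu]; ring
        by_cases hfC : ∃ C δ : ℝ, C ≠ 0 ∧ ∀ x ∈ E.I, E.f x * (x + δ) = C
        · obtain ⟨C, δ, hC, hfC⟩ := hfC
          obtain ⟨E', hE', h'⟩ := exists_gRel hE (q * δ) 0 (div_ne_zero hq hC) hq one_ne_zero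
            one_ne_zero
          refine h'.classified hE (classified_inv hE' (fun h => hD (h'.constOn_D h))
            (h'.eqOn_K (d := fun _ => 1) fun u hu => ?_) (h'.eqOn_f fun x hx => ?_))
          · rw [hK' u hu]; field_simp
          · have h0 : x + δ ≠ 0 := fun h0 => hC (by rw [← hfC x hx, h0, mul_zero])
            rw [← mul_add, mul_inv, ← hfC x hx]
            have := hE.f_ne x hx
            field_simp
        · exact classified_of_allAff hE (allAff_of_const_K hE hD hf hq hK' hfC) hf hKD
      · obtain ⟨E', hE', h'⟩ := exists_gRel hE 0 0 one_ne_zero hp one_ne_zero one_ne_zero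
        have hJ : E'.J = E.J := Set.ext fun u => by simpa using h'.hJ u
        have hf' : ¬ ConstOn E'.f E'.I := fun h => hf (h'.constOn_f h)
        have eD : EqOn E'.D E.D E.J := fun u hu => by simpa using h'.hD u hu
        have eK : ∀ u ∈ E.J, E'.K u = p⁻¹ * E.K u := fun u hu => by simpa using h'.hK u hu
        refine h'.classified hE (classified_of_allAff hE' (allAff_of_span hE'
          (fun h => hD (h'.constOn_D h)) hf' (q := q / p) (div_ne_zero hq hp) fun u hu => ?_) hf'
          fun ⟨k, hk⟩ => hKD ⟨p * k, fun u hu => ?_⟩)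
        · rw [hJ] at hu
          rw [eK u hu, eD hu, hK u hu]; field_simp
        · have := hk u (hJ ▸ hu)
          rw [eK u hu, eD hu] at this
          field_simp at this; linear_combination this
    · exact Eqn.Generic.classified (.inl ⟨hD, hK⟩) hE

/-! ### Change of the convection coefficient by a constant -/

lemma jet_t_const {T I : Set ℝ} (hT : IsOpenInterval T) {g gt gx gxx : ℝ → ℝ → ℝ} {h : ℝ → ℝ}
    (j : Jet T I g gt gx gxx) (hI : IsOpenInterval I) {A : ℝ → ℝ}
    (hx : ∀ t ∈ T, ∀ x ∈ I, gx t x = A t) (ht : ∀ t ∈ T, ∀ x ∈ I, gt t x = h t) :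
    ∃ k, ∀ t ∈ T, A t = k := by
  obtain ⟨x, h1, y, h2, hne⟩ := hI.exists_two
  obtain ⟨t₀, h₀⟩ := hT.2.2
  have e : ∀ t ∈ T, g t x - g t y = A t * (x - y) := fun t ht => by
    obtain ⟨c, hc⟩ := eqOn_affine_of_hasDerivAt hI (g := g t) (k := A t) fun x hx' =>
      (j.x t ht x hx').congr_deriv (hx t ht x hx')
    rw [hc x h1, hc y h2]; ring
  refine ⟨A t₀, fun t h => mul_right_cancel₀ (sub_ne_zero.2 hne) ?_⟩
  rw [← e t h, ← e t₀ h₀]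
  exact eq_of_deriv_eq_zero hT (g := fun t => g t x - g t y)
    (fun t h => (j.t t h x h1).sub (j.t t h y h2)) (fun t h => by rw [ht t h x h1, ht t h y h2]; ring) h h₀

lemma le_rank_of_burgers (hE : E.Nonlinear) {c d k₁ k₀ : ℝ} (hf : ∀ x ∈ E.I, E.f x = c)
    (hd : ∀ u ∈ E.J, E.D u = d) (hK : ∀ u ∈ E.J, E.K u = k₁ * u + k₀) (hk : k₁ ≠ 0) :
    Module.rank ℝ (E.alg hE) = (5 : ℕ) := by
  obtain ⟨E', hE', h', he⟩ := exists_burgers hE hf hd hK hk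
  rw [h'.gEquiv.rank_eq hE hE']
  exact (rank_burgers hE' he.1 he.2.1 he.2.2).antisymm
    (length_le_rank hE' (ops_spec hE' .c3_8 he).1 (ops_spec hE' .c3_8 he).2)

section Const
variable {c₀ p q : ℝ} (hE : E.Nonlinear) (hf : ∀ x ∈ E.I, E.f x = c₀)
include hE hf

/-- The shear of the affine symmetries. -/
lemma Eqn.AllAff.rank_le_shiftK (hA : E.AllAff) (κ : ℝ) :
    Module.rank ℝ (E.alg hE) ≤ Module.rank ℝ ((E.shiftK κ).alg (hE.shiftK κ)) := by
  obtain ⟨t₀, h₀⟩ := hE.hT.2.2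
  obtain ⟨t₁, h₁, t₂, h₂, ht⟩ := hE.hT.exists_two
  obtain ⟨x₁, k₁, x₂, k₂, hx⟩ := hE.hI.exists_two
  obtain ⟨u₀, hu₀⟩ := hE.hJ.2.2
  have hc := hE.const_ne_zero hf
  let d : (E.dom → ℝ × ℝ × ℝ) →ₗ[ℝ] ℝ :=
    { toFun := fun X => ((X ⟨(t₀, x₁, u₀), h₀, k₁, hu₀⟩).2.1 - (X ⟨(t₀, x₂, u₀), h₀, k₂, hu₀⟩).2.1)
        / (x₁ - x₂) - ((X ⟨(t₁, x₁, u₀), h₁, k₁, hu₀⟩).1 - (X ⟨(t₂, x₁, u₀), h₂, k₁, hu₀⟩).1)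
        / (t₁ - t₂)
      map_add' := fun X Y => by simp only [Pi.add_apply, Prod.fst_add, Prod.snd_add]; ring
      map_smul' := fun k X => by
        simp only [Pi.smul_apply, Prod.smul_fst, Prod.smul_snd, smul_eq_mul, RingHom.id_apply]; ring }
  let L : (E.dom → ℝ × ℝ × ℝ) →ₗ[ℝ] (E.dom → ℝ × ℝ × ℝ) :=
    { toFun := fun X z => X z + (0, d X * κ / c₀ * z.1.1, 0)
      map_add' := fun X Y => by
        ext z <;> simp only [map_add, Pi.add_apply, Prod.fst_add, Prod.snd_add] <;> ring
      map_smul' := fun k X => by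
        ext z <;> simp only [map_smul, Pi.smul_apply, Prod.smul_fst, Prod.smul_snd, smul_eq_mul,
          RingHom.id_apply, Pi.add_apply, Prod.fst_add, Prod.snd_add] <;> ring }
  have hLi : Function.Injective L := by
    refine (injective_iff_map_eq_zero L).2 fun X hX => ?_
    have e : ∀ z : E.dom, X z = -(0, d X * κ / c₀ * z.1.1, 0) := fun z =>
      eq_neg_of_add_eq_zero_left (congrFun hX z)
    have : d X = 0 := by
      simp only [d, LinearMap.coe_mk, AddHom.coe_mk]
      rw [e, e, e, e]; simp
    funext z
    rw [e, this]; simp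
  refine LinearMap.rank_le_of_injective (L.restrict (p := E.alg hE)
    (q := ((E.shiftK κ).alg (hE.shiftK κ) : Submodule ℝ (E.dom → ℝ × ℝ × ℝ))) fun X hX => ?_) fun X Y h => Subtype.ext (hLi ?_)
  · obtain ⟨s, -, rfl⟩ := (mem_maxAlg_iff hE).1 hX
    obtain ⟨α, β, a₁, κ', ρ, τ, τ', ξ, ξt, h⟩ := hA s
    obtain ⟨τ₀, σ₀, hQ⟩ := h.f_const hE hf
    have hd : d (E.dom.domRestrict s.Q) = ρ - a₁ := by
      simp only [d, LinearMap.coe_mk, AddHom.coe_mk, Set.domRestrict_apply]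
      rw [hQ t₀ h₀ x₁ k₁ u₀ hu₀, hQ t₀ h₀ x₂ k₂ u₀ hu₀, hQ t₁ h₁ x₁ k₁ u₀ hu₀,
        hQ t₂ h₂ x₁ k₁ u₀ hu₀]
      have := sub_ne_zero.2 hx
      have := sub_ne_zero.2 ht
      field_simp; ring
    have hm := affine_mem (hE.shiftK κ) α β ρ 1 (2 * a₁ - ρ) τ₀ a₁ ((κ' + (ρ - a₁) * κ) / c₀) σ₀
      ((hE.shiftK κ).φ_const hf) (fun _ => h.hD) (fun x hx u hu => by
        have e : deriv (E.shiftK κ).K u = deriv E.K u := deriv_add_const _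
        rw [e, h.hK u hu, show (E.shiftK κ).f x = c₀ from hf x hx]
        simp only [Eqn.shiftK]; field_simp; ring)
      (T := fun t _ _ => (2 * a₁ - ρ) * t + τ₀) (X := fun t x _ => a₁ * x + (κ' + (ρ - a₁) * κ) / c₀ * t
        + σ₀) (U := fun _ _ u => 1 * (α * u + β))
    change _ ∈ (E.shiftK κ).maxAlg
    refine (congrArg (· ∈ (E.shiftK κ).maxAlg) (?_ : _ = L _)).mp hm
    funext z
    obtain ⟨⟨t, x, u⟩, ht, hx, hu⟩ := z
    refine Eq.trans ?_ (congrArg₂ (fun a b => a + (0, b * κ / c₀ * t, 0))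
      (hQ t ht x hx u hu) hd).symm
    simp only [Set.domRestrict_apply]
    ext <;> simp [op] <;> ring
  · exact congrArg Subtype.val h

variable (hD : ¬ ConstOn E.D E.J) (hK : ∀ u ∈ E.J, E.K u = p * E.D u + q)
include hD hK

omit hD hK in
lemma Eqn.const_span_aff {a b c : ℝ} (w : WSol E a b c) (hw : w.Ok)
    (eqs : ∀ t ∈ E.T, ∀ x ∈ E.I, w.lxx t x = -p * w.lx t x ∧ E.f x * w.lt t x = q * w.lx t x ∧
      w.ξxx t x = p * w.ξx t x + 2 * (a + c) * w.lx t x ∧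
      E.f x * w.ξt t x = q * (c * w.l t x - w.ξx t x))
    (hl : ∀ t ∈ E.T, ∀ x ∈ E.I, w.lx t x = 0) : ∃ α β a₁ κ ρ τ τ' ξ ξt,
      AffData E w.Q α β a₁ κ ρ τ τ' ξ ξt := by
  have hc := hE.const_ne_zero hf
  obtain ⟨n, hn⟩ := w.jl.const hE.hT hE.hI (fun t ht x hx => by
    have := (eqs t ht x hx).2.1
    rw [hf x hx, hl t ht x hx, mul_zero] at this
    exact (mul_eq_zero.1 this).resolve_left hc) hl
  have h1 : ∀ t ∈ E.T, ∀ x ∈ E.I, w.ξx t x = (c * n + w.τ' t) / 2 := fun t ht x hx => by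
    have := w.eq1 t ht x hx
    rw [hE.φ_const hf _ hx, hn t ht x hx] at this
    linarith
  have h2 : ∀ t ∈ E.T, ∀ x ∈ E.I, w.ξt t x = q * (c * n - (c * n + w.τ' t) / 2) / c₀ :=
    fun t ht x hx => by
      have := (eqs t ht x hx).2.2.2
      rw [h1 t ht x hx, hn t ht x hx, hf x hx] at this
      rw [← this]; field_simp
  obtain ⟨a₁, h3⟩ := jet_t_const hE.hT w.jξ hE.hI h1 h2
  exact ⟨_, _, _, _, _, _, _, _, _, w.affData hE hw hn (fun t ht x hx => (h1 t ht x hx).trans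
    (h3 t ht)) (κ := q * (c * n - a₁)) fun t ht x hx => by
      rw [hf x hx, h2 t ht x hx, h3 t ht]; field_simp⟩

end Const

section
variable {E E' : Eqn} {c₀ p q b : ℝ}

lemma base_exp_mul (hp : p ≠ 0) :
    Base p (fun x => exp (-p * x)) (fun x => -p * exp (-p * x)) :=
  ⟨hasDerivAt_exp_mul (-p), fun x => (hasDerivAt_exp_mul (-p) x).const_mul (-p), fun x =>
    mul_ne_zero (neg_ne_zero.2 hp) (Real.exp_ne_zero _), by fun_prop⟩

/-- The exceptional power `-2`. -/
lemma rank_of_exp_span (hE : E.Nonlinear) (hf : ∀ x ∈ E.I, E.f x = c₀)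
    (hD : ¬ ConstOn E.D E.J) (hK : ∀ u ∈ E.J, E.K u = p * E.D u + q) (hp : p ≠ 0)
    (h : E.DEq 1 b (-2)) : Module.rank ℝ (E.alg hE) = (4 : ℕ) := by
  have hc := hE.const_ne_zero hf
  have hw0 := h.ne_zero hE (by norm_num)
  have hK' : ∀ u ∈ E.J, deriv E.K u = p * deriv E.D u := fun u hu =>
    deriv_eq_of_eqOn hE.hJ.1 hu hK (((hE.hasDerivAt_D hu).const_mul p).add_const q)
  have B := base_exp_mul hp
  obtain ⟨v, hv⟩ : ∃ v, v = q / c₀ := ⟨_, rfl⟩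
  have hq : q = v * c₀ := by rw [hv]; field_simp
  subst hq
  clear hv
  let y : ℝ → ℝ → ℝ := fun t x => exp (-p * (x + v * t))
  have hyx : ∀ t x, HasDerivAt (y t) (-p * y t x) x := fun t x =>
    (((hasDerivAt_id x).add_const (v * t)).const_mul (-p)).exp.congr_deriv (by
      simp only [y, id]; ring)
  have hyt : ∀ t x, HasDerivAt (fun t => y t x) (-p * v * y t x) t := fun t x =>
    ((((hasDerivAt_id t).const_mul v).const_add x).const_mul (-p)).exp.congr_deriv (by
      simp only [y, id]; ring)
  obtain ⟨t₀, ht⟩ := hE.hT.2.2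
  obtain ⟨u₀, hu⟩ := hE.hJ.2.2
  have m₁ := affine_mem hE 0 0 0 0 0 0 0 0 1 (hE.φ_const hf) (T := fun _ _ _ => 0)
    (X := fun _ _ _ => 1) (U := fun _ _ _ => 0)
  have m₂ := affine_mem hE 1 b (-2) (1 / 2) 1 0 0 (-v) 0 (hE.φ_const hf) (fun _ => h)
    (fun x hx u hu => by
      rw [hK' u hu, hf x hx, hK u hu]
      linear_combination p / 2 * h u hu) (T := fun t _ _ => t) (X := fun t _ _ => -v * t)
      (U := fun _ _ u => 1 / 2 * (u + b))
  have m₃ : E.dom.domRestrict (op fun t x u => (0, 1 / p * y t x, y t x * (u + b))) ∈ E.maxAlg :=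
    mem_maxAlg_of_wSol hE (a := 1) (b := b) (c := -2)
        { τ := fun _ => 0, τ' := fun _ => 0
          ξ := fun t x => 1 / p * y t x, ξt := fun t x => 1 / p * (-p * v * y t x)
          ξx := fun t x => 1 / p * (-p * y t x), ξxx := fun t x => 1 / p * (-p * (-p * y t x))
          l := y, lt := fun t x => -p * v * y t x, lx := fun t x => -p * y t x
          lxx := fun t x => -p * (-p * y t x)
          jτ := fun t _ => hasDerivAt_const t _
          jξ := ⟨fun t _ x _ => (hyt t x).const_mul _, fun t _ x _ => (hyx t x).const_mul _,
            fun t _ x _ => ((hyx t x).const_mul _).const_mul _⟩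
          jl := ⟨fun t _ x _ => hyt t x, fun t _ x _ => hyx t x,
            fun t _ x _ => (hyx t x).const_mul _⟩
          eq1 := fun t _ x hx => by rw [hE.φ_const hf x hx]; field_simp; ring
          eq3 := fun t _ x hx u hu => by
            rw [hK' u hu, hK u hu, hf x hx]
            field_simp
            linear_combination p * y t x * h u hu
          eq4 := fun t _ x hx u hu => by rw [hK u hu, hf x hx]; ring } (.inl h)
        (show ContDiffOn ℝ ∞ (fun z : ℝ × ℝ × ℝ => ((0 : ℝ), 1 / p * exp (-p * (z.2.1 + v * z.1)),
          exp (-p * (z.2.1 + v * z.1)) * (z.2.2 + b))) E.dom by fun_prop) fun t _ x _ u _ => by simp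
  have hs := spec_four hE ht hu m₁ m₂ m₃ fun k₁ k₂ k₃ hk => by
    have hu0 : u₀ + b ≠ 0 := by simpa using hw0 u₀ hu
    obtain ⟨h3, h4⟩ := lin_eq_zero hE.hI (Y := y t₀) (fun v _ w _ huv => by
        have := mul_left_cancel₀ (neg_ne_zero.2 hp) (Real.exp_injective huv)
        linarith) (b := (u₀ + b) * k₃) (c := (u₀ + b) / 2 * k₂) fun x hx => by
      linear_combination (hk x hx).2
    obtain ⟨x, hx⟩ := hE.hI.2.2
    obtain rfl := zero_of_mul hu0 h3
    obtain rfl := zero_of_mul (div_ne_zero hu0 two_ne_zero) h4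
    exact ⟨by simpa using (hk x hx).1, rfl, rfl⟩
  refine le_antisymm (rank_le_four hE (q₁ := op fun _ _ _ => (0, 1, 0))
    (q₂ := op fun t _ u => (t, -v * t, 1 / 2 * (u + b)))
    (q₃ := op fun t x u => (0, 1 / p * y t x, y t x * (u + b))) fun s => ?_)
    (length_le_rank hE hs.1 hs.2)
  obtain ⟨w, hw⟩ := exists_wSol hE (by norm_num) h s
  obtain ⟨β, β', l, l', g, g', k, k', H⟩ := w.exists_coeffs hE hD B hK (.inl ⟨h, hw0⟩)
  have e1 : ∀ t ∈ E.T, w.τ' t = 2 * l t ∧ k t = 0 := fun t ht => by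
    obtain ⟨h1, h2⟩ := lin_eq_zero hE.hI B.inj.injOn (b := w.τ' t - 2 * l t) (c := 2 * k t)
      fun x hx => by
        have := H.e1 t ht x hx
        rw [hE.φ_const hf x hx] at this
        exact mul_left_cancel₀ hp (by linear_combination this)
    exact ⟨by linarith, by linarith⟩
  have e2 : ∀ t ∈ E.T, β' t = -p * v * β t ∧ l' t = 0 := fun t ht => by
    obtain ⟨h1, h2⟩ := lin_eq_zero hE.hI B.inj.injOn (b := β' t + p * v * β t) (c := l' t)
      fun x hx => by
        have := H.e2 t ht x hx
        rw [hf x hx] at this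
        exact mul_left_cancel₀ hc (by linear_combination this)
    exact ⟨by linarith, h2⟩
  have hl : ∀ t ∈ E.T, l t = l t₀ := fun t h =>
    eq_of_deriv_eq_zero hE.hT H.hl (fun t ht => (e2 t ht).2) h ht
  have e3 : ∀ t ∈ E.T, g' t = 2 * p * v * l t₀ := fun t ht => by
    obtain ⟨-, h2, -⟩ := quad_eq_zero hE.hI B.inj.injOn (a := -β' t - p * v * β t)
      (b := g' t - 2 * p * v * l t) (c := k' t + v * p * k t) fun x hx => by
        have := H.e3 t ht x hx
        rw [hf x hx] at this
        exact mul_left_cancel₀ hc (by linear_combination this)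
    rw [← hl t ht]; linarith
  obtain ⟨A, hA⟩ := exp_ode hE.hT H.hβ fun t ht => (e2 t ht).1
  obtain ⟨τ₀, hτ⟩ := eqOn_affine_of_hasDerivAt hE.hT (g := w.τ) (k := 2 * l t₀) fun t ht =>
    (w.jτ t ht).congr_deriv (by rw [(e1 t ht).1, hl t ht])
  obtain ⟨g₀, hg⟩ := eqOn_affine_of_hasDerivAt hE.hT fun t ht => (H.hg t ht).congr_deriv (e3 t ht)
  refine ⟨τ₀, -g₀ / p, 2 * l t₀, A, fun t ht x hx u hu => (hw ⟨ht, hx, hu⟩).trans ?_⟩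
  have hy : y t x = exp (-p * v * t) * exp (-p * x) := by
    rw [← Real.exp_add]; simp only [y]; ring_nf
  have h1 := H.eq_ξ t ht x hx
  have h2 := Real.exp_ne_zero (-p * x)
  rw [(e1 t ht).2, hg t ht, hA t ht] at h1
  rw [show w.Q (t, x, u) = (w.τ t, w.ξ t x, w.l t x * (1 * u + b)) from rfl, hτ t ht,
    H.eq_l t ht x hx, hl t ht, hA t ht]
  generalize exp (-p * x) = Y, exp (-p * v * t) = Z at *
  ext <;> simp only [op, hy, Prod.smul_mk, Prod.mk_add_mk, smul_eq_mul]
  · ring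
  · field_simp
    exact mul_right_cancel₀ h2 (by linear_combination -h1)
  · ring

/-- The exceptional power `-4/3`. -/
lemma rank_of_const_span (hE : E.Nonlinear) (hf : ∀ x ∈ E.I, E.f x = c₀)
    (hD : ¬ ConstOn E.D E.J) (hK : ∀ u ∈ E.J, E.K u = q)
    (h : E.DEq 1 b (-4 / 3)) : Module.rank ℝ (E.alg hE) = (5 : ℕ) := by
  have hc := hE.const_ne_zero hf
  have hw0 := h.ne_zero hE (by norm_num)
  have hK' : ∀ u ∈ E.J, deriv E.K u = 0 := fun u hu => deriv_const_of_eqOn hE.hJ.1 hK hu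
  obtain ⟨v, hv⟩ : ∃ v, v = q / c₀ := ⟨_, rfl⟩
  have hq : q = v * c₀ := by rw [hv]; field_simp
  subst hq
  clear hv
  let y : ℝ → ℝ → ℝ := fun t x => x + v * t
  have hyx : ∀ t x, HasDerivAt (y t) 1 x := fun t x => (hasDerivAt_id x).add_const (v * t)
  have hyt : ∀ t x, HasDerivAt (fun t => y t x) v t := fun t x =>
    (((hasDerivAt_id t).const_mul v).const_add x).congr_deriv (mul_one _)
  obtain ⟨t₀, ht⟩ := hE.hT.2.2
  obtain ⟨u₀, hu⟩ := hE.hJ.2.2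
  have m₁ := affine_mem hE 0 0 0 0 0 0 0 0 1 (hE.φ_const hf) (T := fun _ _ _ => 0)
    (X := fun _ _ _ => 1) (U := fun _ _ _ => 0)
  have m₂ := affine_mem hE 0 0 0 0 1 0 (1 / 2) (-v / 2) 0 (hE.φ_const hf) (by simp)
    (fun x hx u hu => by rw [hf x hx, hK u hu]; ring) (T := fun t _ _ => t)
    (X := fun t x _ => x / 2 - v / 2 * t) (U := fun _ _ _ => 0)
  have m₃ := affine_mem hE 1 b (-4 / 3) 1 0 0 (-2 / 3) (-2 / 3 * v) 0 (hE.φ_const hf) (fun _ => h)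
    (fun x hx u hu => by rw [hf x hx, hK u hu, hK' u hu]; ring) (T := fun _ _ _ => 0)
    (X := fun t x _ => -2 / 3 * y t x) (h2 := fun t x u => by simp only [y]; ring)
    (U := fun _ _ u => u + b)
  have m₄ : E.dom.domRestrict (op fun t x u => (0, -1 / 3 * y t x ^ 2, y t x * (u + b)))
      ∈ E.maxAlg :=
    mem_maxAlg_of_wSol hE (a := 1) (b := b) (c := -4 / 3)
        { τ := fun _ => 0, τ' := fun _ => 0
          ξ := fun t x => -1 / 3 * y t x ^ 2, ξt := fun t x => -2 / 3 * v * y t x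
          ξx := fun t x => -2 / 3 * y t x, ξxx := fun t x => -2 / 3 * 1
          l := y, lt := fun _ _ => v, lx := fun _ _ => 1, lxx := fun _ _ => 0
          jτ := fun t _ => hasDerivAt_const t _
          jξ := ⟨fun t _ x _ => (((hyt t x).pow 2).const_mul _).congr_deriv (by push_cast; ring),
            fun t _ x _ => (((hyx t x).pow 2).const_mul _).congr_deriv (by push_cast; ring),
            fun t _ x _ => (hyx t x).const_mul _⟩
          jl := ⟨fun t _ x _ => hyt t x, fun t _ x _ => hyx t x,
            fun t _ x _ => hasDerivAt_const x _⟩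
          eq1 := fun t _ x hx => by rw [hE.φ_const hf x hx]; ring
          eq3 := fun t _ x hx u hu => by rw [hK' u hu, hK u hu, hf x hx]; ring
          eq4 := fun t _ x hx u hu => by rw [hK u hu, hf x hx]; ring } (.inl h)
        (show ContDiffOn ℝ ∞ (fun z : ℝ × ℝ × ℝ => ((0 : ℝ), -1 / 3 * (z.2.1 + v * z.1) ^ 2,
          (z.2.1 + v * z.1) * (z.2.2 + b))) E.dom by fun_prop) fun t _ x _ u _ => by simp
  have hs := spec_five hE ht hu m₁ m₂ m₃ m₄ fun k₁ k₂ k₃ k₄ hk => by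
    have hu0 : u₀ + b ≠ 0 := by simpa using hw0 u₀ hu
    obtain ⟨h3, h4⟩ := lin_eq_zero hE.hI (Y := y t₀) (fun v _ w _ huv => by
        simp only [y] at huv; linarith) (b := (u₀ + b) * k₄) (c := (u₀ + b) * k₃) fun x hx => by
      linear_combination (hk x hx).2
    obtain rfl := zero_of_mul hu0 h3
    obtain rfl := zero_of_mul hu0 h4
    obtain ⟨h7, h8⟩ := lin_eq_zero hE.hI (Y := fun x => x) (injOn_id _) (b := k₂ / 2)
      (c := k₁ - k₂ * (v / 2 * t₀)) fun x hx => by linear_combination (hk x hx).1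
    obtain rfl : k₂ = 0 := by linarith
    exact ⟨by linarith, rfl, rfl, rfl⟩
  refine le_antisymm (rank_le_five hE (q₁ := op fun _ _ _ => (0, 1, 0))
    (q₂ := op fun t x _ => (t, x / 2 - v / 2 * t, 0))
    (q₃ := op fun t x u => (0, -2 / 3 * y t x, u + b))
    (q₄ := op fun t x u => (0, -1 / 3 * y t x ^ 2, y t x * (u + b))) fun s => ?_)
    (length_le_rank hE hs.1 hs.2)
  obtain ⟨w, hw⟩ := exists_wSol hE (by norm_num) h s
  obtain ⟨β, β', l, l', g, g', k, k', H⟩ := w.exists_coeffs hE hD base_id (q := v * c₀)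
    (fun u hu => by rw [hK u hu]; ring) (.inl ⟨h, hw0⟩)
  have inj := injOn_id E.I
  obtain ⟨x₀, hx₀⟩ := hE.hI.2.2
  have e1 : ∀ t ∈ E.T, w.τ' t = 4 / 3 * l t + 2 * g t := fun t ht => by
    have := H.e1 t ht x₀ hx₀
    rw [hE.φ_const hf x₀ hx₀] at this
    linear_combination -this
  have e2 : ∀ t ∈ E.T, β' t = 0 ∧ l' t = v * β t := fun t ht => by
    obtain ⟨h1, h2⟩ := lin_eq_zero hE.hI (Y := fun x => x) inj (b := β' t) (c := l' t - v * β t)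
      fun x hx => by
        have := H.e2 t ht x hx
        rw [hf x hx] at this
        exact mul_left_cancel₀ hc (by linear_combination this)
    exact ⟨h1, by linarith⟩
  have e3 : ∀ t ∈ E.T, g' t = -2 / 3 * v * β t ∧ k' t = -v * (4 / 3 * l t + g t) := fun t ht => by
    obtain ⟨-, h1, h2⟩ := quad_eq_zero hE.hI (Y := fun x => x) inj (a := -1 / 3 * β' t)
      (b := g' t + 2 / 3 * v * β t) (c := k' t + v * (4 / 3 * l t + g t)) fun x hx => by
        have := H.e3 t ht x hx
        rw [hf x hx] at this
        exact mul_left_cancel₀ hc (by linear_combination this)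
    exact ⟨by linarith, by linarith⟩
  obtain ⟨m, hm⟩ := eqOn_affine_of_hasDerivAt hE.hT fun t ht => (H.hβ t ht).congr_deriv (e2 t ht).1
  simp only [zero_mul, zero_add] at hm
  obtain ⟨n, hn⟩ := eqOn_affine_of_hasDerivAt hE.hT fun t ht => (H.hl t ht).congr_deriv
    ((e2 t ht).2.trans (by rw [hm t ht]))
  obtain ⟨g₀, hg⟩ := eqOn_affine_of_hasDerivAt hE.hT fun t ht => (H.hg t ht).congr_deriv
    ((e3 t ht).1.trans (by rw [hm t ht]))
  obtain ⟨σ₀, hσ⟩ := eqOn_affine_of_hasDerivAt hE.hT (g := fun t => k t + v ^ 2 * m / 3 * t ^ 2)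
    (k := -v * (4 / 3 * n + g₀)) fun t ht => ((H.hh t ht).add ((hasDerivAt_pow 2 t).const_mul
      (v ^ 2 * m / 3))).congr_deriv (by rw [(e3 t ht).2, hn t ht, hg t ht]; push_cast; ring)
  obtain ⟨τ₀, hτ⟩ := eqOn_affine_of_hasDerivAt hE.hT (g := w.τ) (k := 4 / 3 * n + 2 * g₀) fun t ht =>
    (w.jτ t ht).congr_deriv (by rw [e1 t ht, hn t ht, hg t ht]; ring)
  refine ⟨τ₀, σ₀, 4 / 3 * n + 2 * g₀, n, m, fun t ht x hx u hu => (hw ⟨ht, hx, hu⟩).trans ?_⟩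
  have h1 := H.eq_ξ t ht x hx
  rw [hm t ht, hg t ht] at h1
  rw [show w.Q (t, x, u) = (w.τ t, w.ξ t x, w.l t x * (1 * u + b)) from rfl, hτ t ht,
    H.eq_l t ht x hx, hm t ht, hn t ht]
  ext <;> simp only [op, y, Prod.smul_mk, Prod.mk_add_mk, smul_eq_mul]
  · ring
  · linear_combination h1 + hσ t ht
  · ring

/-- The dimension of the algebra does not depend on the additive constant. -/
lemma rank_le_shiftK (hE : E.Nonlinear) (hf : ∀ x ∈ E.I, E.f x = c₀) (κ : ℝ) :
    Module.rank ℝ (E.alg hE) ≤ Module.rank ℝ ((E.shiftK κ).alg (hE.shiftK κ)) := by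
  by_cases hD : ConstOn E.D E.J
  · obtain ⟨d, hd⟩ := hD
    by_cases hK : ∃ p q, ∀ u ∈ E.J, E.K u = p * u + q
    · obtain ⟨k₁, k₀, hK⟩ := hK
      have hk : k₁ ≠ 0 := fun h => hE.not_const hd (k := k₀) fun v hv => by simp [hK v hv, h]
      rw [le_rank_of_burgers hE hf hd hK hk, le_rank_of_burgers (hE.shiftK κ) hf hd (k₀ := k₀ + κ)
        (fun u hu => by rw [← add_assoc, ← hK u hu]; rfl) hk]
    · exact (Eqn.Generic.allAff (.inr ⟨⟨d, hd⟩, hK⟩) hE).rank_le_shiftK hE hf κ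
  by_cases hK : E.KinSpan
  · obtain ⟨p, q, hK⟩ := hK
    have hKκ : ∀ u ∈ (E.shiftK κ).J, (E.shiftK κ).K u = p * (E.shiftK κ).D u + (q + κ) := fun u hu => by
      rw [← add_assoc]; exact congrArg (· + κ) (hK u hu)
    by_cases h1 : ∃ b, E.DEq 1 b (-2) ∧ p ≠ 0
    · obtain ⟨b, h1, hp⟩ := h1
      rw [rank_of_exp_span hE hf hD hK hp h1, rank_of_exp_span (hE.shiftK κ) hf hD hKκ hp h1]
    by_cases h2 : ∃ b, E.DEq 1 b (-4 / 3) ∧ p = 0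
    · obtain ⟨b, h2, rfl⟩ := h2
      rw [rank_of_const_span hE hf hD (by simpa using hK) h2,
        rank_of_const_span (hE.shiftK κ) hf hD (by simpa using hKκ) h2]
    have hA : E.AllAff := fun s => by
      obtain ⟨a, b, c, w, hc, hok, hw⟩ := exists_ok hE hD s
      have hl : ∀ t ∈ E.T, ∀ x ∈ E.I, w.lx t x = 0 := fun t ht => by
        rcases id hok with ⟨hd, -⟩ | h0
        · have hdiv : ∀ k, c = k * a → E.DEq 1 (b / a) k := fun k hk u hu => by
            have ha : a ≠ 0 := fun h => hc (by rw [hk, h, mul_zero])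
            have := hd u hu
            rw [hk] at this
            field_simp; linear_combination this
          have key : ∀ {y β l : ℝ → ℝ}, (∀ x ∈ E.I, w.l t x = β t * y x + l t) → β t = 0 →
              ∀ x ∈ E.I, w.lx t x = 0 := fun hl h x hx =>
            (w.jl.x t ht x hx).eq_zero_of_const hE.hI.1 hx fun x hx => by rw [hl x hx, h, zero_mul]
          by_cases hp : p = 0
          · subst hp
            obtain ⟨β, β', l, l', g, g', h, h', H⟩ := w.exists_coeffs hE hD base_id hK hok
            refine key (H.eq_l t ht) (zero_of_mul (fun h => h2 ⟨_, hdiv _ ?_, rfl⟩) (lin_eq_zero hE.hI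
              (Y := fun x => x) (injOn_id _) (b := (4 * a + 3 * c) * β t)
              (c := 2 * g t - c * l t - w.τ' t) fun x hx => ?_).1)
            · linarith
            · have := H.e1 t ht x hx
              rw [hE.φ_const hf x hx] at this
              linear_combination this
          · have B := base_exp_mul hp
            obtain ⟨β, β', l, l', g, g', h, h', H⟩ := w.exists_coeffs hE hD B hK hok
            refine key (H.eq_l t ht) (zero_of_mul (fun h => h1 ⟨_, hdiv _ ?_, hp⟩) (quad_eq_zero hE.hI
              B.inj.injOn (a := (2 * a + c) * β t)
              (b := -c * l t - w.τ' t) (c := -2 * h t) fun x hx => ?_).1)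
            · linarith
            · have := H.e1 t ht x hx
              rw [hE.φ_const hf x hx] at this
              refine mul_left_cancel₀ hp ?_
              linear_combination -this
        · exact fun x hx => (w.lx_eq_zero hE h0 t ht x hx).2.1
      obtain ⟨α, β, a₁, κ, ρ, τ, τ', ξ, ξt, h⟩ :=
        Eqn.const_span_aff hE hf w hok (w.span_eqs hE hD hK hok) hl
      exact ⟨_, _, _, _, _, _, _, _, _, h.congr hw⟩
    exact hA.rank_le_shiftK hE hf κ
  · exact (Eqn.Generic.allAff (.inl ⟨hD, hK⟩) hE).rank_le_shiftK hE hf κ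

lemma Equivalent.rank_le (h : Equivalent E E') (hE : E.Nonlinear) (hE' : E'.Nonlinear) :
    Module.rank ℝ (E.alg hE) ≤ Module.rank ℝ (E'.alg hE') := by
  obtain ⟨κ, h0, hg⟩ := h
  rw [← hg.rank_eq (hE.shiftK κ) hE']
  rcases h0 with rfl | ⟨c, hc⟩
  · have : ∀ E₁ (h₁ : E₁.Nonlinear), E₁ = E → Module.rank ℝ (E.alg hE) ≤ Module.rank ℝ (E₁.alg h₁) := by
      rintro _ _ rfl; rfl
    exact this _ _ E.shiftK_zero
  · exact rank_le_shiftK hE hc κ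
end

/-! ### When the listed operators form a basis -/

lemma Equivalent.rank_eq (h : Equivalent E E') (hE : E.Nonlinear) (hE' : E'.Nonlinear) :
    Module.rank ℝ (E.alg hE) = Module.rank ℝ (E'.alg hE') :=
  (h.rank_le hE hE').antisymm (h.symm.rank_le hE' hE)

lemma Case.length_le_rank {c : Case} (hE : E.Nonlinear) (hc : c.Entry E) :
    (c.ops.length : Cardinal) ≤ Module.rank ℝ (E.alg hE) :=
  DiffConv.length_le_rank hE (ops_spec hE c hc).1 (ops_spec hE c hc).2

lemma isBasis_iff_proper (hE : E.Nonlinear) {c : Case} (hc : c.Entry E) :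
    E.IsBasis c.ops ↔ c.Proper E := by
  refine ⟨fun h c' E' hE' hc' he => ?_, fun h => isBasis_of_rank hE (ops_spec hE c hc).1
    (ops_spec hE c hc).2 ?_⟩
  · have := Case.length_le_rank hE' hc'
    rw [← he.rank_eq hE hE', rank_eq_of_isBasis hE h] at this
    exact_mod_cast this
  · rcases hE.classified hE with h1 | ⟨c', E', -, hE', hc', -, he, hb⟩
    · exact h1.trans (by exact_mod_cast (by cases c <;> simp [Case.ops] : 1 ≤ c.ops.length))
    · rw [he.rank_eq hE hE', rank_eq_of_isBasis hE' hb]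
      exact_mod_cast h c' E' hE' hc' he

/-- `∂_t` alone does not exhaust the algebra unless its dimension is one. -/
lemma Eqn.HasExtension.exists_case (h : E.HasExtension) (hE : E.Nonlinear) :
    ∃ (c : Case) (E' : Eqn), c ≠ Case.c1_1 ∧ E'.Nonlinear ∧ c.Entry E' ∧ c.Normalized ∧
      Equivalent E E' ∧ E'.IsBasis c.ops := by
  refine (hE.classified hE).resolve_left fun h1 => h ?_
  obtain ⟨t, ht⟩ := hE.hT.2.2
  obtain ⟨u, hu⟩ := hE.hJ.2.2
  have hs : E.Spec [dt] := spec_cons hE ht hu (fun _ _ => by simp) (by simp)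
  have hb := (isBasis_of_rank hE hs.1 hs.2 h1).2
  rw [← hb]
  congr 2
  ext X
  simp [Eqn.fam, eq_comm]

section Weight
variable {α β μ ν l : ℝ} (hE : E.Nonlinear) (hαβ : α ≠ 0 ∨ β ≠ 0)
  (h1 : E.DEq α β μ)
  (h2 : ∀ u ∈ E.J, (α * u + β) * deriv E.K u = ν * E.K u)
include hE h1 h2

omit h2 in
lemma weight_D_ne_zero (hD : ¬ ConstOn E.D E.J) (hαβ : α ≠ 0 ∨ β ≠ 0) : μ ≠ 0 := fun h =>
  hD (hE.constOn_D_of_deriv (eq_zero_of_lin_mul hE.hJ.1 hαβ hE.continuousOn_dD fun u hu => by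
    rw [h1 u hu, h, zero_mul]))

lemma weight_span (hD : ¬ ConstOn E.D E.J) {p q : ℝ} (hK : ∀ u ∈ E.J, E.K u = p * E.D u + q) :
    p * (μ - ν) = 0 ∧ ν * q = 0 := by
  have := const_indep hD (A := p * (μ - ν)) (C := -(ν * q)) fun u hu => by
    have e : deriv E.K u = p * deriv E.D u :=
      deriv_eq_of_eqOn hE.hJ.1 hu hK (((hE.hasDerivAt_D hu).const_mul p).add_const q)
    have e2 := h2 u hu
    rw [e, hK u hu] at e2
    linear_combination e2 - p * h1 u hu
  exact ⟨this.1, neg_eq_zero.1 this.2⟩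

lemma weight_eq (hD : ¬ ConstOn E.D E.J) (hK0 : ∃ u ∈ E.J, E.K u ≠ 0) (hν : ν ≠ 0)
    (hK : E.KinSpan) : μ = ν := by
  obtain ⟨p, q, hK⟩ := hK
  obtain ⟨h3, h4⟩ := weight_span hE h1 h2 hD hK
  obtain ⟨u, hu, hu0⟩ := hK0
  rw [hK u hu, (mul_eq_zero.1 h4).resolve_left hν, add_zero] at hu0
  linarith [(mul_eq_zero.1 h3).resolve_left (left_ne_zero_of_mul hu0)]

end Weight

lemma deriv_two_eq_zero {S : Set ℝ} (hS : IsOpen S) {g g' g'' : ℝ → ℝ} {a b : ℝ}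
    (h1 : ∀ x ∈ S, HasDerivAt g (g' x) x) (h2 : ∀ x ∈ S, HasDerivAt g' (g'' x) x)
    (h : ∀ x ∈ S, g x + (a * x + b) = 0) : ∀ x ∈ S, g'' x = 0 := fun x hx =>
  (h2 x hx).eq_zero_of_const hS hx (c := -a) fun y hy => by
    have := ((h1 y hy).add (((hasDerivAt_id y).const_mul a).add_const b)).eq_zero_of_const hS hy h
    linarith

lemma hasDerivAt_lin_exp (a b x : ℝ) : HasDerivAt (fun x => (a * x + b) * exp (-x))
    ((-a * x + (a - b)) * exp (-x)) x :=
  ((((hasDerivAt_id x).const_mul a).add_const b).mul (hasDerivAt_exp_neg x)).congr_deriv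
    (by simp only [id]; ring)

lemma lin_exp_indep {S : Set ℝ} (hS : IsOpenInterval S) {a b c d e f : ℝ}
    (h : ∀ x ∈ S, (a * x + b) * exp (-x) ^ 2 + (c * x + d) * exp (-x) + (e * x + f) = 0) :
    (a = 0 ∧ b = 0) ∧ (c = 0 ∧ d = 0) ∧ e = 0 ∧ f = 0 := by
  have key : ∀ {a b c d : ℝ}, (∀ x ∈ S, (a * x + b) * exp (-x) + (c * x + d) = 0) →
      (a = 0 ∧ b = 0) ∧ c = 0 ∧ d = 0 := fun {a b c d} h => by
    have h1 := deriv_two_eq_zero hS.1 (fun x _ => hasDerivAt_lin_exp a b x)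
      (fun x _ => hasDerivAt_lin_exp (-a) (a - b) x) h
    have h2 := lin_eq_zero hS (Y := fun x => x) (injOn_id _) (b := a) (c := b - 2 * a) fun x hx => by
      linear_combination zero_of_mul (Real.exp_ne_zero (-x)) ((mul_comm ..).trans (h1 x hx))
    have h3 : b = 0 := by linarith [h2.1, h2.2]
    refine ⟨⟨h2.1, h3⟩, lin_eq_zero hS (Y := fun x => x) (injOn_id _) fun x hx => ?_⟩
    have := h x hx
    rw [h2.1, h3] at this; linear_combination this
  have h1 : ∀ (a b x : ℝ), HasDerivAt (fun x => (a * x + b) * exp (-x) ^ 2)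
      ((-2 * a * x + (a - 2 * b)) * exp (-x) ^ 2) x := fun a b x =>
    ((((hasDerivAt_id x).const_mul a).add_const b).mul ((hasDerivAt_exp_neg x).pow 2)).congr_deriv
      (by simp only [id, Pi.pow_apply]; push_cast; ring)
  have h2 := deriv_two_eq_zero hS.1 (fun x _ => (h1 a b x).add (hasDerivAt_lin_exp c d x))
    (fun x _ => (h1 (-2 * a) (a - 2 * b) x).add (hasDerivAt_lin_exp (-c) (c - d) x)) h
  obtain ⟨⟨h3, h4⟩, h5, h6⟩ := key (a := 4 * a) (b := 4 * b - 4 * a) (c := c) (d := d - 2 * c)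
    fun x hx => mul_right_cancel₀ (Real.exp_ne_zero (-x)) (by linear_combination h2 x hx)
  have h7 : a = 0 := by linarith
  have h8 : b = 0 := by linarith
  refine ⟨⟨h7, h8⟩, key fun x hx => ?_⟩
  have := h x hx
  rw [h7, h8] at this; linear_combination this

section Weight
variable {α β μ ν l : ℝ} (hE : E.Nonlinear) (hαβ : α ≠ 0 ∨ β ≠ 0)
  (h1 : E.DEq α β μ)
  (h2 : ∀ u ∈ E.J, (α * u + β) * deriv E.K u = ν * E.K u)
  (hK0 : ∃ u ∈ E.J, E.K u ≠ 0) (hKD : μ = ν → EqOn E.K E.D E.J)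
include hE hαβ h1 h2 hK0 hKD

omit hαβ h1 h2 hK0 hKD in
lemma φ_abs_rpow (hl : l ≠ 0) (hf : EqOn E.f (fun x => |x| ^ l) E.I) :
    ∀ x ∈ E.I, x ≠ 0 ∧ E.φ x = l / x := by
  simpa using base_id.φ_abs_rpow hE hl fun x hx => by simpa using hf hx

/-- Two operators for powers of `x`. -/
lemma rank_of_power (hl : l ≠ 0) (hf : EqOn E.f (fun x => |x| ^ l) E.I)
    (hνl : ¬ (ν = 0 ∧ l = -1)) : Module.rank ℝ (E.alg hE) ≤ (2 : ℕ) := by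
  have hφ := φ_abs_rpow hE hl hf
  have hf : ¬ ConstOn E.f E.I := fun ⟨c, hc⟩ => by
    obtain ⟨x, hx⟩ := hE.hI.2.2
    exact div_ne_zero hl (hφ x hx).1 ((hφ x hx).2.symm.trans (hE.φ_const hc x hx))
  have fin : E.AllAff → (¬ ∃ p, ∀ u ∈ E.J, E.K u = p * E.D u) →
      Module.rank ℝ (E.alg hE) ≤ (2 : ℕ) := fun hA hK => by
    rcases rank_of_allAff_nonconst hE hA hf hK with h | h | h
    · exact h.trans (by norm_num)
    · exact h.1
    · exact h.1
  by_cases hD : ConstOn E.D E.J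
  · obtain ⟨d, hd⟩ := hD
    have hKc : ∀ k, ¬ ∀ u ∈ E.J, E.K u = k := fun k hk => hE.not_const hd hk
    refine fin ?_ fun ⟨p, hp⟩ => hKc (p * d) fun u hu => by rw [hp u hu, hd u hu]
    by_cases hK : ∃ p q, ∀ u ∈ E.J, E.K u = p * u + q
    · obtain ⟨p, q, hK⟩ := hK
      exact allAff_of_affine hE hf hd hK fun h => hKc q fun u hu => by simp [hK u hu, h]
    · exact allAff_of_const hE hd hK
  have hμ := weight_D_ne_zero hE h1 hD hαβ
  by_cases hK : E.KinSpan
  · by_cases hν : ν = 0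
    · obtain ⟨q, hq⟩ := hE.constOn_K_of_deriv (eq_zero_of_lin_mul hE.hJ.1 hαβ hE.continuousOn_dK
        fun u hu => by rw [h2 u hu, hν, zero_mul])
      obtain ⟨u, hu, hu0⟩ := hK0
      rw [hq u hu] at hu0
      refine fin (allAff_of_const_K hE hD hf hu0 hq fun ⟨C, δ, hC, h⟩ => hνl ⟨hν, ?_⟩)
        fun ⟨p, hp⟩ => hD ⟨q / p, fun v hv => ?_⟩
      · have := (lin_eq_zero hE.hI (Y := fun x => x) (injOn_id _) (b := l + 1) (c := l * δ) fun x hx => by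
          have e := ((hE.hasDerivAt_f hx).mul ((hasDerivAt_id x).add_const δ)).eq_zero_of_const
            hE.hI.1 hx h
          obtain ⟨hx0, hφx⟩ := hφ x hx
          simp only [id] at e
          rw [← hE.f_mul_φ hx, hφx] at e
          field_simp at e
          exact zero_of_mul (hE.f_ne x hx) (by linear_combination e)).1
        linarith
      · have e := hp v hv
        rw [hq v hv] at e
        have : p ≠ 0 := fun h => hu0 (by rw [e, h, zero_mul])
        field_simp; linarith
    · have e := weight_eq hE h1 h2 hD hK0 hν hK
      refine rank_le_two hE (q₁ := op fun t _ u => (t, 0, -1 / μ * (α * u + β))) fun s => ?_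
      obtain ⟨w, hw⟩ := exists_wSol hE hμ h1 s
      obtain ⟨τ₀, τ₁, B, g₁, g₀, l₀, -, hQ, hR⟩ := w.form hE hD base_exp_zero
        (fun u hu => by rw [hKD e hu, one_mul]) (.inl ⟨h1, h1.ne_zero hE hμ⟩)
      obtain ⟨⟨h3, h4⟩, ⟨h5, h6⟩, h7, h8⟩ := lin_exp_indep hE.hI
        (a := 2 * ((α + μ) * B) - (4 * α + 3 * μ) * B) (b := (α + μ) * B * l)
        (c := μ * l₀ + τ₁) (d := g₁ * l) (e := 2 * g₀) (f := g₀ * l) fun x hx => by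
          have h9 := hR x hx
          obtain ⟨hx0, hφx⟩ := hφ x hx
          have := Real.exp_ne_zero (-x)
          rw [hφx] at h9
          field_simp at h9
          linear_combination -h9
      obtain rfl : g₁ = 0 := zero_of_mul hl ((mul_comm ..).trans h6)
      obtain rfl : g₀ = 0 := by linarith
      have h11 : (α + μ) * B = 0 := zero_of_mul hl ((mul_comm ..).trans h4)
      obtain rfl : B = 0 := zero_of_mul hμ (by linarith)
      exact ⟨τ₀, τ₁, fun t ht x hx u hu => (hw ⟨ht, hx, hu⟩).trans ((hQ t ht x hx u hu).trans (by
        obtain rfl : l₀ = -τ₁ / μ := by field_simp; linarith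
        ext <;> simp [op] <;> ring))⟩
  · exact fin (allAff_of_not_kinSpan hE hD hK) fun ⟨p, hp⟩ => hK ⟨p, 0, fun u hu => by
      rw [hp u hu, add_zero]⟩

/-- Three operators for constant `f`. -/
lemma rank_of_weight_const {c : ℝ} (hf : ∀ x ∈ E.I, E.f x = c) (hν : ν ≠ 0)
    (hα : 2 * α + μ ≠ 0 ∨ μ ≠ ν)
    (hA : ¬ (ConstOn E.D E.J ∧ ∃ p q, ∀ u ∈ E.J, E.K u = p * u + q)) :
    Module.rank ℝ (E.alg hE) ≤ (3 : ℕ) := by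
  by_cases hG : E.Generic
  · rcases rank_of_allAff_const hE (hG.allAff hE) hf hG.K_nonconst hG.not_affine with h | h
    · exact h.trans (by norm_num)
    · exact h.1
  have hD : ¬ ConstOn E.D E.J := fun hD => hG (.inr ⟨hD, fun h => hA ⟨hD, h⟩⟩)
  have e := weight_eq hE h1 h2 hD hK0 hν (by_contra fun h => hG (.inl ⟨hD, h⟩))
  have hμ := weight_D_ne_zero hE h1 hD hαβ
  refine rank_le_three hE (q₁ := op fun t _ u => (t, 0, -1 / μ * (α * u + β)))
    (q₂ := op fun _ _ _ => (0, 1, 0)) fun s => ?_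
  obtain ⟨w, hw⟩ := exists_wSol hE hμ h1 s
  obtain ⟨τ₀, τ₁, B, g₁, g₀, l₀, -, hQ, hR⟩ := w.form hE hD base_exp_zero
    (fun u hu => by rw [hKD e hu, one_mul]) (.inl ⟨h1, h1.ne_zero hE hμ⟩)
  obtain ⟨h3, h4, h5⟩ := quad_eq_zero hE.hI base_exp_zero.inj.injOn (a := (2 * α + μ) * B)
    (b := -(μ * l₀ + τ₁)) (c := -2 * g₀) fun x hx => by
      have h9 := hR x hx
      have := Real.exp_ne_zero (-x)
      rw [hE.φ_const hf x hx] at h9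
      field_simp at h9
      linear_combination h9
  obtain rfl : B = 0 := zero_of_mul (hα.resolve_right fun h => h e) h3
  refine ⟨τ₀, τ₁, -g₁, fun t ht x hx u hu => (hw ⟨ht, hx, hu⟩).trans ((hQ t ht x hx u hu).trans ?_)⟩
  obtain rfl : l₀ = -τ₁ / μ := by field_simp; linarith
  obtain rfl : g₀ = 0 := by linarith
  have := Real.exp_ne_zero (-x)
  ext <;> simp [op] <;> field_simp <;> ring

end Weight

section
variable {E E' : Eqn} {μ ν l : ℝ}

lemma not_isBasis_of_rank (hE : E.Nonlinear) {n : ℕ} {l : List VField}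
    (h : (n : Cardinal) ≤ Module.rank ℝ (E.alg hE)) (hn : l.length < n) : ¬ E.IsBasis l := fun hb => by
  rw [rank_eq_of_isBasis hE hb] at h
  exact absurd (by exact_mod_cast h : n ≤ l.length) hn.not_ge

/-- Normalization of the sign in `f = |x|⁻¹`. -/
lemma exists_inv (hE : E.Nonlinear) (hf : EqOn E.f (fun x => |x| ^ (-1 : ℝ)) E.I) :
    ∃ E', E'.Nonlinear ∧ Equivalent E E' ∧ E'.J = E.J ∧ EqOn E'.D E.D E.J ∧
      EqOn E'.K E.K E.J ∧ EqOn E'.f (fun x => x⁻¹) E'.I := by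
  obtain ⟨r, hr, h0⟩ := exists_sign hE.hI (s := 0)
    (fun x hx => by simpa using (φ_abs_rpow hE (by norm_num) hf x hx).1)
  obtain ⟨E', hE', h⟩ := exists_gRel hE (a := r) 0 0 (by rcases hr with rfl | rfl <;> norm_num)
    one_ne_zero one_ne_zero one_ne_zero
  refine ⟨E', hE', h.equivalent, Set.ext fun u => by simpa using h.hJ u,
    fun u hu => by simpa using h.hD u hu, fun u hu => by simpa using h.hK u hu,
    h.eqOn_f fun x hx => ?_⟩
  have := h0 x hx
  rw [hf hx]; simp only; rw [Real.rpow_neg_one]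
  rcases hr with rfl | rfl
  · rw [abs_of_pos (by linarith)]; simp
  · rw [abs_of_neg (by linarith)]; simp

lemma rpow_weight (hE : E.Nonlinear) (hJ : E.J ⊆ Ioi 0 ∨ μ = 0 ∧ ∃ n : ℕ, ν = n)
    (hD : EqOn E.D (fun u => u ^ μ) E.J) (hK : EqOn E.K (fun u => u ^ ν) E.J) :
    (∀ u ∈ E.J, (1 * u + 0) * deriv E.D u = μ * E.D u) ∧
    (∀ u ∈ E.J, (1 * u + 0) * deriv E.K u = ν * E.K u) ∧ ∃ u ∈ E.J, E.K u ≠ 0 := by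
  refine ⟨Eqn.DEq_rpow hE.hJ.1 (hJ.imp id And.left) hD, fun u hu => ?_, ?_⟩
  · rw [one_mul, add_zero, mul_deriv_rpow hE.hJ.1 (hJ.imp id And.right) hK hu]
  · obtain ⟨u, hu, h0⟩ := exists_ne_zero_mem hE.hJ
    refine ⟨u, hu, ?_⟩
    rw [hK hu]
    rcases hJ with hJ | ⟨-, n, rfl⟩
    · exact (Real.rpow_pos_of_pos (hJ hu) ν).ne'
    · simpa using pow_ne_zero n h0

lemma isBasis_c2_1 (hE : E.Nonlinear) (hc : (Case.c2_1 μ ν l).Entry E) :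
    E.IsBasis (Case.c2_1 μ ν l).ops ↔ ¬ (ν = 0 ∧ l = -1) := by
  obtain ⟨h1, h2⟩ := ops_spec hE _ hc
  have hp := isBasis_iff_proper hE hc
  obtain ⟨hl, hD, hK, hf⟩ := hc
  constructor
  · rintro hb ⟨rfl, rfl⟩
    have hK1 : EqOn E.K (fun _ => 1) E.J := fun u hu => by rw [hK hu]; simp
    have hμ : μ ≠ 0 := fun hμ => hE.not_const (d := 1) (fun v hv => by simp [hD hv, hμ]) hK1
    obtain ⟨E₁, hE₁, h⟩ := exists_gRel hE 0 0 one_ne_zero one_ne_zero hμ one_ne_zero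
    obtain ⟨E₂, hE₂, he, hJ, hD', hK', hf'⟩ := exists_inv hE₁ (h.eqOn_f fun x hx => by
      simpa using hf hx)
    have := hp.1 hb .c2_5c E₂ hE₂ ⟨?_, ?_, hf'⟩
      (h.equivalent.trans he)
    · simp [Case.ops] at this
    · rw [hJ]; exact hD'.trans (h.eqOn_D fun u hu => by simpa using hD hu)
    · rw [hJ]; exact hK'.trans (h.eqOn_K (d := fun _ => 1) fun u hu => by simpa using hK1 hu)
  · exact fun h => isBasis_of_rank hE h1 h2 (rank_of_power hE (α := 0) (β := 1) (by simp)
      (Eqn.DEq_exp hE.hJ.1 hD) (ν := ν) (fun u hu => by rw [deriv_exp_mul hE.hJ.1 hK hu]; ring)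
      (hE.hJ.2.2.imp fun u hu => ⟨hu, by rw [hK hu]; exact Real.exp_ne_zero _⟩)
      (fun e => by rw [← e] at hK; exact hK.trans hD.symm) hl hf h)

lemma isBasis_c3_1 (hE : E.Nonlinear) (hc : (Case.c3_1 μ ν l).Entry E) :
    E.IsBasis (Case.c3_1 μ ν l).ops ↔ ¬ (ν = 0 ∧ l = -1) := by
  obtain ⟨h1, h2⟩ := ops_spec hE _ hc
  have hp := isBasis_iff_proper hE hc
  obtain ⟨hJ, hl, hD, hK, hf⟩ := hc
  constructor
  · rintro hb ⟨rfl, rfl⟩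
    have hK1 : EqOn E.K (fun _ => 1) E.J := fun u hu => by rw [hK hu]; simp
    have hμ : μ ≠ 0 := fun hμ => hE.not_const (d := 1) (fun v hv => by simp [hD hv, hμ]) hK1
    have hJ' := hJ.resolve_right fun h => hμ h.1
    obtain ⟨E₂, hE₂, he, hJe, hD', hK', hf'⟩ := exists_inv hE hf
    rw [← hJe] at hD' hK' hJ' hD hK1
    by_cases h3 : μ = -3 / 2
    · subst h3
      have := hp.1 hb .c3_6g E₂ hE₂ ⟨hJ', hD'.trans hD, hK'.trans hK1, hf'⟩ he
      simp [Case.ops] at this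
    · have := hp.1 hb (.c3_5c μ) E₂ hE₂ ⟨hJ', hμ, h3, hD'.trans hD, hK'.trans hK1, hf'⟩ he
      simp [Case.ops] at this
  · obtain ⟨w1, w2, w3⟩ := rpow_weight hE hJ hD hK
    exact fun h => isBasis_of_rank hE h1 h2 (rank_of_power hE (by simp) w1 w2 w3
      (fun e => by rw [← e] at hK; exact hK.trans hD.symm) hl hf h)

lemma isBasis_c3_2 (hE : E.Nonlinear) (hc : (Case.c3_2 μ ν).Entry E) :
    E.IsBasis (Case.c3_2 μ ν).ops ↔ ¬ (μ = -2 ∧ ν = -2) ∧ ¬ (μ = 0 ∧ ν = 1) ∧ ν ≠ 0 := by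
  obtain ⟨h1, h2⟩ := ops_spec hE _ hc
  have hp := isBasis_iff_proper hE hc
  obtain ⟨hJ, hD, hK, hf⟩ := hc
  obtain ⟨w1, w2, w3⟩ := rpow_weight hE hJ hD hK
  have hDμ : ConstOn E.D E.J → μ = 0 := fun ⟨d, hd⟩ => by
    obtain ⟨u, hu⟩ := hE.hJ.2.2
    have := w1 u hu
    rw [deriv_const_of_eqOn hE.hJ.1 hd hu, mul_zero, eq_comm] at this
    exact (mul_eq_zero.1 this).resolve_right (hE.D_ne u hu)
  have hD0 : μ = 0 → ∀ u ∈ E.J, E.D u = 1 := fun h u hu => by rw [hD hu, h]; simp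
  refine ⟨fun hb => ⟨?_, ?_, ?_⟩, fun ⟨h3, h4, h5⟩ => ?_⟩
  · rintro ⟨rfl, rfl⟩
    refine not_isBasis_of_rank hE (n := 4) (rank_of_exp_span hE hf (fun h => by norm_num at hDμ; exact hDμ h)
      (p := 1) (q := 0) (fun u hu => by rw [hK hu, hD hu]; simp) one_ne_zero w1).ge ?_ hb
    simp [Case.ops]
  · rintro ⟨rfl, rfl⟩
    refine not_isBasis_of_rank hE (le_rank_of_burgers hE hf (hD0 rfl) (k₁ := 1) (k₀ := 0)
      (fun u hu => by rw [hK hu]; simp) one_ne_zero).ge ?_ hb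
    simp [Case.ops]
  · rintro rfl
    have hK1 : ∀ u ∈ E.J, E.K u = 1 := fun u hu => by rw [hK hu]; simp
    have hμ : μ ≠ 0 := fun hμ => hE.not_const (hD0 hμ) hK1
    have hJ' := hJ.resolve_right fun h => hμ h.1
    have hK0 : EqOn (E.shiftK (-1)).K (fun _ => 0) E.J := fun u hu => by
      simp only [Eqn.shiftK]; rw [hK1 u hu]; norm_num
    by_cases h4 : μ = -4 / 3
    · subst h4
      have := hp.1 hb .c3_7a _ (hE.shiftK (-1)) ⟨hJ', hD, hK0, hf⟩ (equivalent_shiftK hf)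
      simp [Case.ops] at this
    · have := hp.1 hb (.c3_6a μ) _ (hE.shiftK (-1)) ⟨hJ', hμ, h4, hD, hK0, hf⟩ (equivalent_shiftK hf)
      simp [Case.ops] at this
  · refine isBasis_of_rank hE h1 h2 (rank_of_weight_const hE (by simp) w1 w2 w3
      (fun e => by rw [← e] at hK; exact hK.trans hD.symm) hf h5 ?_ ?_)
    · by_contra! h
      exact h3 ⟨by linarith, by linarith⟩
    · rintro ⟨hDc, p, q, hpq⟩
      refine h4 ⟨hDμ hDc, ?_⟩
      have hdK : ∀ u ∈ E.J, deriv E.K u = p := fun u hu => deriv_eq_of_eqOn hE.hJ.1 hu hpq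
        ((((hasDerivAt_id u).const_mul p).add_const q).congr_deriv (mul_one p))
      have h6 := (lin_eq_zero hE.hJ (Y := fun u => u) (injOn_id _) (b := p * (1 - ν))
        (c := -(ν * q)) fun u hu => by
          have := w2 u hu
          rw [hdK u hu, hpq u hu] at this
          linear_combination this).1
      linarith [zero_of_mul (fun h => hE.not_const (hD0 (hDμ hDc)) (k := q)
        fun u hu => by simp [hpq u hu, h]) h6]
end

/-! ### Invariants of the equivalence -/

/-- `K = p D + q`, possibly with `p = 0` or `q = 0`. -/
def Eqn.KLin (E : Eqn) (P Q : Prop) : Prop :=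
  ∃ p q, (P → p = 0) ∧ (Q → q = 0) ∧ ∀ u ∈ E.J, E.K u = p * E.D u + q

/-- The logarithmic derivative of `f` is constant, possibly zero. -/
def Eqn.PhiConst (E : Eqn) (P : Prop) : Prop := ∃ ε, (P → ε = 0) ∧ ∀ x ∈ E.I, E.φ x = ε

def Eqn.PhiExp (E : Eqn) : Prop := ∃ k A, (∀ u ∈ E.J, E.K u = k * E.D u) ∧
  ∀ x ∈ E.I, E.φ x = -2 * k + A * exp (-k * x)

def Eqn.ExpType (E : Eqn) : Prop := ∃ ρ, ρ ≠ 0 ∧ ((∀ u ∈ E.J, deriv E.D u = ρ * E.D u) ∨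
  (∀ u ∈ E.J, deriv E.D u = 0) ∧ ∃ κ, ∀ u ∈ E.J, deriv E.K u = ρ * E.K u + κ)

def Eqn.LogType (E : Eqn) : Prop := ∃ a b c κ, (a ≠ 0 ∨ b ≠ 0) ∧ E.DEq a b c ∧
  ∀ u ∈ E.J, (a * u + b) * deriv E.K u = κ

open Classical in
/-- The number of the table. -/
def Eqn.table (E : Eqn) : ℕ := if E.Rigid then 1 else if E.ExpType then 2 else 3

open Classical in
/-- The label of the case of an equation whose algebra has dimension `n`. -/
def Eqn.label (E : Eqn) (n : ℕ) : ℕ × ℕ × ℕ :=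
  if n = 1 then (1, 1, 0) else if E.PhiConst True then
    if n = 2 then (1, 2, 1) else if E.table = 1 then (1, 3, 1) else
    if n = 3 then
      (E.table, if E.KLin False False then (5, 2) else if E.LogType then (3, 0) else (2, 0))
    else if n = 4 then (E.table, 6, if E.KLin True False then 1 else 6)
    else if E.KLin True False then (3, 7, 1) else (3, 8, 0)
  else if n = 2 then
    if E.PhiConst False then (1, 2, 1) else
    (E.table, if E.table = 1 then
        if E.KLin True True then (2, 4) else
        if E.KLin False True then if E.PhiExp then (2, 2) else (2, 3) else (2, 5)
      else if E.KLin False True then (4, 0) else (1, 0))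
  else if n = 3 then
    if E.table = 1 then (1, 3, 2) else
    (E.table, 5, if E.KLin True True then 1 else if E.KLin False True then 2 else 3)
  else if n = 4 then
    (E.table, 6, if E.KLin True True then
        if E.table = 2 then 4 else if E.PhiConst False then 3 else 5
      else if E.KLin False True then
        if E.PhiExp then if E.PhiConst False then 2 else 4 else if E.table = 2 then 3 else 6
      else 7)
  else (3, 7, 2)

section Rel
variable {a b p q r s m : ℝ} (h : GRel E E' a b p q r s m) (hE : E.Nonlinear)
include h

lemma GRel.kLin {P Q : Prop} : E.KLin P Q → E'.KLin P Q := fun ⟨k, c, h1, h2, h3⟩ =>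
  ⟨k / p, m / p * c, fun hP => by rw [h1 hP, zero_div], fun hQ => by rw [h2 hQ, mul_zero],
    fun y hy => by
      obtain ⟨u, hu, rfl⟩ := h.exJ hy
      rw [h.hK u hu, h.hD u hu, h3 u hu]; ring⟩

include hE

lemma GRel.phiConst {P : Prop} : E.PhiConst P → E'.PhiConst P := fun ⟨ε, h1, h2⟩ =>
  ⟨ε / p, fun hP => by rw [h1 hP, zero_div], fun y hy => by
    obtain ⟨x, hx, rfl⟩ := h.exI hy
    rw [h.φ_eq hE hx, h2 x hx]⟩

lemma GRel.phiExp : E.PhiExp → E'.PhiExp := fun ⟨k, A, h1, h2⟩ =>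
  ⟨k / p, A / p * exp (k / p * q), fun y hy => by
    obtain ⟨u, hu, rfl⟩ := h.exJ hy
    rw [h.hK u hu, h.hD u hu, h1 u hu]; ring, fun y hy => by
    obtain ⟨x, hx, rfl⟩ := h.exI hy
    have := h.hp
    rw [h.φ_eq hE hx, h2 x hx, mul_assoc, ← Real.exp_add,
      show k / p * q + -(k / p) * (p * x + q) = -k * x by field_simp; ring]; ring⟩

lemma GRel.dEq {k l c : ℝ} (hd : E.DEq k l c) : E'.DEq k (l * r - k * s) c := fun y hy => by
  obtain ⟨u, hu, rfl⟩ := h.exJ hy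
  have hr := h.hr
  rw [h.deriv_D hE hu, h.hD u hu]
  field_simp
  linear_combination m * r * hd u hu

omit hE in
lemma GRel.coeff_ne {k l : ℝ} (h0 : k ≠ 0 ∨ l ≠ 0) : k ≠ 0 ∨ l * r - k * s ≠ 0 := by
  by_contra! h1
  rw [h1.1] at h0 h1
  exact h0.elim (fun h => h rfl) fun h0 => mul_ne_zero h0 h.hr (by linarith [h1.2])

lemma GRel.rigid (hR : E'.Rigid) : E.Rigid := fun k l c hd => by
  by_contra h0
  have := hR _ _ _ (h.dEq hE hd)
  rcases h.coeff_ne (not_and_or.1 h0) with h1 | h1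
  · exact h1 this.1
  · exact h1 this.2

lemma GRel.expType : E.ExpType → E'.ExpType := fun ⟨ρ, h0, h1⟩ =>
  ⟨ρ / r, div_ne_zero h0 h.hr, h1.imp (fun h1 y hy => by
    obtain ⟨u, hu, rfl⟩ := h.exJ hy
    rw [h.deriv_D hE hu, h.hD u hu, h1 u hu]; ring)
    fun ⟨h1, κ, h2⟩ => ⟨fun y hy => by
      obtain ⟨u, hu, rfl⟩ := h.exJ hy
      rw [h.deriv_D hE hu, h1 u hu, mul_zero], m / p / r * κ, fun y hy => by
      obtain ⟨u, hu, rfl⟩ := h.exJ hy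
      rw [h.deriv_K hE hu, h.hK u hu, h2 u hu]; ring⟩⟩

lemma GRel.logType : E.LogType → E'.LogType := fun ⟨k, l, c, κ, h0, h1, h2⟩ =>
  ⟨k, l * r - k * s, c, m / p * κ, h.coeff_ne h0, h.dEq hE h1, fun y hy => by
    obtain ⟨u, hu, rfl⟩ := h.exJ hy
    have := h.hr
    rw [h.deriv_K hE hu, ← h2 u hu]; field_simp; ring⟩

lemma GRel.label_eq (n : ℕ) : E.label n = E'.label n := by
  have hE' := h.symm.nonlinear hE
  have e1 : E.KLin = E'.KLin := funext₂ fun P Q => propext ⟨h.kLin, h.symm.kLin⟩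
  have e2 : E.PhiConst = E'.PhiConst :=
    funext fun P => propext ⟨h.phiConst hE, h.symm.phiConst hE'⟩
  have e3 : E.PhiExp = E'.PhiExp := propext ⟨h.phiExp hE, h.symm.phiExp hE'⟩
  have e4 : E.Rigid = E'.Rigid := propext ⟨h.symm.rigid hE', h.rigid hE⟩
  have e5 : E.ExpType = E'.ExpType := propext ⟨h.expType hE, h.symm.expType hE'⟩
  have e6 : E.LogType = E'.LogType := propext ⟨h.logType hE, h.symm.logType hE'⟩
  unfold Eqn.label Eqn.table
  rw [e1, e2, e3, e4, e5, e6]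

end Rel

lemma Eqn.label_shiftK (κ : ℝ) (h : E.PhiConst True) (n : ℕ) : E.label n = (E.shiftK κ).label n := by
  have hd : ∀ u, deriv (E.shiftK κ).K u = deriv E.K u := fun u => deriv_add_const _
  have e1 : ∀ P, E.KLin P False = (E.shiftK κ).KLin P False := fun P => propext
    ⟨fun ⟨p, q, h1, h2, h3⟩ => ⟨p, q + κ, h1, False.elim, fun u hu => by
      rw [← add_assoc]; exact congrArg (· + κ) (h3 u hu)⟩,
    fun ⟨p, q, h1, h2, h3⟩ => ⟨p, q - κ, h1, False.elim, fun u hu => by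
      have : E.K u + κ = p * E.D u + q := h3 u hu
      linarith⟩⟩
  have e2 : E.ExpType = (E.shiftK κ).ExpType := by
    simp only [Eqn.ExpType, hd]
    refine propext (exists_congr fun ρ => and_congr_right fun _ => or_congr Iff.rfl
      (and_congr_right fun _ => ⟨fun ⟨c, h⟩ => ⟨c - ρ * κ, fun u hu => ?_⟩,
        fun ⟨c, h⟩ => ⟨c + ρ * κ, fun u hu => ?_⟩⟩))
    · rw [h u hu]; simp only [Eqn.shiftK]; ring
    · rw [h u hu]; simp only [Eqn.shiftK]; ring
  have e3 : E.LogType = (E.shiftK κ).LogType := by simp only [Eqn.LogType, hd]; rfl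
  have e4 : (E.shiftK κ).PhiConst True = E.PhiConst True := rfl
  have e5 : (E.shiftK κ).Rigid = E.Rigid := rfl
  unfold Eqn.label Eqn.table
  rw [e1 True, e1 False, e2, e3, e4, e5, if_pos h, if_pos h]

lemma Equivalent.label_eq (h : Equivalent E E') (hE : E.Nonlinear) (n : ℕ) : E.label n = E'.label n := by
  obtain ⟨κ, h0, hg⟩ := h
  obtain ⟨a, b, p, q, r, s, m, hr⟩ := gEquiv_iff.1 hg
  rw [← hr.label_eq (hE.shiftK κ)]
  rcases h0 with rfl | ⟨c, hc⟩
  · rw [E.shiftK_zero]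
  · exact E.label_shiftK κ ⟨0, fun _ => rfl, fun x hx => hE.φ_const hc x hx⟩ n

lemma phiConst_iff (hE : E.Nonlinear) {ε : ℝ} (h : ∀ x ∈ E.I, E.φ x = ε) :
    E.PhiConst False ∧ (E.PhiConst True ↔ ε = 0) := by
  refine ⟨⟨ε, False.elim, h⟩, fun ⟨ε', h1, h2⟩ => ?_, fun h0 => ⟨ε, fun _ => h0, h⟩⟩
  obtain ⟨x, hx⟩ := hE.hI.2.2
  rw [← h x hx, h2 x hx, h1 trivial]

lemma kLin_of_prop (hE : E.Nonlinear) {k : ℝ} (h : ∀ u ∈ E.J, E.K u = k * E.D u) :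
    E.KLin False True ∧ E.KLin False False ∧ (E.KLin True True ↔ k = 0) := by
  have h1 : ∀ {P Q}, (P → k = 0) → E.KLin P Q := fun hP =>
    ⟨k, 0, hP, fun _ => rfl, fun u hu => by rw [h u hu, add_zero]⟩
  refine ⟨h1 False.elim, h1 False.elim, fun ⟨p, q, h1, h2, h3⟩ => ?_, fun h0 => h1 fun _ => h0⟩
  obtain ⟨u, hu⟩ := hE.hJ.2.2
  have := h3 u hu
  rw [h1 trivial, h2 trivial, h u hu, zero_mul, zero_add] at this
  exact (mul_eq_zero.1 this).resolve_right (hE.D_ne u hu)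

lemma not_kLin_of_one (hD : ¬ ConstOn E.D E.J) (h : ∀ u ∈ E.J, E.K u = 1)
    {P : Prop} : ¬ E.KLin P True := fun ⟨p, q, _, h2, h3⟩ =>
  neg_ne_zero.2 one_ne_zero (const_indep hD (A := p) fun u hu => by
    linear_combination h u hu - h3 u hu - h2 trivial).2

lemma Eqn.DEq.nonconst {a b c : ℝ} (h : E.DEq a b c) (hE : E.Nonlinear) (hc : c ≠ 0) :
    ¬ ConstOn E.D E.J := fun ⟨d, hd⟩ => by
  obtain ⟨u, hu⟩ := hE.hJ.2.2
  have := h u hu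
  rw [deriv_const_of_eqOn hE.hJ.1 hd hu, mul_zero, eq_comm] at this
  exact mul_ne_zero hc (hE.D_ne u hu) this

lemma Eqn.Rigid.nonconst (h : E.Rigid) (hE : E.Nonlinear) : ¬ ConstOn E.D E.J := fun ⟨d, hd⟩ => by
  have := h 1 0 0 fun u hu => by rw [deriv_const_of_eqOn hE.hJ.1 hd hu]; ring
  exact one_ne_zero this.1

lemma Eqn.ExpType.table (h : E.ExpType) : E.table = 2 := by
  have : ¬ E.Rigid := fun hR => by
    obtain ⟨ρ, h0, h1 | h1⟩ := h
    · exact one_ne_zero (hR 0 1 ρ fun u hu => by rw [h1 u hu]; ring).2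
    · exact one_ne_zero (hR 1 0 0 fun u hu => by rw [h1.1 u hu]; ring).1
  rw [Eqn.table, if_neg this, if_pos h]

lemma Eqn.Rigid.table (h : E.Rigid) : E.table = 1 := if_pos h

lemma table_of_DEq {μ ν κ : ℝ} (hE : E.Nonlinear) (h1 : E.DEq 1 0 μ)
    (h2 : ∀ u ∈ E.J, u * deriv E.K u = ν * E.K u + κ) : E.table = 3 := by
  rw [Eqn.table, if_neg fun hR : E.Rigid => one_ne_zero (hR 1 0 μ h1).1, if_neg]
  rintro ⟨ρ, h0, h3 | ⟨h3, κ', h4⟩⟩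
  · exact h0 (lin_eq_zero hE.hJ (Y := fun u => u) (injOn_id _) (c := -μ) fun u hu =>
      zero_of_mul (hE.D_ne u hu) (by linear_combination h1 u hu - u * h3 u hu)).1
  · obtain ⟨d, hd⟩ := hE.constOn_D_of_deriv h3
    obtain ⟨k, hk⟩ := hE.constOn_K_of_deriv (eq_zero_of_lin_mul hE.hJ.1 (.inl h0) (b := 1 - ν)
      hE.continuousOn_dK fun u hu => by
        have e := (((hasDerivAt_id u).mul (((hE.hasDerivAt_K hu).const_mul ρ).add_const κ')).sub
          (((hE.hasDerivAt_K hu).const_mul ν).add_const κ)).eq_zero_of_const hE.hJ.1 hu (c := 0)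
          fun v hv => by
            simp only [Pi.sub_apply, Pi.mul_apply, id]
            rw [← h4 v hv, h2 v hv, sub_self]
        simp only [id] at e
        rw [← h4 u hu] at e
        linear_combination e)
    exact hE.not_const hd hk

section Weight
variable {α β μ ν κ : ℝ} (hE : E.Nonlinear)
  (h1 : E.DEq α β μ)
include hE h1

lemma not_kLin_of_log (hκ : κ ≠ 0) (h2 : ∀ u ∈ E.J, (α * u + β) * deriv E.K u = κ) :
    ¬ E.KLin False False := fun ⟨p, q, _, _, h3⟩ => by
  have h4 : ∀ u ∈ E.J, p * μ * E.D u + -κ = 0 := fun u hu => by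
    have e := h2 u hu
    rw [deriv_eq_of_eqOn hE.hJ.1 hu h3 (((hE.hasDerivAt_D hu).const_mul p).add_const q)] at e
    linear_combination e - p * h1 u hu
  obtain ⟨u, hu⟩ := hE.hJ.2.2
  by_cases hμ : μ = 0
  · have := h4 u hu
    rw [hμ] at this
    exact hκ (by linarith)
  · exact hκ (neg_eq_zero.1 (const_indep (h1.nonconst hE hμ) h4).2)

variable (h2 : ∀ u ∈ E.J, (α * u + β) * deriv E.K u = ν * E.K u) (hK0 : ∃ u ∈ E.J, E.K u ≠ 0)
include h2 hK0

lemma not_kLin_of_weight (hμν : μ ≠ ν) : ¬ E.KLin False True := fun ⟨p, q, _, hq, h3⟩ => by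
  obtain ⟨u, hu, hu0⟩ := hK0
  have h3 : ∀ u ∈ E.J, E.K u = p * E.D u := fun u hu => by rw [h3 u hu, hq trivial, add_zero]
  have e := h2 u hu
  rw [deriv_eq_of_eqOn hE.hJ.1 hu h3 ((hE.hasDerivAt_D hu).const_mul p)] at e
  refine mul_ne_zero (sub_ne_zero.2 hμν) hu0 ?_
  rw [h3 u hu] at e ⊢
  linear_combination e - p * h1 u hu

lemma not_kinSpan_of_weight (hμν : μ ≠ ν) (hν : ν ≠ 0) : ¬ E.KLin False False :=
  fun ⟨p, q, _, _, h3⟩ => by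
    by_cases hD : ConstOn E.D E.J
    · obtain ⟨d, hd⟩ := hD
      exact hE.not_const hd fun v hv => by rw [h3 v hv, hd v hv]
    · exact hμν (weight_eq hE h1 h2 hD hK0 hν ⟨p, q, h3⟩)

omit h1 in
lemma logType_of_weight (hν : ν ≠ 0) (hL : E.LogType) :
    ν = α ∧ ∃ ρ, ∀ u ∈ E.J, deriv E.D u = ρ * E.D u := by
  obtain ⟨a, b, c, κ, hab, h3, h4⟩ := hL
  obtain ⟨v, hv, hv0⟩ := hK0
  have hK' : ¬ ∀ u ∈ E.J, deriv E.K u = 0 := fun h => by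
    have := h2 v hv
    rw [h v hv, mul_zero, eq_comm] at this
    exact mul_ne_zero hν hv0 this
  have e1 : ∀ u ∈ E.J, (a * u + b) * ν * E.K u - κ * (α * u + β) = 0 := fun u hu => by
    linear_combination (α * u + β) * h4 u hu - (a * u + b) * h2 u hu
  have e2 : ∀ u ∈ E.J, a * ν * E.K u = κ * (α - ν) := fun u hu => by
    have e := (((((hasDerivAt_id u).const_mul a).add_const b).mul_const ν).mul (hE.hasDerivAt_K hu)
      |>.sub ((((hasDerivAt_id u).const_mul α).add_const β).const_mul κ)).eq_zero_of_const
      hE.hJ.1 hu e1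
    simp only [id] at e
    linear_combination e - ν * h4 u hu
  obtain rfl : a = 0 := by_contra fun ha => hK' fun u hu =>
    deriv_const_of_eqOn hE.hJ.1 (k := κ * (α - ν) / (a * ν)) (fun w hw => by
      rw [← e2 w hw]; field_simp) hu
  have hb := hab.resolve_left fun h => h rfl
  have hκ : κ ≠ 0 := fun h0 => hK' fun u hu => zero_of_mul hb (by linear_combination h4 u hu + h0)
  exact ⟨by linarith [zero_of_mul hκ (b := α - ν) (by linear_combination -e2 v hv)], c / b,
    fun u hu => by field_simp; linear_combination h3 u hu⟩

end Weight

section Phi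
variable (hE : E.Nonlinear) {l γ : ℝ} (hl : l ≠ 0) {P : Prop}
include hE hl

lemma not_phiConst_inv (h : ∀ x ∈ E.I, x ≠ 0 ∧ E.φ x = l / x) : ¬ E.PhiConst P :=
  fun ⟨ε, _, h1⟩ => hl (neg_eq_zero.1 (lin_eq_zero hE.hI (Y := fun x => x) (injOn_id _) (b := ε)
    (c := -l) fun x hx => by
      obtain ⟨h0, e⟩ := h x hx
      rw [h1 x hx] at e
      field_simp at e; linear_combination e).2)

lemma not_phiConst_exp (h : ∀ x ∈ E.I, E.φ x + 2 * 1 = -exp (-x) * l) : ¬ E.PhiConst P :=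
  fun ⟨ε, _, h1⟩ => hl (lin_eq_zero hE.hI base_exp_zero.inj.injOn (c := 2 + ε) fun x hx => by
    linear_combination h x hx - h1 x hx).1

variable (h : ∀ x ∈ E.I, exp (-x) + γ ≠ 0 ∧
  E.φ x + 2 * 1 = -exp (-x) * (l / (exp (-x) + γ)))
include h

lemma phiConst_frac : E.PhiConst P → γ = 0 ∧ (P → l = -2) := fun ⟨ε, h0, h1⟩ => by
  obtain ⟨h2, h3⟩ := lin_eq_zero hE.hI base_exp_zero.inj.injOn (b := ε + 2 + l) (c := (ε + 2) * γ)
    fun x hx => by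
      obtain ⟨h0, e⟩ := h x hx
      rw [h1 x hx] at e
      field_simp at e; linear_combination e
  exact ⟨zero_of_mul (fun h => hl (by linarith)) h3, fun hP => by linarith [h0 hP]⟩

lemma not_phiExp (hK : EqOn E.K E.D E.J) : ¬ E.PhiExp := fun ⟨k, A, h1, h2⟩ => by
  obtain ⟨u, hu⟩ := hE.hJ.2.2
  obtain rfl : k = 1 := mul_right_cancel₀ (hE.D_ne u hu) (by rw [← h1 u hu, hK hu, one_mul])
  obtain ⟨rfl, h3⟩ := lin_eq_zero hE.hI base_exp_zero.inj.injOn (b := A) (c := A * γ + l) fun x hx => by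
    obtain ⟨h0, e⟩ := h x hx
    rw [h2 x hx, neg_one_mul] at e
    refine zero_of_mul (Real.exp_ne_zero (-x)) ?_
    field_simp at e
    linear_combination e
  exact hl (by linarith)

end Phi

lemma phiExp_of_exp {γ : ℝ} (hK : EqOn E.K E.D E.J)
    (h : ∀ x ∈ E.I, E.φ x + 2 * 1 = -exp (-x) * γ) : E.PhiExp :=
  ⟨1, -γ, fun u hu => by rw [hK hu, one_mul], fun x hx => by
    rw [neg_one_mul]; linear_combination h x hx⟩

lemma linear_eq_zero_of_isBasis {l : List VField} (hb : E.IsBasis l)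
    (L : ℝ × ℝ × ℝ →ₗ[ℝ] ℝ) (hl : ∀ q ∈ l, ∀ p, L (q p) = 0) {X : E.dom → ℝ × ℝ × ℝ}
    (hX : X ∈ E.maxAlg) (p : E.dom) : L (X p) = 0 := by
  rw [← hb.2] at hX
  refine Submodule.span_induction (p := fun X _ => L (X p) = 0) ?_ (by simp)
    (fun X Y _ _ h1 h2 => by simp [h1, h2]) (fun k X _ h => by simp [h]) hX
  rintro _ ⟨i, rfl⟩
  exact hl _ (List.get_mem l i) _

lemma rigid_of_isBasis (hE : E.Nonlinear) {l : List VField} (hb : E.IsBasis l)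
    (hl : ∀ q ∈ l, ∀ p, (q p).2.2 = 0) (h : ∀ a b c, E.DEq a b c → ∃ F G : ℝ → ℝ → ℝ → ℝ,
      E.dom.domRestrict (op fun t x u => (F t x u, G t x u, a * u + b)) ∈ E.maxAlg) : E.Rigid :=
  fun a b c hd => by
    obtain ⟨F, G, hX⟩ := h a b c hd
    obtain ⟨t, ht⟩ := hE.hT.2.2
    obtain ⟨x, hx⟩ := hE.hI.2.2
    exact lin_eq_zero hE.hJ (Y := fun u => u) (injOn_id _) fun u hu => linear_eq_zero_of_isBasis hb
      ((LinearMap.snd ℝ ℝ ℝ).comp (LinearMap.snd ℝ ℝ (ℝ × ℝ))) hl hX ⟨(t, x, u), ht, hx, hu⟩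

lemma rigid_of_prop (hE : E.Nonlinear) {l : List VField} (hb : E.IsBasis l)
    (hl : ∀ q ∈ l, ∀ p, (q p).2.2 = 0) {k : ℝ} (hK : ∀ u ∈ E.J, E.K u = k * E.D u) : E.Rigid :=
  rigid_of_isBasis hE hb hl fun a b c hd => ⟨fun t _ _ => -1 * c * t, fun _ _ _ => 0,
    scaling_mem hE 1 hd hK⟩

lemma not_phiConst_of_isBasis (hE : E.Nonlinear) {l : List VField}
    (hb : E.IsBasis l) (hl : ∀ q ∈ l, ∀ p, (q p).2.1 = 0) {P : Prop} : ¬ E.PhiConst P :=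
  fun ⟨ε, _, h⟩ => by
  obtain ⟨t, ht⟩ := hE.hT.2.2
  obtain ⟨x, hx⟩ := hE.hI.2.2
  obtain ⟨u, hu⟩ := hE.hJ.2.2
  exact one_ne_zero (linear_eq_zero_of_isBasis hb ((LinearMap.fst ℝ ℝ ℝ).comp
    (LinearMap.snd ℝ ℝ (ℝ × ℝ))) hl (affine_mem hE 0 0 0 0 ε 0 0 0 1 h
      (T := fun t _ _ => ε * t) (X := fun _ _ _ => 1) (U := fun _ _ _ => 0)) ⟨(t, x, u), ht, hx, hu⟩)

lemma exists_const_one (hE : E.Nonlinear) {c : ℝ} (hf : ∀ x ∈ E.I, E.f x = c) :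
    ∃ E', E'.Nonlinear ∧ Equivalent E E' ∧ E'.J = E.J ∧ EqOn E'.D E.D E.J ∧
      EqOn E'.K E.K E.J ∧ ∀ x ∈ E'.I, E'.f x = 1 := by
  have hc := hE.const_ne_zero hf
  obtain ⟨E', hE', h⟩ := exists_gRel hE (a := c⁻¹) 0 0 (inv_ne_zero hc)
    one_ne_zero one_ne_zero one_ne_zero
  exact ⟨E', hE', h.equivalent, Set.ext fun u => by simpa using h.hJ u,
    fun u hu => by simpa using h.hD u hu, fun u hu => by simpa using h.hK u hu,
    h.eqOn_f (d := fun _ => 1) fun x hx => by rw [hf x hx]; field_simp⟩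

section
lemma weight_table {μ ν : ℝ} (hE : E.Nonlinear) (hJ : E.J ⊆ Ioi 0)
    (hD : EqOn E.D (fun u => u ^ μ) E.J)
    (hK : ∀ u ∈ E.J, u * deriv E.K u = ν * E.K u) : E.table = 3 :=
  table_of_DEq hE (Eqn.DEq_rpow hE.hJ.1 (.inl hJ) hD) (κ := 0) fun u hu => by rw [hK u hu, add_zero]

lemma prop_table {μ k : ℝ} (hE : E.Nonlinear) (hJ : E.J ⊆ Ioi 0)
    (hD : EqOn E.D (fun u => u ^ μ) E.J) (hK : ∀ u ∈ E.J, E.K u = k * E.D u) : E.table = 3 :=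
  weight_table (ν := μ) hE hJ hD fun u hu => by
    rw [deriv_eq_of_eqOn hE.hJ.1 hu hK ((hE.hasDerivAt_D hu).const_mul k), hK u hu]
    have := Eqn.DEq_rpow hE.hJ.1 (.inl hJ) hD u hu
    linear_combination k * this

lemma one_table {μ : ℝ} (hE : E.Nonlinear) (hJ : E.J ⊆ Ioi 0)
    (hD : EqOn E.D (fun u => u ^ μ) E.J) (hK : ∀ u ∈ E.J, E.K u = 1) : E.table = 3 :=
  weight_table (ν := 0) hE hJ hD fun u hu => by rw [deriv_const_of_eqOn hE.hJ.1 hK hu]; ring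

lemma exp_table (hE : E.Nonlinear) (hD : EqOn E.D exp E.J) : E.table = 2 :=
  Eqn.ExpType.table ⟨1, one_ne_zero, .inl fun u hu => by
    simpa using Eqn.DEq_exp_one hE.hJ.1 hD u hu⟩

lemma expType_of_exp (hE : E.Nonlinear) {μ ν : ℝ} (hD : EqOn E.D (fun u => exp (μ * u)) E.J)
    (h : ¬ (μ = 0 ∧ ν = 0)) (hK : ∀ u ∈ E.J, deriv E.K u = ν * E.K u) : E.ExpType := by
  by_cases hμ : μ = 0
  · exact ⟨ν, fun e => h ⟨hμ, e⟩, .inr ⟨fun u hu => by rw [deriv_exp_mul hE.hJ.1 hD hu, hμ, zero_mul],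
      0, fun u hu => by rw [hK u hu, add_zero]⟩⟩
  · exact ⟨μ, hμ, .inl fun u hu => deriv_exp_mul hE.hJ.1 hD hu⟩

attribute [local simp] Eqn.label Case.label Case.ops dt op

/-- The label of a case is determined by the invariants of its equations. -/
lemma label_of_isBasis (hE : E.Nonlinear) (c : Case) (hc : c.Entry E) (hb : E.IsBasis c.ops)
    (hi : c.Irredundant) : E.label c.ops.length = c.label := by
  have hp := (isBasis_iff_proper hE hc).1 hb
  have eq1 : EqOn E.K E.D E.J → _ := fun h => Eqn.K_one h fun _ _ => rfl
  have zero : (∀ u ∈ E.J, E.K u = 0) → _ := fun h => kLin_of_prop hE (Eqn.K_zero h)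
  have one : EqOn E.K E.D E.J → _ := fun h => kLin_of_prop hE (eq1 h)
  have czero : (∀ u ∈ E.J, E.K u = 0) → E.KLin True False := fun h =>
    ⟨0, 0, fun _ => rfl, fun _ => rfl, fun u hu => by simp [h u hu]⟩
  have pc : ∀ {c}, (∀ x ∈ E.I, E.f x = c) → E.PhiConst True := fun h =>
    ⟨0, fun _ => rfl, hE.φ_const h⟩
  have pe : EqOn E.f (fun x => exp (-2 * x)) E.I → ∀ x ∈ E.I, E.φ x = -2 :=
    fun hf x hx => by
      have := base_exp_zero.φ_exp hE (k := 0) (fun x hx => by rw [hf hx, ← exp_neg_two_mul]; simp) x hx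
      linarith
  cases c with
  | c1_1 => simp
  | c1_2a ε =>
    have h1 := base_id.φ_exp hE (k := ε) fun x hx => by rw [hc hx]; simp
    simp [(phiConst_iff hE (ε := ε) (by simpa using h1)).1]
  | c1_2b γ =>
    obtain ⟨hγ, -, hK, hf⟩ := hc
    have hφ := base_exp_zero.φ_exp hE (k := γ) fun x hx => by
      simp only [hf hx, Real.exp_add, exp_neg_two_mul]
    simp [not_phiConst_exp hE hγ hφ, (rigid_of_prop hE hb (by simp) (eq1 hK)).table, one hK,
      phiExp_of_exp hK hφ]
  | c1_2c γ ν =>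
    obtain ⟨hγ, hν, -, hK, hf⟩ := hc
    have hφ := (base_exp γ).φ_abs_rpow hE hν fun x hx => by simp only [hf hx, exp_neg_two_mul]
    have h1 : ∀ P, ¬ E.PhiConst P := fun P h => hγ (phiConst_frac hE hν hφ h).1
    simp [h1, (rigid_of_prop hE hb (by simp) (eq1 hK)).table, one hK, not_phiExp hE hν hφ hK]
  | c1_2d ν =>
    obtain ⟨hν, -, hK, hf⟩ := hc
    simp [not_phiConst_inv hE hν (φ_abs_rpow hE hν hf),
      (rigid_of_prop hE hb (by simp) (Eqn.K_zero hK)).table, zero hK]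
  | c1_2e =>
    obtain ⟨-, hK, hf⟩ := hc
    have hR : E.Rigid := rigid_of_isBasis hE hb (by simp) fun a b c hd =>
      ⟨fun _ _ _ => 0, fun _ x _ => c * x, affine_mem hE a b c 1 0 0 c 0 0 (fun _ _ => rfl)
        (fun _ => hd) (fun x _ u hu => by rw [deriv_const_of_eqOn hE.hJ.1 hK hu]; ring)
        fun x hx t _ => by
          obtain ⟨h0, h⟩ := φ_inv hE hf x hx
          rw [h]; field_simp; ring⟩
    simp [not_phiConst_inv hE (by norm_num) (φ_inv hE hf), hR.table,
      not_kLin_of_one (hR.nonconst hE) hK]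
  | c1_3a =>
    obtain ⟨-, hK, hf⟩ := hc
    simp [pc hf, (rigid_of_prop hE hb (by simp) (Eqn.K_zero hK)).table]
  | c1_3b =>
    obtain ⟨-, hK, hf⟩ := hc
    simp [(phiConst_iff hE (pe hf)).2, (rigid_of_prop hE hb (by simp) (eq1 hK)).table]
  | c2_1 μ ν l =>
    obtain ⟨hl, hD, hK, hf⟩ := hc
    have hK' := fun u hu => deriv_exp_mul hE.hJ.1 hK (u := u) hu
    have h2 := not_kLin_of_weight hE (Eqn.DEq_exp hE.hJ.1 hD) (ν := ν)
      (fun u hu => by rw [hK' u hu]; ring)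
      (hE.hJ.2.2.imp fun u hu => ⟨hu, by rw [hK hu]; exact Real.exp_ne_zero _⟩) hi
    simp [not_phiConst_inv hE hl (φ_abs_rpow hE hl hf), h2,
      (expType_of_exp hE hD (fun h => hi (h.1.trans h.2.symm)) hK').table]
  | c2_2 μ =>
    obtain ⟨hD, hK, hf⟩ := hc
    have hK' : ∀ u ∈ E.J, deriv E.K u = 1 * E.K u := fun u hu =>
      deriv_exp_mul hE.hJ.1 (hK.trans fun u _ => by simp) hu
    have w2 : ∀ u ∈ E.J, (0 * u + 1) * deriv E.K u = 1 * E.K u := fun u hu => by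
      rw [hK' u hu]; ring
    have w3 : ∃ u ∈ E.J, E.K u ≠ 0 :=
      hE.hJ.2.2.imp fun u hu => ⟨hu, by rw [hK hu]; exact Real.exp_ne_zero _⟩
    have h4 := not_kinSpan_of_weight hE (Eqn.DEq_exp hE.hJ.1 hD) w2 w3 hi one_ne_zero
    have h5 : ¬ E.LogType := fun h => one_ne_zero (logType_of_weight hE w2 w3 one_ne_zero h).1
    simp [pc hf, (expType_of_exp hE hD (fun h => one_ne_zero h.2) hK').table, h4, h5]
  | c2_3 =>
    obtain ⟨hD, hK, hf⟩ := hc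
    have hK' : ∀ u ∈ E.J, (0 * u + 1) * deriv E.K u = 1 := fun u hu => by
      rw [deriv_eq_of_eqOn hE.hJ.1 hu hK (hasDerivAt_id u)]; ring
    have hd := Eqn.DEq_exp_one hE.hJ.1 hD
    have h5 : E.LogType := ⟨0, 1, 1, 1, by simp, hd, hK'⟩
    simp [pc hf, exp_table hE hD, h5, not_kLin_of_log hE hd one_ne_zero hK']
  | c2_4 ε =>
    simp [not_phiConst_of_isBasis hE hb (by simp), exp_table hE hc.1,
      kLin_of_prop hE (k := ε) fun u hu => by rw [hc.2 hu, hc.1 hu]]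
  | c2_5a α β γ₁ γ₀ =>
    have h1 : ¬ E.PhiConst True := fun ⟨ε, h1, h2⟩ => by
      obtain ⟨k, hk⟩ := hE.constOn_f_of_φ fun x hx => (h2 x hx).trans (h1 trivial)
      obtain ⟨E', hE', he, hJ, hD, hK, hf⟩ := exists_const_one hE hk
      rw [← hJ] at hD hK
      simpa using hp .c2_6a E' hE' ⟨hD.trans (hJ ▸ hc.1.1), hK.trans (hJ ▸ hc.1.2), hf⟩ he
    simp [h1, exp_table hE hc.1.1, zero hc.1.2]
  | c2_5b α β γ₁ γ₀ =>
    by_cases h1 : E.PhiConst True <;>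
      simp [h1, exp_table hE hc.1.1, one (hc.1.2.trans hc.1.1.symm)]
  | c2_5c =>
    obtain ⟨hD, hK, hf⟩ := hc
    simp [not_phiConst_inv hE (by norm_num) (φ_inv hE hf), exp_table hE hD,
      not_kLin_of_one ((Eqn.DEq_exp_one hE.hJ.1 hD).nonconst hE one_ne_zero) hK]
  | c2_6a =>
    obtain ⟨hD, hK, hf⟩ := hc
    simp [pc hf, exp_table hE hD, czero hK]
  | c2_6b =>
    obtain ⟨hD, hK, hf⟩ := hc
    have hKD := hK.trans hD.symm
    simp [phiConst_iff hE (pe hf), exp_table hE hD, one hKD,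
      phiExp_of_exp (γ := 0) hKD fun x hx => by rw [pe hf x hx]; ring]
  | c2_6c γ =>
    obtain ⟨hD, hK, hf⟩ := hc
    have hφ := (base_exp γ).φ_zpow hE (n := -3) (by norm_num) fun x hx => by
      simp only [hf hx, exp_neg_two_mul]
    have hKD := hK.trans hD.symm
    have h1 : ¬ E.PhiConst True := fun h => by
      have := (phiConst_frac hE (by norm_num) hφ h).2 trivial
      norm_num at this
    simp [h1, exp_table hE hD, one hKD, not_phiExp hE (by norm_num) hφ hKD]
  | c2_6d =>
    obtain ⟨hD, hK, hf⟩ := hc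
    have h := base_id.φ_zpow hE (n := -3) (by norm_num) fun x hx => by simpa using hf hx
    simp [not_phiConst_inv hE (l := -3) (by norm_num) (by simpa using h), exp_table hE hD, zero hK]
  | c3_1 μ ν l =>
    obtain ⟨hJ, hl, hD, hK, hf⟩ := hc
    obtain ⟨w1, w2, w3⟩ := rpow_weight hE hJ hD hK
    have h3 := table_of_DEq hE w1 (ν := ν) (κ := 0) fun u hu => by rw [← w2 u hu]; ring
    simp [not_phiConst_inv hE hl (φ_abs_rpow hE hl hf), h3, not_kLin_of_weight hE w1 w2 w3 hi]
  | c3_2 μ ν =>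
    obtain ⟨h6, h7, hν⟩ := (isBasis_c3_2 hE hc).1 hb
    obtain ⟨hJ, hD, hK, hf⟩ := hc
    obtain ⟨w1, w2, w3⟩ := rpow_weight hE hJ hD hK
    have h3 := table_of_DEq hE w1 (ν := ν) (κ := 0) fun u hu => by rw [← w2 u hu]; ring
    have h5 : ¬ E.LogType := fun h => by
      obtain ⟨h8, ρ, h9⟩ := logType_of_weight hE w2 w3 hν h
      have := (lin_eq_zero hE.hJ (Y := fun u => u) (injOn_id _) (b := ρ) (c := -μ) fun u hu =>
        zero_of_mul (hE.D_ne u hu) (by linear_combination w1 u hu - u * h9 u hu)).2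
      exact h7 ⟨by linarith, h8⟩
    simp [pc hf, h3, h5, not_kinSpan_of_weight hE w1 w2 w3 hi hν]
  | c3_3 μ =>
    obtain ⟨hJ, hD, hK, hf⟩ := hc
    have hd := Eqn.DEq_rpow hE.hJ.1 (.inl hJ) hD
    have hK' : ∀ u ∈ E.J, u * deriv E.K u = 1 := fun u hu => by
      have h0 : u ≠ 0 := (hJ hu).ne'
      rw [deriv_eq_of_eqOn hE.hJ.1 hu hK (Real.hasDerivAt_log h0), mul_inv_cancel₀ h0]
    have h3 := table_of_DEq hE hd (ν := 0) (κ := 1) fun u hu => by rw [hK' u hu]; ring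
    have hK'' : ∀ u ∈ E.J, (1 * u + 0) * deriv E.K u = 1 := by simpa
    have h5 : E.LogType := ⟨1, 0, μ, 1, by simp, hd, hK''⟩
    simp [pc hf, h3, h5, not_kLin_of_log hE hd one_ne_zero hK'']
  | c3_4 μ ε =>
    obtain ⟨hJ, hμ, hD, hK⟩ := hc
    have hKD : ∀ u ∈ E.J, E.K u = ε * E.D u := fun u hu => by rw [hK hu, hD hu]
    simp [not_phiConst_of_isBasis hE hb (by simp), prop_table hE hJ hD hKD, kLin_of_prop hE hKD]
  | c3_5a μ α β γ₁ γ₀ =>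
    obtain ⟨hJ, hμ, ⟨hD, hK⟩, -⟩ := hc
    have h2 := prop_table hE hJ hD (Eqn.K_zero hK)
    have h4 := zero hK
    have h1 : ¬ E.PhiConst True := fun ⟨ε, h1, h2⟩ => by
      obtain ⟨k, hk⟩ := hE.constOn_f_of_φ fun x hx => (h2 x hx).trans (h1 trivial)
      obtain ⟨E', hE', he, hJ', hD', hK', hf⟩ := exists_const_one hE hk
      rw [← hJ'] at hD hK hD' hK' hJ
      by_cases h3 : μ = -4 / 3
      · simpa using hp .c3_7a E' hE' ⟨hJ, h3 ▸ hD'.trans hD, hK'.trans hK, hf⟩ he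
      · simpa using hp (.c3_6a μ) E' hE' ⟨hJ, hμ, h3, hD'.trans hD, hK'.trans hK, hf⟩ he
    simp [h1, h4, h2]
  | c3_5b μ α β γ₁ γ₀ =>
    obtain ⟨hJ, hμ, ⟨hD, hK⟩, -⟩ := hc
    have hKD := hK.trans hD.symm
    by_cases h1 : E.PhiConst True <;> simp [h1, one hKD, prop_table hE hJ hD (eq1 hKD)]
  | c3_5c μ =>
    obtain ⟨hJ, hμ, -, hD, hK, hf⟩ := hc
    simp [not_phiConst_inv hE (by norm_num) (φ_inv hE hf), one_table hE hJ hD hK,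
      not_kLin_of_one ((Eqn.DEq_rpow hE.hJ.1 (.inl hJ) hD).nonconst hE hμ) hK]
  | c3_6a μ =>
    obtain ⟨hJ, hμ, -, hD, hK, hf⟩ := hc
    simp [pc hf, czero hK, prop_table hE hJ hD (Eqn.K_zero hK)]
  | c3_6b μ =>
    obtain ⟨hJ, hμ, -, hD, hK, hf⟩ := hc
    have hKD := hK.trans hD.symm
    simp [phiConst_iff hE (pe hf), one hKD, prop_table hE hJ hD (eq1 hKD),
      phiExp_of_exp (γ := 0) hKD fun x hx => by rw [pe hf x hx]; ring]
  | c3_6c γ =>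
    obtain ⟨hJ, hD, hK, hf⟩ := hc
    have h1 := base_id.φ_exp hE (k := γ) fun x hx => by rw [hf hx]; simp
    replace hD : EqOn E.D (fun u => u ^ (-1 : ℝ)) E.J :=
      hD.trans fun u _ => (Real.rpow_neg_one u).symm
    simp [phiConst_iff hE (ε := γ) (by simpa using h1), show γ ≠ 0 from hi, zero hK,
      prop_table hE hJ hD (Eqn.K_zero hK)]
  | c3_6d γ =>
    obtain ⟨hJ, hD, hK, hf⟩ := hc
    have hφ := base_exp_zero.φ_exp hE (k := γ) fun x hx => by
      simp only [hf hx, Real.exp_add, exp_neg_two_mul]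
    have hKD := hK.trans hD.symm
    replace hD : EqOn E.D (fun u => u ^ (-1 : ℝ)) E.J :=
      hD.trans fun u _ => (Real.rpow_neg_one u).symm
    simp [not_phiConst_exp hE hi hφ, one hKD, phiExp_of_exp hKD hφ, prop_table hE hJ hD (eq1 hKD)]
  | c3_6e μ =>
    obtain ⟨hJ, hμ, h4, h5, hD, hK, hf⟩ := hc
    have hl := (exponent_ne_zero h4 h5).2
    simp [not_phiConst_inv hE hl (φ_abs_rpow hE hl hf), zero hK, prop_table hE hJ hD (Eqn.K_zero hK)]
  | c3_6f μ γ =>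
    obtain ⟨hJ, hμ, h4, h5, hD, hK, hf⟩ := hc
    have hl := (exponent_ne_zero h4 h5).2
    have hφ := (base_exp γ).φ_abs_rpow hE hl fun x hx => by simp only [hf hx, exp_neg_two_mul]
    have hKD := hK.trans hD.symm
    have h3 : ¬ E.KLin True False := fun ⟨p, q, h1, _, h3⟩ =>
      (Eqn.DEq_rpow hE.hJ.1 (.inl hJ) hD).nonconst hE hμ ⟨q, fun u hu => by
        rw [← hKD hu, h3 u hu, h1 trivial]; ring⟩
    by_cases h1 : E.PhiConst True <;>
      simp [h1, prop_table hE hJ hD (eq1 hKD), h3, one hKD, not_phiExp hE hl hφ hKD]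
  | c3_6g =>
    obtain ⟨hJ, hD, hK, hf⟩ := hc
    simp [not_phiConst_inv hE (by norm_num) (φ_inv hE hf), one_table hE hJ hD hK,
      not_kLin_of_one ((Eqn.DEq_rpow hE.hJ.1 (.inl hJ) hD).nonconst hE (by norm_num)) hK]
  | c3_7a =>
    obtain ⟨hJ, hD, hK, hf⟩ := hc
    simp [pc hf, czero hK, prop_table hE hJ hD (Eqn.K_zero hK)]
  | c3_7b => simp [phiConst_iff hE (pe hc.2.2.2)]
  | c3_8 =>
    obtain ⟨hD, hK, hf⟩ := hc
    have h2 := table_of_DEq (ν := 1) (κ := 0) hE (μ := 0) (fun u hu => by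
      rw [deriv_const_of_eqOn hE.hJ.1 hD hu]; ring) fun u hu => by
        rw [deriv_eq_of_eqOn hE.hJ.1 hu hK (hasDerivAt_id u), hK hu]; ring
    have h3 : ¬ E.KLin True False := fun ⟨p, q, h4, _, h3⟩ =>
      one_ne_zero (lin_eq_zero hE.hJ (Y := fun u => u) (injOn_id _) (b := (1 : ℝ)) (c := -q)
        fun u hu => by linear_combination h3 u hu + E.D u * h4 trivial - hK hu).1
    simp [pc hf, h2, h3]

lemma Equivalent.label_eq_of_isBasis (h : Equivalent E E') (hE : E.Nonlinear) (hE' : E'.Nonlinear)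
    {c c' : Case} (hc : c.Entry E) (hc' : c'.Entry E') (hb : E.IsBasis c.ops)
    (hb' : E'.IsBasis c'.ops) (hi : c.Irredundant) (hi' : c'.Irredundant) : c.label = c'.label := by
  have e := h.rank_eq hE hE'
  rw [rank_eq_of_isBasis hE hb, rank_eq_of_isBasis hE' hb'] at e
  have e : c.ops.length = c'.ops.length := by exact_mod_cast e
  rw [← label_of_isBasis hE c hc hb hi, ← label_of_isBasis hE' c' hc' hb' hi', ← e, h.label_eq hE]
end

/-! ### Point transformations -/

section Slice
variable {W : Set (ℝ × ℝ)} {u : ℝ → ℝ → ℝ} (hW : IsOpen W)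
  (hu : ContDiffOn ℝ ∞ (fun z : ℝ × ℝ => u z.1 z.2) W) {t x : ℝ} (h : (t, x) ∈ W)
include hW hu h

lemma contDiffAt_slice : ContDiffAt ℝ ∞ (u t) x :=
  ContDiffAt.comp (g := fun z : ℝ × ℝ => u z.1 z.2) (f := fun y => (t, y)) x
    (hu.contDiffAt (hW.mem_nhds h)) (by fun_prop)

lemma hasDerivAt_slice : HasDerivAt (u t) (deriv (u t) x) x :=
  ((contDiffAt_slice hW hu h).differentiableAt (by simp)).hasDerivAt

lemma hasDerivAt_deriv_slice : HasDerivAt (deriv (u t)) (deriv (deriv (u t)) x) x :=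
  (DifferentiableAt.hasDerivAt <| by
    have : ContDiffAt ℝ ∞ (fun y => fderiv ℝ (u t) y 1) x :=
      ((contDiffAt_slice hW hu h).fderiv_right (m := ∞) (by simp)).clm_apply contDiffAt_const
    exact this.differentiableAt (by simp))

lemma hasDerivAt_slice_left : HasDerivAt (fun s => u s x) (deriv (fun s => u s x) t) t := by
  have : ContDiffAt ℝ ∞ (fun s => u s x) t :=
    ContDiffAt.comp (g := fun z : ℝ × ℝ => u z.1 z.2) (f := fun s => (s, x)) t
      (hu.contDiffAt (hW.mem_nhds h)) (by fun_prop)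
  exact (this.differentiableAt (by simp)).hasDerivAt

lemma holdsAt_iff (hE : E.Nonlinear) (hJ : u t x ∈ E.J) : E.HoldsAt u t x ↔
    E.f x * deriv (fun s => u s x) t = E.D (u t x) * deriv (deriv (u t)) x
      + deriv E.D (u t x) * deriv (u t) x ^ 2 + E.K (u t x) * deriv (u t) x := by
  have := (((hE.hasDerivAt_D hJ).comp x (hasDerivAt_slice hW hu h)).mul
    (hasDerivAt_deriv_slice hW hu h)).deriv
  rw [Eqn.HoldsAt, show (fun y => E.D (u t y) * deriv (u t) y) = (E.D ∘ u t) * deriv (u t) from rfl,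
    this]
  simp only [Function.comp]
  constructor <;> intro h <;> linear_combination h

end Slice

lemma injOn_of_deriv_ne_zero {S : Set ℝ} (hS : S.OrdConnected) {g g' : ℝ → ℝ}
    (hg : ∀ x ∈ S, HasDerivAt g (g' x) x) (h0 : ∀ x ∈ S, g' x ≠ 0) : InjOn g S := by
  have key : ∀ x ∈ S, ∀ y ∈ S, x < y → g x ≠ g y := fun x hx y hy hxy e => by
    have hs := hS.out hx hy
    obtain ⟨z, hz, h⟩ := exists_hasDerivAt_eq_zero hxy
      (fun z hz => (hg z (hs hz)).continuousAt.continuousWithinAt) e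
      (fun z hz => hg z (hs (Set.Ioo_subset_Icc_self hz)))
    exact h0 z (hs (Set.Ioo_subset_Icc_self hz)) h
  intro x hx y hy e
  by_contra hne
  rcases lt_or_gt_of_ne hne with h | h
  · exact key x hx y hy h e
  · exact key y hy x hx h e.symm

lemma transforms_of_jet (hE : E.Nonlinear) (hE' : E'.Nonlinear) {Φ : VField}
    {θ θ' : ℝ → ℝ} {X Xt Xx Xxx M Mt Mx Mxx N Nt Nx Nxx : ℝ → ℝ → ℝ}
    (e : ∀ t ∈ E.T, ∀ x ∈ E.I, ∀ u ∈ E.J, Φ (t, x, u) = (θ t, X t x, M t x * u + N t x))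
    (hs : ContDiffOn ℝ ∞ (fun p : ℝ × ℝ × ℝ =>
      (θ p.1, X p.1 p.2.1, M p.1 p.2.1 * p.2.2 + N p.1 p.2.1)) E.dom)
    (hθ : ∀ t ∈ E.T, HasDerivAt θ (θ' t) t) (jX : Jet E.T E.I X Xt Xx Xxx)
    (jM : Jet E.T E.I M Mt Mx Mxx) (jN : Jet E.T E.I N Nt Nx Nxx)
    (hθ0 : ∀ t ∈ E.T, θ' t ≠ 0) (hX0 : ∀ t ∈ E.T, ∀ x ∈ E.I, Xx t x ≠ 0)
    (hM0 : ∀ t ∈ E.T, ∀ x ∈ E.I, M t x ≠ 0) (hm : ∀ t ∈ E.T, ∀ x ∈ E.I, ∀ u ∈ E.J,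
      θ t ∈ E'.T ∧ X t x ∈ E'.I ∧ M t x * u + N t x ∈ E'.J)
    (key : ∀ t ∈ E.T, ∀ x ∈ E.I, ∀ u ∈ E.J, ∀ ut ux uxx v₁ v₂ v₂₂ : ℝ,
      M t x * ut + Mt t x * u + Nt t x = θ' t * v₁ + Xt t x * v₂ →
      M t x * ux + Mx t x * u + Nx t x = Xx t x * v₂ →
      M t x * uxx + 2 * Mx t x * ux + Mxx t x * u + Nxx t x = Xx t x ^ 2 * v₂₂ + Xxx t x * v₂ →
      (E.f x * ut = E.D u * uxx + deriv E.D u * ux ^ 2 + E.K u * ux ↔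
        E'.f (X t x) * v₁ = E'.D (M t x * u + N t x) * v₂₂
          + deriv E'.D (M t x * u + N t x) * v₂ ^ 2 + E'.K (M t x * u + N t x) * v₂)) :
    Transforms Φ E E' := by
  have e' : EqOn Φ (fun p => (θ p.1, X p.1 p.2.1, M p.1 p.2.1 * p.2.2 + N p.1 p.2.1)) E.dom :=
    fun p hp => e _ hp.1 _ hp.2.1 _ hp.2.2
  refine ⟨hs.congr e', ?_, fun p hp => ?_, ?_, ?_⟩
  · rintro ⟨t, x, u⟩ ⟨ht, hx, hu⟩ ⟨t', x', u'⟩ ⟨ht', hx', hu'⟩ h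
    simp only at ht hx hu ht' hx' hu'
    rw [e t ht x hx u hu, e t' ht' x' hx' u' hu', Prod.mk.injEq, Prod.mk.injEq] at h
    obtain ⟨h1, h2, h3⟩ := h
    obtain rfl := injOn_of_deriv_ne_zero hE.hT.2.1 hθ hθ0 ht ht' h1
    obtain rfl := injOn_of_deriv_ne_zero hE.hI.2.1 (jX.x t ht) (hX0 t ht) hx hx' h2
    rw [mul_left_cancel₀ (hM0 t ht x hx) (add_right_cancel h3)]
  · rw [e' hp]; exact hm _ hp.1 _ hp.2.1 _ hp.2.2
  · rintro ⟨t, x, u⟩ ⟨ht, hx, hu⟩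
    simp only at ht hx hu
    have hd : HasFDerivAt Φ (fderiv ℝ Φ (t, x, u)) (t, x, u) :=
      (((hs.congr e').contDiffAt (hE.isOpen_dom.mem_nhds ⟨ht, hx, hu⟩)).differentiableAt
        (by simp)).hasFDerivAt
    have h1 : fderiv ℝ Φ (t, x, u) (1, 0, 0) = (θ' t, Xt t x, Mt t x * u + Nt t x) :=
      (HasFDerivAt.comp_hasDerivAt (f := fun s => (s, x, u)) t hd ((hasDerivAt_id t).prodMk
        ((hasDerivAt_const t x).prodMk (hasDerivAt_const t u)))).unique
      (((hθ t ht).prodMk ((jX.t t ht x hx).prodMk (((jM.t t ht x hx).mul_const u).add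
        (jN.t t ht x hx)))).congr_on hE.hT.1 ht fun s hs => e s hs x hx u hu)
    have h2 : fderiv ℝ Φ (t, x, u) (0, 1, 0) = (0, Xx t x, Mx t x * u + Nx t x) :=
      (HasFDerivAt.comp_hasDerivAt (f := fun s => (t, s, u)) x hd ((hasDerivAt_const x t).prodMk
        ((hasDerivAt_id x).prodMk (hasDerivAt_const x u)))).unique
      (((hasDerivAt_const x (θ t)).prodMk ((jX.x t ht x hx).prodMk (((jM.x t ht x hx).mul_const u).add
        (jN.x t ht x hx)))).congr_on hE.hI.1 hx fun s hs => e t ht s hs u hu)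
    have h3 : fderiv ℝ Φ (t, x, u) (0, 0, 1) = (0, 0, M t x) :=
      (HasFDerivAt.comp_hasDerivAt (f := fun s => (t, x, s)) u hd ((hasDerivAt_const u t).prodMk
        ((hasDerivAt_const u x).prodMk (hasDerivAt_id u)))).unique
      ((((hasDerivAt_const u (θ t)).prodMk ((hasDerivAt_const u (X t x)).prodMk
        (((hasDerivAt_id u).const_mul (M t x)).add_const (N t x)))).congr_deriv
          (by rw [mul_one])).congr_on hE.hJ.1 hu fun s hs => e t ht x hx s hs)
    have hinj : Function.Injective (fderiv ℝ Φ (t, x, u)) :=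
      (injective_iff_map_eq_zero _).2 fun ⟨a, b, c⟩ h => by
        rw [show ((a, b, c) : ℝ × ℝ × ℝ) = a • (1, 0, 0) + b • (0, 1, 0) + c • (0, 0, 1) by simp,
          map_add, map_add, map_smul, map_smul, map_smul, h1, h2, h3] at h
        simp only [Prod.smul_mk, Prod.mk_add_mk, Prod.mk_eq_zero, smul_eq_mul, mul_zero,
          add_zero] at h
        obtain ⟨h4, h5, h6⟩ := h
        obtain rfl := zero_of_mul (hθ0 t ht) ((mul_comm _ _).trans h4)
        simp only [zero_mul, zero_add] at h5 h6
        obtain rfl := zero_of_mul (hX0 t ht x hx) ((mul_comm _ _).trans h5)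
        simp only [zero_mul, zero_add] at h6
        obtain rfl := zero_of_mul (hM0 t ht x hx) ((mul_comm _ _).trans h6)
        rfl
    exact ⟨hinj, (LinearMap.injective_iff_surjective
      (f := (fderiv ℝ Φ (t, x, u) : ℝ × ℝ × ℝ →ₗ[ℝ] ℝ × ℝ × ℝ))).1 hinj⟩
  · intro W W' u v hW hW' hWs hWs' hu hv hJ hΦ t x h
    obtain ⟨ht, hx⟩ : t ∈ E.T ∧ x ∈ E.I := hWs h
    have hΦ' : ∀ s y, (s, y) ∈ W → (θ s, X s y) ∈ W' ∧
        M s y * u s y + N s y = v (θ s) (X s y) := fun s y hsy => by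
      have := hΦ s y hsy
      rwa [e s (hWs hsy).1 y (hWs hsy).2 _ (hJ s y hsy)] at this
    have hux := hJ t x h
    obtain ⟨hp, hval⟩ := hΦ' t x h
    rw [e t ht x hx _ hux]
    simp only
    rw [holdsAt_iff hW hu h hE hux, holdsAt_iff hW' hv hp hE' (hval ▸ (hm t ht x hx _ hux).2.2), ← hval]
    have hSt : IsOpen {s | (s, x) ∈ W} := hW.preimage (Continuous.prodMk_left x)
    have hSx : IsOpen {y | (t, y) ∈ W} := hW.preimage (Continuous.prodMk_right t)
    refine key t ht x hx _ hux _ _ _ _ _ _ ?_ ?_ ?_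
    · have hV : HasFDerivAt (fun z : ℝ × ℝ => v z.1 z.2) _ (θ t, X t x) :=
        ((hv.contDiffAt (hW'.mem_nhds hp)).differentiableAt (by simp)).hasFDerivAt
      set A := fderiv ℝ (fun z : ℝ × ℝ => v z.1 z.2) (θ t, X t x)
      have a1 : A (1, 0) = deriv (fun s => v s (X t x)) (θ t) :=
        (HasFDerivAt.comp_hasDerivAt (f := fun s => (s, X t x)) (θ t) hV
          ((hasDerivAt_id _).prodMk (hasDerivAt_const _ _))).unique (hasDerivAt_slice_left hW' hv hp)
      have a2 : A (0, 1) = deriv (v (θ t)) (X t x) :=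
        (HasFDerivAt.comp_hasDerivAt (f := fun s => (θ t, s)) (X t x) hV
          ((hasDerivAt_const _ _).prodMk (hasDerivAt_id _))).unique (hasDerivAt_slice hW' hv hp)
      have h1 := (HasFDerivAt.comp_hasDerivAt (f := fun s => (θ s, X s x)) t hV
        ((hθ t ht).prodMk (jX.t t ht x hx))).unique
        ((((jM.t t ht x hx).mul (hasDerivAt_slice_left hW hu h)).add
          (jN.t t ht x hx)).congr_on hSt h fun s hs => (hΦ' s x hs).2.symm)
      rw [show ((θ' t, Xt t x) : ℝ × ℝ) = θ' t • (1, 0) + Xt t x • (0, 1) by simp, map_add, map_smul,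
        map_smul, a1, a2, smul_eq_mul, smul_eq_mul] at h1
      linear_combination -h1
    all_goals
      have h1 : ∀ y, (t, y) ∈ W → Xx t y * deriv (v (θ t)) (X t y) =
          M t y * deriv (u t) y + Mx t y * u t y + Nx t y := fun y hy => by
        have hy' := (hWs hy).2
        have := ((hasDerivAt_slice hW' hv (hΦ' t y hy).1).comp y (jX.x t ht y hy')).unique
          ((((jM.x t ht y hy').mul (hasDerivAt_slice hW hu hy)).add
            (jN.x t ht y hy')).congr_on hSx hy fun s hs => (hΦ' t s hs).2.symm)
        linear_combination this
    · exact (h1 x h).symm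
    · have := ((jX.xx t ht x hx).mul ((hasDerivAt_deriv_slice hW' hv hp).comp x
        (jX.x t ht x hx))).unique
        (((((jM.x t ht x hx).mul (hasDerivAt_deriv_slice hW hu h)).add ((jM.xx t ht x hx).mul
          (hasDerivAt_slice hW hu h))).add (jN.xx t ht x hx)).congr_on hSx h h1)
      simp only [Function.comp] at this
      linear_combination -this

lemma isOpenInterval_univ : IsOpenInterval univ :=
  ⟨isOpen_univ, Set.ordConnected_univ, Set.univ_nonempty⟩

lemma isOpenInterval_Ioi : IsOpenInterval (Ioi (0 : ℝ)) :=
  ⟨isOpen_Ioi, Set.ordConnected_Ioi, 1, one_pos (α := ℝ)⟩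

section Reduction
variable (hE : E.Nonlinear) {Φ : VField} {θ θ' : ℝ → ℝ}
  {X Xt Xx Xxx M Mt Mx Mxx : ℝ → ℝ → ℝ} {f' : ℝ → ℝ} {I' : Set ℝ} {κ κ₀ k μ : ℝ}
include hE

/-- Transformations that do not change `u`. -/
lemma reduction (hK : ∀ u ∈ E.J, E.K u = κ * E.D u + κ₀)
    (e : ∀ t ∈ E.T, ∀ x ∈ E.I, ∀ u ∈ E.J, Φ (t, x, u) = (θ t, X t x, u))
    (hs : ContDiffOn ℝ ∞ (fun p : ℝ × ℝ × ℝ => (θ p.1, X p.1 p.2.1, 1 * p.2.2 + 0)) E.dom)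
    (hθ : ∀ t ∈ E.T, HasDerivAt θ (θ' t) t) (jX : Jet E.T E.I X Xt Xx Xxx)
    (hθ0 : ∀ t ∈ E.T, θ' t ≠ 0) (hX0 : ∀ t ∈ E.T, ∀ x ∈ E.I, Xx t x ≠ 0)
    (hI : IsOpenInterval I') (hf : ContDiffOn ℝ ∞ f' I') (hf0 : ∀ y ∈ I', f' y ≠ 0)
    (hm : ∀ t ∈ E.T, ∀ x ∈ E.I, X t x ∈ I')
    (h : ∀ t ∈ E.T, ∀ x ∈ E.I, E.f x * θ' t = Xx t x ^ 2 * f' (X t x) ∧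
      Xxx t x + κ * Xx t x = k * Xx t x ^ 2 ∧ κ₀ * Xx t x = E.f x * Xt t x) :
    Eqn.Nonlinear ⟨univ, I', E.J, f', E.D, fun u => k * E.D u⟩ ∧
      Transforms Φ E ⟨univ, I', E.J, f', E.D, fun u => k * E.D u⟩ := by
  have hN : Eqn.Nonlinear ⟨univ, I', E.J, f', E.D, fun u => k * E.D u⟩ :=
    ⟨isOpenInterval_univ, hI, hE.hJ, hf, hE.smooth_D, contDiffOn_const.mul hE.smooth_D, hf0,
      hE.D_ne, by
        obtain ⟨u, hu, h | h⟩ := hE.nonlin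
        · exact ⟨u, hu, .inl h⟩
        · refine ⟨u, hu, .inl fun h0 => h ?_⟩
          have := (hE.hasDerivAt_K hu).unique ((((hE.hasDerivAt_D hu).const_mul κ).add_const κ₀).congr_on
            hE.hJ.1 hu hK)
          simp only at h0
          rw [this, h0, mul_zero]⟩
  refine ⟨hN, transforms_of_jet hE hN (M := fun _ _ => 1) (N := fun _ _ => 0)
    (fun t ht x hx u hu => by rw [e t ht x hx u hu, one_mul, add_zero]) hs hθ jX
    (jet_const 1) (jet_const 0) hθ0 hX0 (fun _ _ _ _ => one_ne_zero)
    (fun t ht x hx u hu => ⟨trivial, hm t ht x hx, by simpa using hu⟩)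
    fun t ht x hx u hu ut ux uxx v₁ v₂ v₂₂ h1 h2 h3 => ?_⟩
  obtain ⟨a1, a2, a3⟩ := h t ht x hx
  have h0 := pow_ne_zero 2 (hX0 t ht x hx)
  simp only [one_mul, zero_mul, add_zero, mul_zero] at h1 h2 h3 ⊢
  rw [h1, h2, h3, hK u hu]
  refine ⟨fun h => mul_left_cancel₀ h0 ?_, fun h => ?_⟩
  · linear_combination h - v₁ * a1 + E.D u * v₂ * a2 + v₂ * a3
  · linear_combination Xx t x ^ 2 * h + v₁ * a1 - E.D u * v₂ * a2 - v₂ * a3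

/-- Reductions of equations with power nonlinearities to `u_t = (u ^ μ u_x)_x`. -/
lemma power_reduction (hμ : μ ≠ 0) (hJ : E.J ⊆ Ioi 0) (hD : ∀ u ∈ E.J, E.D u = u ^ μ)
    (hK : ∀ u ∈ E.J, E.K u = κ * u ^ μ + k)
    (e : ∀ t ∈ E.T, ∀ x ∈ E.I, ∀ u ∈ E.J, Φ (t, x, u) = (θ t, X t x, M t x * u))
    (hs : ContDiffOn ℝ ∞ (fun p : ℝ × ℝ × ℝ => (θ p.1, X p.1 p.2.1, M p.1 p.2.1 * p.2.2 + 0)) E.dom)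
    (hθ : ∀ t ∈ E.T, HasDerivAt θ (θ' t) t) (jX : Jet E.T E.I X Xt Xx Xxx)
    (jM : Jet E.T E.I M Mt Mx Mxx)
    (hθ0 : ∀ t ∈ E.T, θ' t ≠ 0) (hX0 : ∀ t ∈ E.T, ∀ x ∈ E.I, Xx t x ≠ 0)
    (hM0 : ∀ t ∈ E.T, ∀ x ∈ E.I, 0 < M t x)
    (h : ∀ t ∈ E.T, ∀ x ∈ E.I, E.f x * θ' t * M t x ^ μ = Xx t x ^ 2 ∧
      Xxx t x * M t x + κ * Xx t x * M t x = 2 * (1 + μ) * Mx t x * Xx t x ∧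
      (2 + μ) * Mx t x ^ 2 = Mxx t x * M t x + κ * Mx t x * M t x ∧
      k * Xx t x = E.f x * Xt t x ∧ k * Mx t x = E.f x * Mt t x) :
    ∃ E' : Eqn, E'.Nonlinear ∧ (E'.J ⊆ Ioi 0 ∧
      E'.Has (fun u => u ^ μ) (fun _ => 0) (fun _ => 1)) ∧ Transforms Φ E E' := by
  have hd : ∀ u : ℝ, 0 < u → HasDerivAt (fun u => u ^ μ) (μ * u ^ (μ - 1)) u := fun u hu =>
    Real.hasDerivAt_rpow_const (.inl hu.ne')
  have hN : Eqn.Nonlinear ⟨univ, univ, Ioi 0, fun _ => 1, fun u => u ^ μ, fun _ => 0⟩ :=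
    ⟨isOpenInterval_univ, isOpenInterval_univ, isOpenInterval_Ioi, contDiffOn_const,
      contDiffOn_id.rpow_const_of_ne fun u hu => ne_of_gt hu,
      contDiffOn_const, fun _ _ => one_ne_zero, fun u hu => (Real.rpow_pos_of_pos hu μ).ne',
      1, one_pos (α := ℝ), .inl (by rw [(hd 1 one_pos).deriv]; simpa)⟩
  refine ⟨_, hN, ⟨subset_rfl, fun _ _ => rfl, fun _ _ => rfl, fun _ _ => rfl⟩,
    transforms_of_jet hE hN (N := fun _ _ => 0)
    (fun t ht x hx u hu => by rw [e t ht x hx u hu, add_zero]) hs hθ jX jM (jet_const 0) hθ0 hX0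
    (fun t ht x hx => (hM0 t ht x hx).ne')
    (fun t ht x hx u hu => ⟨trivial, trivial, by
      simpa using mul_pos (hM0 t ht x hx) (hJ hu)⟩)
    fun t ht x hx u hu ut ux uxx v₁ v₂ v₂₂ h1 h2 h3 => ?_⟩
  obtain ⟨a1, a2, a3, a4, a5⟩ := h t ht x hx
  have u0 : 0 < u := hJ hu
  have M0 := hM0 t ht x hx
  have hDu : u * deriv E.D u = μ * u ^ μ := by
    rw [deriv_eq_of_eqOn hE.hJ.1 hu hD (hd u u0),
      Real.rpow_sub_one u0.ne']
    field_simp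
  have hDv : M t x * u * deriv (fun u => u ^ μ) (M t x * u) = μ * (M t x ^ μ * u ^ μ) := by
    rw [(hd _ (mul_pos M0 u0)).deriv, Real.rpow_sub_one (mul_pos M0 u0).ne',
      Real.mul_rpow M0.le u0.le]
    field_simp
  simp only [add_zero, one_mul, zero_mul] at h1 h2 h3 ⊢
  rw [hD u hu, hK u hu, Real.mul_rpow M0.le u0.le]
  generalize deriv (fun u : ℝ => u ^ μ) (M t x * u) = d' at *
  have key : Xx t x * M t x ^ 2 * u * (E.f x * ut - (u ^ μ * uxx + deriv E.D u * ux ^ 2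
      + (κ * u ^ μ + k) * ux)) = Xx t x * E.f x * θ' t * M t x * u * (v₁ - (M t x ^ μ * u ^ μ * v₂₂
      + d' * v₂ ^ 2)) := by
    linear_combination Xx t x * M t x * u * E.f x * h1 - Xx t x * M t x * u * u ^ μ * h3
      - Xx t x * M t x ^ 2 * ux ^ 2 * hDu + Xx t x * E.f x * θ' t * v₂ ^ 2 * hDv
      + Xx t x * (M t x * u * u ^ μ * v₂₂ + μ * u ^ μ * v₂ ^ 2) * a1
      + (M t x * u * u ^ μ * Xxx t x - k * Xx t x * M t x * u
        - Xx t x * μ * u ^ μ * (Xx t x * v₂ + M t x * ux + Mx t x * u)) * h2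
      - Xx t x * M t x * u * v₂ * a4 + Xx t x * M t x * u ^ 2 * a5
      - u ^ μ * u * (M t x * ux + Mx t x * u) * a2 - Xx t x * u ^ 2 * u ^ μ * a3
  rw [← sub_eq_zero, ← sub_eq_zero (a := v₁), ← mul_right_inj' (mul_ne_zero (mul_ne_zero
    (hX0 t ht x hx) (pow_ne_zero 2 M0.ne')) u0.ne'), key, mul_zero, mul_eq_zero, or_iff_right]
  exact mul_ne_zero (mul_ne_zero (mul_ne_zero (mul_ne_zero (hX0 t ht x hx) (hE.f_ne x hx))
    (hθ0 t ht)) M0.ne') u0.ne'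

end Reduction

lemma exists_real_sign {I : Set ℝ} (hI : IsOpenInterval I) {y : ℝ → ℝ} (hy : Continuous y)
    (h0 : ∀ x ∈ I, y x ≠ 0) :
    ∃ σ : ℝ, (σ = 1 ∨ σ = -1) ∧ σ ^ 2 = 1 ∧ σ ≠ 0 ∧ ∀ x ∈ I, Real.sign (y x) = σ ∧ |y x| = σ * y x := by
  have key : ∀ a ∈ I, ∀ b ∈ I, y a < 0 → y b < 0 := fun a ha b hb hn => by
    by_contra hp
    obtain ⟨z, hz, e⟩ := hI.2.1.isPreconnected.intermediate_value ha hb hy.continuousOn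
      ⟨hn.le, not_lt.1 hp⟩
    exact h0 z hz e
  obtain ⟨x₀, hx₀⟩ := hI.2.2
  rcases lt_or_gt_of_ne (h0 x₀ hx₀) with h | h
  · refine ⟨-1, .inr rfl, by norm_num, by norm_num, fun x hx => ?_⟩
    have := key x₀ hx₀ x hx h
    exact ⟨Real.sign_of_neg this, by rw [abs_of_neg this, neg_one_mul]⟩
  · refine ⟨1, .inl rfl, one_pow 2, one_ne_zero, fun x hx => ?_⟩
    have : 0 < y x := lt_of_le_of_ne (not_lt.1 fun hn => (key x hx x₀ hx₀ hn).not_gt h) (h0 x hx).symm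
    exact ⟨Real.sign_of_pos this, by rw [abs_of_pos this, one_mul]⟩

lemma exp_two_mul_log {x : ℝ} (hx : x ≠ 0) : exp (2 * log x) = x ^ 2 := by
  rw [← abs_rpow_eq_exp hx, Real.rpow_two, sq_abs]

section
variable {κ : ℝ} {y y' : ℝ → ℝ} (B : Base κ y y') (hE : E.Nonlinear)
  {Φ : VField}
include B

include hE

lemma Base.linear_reduction {c : ℝ} (hc : c ≠ 0) {f' : ℝ → ℝ} {I' : Set ℝ}
    (hK : ∀ u ∈ E.J, E.K u = κ * E.D u)
    (e : ∀ t x u, Φ (t, x, u) = (c ^ 2 * t, c * y x, u))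
    (hI : IsOpenInterval I') (hf' : ContDiffOn ℝ ∞ f' I') (hf0 : ∀ y ∈ I', f' y ≠ 0)
    (hm : ∀ x ∈ E.I, c * y x ∈ I')
    (hf : ∀ x ∈ E.I, E.f x = y' x ^ 2 * f' (c * y x)) :
    Eqn.Nonlinear ⟨univ, I', E.J, f', E.D, fun u => 0 * E.D u⟩ ∧
      Transforms Φ E ⟨univ, I', E.J, f', E.D, fun u => 0 * E.D u⟩ := by
  have := B.smooth
  refine reduction hE (κ := κ) (κ₀ := 0) (θ := fun t => c ^ 2 * t) (θ' := fun _ => c ^ 2)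
    (fun u hu => by rw [hK u hu, add_zero]) (fun t _ x _ u _ => e t x u) (by fun_prop)
    (fun t _ => ((hasDerivAt_id t).const_mul _).congr_deriv (mul_one _))
    (B.jet (g := fun y => c * y) (g' := fun _ => c) (g'' := fun _ => 0) (fun x _ =>
      ((hasDerivAt_id (y x)).const_mul c).congr_deriv (mul_one c)) fun x _ => hasDerivAt_const _ _)
    (fun _ _ => pow_ne_zero 2 hc) (fun _ _ x _ => mul_ne_zero hc (B.ne x)) hI hf' hf0
    (fun _ _ => hm) fun t _ x hx => ⟨?_, by ring, by ring⟩
  rw [hf x hx]; ring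

lemma Base.log_reduction {c ν ε k : ℝ} (hk : k * c = -1) (hν : ε * c = ν + 2)
    (hν0 : ν ≠ 0) (hK : ∀ u ∈ E.J, E.K u = κ * E.D u)
    (e : ∀ t x u, Φ (t, x, u) = (c ^ 2 * t, c * log |y x|, u))
    (hf : ∀ x ∈ E.I, E.f x = y' x ^ 2 * |y x| ^ ν) :
    ∃ E' : Eqn, E'.Nonlinear ∧ (Case.c1_2a ε).Entry E' ∧
    E'.J = E.J ∧ EqOn E'.D E.D E.J ∧ (∀ u ∈ E.J, E'.K u = k * E.D u) ∧
    Transforms Φ E E' := by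
  have hc : c ≠ 0 := right_ne_zero_of_mul_eq_one (a := -k) (by linarith)
  have := B.smooth
  have h0 := fun x hx => (B.φ_abs_rpow hE hν0 hf x hx).1
  obtain ⟨h1, h2⟩ := reduction hE (Φ := Φ) (κ := κ) (κ₀ := 0) (k := k) (I' := univ)
    (θ := fun t => c ^ 2 * t) (θ' := fun _ => c ^ 2) (f' := fun x => exp (ε * x))
    (fun u hu => by rw [hK u hu, add_zero])
    (fun t _ x _ u _ => by rw [e t x u, Real.log_abs])
    (by fun_prop (disch := exact fun p hp => h0 _ hp.2.1))
    (fun t _ => ((hasDerivAt_id t).const_mul _).congr_deriv (mul_one _))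
    (B.jet (g := fun y => c * log y) (g' := fun y => c * y⁻¹)
      (g'' := fun y => c * (-(y ^ 2)⁻¹)) (fun x hx => (Real.hasDerivAt_log (h0 x hx)).const_mul c)
      fun x hx => (hasDerivAt_inv (h0 x hx)).const_mul c)
    (fun _ _ => pow_ne_zero 2 hc)
    (fun _ _ x hx => mul_ne_zero (mul_ne_zero hc (inv_ne_zero (h0 x hx))) (B.ne x))
    isOpenInterval_univ (by fun_prop) (fun y _ => (Real.exp_pos _).ne') (fun _ _ _ _ => trivial)
    fun t _ x hx => ⟨by
      have := h0 x hx
      rw [hf x hx, abs_rpow_eq_exp this, ← mul_assoc, hν, add_mul, Real.exp_add,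
        exp_two_mul_log this]
      field_simp, by have := h0 x hx; field_simp; linear_combination -y' x ^ 2 * hk, by ring⟩
  exact ⟨_, h1, fun _ _ => rfl, rfl, fun _ _ => rfl, fun _ _ => rfl, h2⟩

lemma Base.exp_power_reduction {γ : ℝ} (hJ : E.J ⊆ Ioi 0) (hD : ∀ u ∈ E.J, E.D u = u⁻¹)
    (hK : ∀ u ∈ E.J, E.K u = κ * E.D u)
    (e : ∀ t x u, Φ (t, x, u) = (t, y x, exp (γ * y x) * u))
    (hf : ∀ x ∈ E.I, E.f x = y' x ^ 2 * exp (γ * y x)) :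
    ∃ E' : Eqn, E'.Nonlinear ∧ (Case.c3_6a (-1)).Entry E' ∧ Transforms Φ E E' := by
  have := B.smooth
  obtain ⟨E', h1, h2, h3⟩ := power_reduction hE (Φ := Φ) (μ := -1) (κ := κ) (k := 0) (θ := fun t => t)
    (θ' := fun _ => 1)
    (by norm_num) hJ (fun u hu => by rw [hD u hu, Real.rpow_neg_one])
    (fun u hu => by rw [hK u hu, hD u hu, Real.rpow_neg_one, add_zero])
    (fun t _ x _ u _ => e t x u) (by fun_prop) (fun t _ => hasDerivAt_id t)
    (B.jet (g := fun y => y) (g' := fun _ => 1) (g'' := fun _ => 0) (fun x _ =>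
      hasDerivAt_id (y x)) fun x _ => hasDerivAt_const _ _)
    (B.jet (g := fun y => exp (γ * y)) (g' := fun y => γ * exp (γ * y))
      (g'' := fun y => γ ^ 2 * exp (γ * y)) (fun x _ =>
      (((hasDerivAt_id (y x)).const_mul γ).exp).congr_deriv (by simp [mul_comm])) fun x _ =>
      ((((hasDerivAt_id (y x)).const_mul γ).exp).const_mul γ).congr_deriv (by simp; ring))
    (fun _ _ => one_ne_zero) (fun _ _ x _ => by simpa using B.ne x)
    (fun _ _ x _ => Real.exp_pos _) fun t _ x hx => ⟨by
      rw [hf x hx, Real.rpow_neg_one]; have := Real.exp_pos (γ * y x); field_simp,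
      by ring, by ring, by ring, by ring⟩
  exact ⟨E', h1, ⟨h2.1, by norm_num, by norm_num, h2.2⟩, h3⟩

lemma Base.inv_power_reduction {μ : ℝ} (hμ : μ ≠ 0) (h43 : μ ≠ -4 / 3) (h1 : μ ≠ -1)
    (hJ : E.J ⊆ Ioi 0) (hD : ∀ u ∈ E.J, E.D u = u ^ μ)
    (hK : ∀ u ∈ E.J, E.K u = κ * E.D u)
    (e : ∀ t x u, Φ (t, x, u) = (t, -1 / y x, |y x| ^ (-1 / (1 + μ)) * u))
    (hf : ∀ x ∈ E.I, E.f x = y' x ^ 2 * |y x| ^ (-(4 + 3 * μ) / (1 + μ))) :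
    ∃ E' : Eqn, E'.Nonlinear ∧ (Case.c3_6a μ).Entry E' ∧ Transforms Φ E E' := by
  have := B.smooth
  obtain ⟨hμ1, hl⟩ := exponent_ne_zero h43 h1
  have h0 := fun x hx => (B.φ_abs_rpow hE hl hf x hx).1
  obtain ⟨p, hp⟩ : ∃ p, p = -1 / (1 + μ) := ⟨_, rfl⟩
  have hp1 : p * (1 + μ) = -1 := by rw [hp]; field_simp
  obtain ⟨E', h1, h2, h3⟩ := power_reduction hE (Φ := Φ) (κ := κ) (k := 0) (θ := fun t => t)
    (θ' := fun _ => 1) hμ hJ hD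
    (fun u hu => by rw [hK u hu, hD u hu, add_zero])
    (fun t _ x hx u _ => by rw [e t x u, abs_rpow_eq_exp (h0 x hx), ← hp, neg_div, one_div])
    (by fun_prop (disch := exact fun p hp => h0 _ hp.2.1)) (fun t _ => hasDerivAt_id t)
    (B.jet (g := fun y => -y⁻¹) (g' := fun y => (y ^ 2)⁻¹) (g'' := fun y => -2 * (y ^ 3)⁻¹)
      (fun x hx => ((hasDerivAt_inv (h0 x hx)).neg).congr_deriv (neg_neg _)) fun x hx =>
      ((hasDerivAt_pow 2 (y x)).inv (pow_ne_zero 2 (h0 x hx))).congr_deriv (by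
        have := h0 x hx; field_simp; ring))
    (B.jet (g := fun y => exp (p * log y))
      (g' := fun y => exp (p * log y) * (p * y⁻¹))
      (g'' := fun y => exp (p * log y) * ((p ^ 2 - p) * (y ^ 2)⁻¹)) (fun x hx =>
      ((Real.hasDerivAt_log (h0 x hx)).const_mul p).exp) fun x hx =>
      ((((Real.hasDerivAt_log (h0 x hx)).const_mul p).exp).mul
        ((hasDerivAt_inv (h0 x hx)).const_mul p)).congr_deriv (by ring))
    (fun _ _ => one_ne_zero)
    (fun _ _ x hx => mul_ne_zero (inv_ne_zero (pow_ne_zero 2 (h0 x hx))) (B.ne x))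
    (fun _ _ x _ => Real.exp_pos _) fun t _ x hx => by
      have y0 := h0 x hx
      refine ⟨?_, ?_, ?_, by ring, by ring⟩
      · rw [hf x hx, abs_rpow_eq_exp y0, ← Real.exp_mul, mul_one, mul_assoc, ← Real.exp_add,
          show -(4 + 3 * μ) / (1 + μ) * log (y x) + p * log (y x) * μ
            = -(2 * log (y x) + 2 * log (y x)) by rw [hp]; field_simp; ring, Real.exp_neg,
          Real.exp_add, exp_two_mul_log y0]
        field_simp
      · field_simp
        linear_combination -2 * y' x ^ 2 * hp1
      · field_simp
        linear_combination p * y' x ^ 2 * hp1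
  exact ⟨E', h1, ⟨h2.1, hμ, h43, h2.2⟩, h3⟩

/-- Reductions of equations with exponential nonlinearities to `u_t = (e ^ u u_x)_x`. -/
lemma Base.exp_reduction (hD : ∀ u ∈ E.J, E.D u = exp u)
    (hK : ∀ u ∈ E.J, E.K u = κ * E.D u)
    (e : ∀ t x u, Φ (t, x, u) = (t * Real.sign (y x), 1 / y x, u - log |y x|))
    (hf : ∀ x ∈ E.I, E.f x = y' x ^ 2 * y x ^ (-3 : ℤ)) :
    ∃ E' : Eqn, E'.Nonlinear ∧ Case.c2_6a.Entry E' ∧ Transforms Φ E E' := by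
  have := B.smooth
  have hN : Eqn.Nonlinear ⟨univ, univ, univ, fun _ => 1, exp, fun _ => 0⟩ :=
    ⟨isOpenInterval_univ, isOpenInterval_univ, isOpenInterval_univ, contDiffOn_const,
      Real.contDiff_exp.contDiffOn, contDiffOn_const, fun _ _ => one_ne_zero,
      fun u _ => (Real.exp_pos u).ne', 0, trivial, .inl (by rw [Real.deriv_exp]; simp)⟩
  have h0 := fun x hx => (B.φ_zpow hE (by norm_num) hf x hx).1
  obtain ⟨σ, hσ, hσ2, hσ0, hs⟩ := exists_real_sign hE.hI B.smooth.continuous h0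
  refine ⟨_, hN, ⟨fun _ _ => rfl, fun _ _ => rfl, fun _ _ => rfl⟩,
    transforms_of_jet hE hN (θ := fun t => σ * t) (θ' := fun _ => σ) (M := fun _ _ => 1)
    (fun t _ x hx u _ => by rw [e t x u, (hs x hx).1, mul_comm t, Real.log_abs, one_div, one_mul, sub_eq_add_neg])
    (by fun_prop (disch := exact fun p hp => h0 _ hp.2.1))
    (fun t _ => ((hasDerivAt_id t).const_mul _).congr_deriv (mul_one _))
    (B.jet (g := fun y => y⁻¹) (g' := fun y => -(y ^ 2)⁻¹) (g'' := fun y => 2 * (y ^ 3)⁻¹)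
      (fun x hx => hasDerivAt_inv (h0 x hx)) fun x hx =>
      ((hasDerivAt_pow 2 (y x)).inv (pow_ne_zero 2 (h0 x hx))).neg.congr_deriv (by
        have := h0 x hx; field_simp; ring))
    (jet_const 1)
    (B.jet (g := fun y => -log y) (g' := fun y => -y⁻¹) (g'' := fun y => (y ^ 2)⁻¹)
      (fun x hx => (Real.hasDerivAt_log (h0 x hx)).neg) fun x hx =>
      (hasDerivAt_inv (h0 x hx)).neg.congr_deriv (neg_neg _))
    (fun _ _ => hσ0)
    (fun _ _ x hx => mul_ne_zero (neg_ne_zero.2 (inv_ne_zero (pow_ne_zero 2 (h0 x hx)))) (B.ne x))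
    (fun _ _ _ _ => one_ne_zero) (fun _ _ _ _ _ _ => ⟨trivial, trivial, trivial⟩)
    fun t _ x hx u hu ut ux uxx v₁ v₂ v₂₂ h1 h2 h3 => ?_⟩
  have y0 := h0 x hx
  have hDu : deriv E.D u = exp u :=
    deriv_eq_of_eqOn hE.hJ.1 hu hD (Real.hasDerivAt_exp u)
  have hv : exp (u + -log (y x)) = exp u * (σ * (y x)⁻¹) := by
    rw [Real.exp_add, Real.exp_neg, Real.exp_log_eq_abs y0, (hs x hx).2, mul_inv]
    congr 2
    rcases hσ with rfl | rfl <;> norm_num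
  simp only [one_mul, zero_mul, add_zero, mul_zero, Real.deriv_exp] at h1 h2 h3 ⊢
  rw [h1, hK u hu, hD u hu, hf x hx, hDu, hv, zpow_neg]
  simp only [← inv_pow] at h2 h3 ⊢
  rw [show ((y x) ^ (3 : ℤ))⁻¹ = (y x)⁻¹ ^ 3 by rw [inv_pow]; rfl]
  have z0 := inv_ne_zero y0
  generalize (y x)⁻¹ = z at *
  have b0 := B.ne x
  have hc : y' x ^ 2 * z ^ 3 * σ ≠ 0 := by positivity
  have key : y' x ^ 2 * z ^ 3 * (σ * v₁) - (exp u * uxx + exp u * ux ^ 2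
      + κ * exp u * ux) = y' x ^ 2 * z ^ 3 * σ * (v₁ - (exp u * (σ * z) * v₂₂
      + exp u * (σ * z) * v₂ ^ 2)) := by
    linear_combination -exp u * h3 + exp u * y' x ^ 2 * z ^ 4 * (v₂₂ + v₂ ^ 2) * hσ2
      - exp u * (ux - y' x * z - y' x * z ^ 2 * v₂ + κ + 2 * y' x * z) * h2
  rw [← sub_eq_zero, key, mul_eq_zero, or_iff_right hc, sub_eq_zero]

end

lemma exp_neg_reduction (hE : E.Nonlinear) (hK : EqOn E.K E.D E.J)
    (hf : EqOn E.f (fun x => exp (-2 * x)) E.I) :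
    Eqn.Nonlinear ⟨univ, univ, E.J, fun _ => 1, E.D, fun u => 0 * E.D u⟩ ∧
      Transforms (op fun t x u => (t, exp (-x), u)) E
        ⟨univ, univ, E.J, fun _ => 1, E.D, fun u => 0 * E.D u⟩ :=
  base_exp_zero.linear_reduction hE one_ne_zero (fun u hu => by rw [hK hu, one_mul])
    (fun t x u => by simp [op]) isOpenInterval_univ contDiffOn_const (fun _ _ => one_ne_zero)
    (fun _ _ => trivial) fun x hx => by
    rw [hf hx, mul_one, ← exp_neg_two_mul]

lemma exp_neg_expInt_reduction (hE : E.Nonlinear) (hK : EqOn E.K E.D E.J)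
    {num den num' den' : ℝ → ℝ} (h : E.HasExpInt num den)
    (hd : ∀ x, den' (exp (-x)) = exp (-x) * den x)
    (hn : ∀ x, num' (exp (-x)) = -(num x + 2 * den x)) :
    ∃ E' : Eqn, E'.Nonlinear ∧ (E'.J = E.J ∧ E'.D = E.D ∧ EqOn E'.K (fun _ => 0) E'.J) ∧
      E'.HasExpInt num' den' ∧ Transforms (op fun t x u => (t, exp (-x), u)) E E' := by
  have hlog : ∀ x : ℝ, log (1 * exp (-x)) = -x := fun x => by simp
  obtain ⟨h1, h2⟩ := base_exp_zero.linear_reduction hE (f' := fun y => E.f (-log y) *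
    exp (-(2 * log y))) (I' := {y | 0 < y ∧ -log y ∈ E.I}) one_ne_zero
    (Φ := op fun t x u => (t, exp (-x), u))
    (fun u hu => by rw [hK hu, one_mul]) (fun t x u => by simp [op])
    ⟨(Real.continuousOn_log.neg.mono fun y (hy : 0 < y) => hy.ne').isOpen_inter_preimage
      isOpen_Ioi hE.hI.1, ⟨fun a ha b hb c hc => ⟨ha.1.trans_le hc.1, hE.hI.2.1.out hb.2 ha.2
        ⟨neg_le_neg (Real.log_le_log (ha.1.trans_le hc.1) hc.2),
          neg_le_neg (Real.log_le_log ha.1 hc.1)⟩⟩⟩, by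
      obtain ⟨x, hx⟩ := hE.hI.2.2
      exact ⟨exp (-x), Real.exp_pos _, by simpa⟩⟩
    ((hE.smooth_f.comp (Real.contDiffOn_log.neg.mono fun y hy => ne_of_gt hy.1)
      fun y hy => hy.2).mul ((contDiffOn_const.mul (Real.contDiffOn_log.mono
        fun y hy => ne_of_gt hy.1)).neg.exp))
    (fun y hy => mul_ne_zero (hE.f_ne _ hy.2) (Real.exp_pos _).ne')
    (fun x hx => ⟨by rw [one_mul]; exact Real.exp_pos _, by rwa [hlog, neg_neg]⟩)
    fun x hx => by
      rw [hlog, neg_neg, mul_neg, neg_neg, mul_left_comm, neg_sq, ← Real.exp_nat_mul,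
        ← Real.exp_add]
      simp
  obtain ⟨F, hF⟩ := h
  refine ⟨_, h1, ⟨rfl, rfl, fun _ _ => zero_mul _⟩, ⟨fun y => F (-log y) - 2 * log y, fun y hy => ?_⟩, h2⟩
  obtain ⟨y0, hy⟩ := hy
  obtain ⟨d0, dF, eF⟩ := hF _ hy
  have hd := hd (-log y)
  have hn := hn (-log y)
  rw [neg_neg, Real.exp_log y0] at hd hn
  refine ⟨by rw [hd]; exact mul_ne_zero y0.ne' d0, ((dF.comp y (Real.hasDerivAt_log y0.ne').neg).sub
    ((Real.hasDerivAt_log y0.ne').const_mul 2)).congr_deriv ?_, ?_⟩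
  · rw [hd, hn]; field_simp; ring
  · simp only
    rw [eF, ← Real.exp_add, sub_eq_add_neg]

section InverseX
variable (hE : E.Nonlinear) (hK : EqOn E.K (fun _ => 1) E.J)
  (hf : EqOn E.f (fun x => x⁻¹) E.I)
include hE hK hf

lemma exp_mul_reduction :
    ∃ E' : Eqn, E'.Nonlinear ∧ (E'.J = E.J ∧ E'.D = E.D ∧ EqOn E'.K (fun _ => 0) E'.J) ∧
      (∀ num den : ℝ → ℝ, (∀ x, num x = -1) → (∀ x, den x = x) → E'.HasExpInt num den) ∧
      Transforms (op fun t x u => (Real.sign x * exp t, exp t * x, u)) E E' := by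
  have h0 := fun x hx => (φ_inv hE hf x hx).1
  obtain ⟨σ, hσ, hσ2, hσ0, hs⟩ := exists_real_sign hE.hI continuous_id h0
  have hlog : ContDiffOn ℝ ∞ log {x | 0 < σ * x} :=
    Real.contDiffOn_log.mono fun x hx => right_ne_zero_of_mul (ne_of_gt hx)
  obtain ⟨h1, h2⟩ := reduction hE (Φ := op fun t x u => (Real.sign x * exp t, exp t * x, u))
    (κ := 0) (κ₀ := 1) (k := 0) (θ := fun t => σ * exp t) (θ' := fun t => σ * exp t)
    (X := fun t x => exp t * x) (Xt := fun t x => exp t * x) (Xx := fun t _ => exp t)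
    (Xxx := fun _ _ => 0) (I' := {x | 0 < σ * x}) (f' := fun x => exp (-log x))
    (fun u hu => by rw [hK hu]; ring)
    (fun t _ x hx u _ => by rw [← (hs x hx).1]; rfl) (by fun_prop)
    (fun t _ => (Real.hasDerivAt_exp t).const_mul σ)
    ⟨fun t _ x _ => (Real.hasDerivAt_exp t).mul_const x,
      fun t _ x _ => ((hasDerivAt_id x).const_mul _).congr_deriv (mul_one _),
      fun t _ x _ => hasDerivAt_const _ _⟩
    (fun t _ => mul_ne_zero hσ0 (Real.exp_pos t).ne') (fun t _ x _ => (Real.exp_pos t).ne')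
    ⟨isOpen_lt continuous_const (by fun_prop), by
      rcases hσ with rfl | rfl
      · simp only [one_mul]; exact Set.ordConnected_Ioi
      · simp only [neg_one_mul, neg_pos]; exact Set.ordConnected_Iio, σ, by rcases hσ with rfl | rfl <;> simp⟩
    hlog.neg.exp (fun y _ => (Real.exp_pos _).ne')
    (fun t _ x hx => by
      have : 0 < σ * x := (hs x hx).2 ▸ abs_pos.2 (h0 x hx)
      change 0 < σ * (exp t * x)
      rw [mul_left_comm]; exact mul_pos (Real.exp_pos t) this)
    fun t _ x hx => ⟨by
      have := h0 x hx
      have h3 : |x| = σ * x := (hs x hx).2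
      rw [hf hx, Real.exp_neg, Real.exp_log_eq_abs (mul_ne_zero (Real.exp_pos t).ne' this), abs_mul,
        Real.abs_exp, h3]
      field_simp
      exact hσ2, by ring, by have := h0 x hx; rw [hf hx]; field_simp⟩
  refine ⟨_, h1, ⟨rfl, rfl, fun _ _ => zero_mul _⟩, fun num den hn hd =>
    ⟨fun x => -log x, fun x hx => ?_⟩, h2⟩
  have h0 : x ≠ 0 := right_ne_zero_of_mul (ne_of_gt hx)
  rw [hn, hd, neg_div, one_div]
  exact ⟨h0, (Real.hasDerivAt_log h0).neg, rfl⟩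

lemma log_add_reduction :
    ∃ E' : Eqn, E'.Nonlinear ∧ (Case.c1_2a 1).Entry E' ∧
    E'.J = E.J ∧ EqOn E'.D E.D E.J ∧ (∀ u ∈ E.J, E'.K u = -1 * E.D u) ∧
    Transforms (op fun t x u => (Real.sign x * exp t, log |x| + t, u)) E E' := by
  have h0 := fun x hx => (φ_inv hE hf x hx).1
  obtain ⟨σ, hσ, hσ2, hσ0, hs⟩ := exists_real_sign hE.hI continuous_id h0
  obtain ⟨h1, h2⟩ := reduction hE
    (Φ := op fun t x u => (Real.sign x * exp t, log |x| + t, u))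
    (κ := 0) (κ₀ := 1) (k := -1) (θ := fun t => σ * exp t) (θ' := fun t => σ * exp t)
    (X := fun t x => log x + t) (Xt := fun _ _ => 1) (Xx := fun _ x => x⁻¹)
    (Xxx := fun _ x => -(x ^ 2)⁻¹) (I' := univ) (f' := fun x => exp (1 * x))
    (fun u hu => by rw [hK hu]; ring)
    (fun t _ x hx u _ => by rw [← (hs x hx).1, ← Real.log_abs]; rfl)
    (by fun_prop (disch := exact fun p hp => h0 _ hp.2.1))
    (fun t _ => (Real.hasDerivAt_exp t).const_mul σ)
    ⟨fun t _ x _ => (hasDerivAt_id t).const_add _,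
      fun t _ x hx => (Real.hasDerivAt_log (h0 x hx)).add_const t,
      fun t _ x hx => hasDerivAt_inv (h0 x hx)⟩
    (fun t _ => mul_ne_zero hσ0 (Real.exp_pos t).ne') (fun t _ x hx => inv_ne_zero (h0 x hx))
    isOpenInterval_univ (by fun_prop) (fun y _ => (Real.exp_pos _).ne') (fun _ _ _ _ => trivial)
    fun t _ x hx => ⟨by
      have := h0 x hx
      have h3 : |x| = σ * x := (hs x hx).2
      rw [hf hx, one_mul, Real.exp_add, Real.exp_log_eq_abs this, h3]
      field_simp, by ring, by rw [hf hx, one_mul, mul_one]⟩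
  exact ⟨_, h1, fun _ _ => rfl, rfl, fun _ _ => rfl, fun _ _ => rfl, h2⟩

lemma inv_exp_reduction (hJ : E.J ⊆ Ioi 0) (hD : EqOn E.D (fun u => u ^ (-3 / 2 : ℝ)) E.J) :
    ∃ E' : Eqn, E'.Nonlinear ∧ (Case.c3_6a (-3 / 2)).Entry E' ∧
    Transforms (op fun t x u => (Real.sign x * exp t, -exp (-t) / x,
        |exp t * x| ^ (2 : ℝ) * u)) E E' := by
  have h0 := fun x hx => (φ_inv hE hf x hx).1
  obtain ⟨σ, -, hσ2, hσ0, hs⟩ := exists_real_sign hE.hI continuous_id h0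
  have he := fun t : ℝ => (Real.exp_pos t).ne'
  obtain ⟨E', h1, h2, h3⟩ := power_reduction hE (Φ := op fun t x u => (Real.sign x * exp t,
      -exp (-t) / x, |exp t * x| ^ (2 : ℝ) * u)) (μ := -3 / 2)
    (κ := 0) (k := 1) (θ := fun t => σ * exp t) (θ' := fun t => σ * exp t)
    (X := fun t x => -(exp t * x)⁻¹) (Xt := fun t x => (exp t * x)⁻¹)
    (Xx := fun t x => (exp t)⁻¹ * (x ^ 2)⁻¹) (Xxx := fun t x => (exp t)⁻¹ * (-2 * (x ^ 3)⁻¹))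
    (M := fun t x => (exp t * x) ^ 2) (Mt := fun t x => 2 * (exp t * x) ^ 2)
    (Mx := fun t x => 2 * exp t ^ 2 * x) (Mxx := fun t _ => 2 * exp t ^ 2)
    (by norm_num) hJ hD (fun u hu => by rw [hK hu]; ring)
    (fun t _ x hx u _ => by
      rw [← (hs x hx).1, ← sq_abs (exp t * x), ← Real.rpow_two, mul_inv, ← Real.exp_neg,
        neg_mul_eq_neg_mul]; rfl)
    (by fun_prop (disch := exact fun p hp => mul_ne_zero (he _) (h0 _ hp.2.1)))
    (fun t _ => (Real.hasDerivAt_exp t).const_mul σ)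
    ⟨fun t _ x hx => (((Real.hasDerivAt_exp t).mul_const x).inv
        (mul_ne_zero (he t) (h0 x hx))).neg.congr_deriv (by
          have := h0 x hx; have := he t; field_simp),
      fun t _ x hx => (((hasDerivAt_id x).const_mul (exp t)).inv
        (mul_ne_zero (he t) (h0 x hx))).neg.congr_deriv (by
          have := h0 x hx; have := he t; simp only [id]; field_simp),
      fun t _ x hx => (((hasDerivAt_pow 2 x).inv
        (pow_ne_zero 2 (h0 x hx))).const_mul _).congr_deriv (by
          have := h0 x hx; have := he t; field_simp; ring)⟩
    ⟨fun t _ x hx => (((Real.hasDerivAt_exp t).mul_const x).pow 2).congr_deriv (by ring),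
      fun t _ x hx => (((hasDerivAt_id x).const_mul (exp t)).pow 2).congr_deriv (by
        simp only [id]; ring),
      fun t _ x hx => ((hasDerivAt_id x).const_mul _).congr_deriv (by ring)⟩
    (fun t _ => mul_ne_zero hσ0 (he t))
    (fun t _ x hx => mul_ne_zero (inv_ne_zero (he t)) (inv_ne_zero (pow_ne_zero 2 (h0 x hx))))
    (fun t _ x hx => sq_pos_of_ne_zero (mul_ne_zero (he t) (h0 x hx)))
    fun t _ x hx => by
      have x0 := h0 x hx
      have t0 := he t
      have h3 : |x| = σ * x := (hs x hx).2
      have hp : ((exp t * x) ^ 2) ^ (-3 / 2 : ℝ) = ((exp t * (σ * x)) ^ 3)⁻¹ := by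
        rw [← sq_abs, abs_mul, h3, Real.abs_exp, ← Real.rpow_natCast, ← Real.rpow_mul
          (mul_nonneg (Real.exp_pos t).le (h3 ▸ abs_nonneg x)), ← Real.rpow_natCast, ← Real.rpow_neg
          (mul_nonneg (Real.exp_pos t).le (h3 ▸ abs_nonneg x))]
        norm_num
      refine ⟨?_, ?_, ?_, ?_, ?_⟩
      · rw [hp, hf hx]; field_simp; linear_combination -hσ2
      · field_simp; ring
      · ring
      · rw [hf hx]; field_simp
      · rw [hf hx]; field_simp
  exact ⟨E', h1, ⟨h2.1, by norm_num, by norm_num, h2.2⟩, h3⟩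

end InverseX

end
end DiffConv

open DiffConv in
theorem theorem3 :
    -- completeness of the list, up to equivalence
    (∀ E : Eqn, E.Nonlinear → E.HasExtension →
      ∃ (c : Case) (E' : Eqn), c ≠ Case.c1_1 ∧ E'.Nonlinear ∧ c.Entry E' ∧ c.Normalized ∧
        Equivalent E E' ∧ E'.IsBasis c.ops) ∧
    -- the listed operators are independent symmetries, and they form a basis of the maximal
    -- algebra iff the equation is not equivalent to an entry with a larger algebra
    (∀ (c : Case) (E : Eqn), E.Nonlinear → c.Entry E →
      LinearIndependent ℝ (E.fam c.ops) ∧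
      (∀ i, E.fam c.ops i ∈ E.maxAlg) ∧
      (E.IsBasis c.ops ↔ c.Proper E)) ∧
    -- the explicit conditions for some cases
    (∀ (μ ν l : ℝ) (E : Eqn), E.Nonlinear → (Case.c2_1 μ ν l).Entry E →
      (E.IsBasis (Case.c2_1 μ ν l).ops ↔ ¬ (ν = 0 ∧ l = -1))) ∧
    (∀ (μ ν l : ℝ) (E : Eqn), E.Nonlinear → (Case.c3_1 μ ν l).Entry E →
      (E.IsBasis (Case.c3_1 μ ν l).ops ↔ ¬ (ν = 0 ∧ l = -1))) ∧
    (∀ (μ ν : ℝ) (E : Eqn), E.Nonlinear → (Case.c3_2 μ ν).Entry E →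
      (E.IsBasis (Case.c3_2 μ ν).ops ↔
        ¬ (μ = -2 ∧ ν = -2) ∧ ¬ (μ = 0 ∧ ν = 1) ∧ ν ≠ 0)) ∧
    -- different cases are inequivalent
    (∀ (c c' : Case) (E E' : Eqn), E.Nonlinear → E'.Nonlinear → c.Entry E → c'.Entry E' →
      E.IsBasis c.ops → E'.IsBasis c'.ops → c.Irredundant → c'.Irredundant →
      c.label ≠ c'.label → ¬ Equivalent E E') ∧
    -- additional equivalence transformations, arbitrary `D`
    (∀ γ, ReducesKD (op fun t x u => (γ ^ 2 * t, γ * Real.exp (-x), u))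
      (Case.c1_2b γ) (Case.c1_2a 1) 0) ∧
    (∀ γ ν, ν ≠ -2 → ReducesKD
      (op fun t x u => ((ν + 2) ^ 2 * t, (ν + 2) * Real.log |Real.exp (-x) + γ|, u))
      (Case.c1_2c γ ν) (Case.c1_2a 1) (-1 / (ν + 2))) ∧
    (∀ γ, ReducesKD (op fun t x u => (t, Real.log |Real.exp (-x) + γ|, u))
      (Case.c1_2c γ (-2)) (Case.c1_2a 0) (-1)) ∧
    (∀ ν, ν ≠ -2 → ReducesKD
      (op fun t x u => ((ν + 2) ^ 2 * t, (ν + 2) * Real.log |x|, u))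
      (Case.c1_2d ν) (Case.c1_2a 1) (-1 / (ν + 2))) ∧
    ReducesKD (op fun t x u => (t, Real.log |x|, u)) (Case.c1_2d (-2)) (Case.c1_2a 0) (-1) ∧
    ReducesKD (op fun t x u => (Real.sign x * Real.exp t, Real.log |x| + t, u))
      Case.c1_2e (Case.c1_2a 1) (-1) ∧
    ReducesKD (op fun t x u => (t, Real.exp (-x), u)) Case.c1_3b Case.c1_3a 0 ∧
    -- additional equivalence transformations, exponential `D`
    (∀ α β γ₁ γ₀, Reduces (op fun t x u => (t, Real.exp (-x), u))
      (Case.c2_5b α β γ₁ γ₀) (Case.c2_5a α β γ₁ γ₀)) ∧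
    Reduces (op fun t x u => (Real.sign x * Real.exp t, Real.exp t * x, u))
      Case.c2_5c (Case.c2_5a 1 0 1 0) ∧
    Reduces (op fun t x u => (t, Real.exp (-x), u)) Case.c2_6b Case.c2_6a ∧
    (∀ γ, Reduces (op fun t x u => (t * Real.sign (Real.exp (-x) + γ),
        1 / (Real.exp (-x) + γ), u - Real.log |Real.exp (-x) + γ|))
      (Case.c2_6c γ) Case.c2_6a) ∧
    Reduces (op fun t x u => (t * Real.sign x, 1 / x, u - Real.log |x|))
      Case.c2_6d Case.c2_6a ∧
    -- additional equivalence transformations, power `D`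
    (∀ μ α β γ₁ γ₀, Reduces (op fun t x u => (t, Real.exp (-x), u))
      (Case.c3_5b μ α β γ₁ γ₀) (Case.c3_5a μ α β γ₁ γ₀)) ∧
    (∀ μ, Reduces (op fun t x u => (Real.sign x * Real.exp t, Real.exp t * x, u))
      (Case.c3_5c μ) (Case.c3_5a μ 1 0 1 0)) ∧
    (∀ μ, Reduces (op fun t x u => (t, Real.exp (-x), u)) (Case.c3_6b μ) (Case.c3_6a μ)) ∧
    (∀ γ, Reduces (op fun t x u => (t, x, Real.exp (γ * x) * u))
      (Case.c3_6c γ) (Case.c3_6a (-1))) ∧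
    (∀ γ, Reduces (op fun t x u => (t, Real.exp (-x), Real.exp (γ * Real.exp (-x)) * u))
      (Case.c3_6d γ) (Case.c3_6a (-1))) ∧
    (∀ μ, Reduces (op fun t x u => (t, -1 / x, |x| ^ (-1 / (1 + μ)) * u))
      (Case.c3_6e μ) (Case.c3_6a μ)) ∧
    (∀ μ γ, Reduces (op fun t x u => (t, -1 / (Real.exp (-x) + γ),
        |Real.exp (-x) + γ| ^ (-1 / (1 + μ)) * u))
      (Case.c3_6f μ γ) (Case.c3_6a μ)) ∧
    Reduces (op fun t x u => (Real.sign x * Real.exp t, -Real.exp (-t) / x,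
        |Real.exp t * x| ^ (2 : ℝ) * u))
      Case.c3_6g (Case.c3_6a (-3 / 2)) ∧
    Reduces (op fun t x u => (t, Real.exp (-x), u)) Case.c3_7b Case.c3_7a := by
  refine ⟨fun E hE h => h.exists_case hE,
    fun c E hE hc => ⟨(ops_spec hE c hc).1, (ops_spec hE c hc).2, isBasis_iff_proper hE hc⟩,
    fun _ _ _ E hE hc => isBasis_c2_1 hE hc, fun _ _ _ E hE hc => isBasis_c3_1 hE hc,
    fun _ _ E hE hc => isBasis_c3_2 hE hc,
    fun c c' E E' hE hE' hc hc' hb hb' hi hi' hne h =>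
      hne (h.label_eq_of_isBasis hE hE' hc hc' hb hb' hi hi'),
    ?_, ?_, ?_, ?_, ?_, ?_, ?_, ?_, ?_, ?_, ?_, ?_, ?_, ?_, ?_, ?_, ?_, ?_, ?_, ?_, ?_⟩
  · rintro γ E hE ⟨h0, -, hK, hf⟩
    obtain ⟨h1, h2⟩ := base_exp_zero.linear_reduction hE h0 (f' := fun x => Real.exp (1 * x))
      (Φ := op fun t x u => (γ ^ 2 * t, γ * Real.exp (-x), u))
      (fun u hu => by rw [hK hu, one_mul]) (fun t x u => rfl)
      isOpenInterval_univ (by fun_prop) (fun y _ => (Real.exp_pos _).ne') (fun _ _ => trivial)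
      fun x hx => by
        rw [hf hx, ← exp_neg_two_mul, one_mul, ← Real.exp_add]
    exact ⟨_, h1, fun _ _ => rfl, rfl, fun _ _ => rfl, fun _ _ => rfl, h2⟩
  · rintro γ ν hν E hE ⟨-, h0, -, hK, hf⟩
    have : ν + 2 ≠ 0 := fun h => hν (by linarith)
    exact (base_exp γ).log_reduction hE (div_mul_cancel₀ _ this) (one_mul _) h0
      (fun u hu => by rw [hK hu, one_mul]) (fun t x u => rfl)
      fun x hx => by rw [hf hx, ← exp_neg_two_mul]
  · rintro γ E hE ⟨-, h0, -, hK, hf⟩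
    exact (base_exp γ).log_reduction hE (mul_one _) (by norm_num) h0
      (fun u hu => by rw [hK hu, one_mul]) (fun t x u => by simp [op])
      fun x hx => by rw [hf hx, ← exp_neg_two_mul]
  · rintro ν hν E hE ⟨h0, -, hK, hf⟩
    have : ν + 2 ≠ 0 := fun h => hν (by linarith)
    exact base_id.log_reduction hE (div_mul_cancel₀ _ this) (one_mul _) h0
      (Eqn.K_zero hK) (fun t x u => rfl)
      fun x hx => by rw [hf hx, one_pow, one_mul]
  · rintro E hE ⟨h0, -, hK, hf⟩
    exact base_id.log_reduction hE (mul_one _) (by norm_num) h0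
      (Eqn.K_zero hK) (fun t x u => by simp [op])
      fun x hx => by rw [hf hx, one_pow, one_mul]
  · exact fun E hE ⟨_, hK, hf⟩ => log_add_reduction hE hK hf
  · rintro E hE ⟨-, hK, hf⟩
    obtain ⟨h1, h2⟩ := exp_neg_reduction hE hK hf
    exact ⟨_, h1, ⟨fun _ _ => rfl, fun _ _ => zero_mul _, fun _ _ => rfl⟩, rfl, fun _ _ => rfl,
      fun _ _ => rfl, h2⟩
  · rintro α β γ₁ γ₀ E hE ⟨⟨hD, hK⟩, hf⟩
    obtain ⟨E', h1, ⟨e1, e2, e3⟩, h2, h3⟩ := exp_neg_expInt_reduction hE (hK.trans hD.symm) hf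
      (den' := fun x => β * x ^ 2 + γ₁ * x + γ₀) (num' := fun x => -3 * β * x - 2 * γ₁ + α)
      (fun x => by rw [Real.exp_neg]; field_simp) fun x => by ring
    exact ⟨E', h1, ⟨⟨by rwa [e1, e2], e3⟩, h2⟩, h3⟩
  · rintro E hE ⟨hD, hK, hf⟩
    obtain ⟨E', h1, ⟨e1, e2, e3⟩, h2, h3⟩ := exp_mul_reduction hE hK hf
    exact ⟨E', h1, ⟨⟨by rwa [e1, e2], e3⟩,
      h2 _ _ (fun _ => by ring) fun _ => by ring⟩, h3⟩
  · rintro E hE ⟨hD, hK, hf⟩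
    obtain ⟨h1, h2⟩ := exp_neg_reduction hE (hK.trans hD.symm) hf
    exact ⟨_, h1, ⟨hD, fun _ _ => zero_mul _, fun _ _ => rfl⟩, h2⟩
  · rintro γ E hE ⟨hD, hK, hf⟩
    exact (base_exp γ).exp_reduction hE hD (Eqn.K_one hK hD) (fun t x u => rfl)
      fun x hx => by rw [hf hx, ← exp_neg_two_mul]
  · rintro E hE ⟨hD, hK, hf⟩
    exact base_id.exp_reduction hE hD (Eqn.K_zero hK) (fun t x u => rfl)
      fun x hx => by rw [hf hx, one_pow, one_mul]
  · rintro μ α β γ₁ γ₀ E hE ⟨hJ, hμ, ⟨hD, hK⟩, hf⟩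
    obtain ⟨E', h1, ⟨e1, e2, e3⟩, h2, h3⟩ := exp_neg_expInt_reduction hE (hK.trans hD.symm) hf
      (den' := fun x => (1 + μ) * β * x ^ 2 + γ₁ * x + γ₀)
      (num' := fun x => -(4 + 3 * μ) * β * x - 2 * γ₁ + α)
      (fun x => by rw [Real.exp_neg]; field_simp) fun x => by ring
    exact ⟨E', h1, ⟨by rwa [e1], hμ, ⟨by rwa [e1, e2], e3⟩, h2⟩, h3⟩
  · rintro μ E hE ⟨hJ, hμ, -, hD, hK, hf⟩
    obtain ⟨E', h1, ⟨e1, e2, e3⟩, h2, h3⟩ := exp_mul_reduction hE hK hf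
    exact ⟨E', h1, ⟨by rwa [e1], hμ, ⟨by rwa [e1, e2], e3⟩,
      h2 _ _ (fun _ => by ring) fun _ => by ring⟩, h3⟩
  · rintro μ E hE ⟨hJ, hμ, h43, hD, hK, hf⟩
    obtain ⟨h1, h2⟩ := exp_neg_reduction hE (hK.trans hD.symm) hf
    exact ⟨_, h1, ⟨hJ, hμ, h43, hD, fun _ _ => zero_mul _, fun _ _ => rfl⟩, h2⟩
  · rintro γ E hE ⟨hJ, hD, hK, hf⟩
    exact base_id.exp_power_reduction hE hJ hD (Eqn.K_zero hK) (fun t x u => rfl)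
      fun x hx => by rw [hf hx, one_pow, one_mul]
  · rintro γ E hE ⟨hJ, hD, hK, hf⟩
    exact base_exp_zero.exp_power_reduction hE hJ hD (Eqn.K_one hK hD) (fun t x u => rfl)
      fun x hx => by rw [hf hx, ← exp_neg_two_mul, ← Real.exp_add]
  · rintro μ E hE ⟨hJ, hμ, h43, h1, hD, hK, hf⟩
    exact base_id.inv_power_reduction hE hμ h43 h1 hJ hD (Eqn.K_zero hK) (fun t x u => rfl)
      fun x hx => by rw [hf hx, one_pow, one_mul]
  · rintro μ γ E hE ⟨hJ, hμ, h43, h1, hD, hK, hf⟩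
    exact (base_exp γ).inv_power_reduction hE hμ h43 h1 hJ hD (Eqn.K_one hK hD) (fun t x u => rfl)
      fun x hx => by rw [hf hx, ← exp_neg_two_mul]
  · exact fun E hE ⟨hJ, hD, hK, hf⟩ => inv_exp_reduction hE hK hf hJ hD
  · rintro E hE ⟨hJ, hD, hK, hf⟩
    obtain ⟨h1, h2⟩ := exp_neg_reduction hE (hK.trans hD.symm) hf
    exact ⟨_, h1, ⟨hJ, hD, fun _ _ => zero_mul _, fun _ _ => rfl⟩, h2⟩
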